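/- Let $\mathbf B\subset\mathbb R^3$ be the open unit ball with the Poincaré metric $4|dx|^2/(1-|x|^2)^2$, and let $Z$ be the $x_3$-axis. Area, minimality and area-minimization refer to this metric. Let $\mathcal R$ be an oriented foliation of $\mathbf B\setminus Z$ by smooth minimal surfaces, with locally Lipschitz unit normal field $\nu$ compatible with the orientation, and suppose that $\mathcal R$ (with its orientation) is invariant under rotations about $Z$. Let $\mathcal L'$ be the set of leaves of $\mathcal R$ that are themselves rotationally invariant about $Z$. A set $M\subset\mathbf B$ is said to consist of leaves of $\mathcal L'$ if $M\setminus Z$ is a union of such leaves. An oriented surface $M$ in $\mathbf B$ without boundary in $\mathbf B$ is called area-minimizing if every compact portion of it has area at most the mass of any compactly supported integer-multiplicity rectifiable $2$-current in $\mathbf B$ with the same (oriented) boundary. Let $U\subset\mathbf B$ be a regular open set (that is, $U$ is the interior of its closure) such that $M:=(\partial U)\cap\mathbf B$ consists of leaves of $\mathcal L'$ and $\nu$ points out of $U$ at every point of $M\setminus Z$. Orient $M$ by $\nu$. Then: 1. $M$ is area-minimizing, and, if $M\neq\emptyset$, $M$ has infinite area. 2. Suppose that $M$ consists of finitely many leaves,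 and let $M'$ be a smooth, properly embedded, oriented surface in $\mathbf B$ that is rotationally invariant about $Z$, is area-minimizing, and satisfies $\partial M'=\partial M$ as oriented surfaces in $\overline{\mathbf B}$: that is, $\overline{M'}\cap\partial\mathbf B=\overline{M}\cap\partial\mathbf B$, and $M$ and $M'$ have the same boundary as currents in $\mathbb R^3$. Then $M'$ also consists of leaves of $\mathcal L'$, and the orienting unit normal of $M'$ equals $\nu$ on $M'\setminus Z$. -/

import Mathlib

open Set Filter Topology MeasureTheory
open scoped ContDiff RealInnerProductSpace

noncomputable section

namespace HypFoliation

/-- Euclidean three-space. -/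
abbrev E3 : Type := EuclideanSpace ℝ (Fin 3)

/-- The open unit ball, the underlying set of the Poincaré model. -/
def B : Set E3 := Metric.ball 0 1

/-- The `x₃`-axis. -/
def Z : Set E3 := {x | x 0 = 0 ∧ x 1 = 0}

/-- Rotation by the angle `α` about the axis `Z`. -/
def rotZ (α : ℝ) (x : E3) : E3 :=
  !₂[Real.cos α * x 0 - Real.sin α * x 1, Real.sin α * x 0 + Real.cos α * x 1, x 2]

/-- The conformal factor of the Poincaré metric `g = lam² |dx|²` on the unit ball. -/
def lam (x : E3) : ℝ := 2 / (1 - ‖x‖ ^ 2)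

/-! ### Vector calculus -/

/-- `∂ᵢ Xⱼ`. -/
def pd (i : Fin 3) (X : E3 → E3) (j : Fin 3) (x : E3) : ℝ :=
  (fderiv ℝ X x (EuclideanSpace.single i 1)) j

/-- Euclidean divergence. -/
def div (X : E3 → E3) (x : E3) : ℝ := ∑ i, pd i X i x

/-- Euclidean curl. If vector fields stand for 1-forms (through the Euclidean inner product) and
for 2-forms (through the Euclidean Hodge star), this is the exterior derivative on 1-forms. -/
def curl (Y : E3 → E3) (x : E3) : E3 :=
  !₂[pd 1 Y 2 x - pd 2 Y 1 x, pd 2 Y 0 x - pd 0 Y 2 x, pd 0 Y 1 x - pd 1 Y 0 x]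

/-- Divergence with respect to the Poincaré metric, whose volume density is `lam³`. -/
def hypDiv (X : E3 → E3) (x : E3) : ℝ :=
  (lam x ^ 3)⁻¹ * div (fun y => (lam y ^ 3) • X y) x

/-- The unit normal, with respect to the Poincaré metric, of the level sets of `f`. -/
def hypUnitGrad (f : E3 → ℝ) (x : E3) : E3 :=
  (lam x * ‖gradient f x‖)⁻¹ • gradient f x

/-- The mean curvature, with respect to the Poincaré metric, of the level set of `f` through `x`
(divergence of the unit normal field of the level sets). -/
def hypMeanCurvature (f : E3 → ℝ) (x : E3) : ℝ := hypDiv (hypUnitGrad f) x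

/-! ### Surfaces -/

/-- `f` is a regular defining function of class `C^k` for the set `N` in the open set `V`. -/
def IsDefiningFunction (k : WithTop ℕ∞) (N V : Set E3) (f : E3 → ℝ) : Prop :=
  IsOpen V ∧ ContDiffOn ℝ k f V ∧ (∀ x ∈ V, gradient f x ≠ 0) ∧ N ∩ V = {x ∈ V | f x = 0}

/-- `N` is an embedded surface (without boundary) of class `C^k`. -/
def IsSurface (k : WithTop ℕ∞) (N : Set E3) : Prop :=
  ∀ p ∈ N, ∃ V f, p ∈ V ∧ IsDefiningFunction k N V f

/-- `v` is one of the two Euclidean unit normals to the surface `N` at `p`. (The Poincaré metric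
is conformal, so the hyperbolic unit normals are the vectors `v / lam p`.) -/
def IsUnitNormal (N : Set E3) (p v : E3) : Prop :=
  ‖v‖ = 1 ∧ ∃ V f, p ∈ V ∧ IsDefiningFunction 1 N V f ∧ ∃ c : ℝ, gradient f p = c • v

/-- `N` is a smooth embedded surface that is minimal for the Poincaré metric. -/
def IsMinimalSurface (N : Set E3) : Prop :=
  ∀ p ∈ N, ∃ V f, p ∈ V ∧ IsDefiningFunction ∞ N V f ∧ ∀ x ∈ N ∩ V, hypMeanCurvature f x = 0

/-- Hyperbolic area of a (two-dimensional) set. -/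
def hypArea (S : Set E3) : ENNReal :=
  ∫⁻ x in S, ENNReal.ofReal (lam x ^ 2) ∂μHE[2]

/-- `(M, n)` is a smooth, properly embedded, oriented surface in the ball: `n` is a continuous
unit normal field and `M` is relatively closed in the ball. -/
structure IsProperOrientedSurface (M : Set E3) (n : E3 → E3) : Prop where
  subset_ball : M ⊆ B
  closed : closure M ∩ B ⊆ M
  smooth : IsSurface ∞ M
  continuousOn_normal : ContinuousOn n M
  normal : ∀ p ∈ M, IsUnitNormal M p (n p)

/-! ### Currents and area minimization -/

/-- Test fields (smooth compactly supported 1-forms) on `ℝ³`. -/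
def IsTestField (Y : E3 → E3) : Prop := ContDiff ℝ ∞ Y ∧ HasCompactSupport Y

/-- The boundary of the oriented surface `(S, n)` with multiplicity `m`, as a 1-current in `ℝ³`:
it pairs the test field `Y` with the flux of `curl Y` through the surface. -/
def bdry (S : Set E3) (n : E3 → E3) (m : E3 → ℕ) (Y : E3 → E3) : ℝ :=
  ∫ x in S, (m x : ℝ) * ⟪curl Y x, n x⟫ ∂μHE[2]

/-- A rectifiable 2-current with integer multiplicity, finite mass and compact support in the
ball. The carrier is covered, up to a null set, by countably many `C¹` surfaces, to which `normal`
is almost everywhere normal. -/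
structure RectCurrent where
  carrier : Set E3
  normal : E3 → E3
  mult : E3 → ℕ
  measurableSet_carrier : MeasurableSet carrier
  measurable_normal : Measurable normal
  measurable_mult : Measurable mult
  compact_support : ∃ K, IsCompact K ∧ K ⊆ B ∧ carrier ⊆ K
  rectifiable : ∃ N : ℕ → Set E3, (∀ i, IsSurface 1 (N i)) ∧
    μHE[2] (carrier \ ⋃ i, N i) = 0 ∧
    ∀ i, ∀ᵐ x ∂(μHE[2] : Measure E3).restrict (carrier ∩ N i), IsUnitNormal (N i) x (normal x)
  finite_mass : ∫⁻ x in carrier, (mult x : ENNReal) ∂μHE[2] < ⊤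

/-- Mass of a rectifiable current with respect to the Poincaré metric. -/
def RectCurrent.hypMass (T : RectCurrent) : ENNReal :=
  ∫⁻ x in T.carrier, (T.mult x : ENNReal) * ENNReal.ofReal (lam x ^ 2) ∂μHE[2]

/-- The oriented surface `(M, n)` in the ball is area-minimizing for the Poincaré metric: every
compact portion of it has no more area than any rectifiable current with the same boundary. -/
def IsAreaMinimizing (M : Set E3) (n : E3 → E3) : Prop :=
  ∀ K, IsCompact K → K ⊆ B → ∀ T : RectCurrent,
    (∀ Y, IsTestField Y → bdry T.carrier T.normal T.mult Y = bdry (M ∩ K) n (fun _ => 1) Y) →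
    hypArea (M ∩ K) ≤ T.hypMass

/-- The ideal boundary of a subset of the ball. -/
def idealBoundary (S : Set E3) : Set E3 := closure S ∩ Metric.sphere 0 1

/-- Two oriented surfaces of the ball have the same oriented boundary in the closed ball: their
ideal boundaries agree as sets and their boundaries agree as 1-currents in `ℝ³`. -/
def SameOrientedBoundary (M : Set E3) (n : E3 → E3) (M' : Set E3) (n' : E3 → E3) : Prop :=
  idealBoundary M = idealBoundary M' ∧
    ∀ Y, IsTestField Y → bdry M n (fun _ => 1) Y = bdry M' n' (fun _ => 1) Y

/-! ### Foliations -/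

/-- The plaque of the foliated chart `φ` at height `t`. -/
def plaque (φ : OpenPartialHomeomorph E3 (EuclideanSpace ℝ (Fin 2) × ℝ)) (t : ℝ) : Set E3 :=
  {x ∈ φ.source | (φ x).2 = t}

/-- An oriented foliation of `B \ Z` by surfaces that are minimal for the Poincaré metric, given
by a coherent atlas of foliated charts and by its (Euclidean) unit normal field `ν`. -/
structure OrientedMinimalFoliation where
  atlas : Set (OpenPartialHomeomorph E3 (EuclideanSpace ℝ (Fin 2) × ℝ))
  ν : E3 → E3
  source_subset : ∀ φ ∈ atlas, φ.source ⊆ B \ Z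
  cover : ∀ p ∈ B \ Z, ∃ φ ∈ atlas, p ∈ φ.source
  target_eq : ∀ φ ∈ atlas, φ.target = univ
  coherent : ∀ φ ∈ atlas, ∀ ψ ∈ atlas, ∀ p ∈ φ.source ∩ ψ.source, ∃ V ∈ 𝓝 p,
    V ⊆ φ.source ∩ ψ.source ∧
      ∀ x ∈ V, ∀ y ∈ V, (φ x).2 = (φ y).2 ↔ (ψ x).2 = (ψ y).2
  minimal : ∀ φ ∈ atlas, ∀ t, IsMinimalSurface (plaque φ t)
  normal : ∀ φ ∈ atlas, ∀ t, ∀ x ∈ plaque φ t, IsUnitNormal (plaque φ t) x (ν x)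
  lipschitz : LocallyLipschitzOn (B \ Z) ν

namespace OrientedMinimalFoliation

variable (R : OrientedMinimalFoliation)

/-- `p` and `q` lie on a common plaque. -/
def SamePlaque (p q : E3) : Prop :=
  ∃ φ ∈ R.atlas, ∃ t, p ∈ plaque φ t ∧ q ∈ plaque φ t

/-- The leaf through `p`: all points that can be reached from `p` along a chain of plaques. -/
def leaf (p : E3) : Set E3 := {q | Relation.ReflTransGen R.SamePlaque p q}

/-- The leaves of the foliation. -/
def leaves : Set (Set E3) := R.leaf '' (B \ Z)

/-- The rotationally invariant leaves. -/
def rotLeaves : Set (Set E3) := {L ∈ R.leaves | ∀ α, rotZ α '' L = L}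

/-- The oriented foliation is invariant under the rotations about `Z`. -/
def IsRotationallyInvariant : Prop :=
  ∀ α, (∀ L ∈ R.leaves, rotZ α '' L ∈ R.leaves) ∧ ∀ p ∈ B \ Z, R.ν (rotZ α p) = rotZ α (R.ν p)

end OrientedMinimalFoliation

/-- The vector `v` at the boundary point `p` of `U` points out of `U`. -/
def PointsOut (U : Set E3) (p v : E3) : Prop :=
  ∀ᶠ t : ℝ in 𝓝[>] 0, p - t • v ∈ U ∧ p + t • v ∉ closure U

/-- `M`, apart from points of the axis `Z` (where the foliation is not defined), is a union of
rotationally invariant leaves of `R`. -/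
def ConsistsOfRotLeaves (R : OrientedMinimalFoliation) (M : Set E3) : Prop :=
  ∃ 𝓛 ⊆ R.rotLeaves, M \ Z = ⋃₀ 𝓛

end HypFoliation

end

noncomputable section

open Real
open Metric (ball closedBall isOpen_ball ball_mem_nhds ball_subset_closedBall)
open EuclideanSpace (single proj)
open intervalIntegral (integral_of_le integral_hasDerivAt_right integral_eq_sub_of_hasDerivAt)
open ENNReal (ofReal)

namespace HypFoliation

/-! ### The area formula for injective immersions of planar domains -/

/-- The Euclidean plane. -/
abbrev E2 : Type := EuclideanSpace ℝ (Fin 2)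

theorem euclideanHausdorffMeasure_image_le {X Y : Type*} [EMetricSpace X] [MeasurableSpace X]
    [BorelSpace X] [EMetricSpace Y] [MeasurableSpace Y] [BorelSpace Y] {K : NNReal} {g : X → Y}
    {S : Set X} (d : ℕ) (hg : LipschitzOnWith K g S) :
    μHE[d] (g '' S) ≤ (K : ENNReal) ^ d * μHE[d] S := by
  simp_rw [Measure.euclideanHausdorffMeasure_def, Measure.smul_apply, Measure.nnreal_smul_coe_apply]
  rw [mul_left_comm]
  gcongr
  simpa using hg.hausdorffMeasure_image_le (d := (d : ℝ)) (by positivity)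

/-- Near a point where `f` is strictly differentiable with injective derivative `A`, the map `f` is
bi-Lipschitz relative to `A` with constants close to `1`. -/
theorem exists_nhds_norm_sub_bounds {f : E2 → E3} {A : E2 →L[ℝ] E3} {x : E2}
    (hf : HasStrictFDerivAt f A x) (hA : Function.Injective A) {ε : ℝ} (hε : 0 < ε) :
    ∃ V ∈ 𝓝 x, ∀ y ∈ V, ∀ z ∈ V, ‖f y - f z‖ ≤ (1 + ε) * ‖A y - A z‖ ∧
      (1 - ε) * ‖A y - A z‖ ≤ ‖f y - f z‖ := by
  obtain ⟨K, hK0, hK⟩ := (A : E2 →ₗ[ℝ] E3).exists_antilipschitzWith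
    (LinearMap.ker_eq_bot.2 hA)
  have hK0' : (0 : ℝ) < K := by exact_mod_cast hK0
  obtain ⟨V, hV, hV2⟩ := hf.approximates_deriv_on_nhds
    (c := (⟨ε / K, by positivity⟩ : NNReal)) (Or.inr (NNReal.coe_pos.1 (div_pos hε hK0')))
  refine ⟨V, hV, fun y hy z hz => ?_⟩
  have h2 : ‖f y - f z - A (y - z)‖ ≤ ε / K * ‖y - z‖ := hV2 y hy z hz
  have h3 : ‖y - z‖ ≤ K * ‖A y - A z‖ := by
    have := hK.le_mul_dist y z
    rw [dist_eq_norm, dist_eq_norm] at this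
    exact this
  rw [map_sub] at h2
  have h4 : ‖f y - f z - (A y - A z)‖ ≤ ε * ‖A y - A z‖ := by
    refine h2.trans ?_
    calc ε / K * ‖y - z‖ ≤ ε / K * (K * ‖A y - A z‖) := by gcongr
      _ = ε * ‖A y - A z‖ := by field_simp
  have h5 := norm_sub_norm_le (f y - f z) (A y - A z)
  have h6 := norm_sub_norm_le (A y - A z) (f y - f z)
  rw [norm_sub_rev (A y - A z) (f y - f z)] at h6
  constructor <;> linarith

theorem image_measure_le_of_norm_sub_le {f : E2 → E3} {A : E2 →L[ℝ] E3} {S : Set E2}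
    (hA : Function.Injective A) {K : NNReal} (h : ∀ y ∈ S, ∀ z ∈ S, ‖f y - f z‖ ≤ K * ‖A y - A z‖) :
    μHE[2] (f '' S) ≤ (K : ENNReal) ^ 2 * (ofReal (A : E2 →ₗ[ℝ] E3).normDet * volume S) := by
  have h1 := (A : E2 →ₗ[ℝ] E3).euclideanHausdorffMeasure_image_eq_normDet_mul_volume S
  rw [finrank_euclideanSpace_fin] at h1
  rw [← h1]
  have h2 : f '' S = (f ∘ Function.invFun A) '' (A '' S) := by
    rw [image_image]
    refine image_congr fun y _ => ?_
    simp [Function.leftInverse_invFun hA y]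
  rw [h2]
  apply euclideanHausdorffMeasure_image_le
  refine LipschitzOnWith.of_dist_le_mul ?_
  rintro _ ⟨y, hy, rfl⟩ _ ⟨z, hz, rfl⟩
  simpa [Function.leftInverse_invFun hA _, dist_eq_norm] using h y hy z hz

theorem le_image_measure_of_le_norm_sub {f : E2 → E3} {A : E2 →L[ℝ] E3} {S : Set E2}
    (hf : InjOn f S) {K : NNReal} (h : ∀ y ∈ S, ∀ z ∈ S, ‖A y - A z‖ ≤ K * ‖f y - f z‖) :
    ofReal (A : E2 →ₗ[ℝ] E3).normDet * volume S ≤ (K : ENNReal) ^ 2 * μHE[2] (f '' S) := by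
  have h1 := (A : E2 →ₗ[ℝ] E3).euclideanHausdorffMeasure_image_eq_normDet_mul_volume S
  rw [finrank_euclideanSpace_fin] at h1
  rw [← h1]
  have h2 : A '' S = (A ∘ Function.invFunOn f S) '' (f '' S) := by
    rw [image_image]
    refine image_congr fun y hy => ?_
    simp [hf.leftInvOn_invFunOn hy]
  have h3 : ((A : E2 →ₗ[ℝ] E3) : E2 → E3) '' S = A '' S := rfl
  rw [h3, h2]
  apply euclideanHausdorffMeasure_image_le
  refine LipschitzOnWith.of_dist_le_mul ?_
  rintro _ ⟨y, hy, rfl⟩ _ ⟨z, hz, rfl⟩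
  simpa [hf.leftInvOn_invFunOn hy, hf.leftInvOn_invFunOn hz, dist_eq_norm] using h y hy z hz

/-- The data of an injective `C¹` immersion of the open planar set `Ω` with Jacobian `J`. -/
structure IsParam (f : E2 → E3) (f' : E2 → E2 →L[ℝ] E3) (J : E2 → ℝ) (Ω : Set E2) : Prop where
  isOpen : IsOpen Ω
  hasStrictFDerivAt : ∀ x ∈ Ω, HasStrictFDerivAt f (f' x) x
  injective : ∀ x ∈ Ω, Function.Injective (f' x)
  injOn : InjOn f Ω
  jac_eq : ∀ x ∈ Ω, J x = ((f' x : E2 →L[ℝ] E3) : E2 →ₗ[ℝ] E3).normDet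
  jac_pos : ∀ x ∈ Ω, 0 < J x
  continuousOn_jac : ContinuousOn J Ω

namespace IsParam

variable {f : E2 → E3} {f' : E2 → E2 →L[ℝ] E3} {J : E2 → ℝ} {Ω : Set E2}

theorem continuousOn (h : IsParam f f' J Ω) : ContinuousOn f Ω := fun x hx =>
  (h.hasStrictFDerivAt x hx).hasFDerivAt.continuousAt.continuousWithinAt

theorem exists_nhds_bounds (h : IsParam f f' J Ω) {x : E2} (hx : x ∈ Ω) {r : NNReal} (hr : 1 < r) :
    ∃ V, IsOpen V ∧ x ∈ V ∧ V ⊆ Ω ∧ ∀ S ⊆ V, MeasurableSet S →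
      μHE[2] (f '' S) ≤ (r : ENNReal) ^ 3 * ∫⁻ y in S, ofReal (J y) ∧
      ∫⁻ y in S, ofReal (J y) ≤ (r : ENNReal) ^ 3 * μHE[2] (f '' S) := by
  have hr' : (1 : ℝ) < r := by exact_mod_cast hr
  have hr0 : (0 : ℝ) < r := by linarith
  obtain ⟨ε, hε, hε1, hε2⟩ : ∃ ε : ℝ, 0 < ε ∧ 1 + ε ≤ r ∧ 1 ≤ r * (1 - ε) := by
    refine ⟨(r - 1) / r, by apply div_pos <;> linarith, ?_, ?_⟩
    · rw [← sub_nonneg]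
      have : (r : ℝ) - (1 + (r - 1) / r) = (r - 1) ^ 2 / r := by field_simp; ring
      rw [this]; positivity
    · have : (r : ℝ) * (1 - (r - 1) / r) = 1 := by field_simp; ring
      rw [this]
  obtain ⟨V, hV, hVb⟩ := exists_nhds_norm_sub_bounds (h.hasStrictFDerivAt x hx)
    (h.injective x hx) hε
  have hJc : ContinuousAt J x := h.continuousOn_jac.continuousAt (h.isOpen.mem_nhds hx)
  have hJ0 := h.jac_pos x hx
  have hJ1 : ∀ᶠ y in 𝓝 x, J y < r * J x :=
    hJc.eventually_lt continuousAt_const (by nlinarith)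
  have hJ2 : ∀ᶠ y in 𝓝 x, J x < r * J y :=
    continuousAt_const.eventually_lt (continuousAt_const.mul hJc) (by nlinarith)
  obtain ⟨O, hO, hOo, hxO⟩ := mem_nhds_iff.1
    (inter_mem (inter_mem hV (h.isOpen.mem_nhds hx)) (hJ1.and hJ2))
  refine ⟨O, hOo, hxO, fun y hy => (hO hy).1.2, fun S hS hSm => ?_⟩
  have hI : ofReal (J x) * volume S = ∫⁻ _ in S, ofReal (J x) := by simp
  have c1 : μHE[2] (f '' S) ≤ (r : ENNReal) ^ 2 * (ofReal (J x) * volume S) := by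
    rw [h.jac_eq x hx]
    refine image_measure_le_of_norm_sub_le (h.injective x hx) fun y hy z hz => ?_
    refine ((hVb y (hO (hS hy)).1.1 z (hO (hS hz)).1.1).1).trans ?_
    gcongr
  have c2 : ofReal (J x) * volume S ≤ (r : ENNReal) ^ 2 * μHE[2] (f '' S) := by
    rw [h.jac_eq x hx]
    refine le_image_measure_of_le_norm_sub (h.injOn.mono fun y hy => (hO (hS hy)).1.2)
      fun y hy z hz => ?_
    have h1 := ((hVb y (hO (hS hy)).1.1 z (hO (hS hz)).1.1).2)
    calc ‖f' x y - f' x z‖ ≤ r * (1 - ε) * ‖f' x y - f' x z‖ :=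
          le_mul_of_one_le_left (norm_nonneg _) hε2
      _ ≤ r * ‖f y - f z‖ := by rw [mul_assoc]; gcongr
  have c3 : ofReal (J x) * volume S ≤ r * ∫⁻ y in S, ofReal (J y) := by
    rw [hI, ← lintegral_const_mul' _ _ ENNReal.coe_ne_top]
    refine setLIntegral_mono' hSm fun y hy => ?_
    rw [← ENNReal.ofReal_coe_nnreal, ← ENNReal.ofReal_mul hr0.le]
    exact ENNReal.ofReal_le_ofReal (hO (hS hy)).2.2.le
  have c4 : ∫⁻ y in S, ofReal (J y) ≤ r * (ofReal (J x) * volume S) := by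
    rw [hI, ← lintegral_const_mul' _ _ ENNReal.coe_ne_top]
    refine setLIntegral_mono' hSm fun y hy => ?_
    rw [← ENNReal.ofReal_coe_nnreal, ← ENNReal.ofReal_mul hr0.le]
    exact ENNReal.ofReal_le_ofReal (hO (hS hy)).2.1.le
  constructor
  · calc _ ≤ _ := c1
      _ ≤ (r : ENNReal) ^ 2 * (r * ∫⁻ y in S, ofReal (J y)) := by gcongr
      _ = _ := by ring
  · calc _ ≤ _ := c4
      _ ≤ (r : ENNReal) * ((r : ENNReal) ^ 2 * μHE[2] (f '' S)) := by gcongr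
      _ = _ := by ring

theorem measurableSet_image (h : IsParam f f' J Ω) {S : Set E2} (hS : S ⊆ Ω)
    (hSm : MeasurableSet S) : MeasurableSet (f '' S) :=
  hSm.image_of_continuousOn_injOn (h.continuousOn.mono hS) (h.injOn.mono hS)

theorem bounds (h : IsParam f f' J Ω) {r : NNReal} (hr : 1 < r) {S : Set E2} (hS : S ⊆ Ω)
    (hSm : MeasurableSet S) : μHE[2] (f '' S) ≤ (r : ENNReal) ^ 3 * ∫⁻ y in S, ofReal (J y) ∧
      ∫⁻ y in S, ofReal (J y) ≤ (r : ENNReal) ^ 3 * μHE[2] (f '' S) := by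
  choose! V hVo hxV hVΩ hV using fun x (hx : x ∈ Ω) => h.exists_nhds_bounds hx hr
  obtain ⟨T, hTS, hTc, hT⟩ := TopologicalSpace.countable_cover_nhdsWithin
    (s := S) (f := V) fun x hx => mem_nhdsWithin_of_mem_nhds ((hVo x (hS hx)).mem_nhds (hxV x (hS hx)))
  rcases S.eq_empty_or_nonempty with rfl | hne
  · simp
  have hTne : T.Nonempty := by
    obtain ⟨x, hx⟩ := hne
    obtain ⟨y, hy, -⟩ := mem_iUnion₂.1 (hT hx)
    exact ⟨y, hy⟩
  obtain ⟨e, he⟩ := hTc.exists_eq_range hTne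
  have heS : ∀ n, e n ∈ Ω := fun n => hS (hTS (he ▸ mem_range_self n))
  set D : ℕ → Set E2 := disjointed fun n => V (e n) with hD
  have hDV : ∀ n, D n ⊆ V (e n) := fun n => disjointed_subset _ n
  have hDm : ∀ n, MeasurableSet (D n) :=
    fun n => MeasurableSet.disjointed (fun i => (hVo _ (heS i)).measurableSet) n
  have hcov : S = ⋃ n, S ∩ D n := by
    rw [← inter_iUnion, hD, iUnion_disjointed, eq_comm, inter_eq_left]
    refine hT.trans ?_
    rw [he]
    simp
  have hdisj : Pairwise (Function.onFun Disjoint fun n => S ∩ D n) := fun i j hij =>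
    ((disjoint_disjointed _) hij).mono inter_subset_right inter_subset_right
  have hI : ∫⁻ y in S, ofReal (J y) = ∑' n, ∫⁻ y in S ∩ D n, ofReal (J y) := by
    conv_lhs => rw [hcov]
    exact lintegral_iUnion (fun n => hSm.inter (hDm n)) hdisj _
  have hμ : μHE[2] (f '' S) = ∑' n, μHE[2] (f '' (S ∩ D n)) := by
    conv_lhs => rw [hcov]
    rw [image_iUnion]
    refine measure_iUnion (fun i j hij => ?_) fun n =>
      h.measurableSet_image (inter_subset_left.trans hS) (hSm.inter (hDm n))
    exact disjoint_image_image fun a ha b hb hab => (hdisj hij).le_bot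
      ⟨ha, by rwa [h.injOn (hS ha.1) (hS hb.1) hab]⟩
  have key := fun n => hV (e n) (heS n) (S ∩ D n) (inter_subset_right.trans (hDV n))
    (hSm.inter (hDm n))
  rw [hI, hμ, ← ENNReal.tsum_mul_left, ← ENNReal.tsum_mul_left]
  exact ⟨ENNReal.tsum_le_tsum fun n => (key n).1, ENNReal.tsum_le_tsum fun n => (key n).2⟩

/-- The area of the image of an injective immersion is the integral of its Jacobian. -/
theorem measure_image (h : IsParam f f' J Ω) {S : Set E2} (hS : S ⊆ Ω) (hSm : MeasurableSet S) :
    μHE[2] (f '' S) = ∫⁻ y in S, ofReal (J y) := by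
  have aux : ∀ a b : ENNReal, (∀ r : NNReal, 1 < r → a ≤ (r : ENNReal) ^ 3 * b) → a ≤ b := by
    intro a b hab
    rcases eq_or_ne b ⊤ with rfl | hb
    · exact le_top
    have hlim : Tendsto (fun r : NNReal => (r : ENNReal) ^ 3 * b) (𝓝[>] 1) (𝓝 (1 * b)) := by
      refine ENNReal.Tendsto.mul_const ?_ (Or.inr hb)
      have : Tendsto (fun r : NNReal => ((r ^ 3 : NNReal) : ENNReal)) (𝓝 1)
          (𝓝 (((1 : NNReal) ^ 3 : NNReal) : ENNReal)) :=
        ENNReal.tendsto_coe.2 ((continuous_pow 3).tendsto 1)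
      simpa using this.mono_left nhdsWithin_le_nhds
    rw [one_mul] at hlim
    refine ge_of_tendsto hlim ?_
    filter_upwards [self_mem_nhdsWithin] with r hr using hab r hr
  exact le_antisymm (aux _ _ fun r hr => (h.bounds hr hS hSm).1)
    (aux _ _ fun r hr => (h.bounds hr hS hSm).2)

theorem aemeasurable_jac (h : IsParam f f' J Ω) : AEMeasurable J (volume.restrict Ω) :=
  h.continuousOn_jac.aemeasurable h.isOpen.measurableSet

theorem measurableEmbedding (h : IsParam f f' J Ω) : MeasurableEmbedding (Ω.domRestrict f) :=
  h.continuousOn.measurableEmbedding h.isOpen.measurableSet h.injOn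

theorem map_eq (h : IsParam f f' J Ω) : Measure.map (Ω.domRestrict f)
      (Measure.comap (↑) (volume.withDensity fun x => ofReal (J x))) =
      (μHE[2] : Measure E3).restrict (f '' Ω) := by
  have hm := h.isOpen.measurableSet
  ext E hE
  rw [h.measurableEmbedding.map_apply, Measure.restrict_apply hE,
    (MeasurableEmbedding.subtype_coe hm).comap_apply]
  have h1 : ((↑) : Ω → E2) '' (Ω.domRestrict f ⁻¹' E) = Ω ∩ f ⁻¹' E := by
    ext x; simp [and_comm]
  have hm2 : MeasurableSet (Ω ∩ f ⁻¹' E) := by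
    rw [← h1]
    exact hm.subtype_image (h.measurableEmbedding.measurable hE)
  rw [h1, withDensity_apply _ hm2, ← h.measure_image inter_subset_left hm2]
  congr 1
  ext y
  constructor
  · rintro ⟨x, hx, rfl⟩; exact ⟨hx.2, x, hx.1, rfl⟩
  · rintro ⟨hy, x, hx, rfl⟩; exact ⟨x, ⟨hx, hy⟩, rfl⟩

theorem lintegral_image (h : IsParam f f' J Ω) (g : E3 → ENNReal) :
    ∫⁻ x in f '' Ω, g x ∂μHE[2] = ∫⁻ y in Ω, ofReal (J y) * g (f y) := by
  have hm := h.isOpen.measurableSet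
  rw [← h.map_eq, h.measurableEmbedding.lintegral_map]
  simp only [Set.domRestrict_apply, ← Function.comp_apply (f := g)]
  rw [← (MeasurableEmbedding.subtype_coe hm).lintegral_map (g := _) (f := g ∘ f),
    map_comap_subtype_coe hm,
    setLIntegral_withDensity_eq_setLIntegral_mul_non_measurable₀ _ _ _ hm]
  · simp only [Pi.mul_apply, Function.comp_apply]
  · simp only [eventually_true, ENNReal.ofReal_lt_top]
  · exact h.aemeasurable_jac.ennreal_ofReal

theorem integrableOn_image_iff (h : IsParam f f' J Ω) (g : E3 → ℝ) :
    IntegrableOn g (f '' Ω) μHE[2] ↔ IntegrableOn (fun y => J y * g (f y)) Ω := by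
  have hm := h.isOpen.measurableSet
  rw [IntegrableOn, ← h.map_eq, h.measurableEmbedding.integrable_map_iff]
  simp only [Set.domRestrict_eq, ← Function.comp_assoc, ofReal]
  rw [← (MeasurableEmbedding.subtype_coe hm).integrable_map_iff, map_comap_subtype_coe hm,
    restrict_withDensity hm, integrable_withDensity_iff_integrable_coe_smul₀]
  · refine integrableOn_congr_fun (fun x hx => ?_) hm
    simp [coe_toNNReal _ (h.jac_pos x hx).le]
  · exact h.aemeasurable_jac.real_toNNReal

theorem integral_image (h : IsParam f f' J Ω) (g : E3 → ℝ) :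
    ∫ x in f '' Ω, g x ∂μHE[2] = ∫ y in Ω, J y * g (f y) := by
  have hm := h.isOpen.measurableSet
  rw [← h.map_eq, h.measurableEmbedding.integral_map]
  simp only [Set.domRestrict_apply, ← Function.comp_apply (f := g), ofReal]
  rw [← (MeasurableEmbedding.subtype_coe hm).integral_map (g := g ∘ f), map_comap_subtype_coe hm,
    setIntegral_withDensity_eq_setIntegral_smul₀ h.aemeasurable_jac.real_toNNReal _ hm]
  refine setIntegral_congr_fun hm fun x hx => ?_
  simp [NNReal.smul_def, coe_toNNReal _ (h.jac_pos x hx).le]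

end IsParam

/-! ### Vectors in three-space -/

theorem inner_E3 (v w : E3) : ⟪v, w⟫ = v 0 * w 0 + v 1 * w 1 + v 2 * w 2 := by
  simp [PiLp.inner_apply, Fin.sum_univ_three, mul_comm]

theorem norm_sq_E3 (v : E3) : ‖v‖ ^ 2 = v 0 ^ 2 + v 1 ^ 2 + v 2 ^ 2 := by
  rw [EuclideanSpace.real_norm_sq_eq, Fin.sum_univ_three]

theorem ext_E3 {v w : E3} (h0 : v 0 = w 0) (h1 : v 1 = w 1) (h2 : v 2 = w 2) : v = w := by
  ext i; fin_cases i <;> assumption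

/-- The cross product. -/
def crs (a b : E3) : E3 :=
  !₂[a 1 * b 2 - a 2 * b 1, a 2 * b 0 - a 0 * b 2, a 0 * b 1 - a 1 * b 0]

theorem sum_single (a : E3) : a = a 0 • single 0 1 + a 1 • single 1 1 + a 2 • single 2 (1 : ℝ) := by
  apply ext_E3 <;> simp

theorem inner_curl_crs (Y : E3 → E3) (x a b : E3) :
    ⟪curl Y x, crs a b⟫ = ⟪fderiv ℝ Y x a, b⟫ - ⟪fderiv ℝ Y x b, a⟫ := by
  have ha : ∀ (c : E3) (j : Fin 3), fderiv ℝ Y x c j =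
      c 0 * pd 0 Y j x + c 1 * pd 1 Y j x + c 2 * pd 2 Y j x := by
    intro c j
    conv_lhs => rw [sum_single c]
    simp [pd]
  simp only [inner_E3, ha]
  simp only [curl, crs, PiLp.toLp_apply, Matrix.cons_val]
  ring

/-! ### Coordinates adapted to the axis -/

/-- The conformal factor of the coordinates `(t, φ)` on the half-disc. -/
def kap (t φ : ℝ) : ℝ := (cosh t + cos φ)⁻¹

/-- The point of the closed ball with axial coordinates `(t, φ, θ)`: the coordinate `t` is the
position along the axis, `φ` the angle seen from the axis, `θ` the azimuth. -/
def P (t φ θ : ℝ) : E3 :=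
  !₂[kap t φ * sin φ * cos θ, kap t φ * sin φ * sin θ, kap t φ * sinh t]

/-- Unit vector in the direction of `∂ₜ`. -/
def et (t φ θ : ℝ) : E3 :=
  !₂[-(kap t φ * (sinh t * sin φ) * cos θ),
     -(kap t φ * (sinh t * sin φ) * sin θ),
     kap t φ * (1 + cosh t * cos φ)]

/-- Unit vector in the direction of `∂_φ`. -/
def ep (t φ θ : ℝ) : E3 :=
  !₂[kap t φ * (1 + cosh t * cos φ) * cos θ,
     kap t φ * (1 + cosh t * cos φ) * sin θ,
     kap t φ * (sinh t * sin φ)]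

/-- Unit vector in the direction of `∂_θ`. -/
def eth (θ : ℝ) : E3 := !₂[-sin θ, cos θ, 0]

theorem denom_pos {t φ : ℝ} (h : 0 ≤ cos φ) : 0 < cosh t + cos φ := by
  have := cosh_pos t; linarith

theorem kap_pos {t φ : ℝ} (h : 0 ≤ cos φ) : 0 < kap t φ := inv_pos.2 (denom_pos h)

theorem kap_le_one {t φ : ℝ} (h : 0 ≤ cos φ) : kap t φ ≤ 1 :=
  inv_le_one_of_one_le₀ (by have := one_le_cosh t; linarith)

theorem kap_mul {t φ : ℝ} (h : 0 ≤ cos φ) : kap t φ * (cosh t + cos φ) = 1 :=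
  inv_mul_cancel₀ (denom_pos h).ne'

theorem frame_identity {t φ : ℝ} (h : 0 ≤ cos φ) : (kap t φ * (sinh t * sin φ)) ^ 2
      + (kap t φ * (1 + cosh t * cos φ)) ^ 2 = 1 := by
  have h1 := kap_mul (t := t) h
  have h2 := cosh_sq t
  have h3 := sin_sq_add_cos_sq φ
  have e : (sinh t * sin φ) ^ 2 + (1 + cosh t * cos φ) ^ 2
      = (cosh t + cos φ) ^ 2 := by
    have h4 : sinh t ^ 2 = cosh t ^ 2 - 1 := by linarith
    have h5 : sin φ ^ 2 = 1 - cos φ ^ 2 := by linarith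
    rw [mul_pow, h4, h5]; ring
  calc _ = kap t φ ^ 2 * ((sinh t * sin φ) ^ 2 + (1 + cosh t * cos φ) ^ 2) := by
        ring
    _ = (kap t φ * (cosh t + cos φ)) ^ 2 := by rw [e]; ring
    _ = 1 := by rw [h1]; norm_num

section frame
variable {t φ θ : ℝ}

theorem inner_et_et (h : 0 ≤ cos φ) : ⟪et t φ θ, et t φ θ⟫ = 1 := by
  have h1 := frame_identity (t := t) h
  have h2 := sin_sq_add_cos_sq θ
  simp only [inner_E3, et, Matrix.cons_val]
  linear_combination h1 + (kap t φ * (sinh t * sin φ)) ^ 2 * h2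

theorem inner_ep_ep (h : 0 ≤ cos φ) : ⟪ep t φ θ, ep t φ θ⟫ = 1 := by
  have h1 := frame_identity (t := t) h
  have h2 := sin_sq_add_cos_sq θ
  simp only [inner_E3, ep, Matrix.cons_val]
  linear_combination h1 + (kap t φ * (1 + cosh t * cos φ)) ^ 2 * h2

theorem inner_eth_eth : ⟪eth θ, eth θ⟫ = 1 := by
  have h2 := sin_sq_add_cos_sq θ
  simp only [inner_E3, eth, Matrix.cons_val]
  linear_combination h2

theorem inner_et_ep : ⟪et t φ θ, ep t φ θ⟫ = 0 := by
  have h2 := sin_sq_add_cos_sq θ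
  simp only [inner_E3, et, ep, Matrix.cons_val]
  linear_combination (-(kap t φ * (sinh t * sin φ)) *
    (kap t φ * (1 + cosh t * cos φ))) * h2

theorem inner_et_eth : ⟪et t φ θ, eth θ⟫ = 0 := by
  simp only [inner_E3, et, eth, Matrix.cons_val]; ring

theorem inner_ep_eth : ⟪ep t φ θ, eth θ⟫ = 0 := by
  simp only [inner_E3, ep, eth, Matrix.cons_val]; ring

theorem inner_ep_et : ⟪ep t φ θ, et t φ θ⟫ = 0 := by rw [real_inner_comm]; exact inner_et_ep
theorem inner_eth_et : ⟪eth θ, et t φ θ⟫ = 0 := by rw [real_inner_comm]; exact inner_et_eth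
theorem inner_eth_ep : ⟪eth θ, ep t φ θ⟫ = 0 := by rw [real_inner_comm]; exact inner_ep_eth

theorem norm_et (h : 0 ≤ cos φ) : ‖et t φ θ‖ = 1 := by
  rw [norm_eq_sqrt_real_inner, inner_et_et h, sqrt_one]

theorem norm_ep (h : 0 ≤ cos φ) : ‖ep t φ θ‖ = 1 := by
  rw [norm_eq_sqrt_real_inner, inner_ep_ep h, sqrt_one]

theorem norm_eth : ‖eth θ‖ = 1 := by
  rw [norm_eq_sqrt_real_inner, inner_eth_eth, sqrt_one]

theorem crs_et_eth (a b d : ℝ) :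
    crs (a • et t φ θ + b • ep t φ θ) (d • eth θ) = (d * b) • et t φ θ - (d * a) • ep t φ θ := by
  have h2 := sin_sq_add_cos_sq θ
  apply ext_E3 <;>
    simp only [crs, et, ep, eth, PiLp.toLp_apply, Matrix.cons_val, PiLp.add_apply, PiLp.smul_apply,
      PiLp.sub_apply, smul_eq_mul]
  · ring
  · ring
  · linear_combination (d * (-a * (kap t φ * (sinh t * sin φ)) +
      b * (kap t φ * (1 + cosh t * cos φ)))) * h2

theorem frame_expand (h : 0 ≤ cos φ) (v : E3) :
    v = ⟪et t φ θ, v⟫ • et t φ θ + ⟪ep t φ θ, v⟫ • ep t φ θ + ⟪eth θ, v⟫ • eth θ := by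
  have hon : Orthonormal ℝ ![et t φ θ, ep t φ θ, eth θ] := by
    rw [orthonormal_iff_ite]
    intro i j
    fin_cases i <;> fin_cases j <;>
      simp [norm_et h, norm_ep h, norm_eth, inner_et_ep, inner_et_eth, inner_ep_eth,
        inner_ep_et, inner_eth_et, inner_eth_ep]
  let b := (basisOfOrthonormalOfCardEqFinrank hon (by simp)).toOrthonormalBasis (by simpa using hon)
  have := b.sum_repr' v
  simpa [b, Fin.sum_univ_three] using this.symm

end frame

theorem normSq_P {t φ θ : ℝ} (h : 0 ≤ cos φ) : ‖P t φ θ‖ ^ 2 = 1 - 2 * kap t φ * cos φ := by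
  have h1 := kap_mul (t := t) h
  have h2 := sin_sq_add_cos_sq θ
  have h3 := sin_sq_add_cos_sq φ
  have h4 := cosh_sq t
  rw [norm_sq_E3]
  simp only [P, PiLp.toLp_apply, Matrix.cons_val]
  linear_combination (kap t φ * sin φ) ^ 2 * h2 + kap t φ ^ 2 * h3 - kap t φ ^ 2 * h4
    + (kap t φ * cosh t - kap t φ * cos φ + 1) * h1

theorem P_mem_B {t φ θ : ℝ} (h : 0 < cos φ) : P t φ θ ∈ B := by
  have h1 := normSq_P (t := t) (θ := θ) h.le
  have h2 := kap_pos (t := t) h.le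
  rw [B, mem_ball_zero_iff]
  have : ‖P t φ θ‖ ^ 2 < 1 := by rw [h1]; nlinarith [mul_pos h2 h]
  nlinarith [norm_nonneg (P t φ θ)]

theorem lam_P {t φ θ : ℝ} (h : 0 < cos φ) : lam (P t φ θ) = (kap t φ * cos φ)⁻¹ := by
  have h2 := kap_pos (t := t) h.le
  rw [lam, normSq_P h.le]
  field_simp
  ring

theorem P_notMem_Z {t φ θ : ℝ} (h : 0 ≤ cos φ) (h' : 0 < sin φ) : P t φ θ ∉ Z := by
  rintro ⟨h0, h1⟩
  simp only [P, PiLp.toLp_apply, Matrix.cons_val] at h0 h1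
  have h2 := kap_pos (t := t) h
  have h3 := mul_pos h2 h'
  have h4 : cos θ = 0 := by simpa [h3.ne'] using h0
  have h5 : sin θ = 0 := by simpa [h3.ne'] using h1
  have := sin_sq_add_cos_sq θ
  simp [h4, h5] at this

/-- The open interval of values of the coordinate `φ`. -/
abbrev Iφ : Set ℝ := Ioo 0 (π / 2)

theorem cos_pos_of_mem {φ : ℝ} (h : φ ∈ Iφ) : 0 < cos φ :=
  cos_pos_of_mem_Ioo ⟨by linarith [h.1, pi_pos], h.2⟩

theorem sin_pos_of_mem {φ : ℝ} (h : φ ∈ Iφ) : 0 < sin φ :=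
  sin_pos_of_pos_of_lt_pi h.1 (by linarith [h.2, pi_pos])

theorem P_mem {t φ θ : ℝ} (h : φ ∈ Iφ) : P t φ θ ∈ B \ Z :=
  ⟨P_mem_B (cos_pos_of_mem h), P_notMem_Z (cos_pos_of_mem h).le (sin_pos_of_mem h)⟩

/-- Distance to the axis. -/
def rad (x : E3) : ℝ := √(x 0 ^ 2 + x 1 ^ 2)

/-- The coordinate `t`. -/
def tc (x : E3) : ℝ :=
  2⁻¹ * log (((1 + x 2) ^ 2 + (x 0 ^ 2 + x 1 ^ 2)) / ((1 - x 2) ^ 2 + (x 0 ^ 2 + x 1 ^ 2)))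

/-- The coordinate `φ`. -/
def phc (x : E3) : ℝ := arctan (2 * rad x / (1 - ‖x‖ ^ 2))

theorem rad_sq_pos {x : E3} (hx : x ∉ Z) : 0 < x 0 ^ 2 + x 1 ^ 2 := by
  have : x 0 ≠ 0 ∨ x 1 ≠ 0 := by
    by_contra hcon; push Not at hcon; exact hx hcon
  rcases this with h | h <;> positivity

theorem one_sub_normSq_pos {x : E3} (hx : x ∈ B) : 0 < 1 - ‖x‖ ^ 2 := by
  rw [B, mem_ball_zero_iff] at hx
  nlinarith [norm_nonneg x]

theorem phc_mem {x : E3} (hx : x ∈ B \ Z) : phc x ∈ Iφ := by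
  refine ⟨?_, arctan_lt_pi_div_two _⟩
  rw [phc, arctan_pos]
  exact div_pos (mul_pos two_pos (sqrt_pos.2 (rad_sq_pos hx.2))) (one_sub_normSq_pos hx.1)

theorem rad_P {t φ θ : ℝ} (h : φ ∈ Iφ) : rad (P t φ θ) = kap t φ * sin φ := by
  have h2 := sin_sq_add_cos_sq θ
  rw [rad, ← sqrt_sq (mul_pos (kap_pos (t := t) (cos_pos_of_mem h).le) (sin_pos_of_mem h)).le]
  congr 1
  simp only [P, PiLp.toLp_apply, Matrix.cons_val]
  linear_combination (kap t φ * sin φ) ^ 2 * h2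

theorem phc_P {t φ θ : ℝ} (h : φ ∈ Iφ) : phc (P t φ θ) = φ := by
  have hc := cos_pos_of_mem h
  have hk := kap_pos (t := t) hc.le
  rw [phc, rad_P h, normSq_P hc.le]
  have : 2 * (kap t φ * sin φ) / (1 - (1 - 2 * kap t φ * cos φ)) = tan φ := by
    rw [tan_eq_sin_div_cos]; field_simp; ring
  rw [this]
  exact arctan_tan (by linarith [h.1, pi_pos]) h.2

theorem tc_P {t φ θ : ℝ} (h : φ ∈ Iφ) : tc (P t φ θ) = t := by
  have hc := cos_pos_of_mem h
  have hk := kap_pos (t := t) hc.le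
  have h1 := kap_mul (t := t) hc.le
  have h2 := sin_sq_add_cos_sq θ
  have h3 := sin_sq_add_cos_sq φ
  have h4 := cosh_sq t
  have hA : (1 + (P t φ θ) 2) ^ 2 + ((P t φ θ) 0 ^ 2 + (P t φ θ) 1 ^ 2)
      = 2 * kap t φ * exp t := by
    rw [← cosh_add_sinh]
    simp only [P, PiLp.toLp_apply, Matrix.cons_val]
    linear_combination (kap t φ * sin φ) ^ 2 * h2 + kap t φ ^ 2 * h3 - kap t φ ^ 2 * h4
      + (kap t φ * cosh t - kap t φ * cos φ - 1) * h1
  have hB : (1 - (P t φ θ) 2) ^ 2 + ((P t φ θ) 0 ^ 2 + (P t φ θ) 1 ^ 2)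
      = 2 * kap t φ * exp (-t) := by
    rw [← cosh_sub_sinh]
    simp only [P, PiLp.toLp_apply, Matrix.cons_val]
    linear_combination (kap t φ * sin φ) ^ 2 * h2 + kap t φ ^ 2 * h3 - kap t φ ^ 2 * h4
      + (kap t φ * cosh t - kap t φ * cos φ - 1) * h1
  rw [tc, hA, hB, mul_div_mul_left _ _ (by positivity), ← exp_sub, log_exp]
  ring

theorem P_surj {x : E3} (hx : x ∈ B \ Z) : ∃ θ ∈ Ioc (-π) π, x = P (tc x) (phc x) θ := by
  have hr := rad_sq_pos hx.2
  have h1 := one_sub_normSq_pos hx.1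
  set D : ℝ := (1 - ‖x‖ ^ 2) ^ 2 + 4 * (x 0 ^ 2 + x 1 ^ 2) with hD
  have hD0 : 0 < D := by positivity
  set s := √D with hs
  have hs0 : 0 < s := sqrt_pos.2 hD0
  have hsq : s ^ 2 = D := sq_sqrt hD0.le
  have hn := norm_sq_E3 x
  have hrs : rad x ^ 2 = x 0 ^ 2 + x 1 ^ 2 := sq_sqrt hr.le
  have hr0 : 0 < rad x := sqrt_pos.2 hr
  set A := (1 + x 2) ^ 2 + (x 0 ^ 2 + x 1 ^ 2) with hA
  set C := (1 - x 2) ^ 2 + (x 0 ^ 2 + x 1 ^ 2) with hC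
  have hA0 : 0 < A := by positivity
  have hC0 : 0 < C := by positivity
  have hAC : A * C = s ^ 2 := by rw [hsq, hD, hn, hA, hC]; ring
  have hexp : exp (tc x) = A / s := by
    have e2 : exp (tc x) ^ 2 = (A / s) ^ 2 := by
      rw [← exp_nat_mul, tc]
      push_cast
      rw [← mul_assoc, mul_inv_cancel₀ two_ne_zero, one_mul, exp_log (by positivity)]
      rw [div_pow, ← hAC]
      change A / C = _
      field_simp
    exact (sq_eq_sq₀ (exp_pos _).le (by positivity)).1 e2
  have hexpn : exp (-tc x) = C / s := by
    rw [exp_neg, hexp, inv_div, div_eq_div_iff hA0.ne' hs0.ne', ← pow_two, ← hAC, mul_comm]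
  have hcosh : cosh (tc x) = (1 + ‖x‖ ^ 2) / s := by
    rw [cosh_eq, hexp, hexpn, hA, hC, hn]; ring
  have hsinh : sinh (tc x) = 2 * x 2 / s := by
    rw [sinh_eq, hexp, hexpn, hA, hC]; ring
  have hsq1 : √(1 + (2 * rad x / (1 - ‖x‖ ^ 2)) ^ 2) = s / (1 - ‖x‖ ^ 2) := by
    rw [← sqrt_sq (div_pos hs0 h1).le]
    congr 1
    rw [div_pow, div_pow, mul_pow, hrs, hsq, hD]
    field_simp
    ring
  have hcos : cos (phc x) = (1 - ‖x‖ ^ 2) / s := by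
    rw [phc, cos_arctan, hsq1, one_div_div]
  have hsin : sin (phc x) = 2 * rad x / s := by
    rw [phc, sin_arctan, hsq1]; field_simp
  have hkap : kap (tc x) (phc x) = s / 2 := by
    rw [kap, hcosh, hcos, ← add_div]; ring_nf; rw [inv_inv]
  refine ⟨Complex.arg ⟨x 0, x 1⟩, Complex.arg_mem_Ioc _, ?_⟩
  have hnorm : ‖(⟨x 0, x 1⟩ : ℂ)‖ = rad x := by
    rw [Complex.norm_eq_sqrt_sq_add_sq, rad]
  have hca : rad x * cos (Complex.arg ⟨x 0, x 1⟩) = x 0 := by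
    rw [← hnorm]; exact Complex.norm_mul_cos_arg _
  have hsa : rad x * sin (Complex.arg ⟨x 0, x 1⟩) = x 1 := by
    rw [← hnorm]; exact Complex.norm_mul_sin_arg _
  apply ext_E3 <;> simp only [P, PiLp.toLp_apply, Matrix.cons_val, hkap, hsin, hsinh]
  · have : s / 2 * (2 * rad x / s) = rad x := by field_simp
    rw [this, hca]
  · have : s / 2 * (2 * rad x / s) = rad x := by field_simp
    rw [this, hsa]
  · field_simp

theorem rotZ_P (α t φ θ : ℝ) : rotZ α (P t φ θ) = P t φ (θ + α) := by
  apply ext_E3 <;> simp only [P, rotZ, PiLp.toLp_apply, Matrix.cons_val, cos_add, sin_add]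
    <;> ring

theorem P_inj {t φ θ t' φ' θ' : ℝ} (h : φ ∈ Iφ) (h' : φ' ∈ Iφ) (he : P t φ θ = P t' φ' θ') :
    t = t' ∧ φ = φ' ∧ cos θ = cos θ' ∧ sin θ = sin θ' := by
  have h1 : t = t' := by rw [← tc_P (t := t) (θ := θ) h, he, tc_P h']
  have h2 : φ = φ' := by rw [← phc_P (t := t) (θ := θ) h, he, phc_P h']
  subst h1 h2
  have h3 := mul_pos (kap_pos (t := t) (cos_pos_of_mem h).le) (sin_pos_of_mem h)
  refine ⟨rfl, rfl, ?_, ?_⟩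
  · have := congrArg (fun v : E3 => v 0) he
    simpa [P, h3.ne'] using this
  · have := congrArg (fun v : E3 => v 1) he
    simpa [P, h3.ne'] using this

/-! ### Differential calculus in axial coordinates -/

theorem hasDerivAt_E3 {f : ℝ → E3} {f' : E3} {s : ℝ} (h0 : HasDerivAt (fun s => f s 0) (f' 0) s)
    (h1 : HasDerivAt (fun s => f s 1) (f' 1) s) (h2 : HasDerivAt (fun s => f s 2) (f' 2) s) :
    HasDerivAt f f' s := by
  rw [hasDerivAt_iff_hasFDerivAt, ← hasFDerivWithinAt_univ, hasFDerivWithinAt_euclidean]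
  intro i
  rw [hasFDerivWithinAt_univ]
  have key : ∀ j : Fin 3, HasDerivAt (fun s => f s j) (f' j) s →
      HasFDerivAt (fun x => (f x).ofLp j)
        ((proj j).comp (ContinuousLinearMap.toSpanSingleton ℝ f')) s := by
    intro j hj
    refine hj.hasFDerivAt.congr_fderiv ?_
    ext
    simp
  fin_cases i
  exacts [key 0 h0, key 1 h1, key 2 h2]

theorem contDiffAt_P {p : ℝ × ℝ × ℝ} (h : 0 < cosh p.1 + cos p.2.1) :
    ContDiffAt ℝ ∞ (fun p : ℝ × ℝ × ℝ => P p.1 p.2.1 p.2.2) p := by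
  have hk : ContDiffAt ℝ ∞ (fun p : ℝ × ℝ × ℝ => kap p.1 p.2.1) p := by
    unfold kap
    refine ContDiffAt.inv ?_ h.ne'
    fun_prop
  rw [contDiffAt_euclidean]
  intro i
  fin_cases i <;> simp only [P, Fin.zero_eta, Fin.mk_one, Fin.reduceFinMk, Matrix.cons_val] <;>
    fun_prop

theorem hasDerivAt_kap_t {t φ : ℝ} (h : 0 < cosh t + cos φ) :
    HasDerivAt (fun t => kap t φ) (-(kap t φ ^ 2 * sinh t)) t := by
  have := ((hasDerivAt_cosh t).add_const (cos φ)).fun_inv h.ne'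
  refine this.congr_deriv ?_
  simp only [kap]; field_simp

theorem hasDerivAt_kap_phi {t φ : ℝ} (h : 0 < cosh t + cos φ) :
    HasDerivAt (fun φ => kap t φ) (kap t φ ^ 2 * sin φ) φ := by
  have := ((hasDerivAt_cos φ).const_add (cosh t)).fun_inv h.ne'
  refine this.congr_deriv ?_
  simp only [kap]; field_simp

theorem kap_mul' {t φ : ℝ} (h : 0 < cosh t + cos φ) : kap t φ * (cosh t + cos φ) = 1 :=
  inv_mul_cancel₀ h.ne'

theorem hasDerivAt_P_t {t φ : ℝ} (h : 0 < cosh t + cos φ) (θ : ℝ) :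
    HasDerivAt (fun t => P t φ θ) (kap t φ • et t φ θ) t := by
  have hk := hasDerivAt_kap_t h
  have h1 := kap_mul' h
  have h4 := cosh_sq t
  apply hasDerivAt_E3 <;>
    simp only [P, et, Matrix.cons_val, PiLp.smul_apply, smul_eq_mul]
  · refine HasDerivAt.congr_deriv ((hk.mul_const (sin φ)).mul_const (cos θ)) ?_; ring
  · refine HasDerivAt.congr_deriv ((hk.mul_const (sin φ)).mul_const (sin θ)) ?_; ring
  · refine HasDerivAt.congr_deriv (hk.mul (hasDerivAt_sinh t)) ?_
    linear_combination -(kap t φ * cosh t) * h1 + kap t φ ^ 2 * h4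

theorem hasDerivAt_radial_phi {t φ : ℝ} (h : 0 < cosh t + cos φ) :
    HasDerivAt (fun φ => kap t φ * sin φ) (kap t φ * (kap t φ * (1 + cosh t * cos φ))) φ := by
  have hk := hasDerivAt_kap_phi h
  have h1 := kap_mul' h
  have h4 := sin_sq_add_cos_sq φ
  refine HasDerivAt.congr_deriv (hk.mul (hasDerivAt_sin φ)) ?_
  linear_combination -(kap t φ * cos φ) * h1 + kap t φ ^ 2 * h4

theorem hasDerivAt_P_phi {t φ : ℝ} (h : 0 < cosh t + cos φ) (θ : ℝ) :
    HasDerivAt (fun φ => P t φ θ) (kap t φ • ep t φ θ) φ := by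
  have hk := hasDerivAt_kap_phi h
  have hr := hasDerivAt_radial_phi h
  apply hasDerivAt_E3 <;>
    simp only [P, ep, Matrix.cons_val, PiLp.smul_apply, smul_eq_mul]
  · refine HasDerivAt.congr_deriv (hr.mul_const (cos θ)) ?_; ring
  · refine HasDerivAt.congr_deriv (hr.mul_const (sin θ)) ?_; ring
  · refine HasDerivAt.congr_deriv (hk.mul_const (sinh t)) ?_; ring

theorem hasDerivAt_P_theta (t φ θ : ℝ) :
    HasDerivAt (fun θ => P t φ θ) ((kap t φ * sin φ) • eth θ) θ := by
  apply hasDerivAt_E3 <;>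
    simp only [P, eth, Matrix.cons_val, PiLp.smul_apply, smul_eq_mul]
  · exact (hasDerivAt_cos θ).const_mul _
  · exact (hasDerivAt_sin θ).const_mul _
  · simpa using hasDerivAt_const θ _

/-- The derivative of `P`. -/
def dP (t φ θ : ℝ) : ℝ × ℝ × ℝ →L[ℝ] E3 :=
  (ContinuousLinearMap.fst ℝ ℝ (ℝ × ℝ)).smulRight (kap t φ • et t φ θ) +
  ((ContinuousLinearMap.fst ℝ ℝ ℝ).comp (ContinuousLinearMap.snd ℝ ℝ (ℝ × ℝ))).smulRight
    (kap t φ • ep t φ θ) +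
  ((ContinuousLinearMap.snd ℝ ℝ ℝ).comp (ContinuousLinearMap.snd ℝ ℝ (ℝ × ℝ))).smulRight
    ((kap t φ * sin φ) • eth θ)

theorem dP_apply (t φ θ a b c : ℝ) : dP t φ θ (a, b, c) =
    a • kap t φ • et t φ θ + b • kap t φ • ep t φ θ + c • (kap t φ * sin φ) • eth θ := by
  simp [dP]

theorem hasStrictFDerivAt_P {t φ : ℝ} (θ : ℝ) (h : 0 < cosh t + cos φ) :
    HasStrictFDerivAt (fun p : ℝ × ℝ × ℝ => P p.1 p.2.1 p.2.2) (dP t φ θ) (t, φ, θ) := by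
  have hc := contDiffAt_P (p := (t, φ, θ)) h
  have hs := hc.hasStrictFDerivAt (by simp)
  set L := fderiv ℝ (fun p : ℝ × ℝ × ℝ => P p.1 p.2.1 p.2.2) (t, φ, θ) with hL
  have hd := hs.hasFDerivAt
  have e1 : L (1, 0, 0) = kap t φ • et t φ θ := by
    have hg : HasDerivAt (fun s : ℝ => ((s, φ, θ) : ℝ × ℝ × ℝ)) (1, 0, 0) t :=
      (hasDerivAt_id t).prodMk (hasDerivAt_const t (φ, θ))
    have hh := HasFDerivAt.comp_hasDerivAt (x := t)
      (l := (fun p : ℝ × ℝ × ℝ => P p.1 p.2.1 p.2.2)) (f := fun s : ℝ => ((s, φ, θ) : ℝ × ℝ × ℝ))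
      hd hg
    exact hh.unique (hasDerivAt_P_t h θ)
  have e2 : L (0, 1, 0) = kap t φ • ep t φ θ := by
    have hg : HasDerivAt (fun s : ℝ => ((t, s, θ) : ℝ × ℝ × ℝ)) (0, 1, 0) φ :=
      (hasDerivAt_const φ t).prodMk ((hasDerivAt_id φ).prodMk (hasDerivAt_const φ θ))
    have hh := HasFDerivAt.comp_hasDerivAt (x := φ)
      (l := (fun p : ℝ × ℝ × ℝ => P p.1 p.2.1 p.2.2)) (f := fun s : ℝ => ((t, s, θ) : ℝ × ℝ × ℝ))
      hd hg
    exact hh.unique (hasDerivAt_P_phi h θ)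
  have e3 : L (0, 0, 1) = (kap t φ * sin φ) • eth θ := by
    have hg : HasDerivAt (fun s : ℝ => ((t, φ, s) : ℝ × ℝ × ℝ)) (0, 0, 1) θ :=
      (hasDerivAt_const θ t).prodMk ((hasDerivAt_const θ φ).prodMk (hasDerivAt_id θ))
    have hh := HasFDerivAt.comp_hasDerivAt (x := θ)
      (l := (fun p : ℝ × ℝ × ℝ => P p.1 p.2.1 p.2.2)) (f := fun s : ℝ => ((t, φ, s) : ℝ × ℝ × ℝ))
      hd hg
    exact hh.unique (hasDerivAt_P_theta t φ θ)
  have : L = dP t φ θ := by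
    ext1
    · ext1; simp [dP]; exact e1
    · ext1
      · ext1; simpa [dP] using e2
      · ext1; simpa [dP] using e3
  rwa [this] at hs

theorem continuousAt_P {p : ℝ × ℝ × ℝ} (h : 0 < cosh p.1 + cos p.2.1) :
    ContinuousAt (fun p : ℝ × ℝ × ℝ => P p.1 p.2.1 p.2.2) p := (contDiffAt_P h).continuousAt

theorem inner_gradient {f : E3 → ℝ} {x : E3} (v : E3) : ⟪gradient f x, v⟫ = fderiv ℝ f x v := by
  simp [gradient]

theorem isOpen_B_diff_Z : IsOpen (B \ Z) := by
  refine isOpen_ball.sdiff ?_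
  have h0 : Continuous fun x : E3 => x 0 := by fun_prop
  have h1 : Continuous fun x : E3 => x 1 := by fun_prop
  exact (isClosed_eq h0 continuous_const).inter (isClosed_eq h1 continuous_const)

theorem contDiffOn_tc : ContDiffOn ℝ ∞ tc (B \ Z) := by
  intro x hx
  apply ContDiffAt.contDiffWithinAt
  have hr := rad_sq_pos hx.2
  have h1 : (1 + x 2) ^ 2 + (x 0 ^ 2 + x 1 ^ 2) ≠ 0 := by positivity
  have h2 : (1 - x 2) ^ 2 + (x 0 ^ 2 + x 1 ^ 2) ≠ 0 := by positivity
  unfold tc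
  refine contDiffAt_const.mul (ContDiffAt.log (ContDiffAt.div ?_ ?_ h2) (div_ne_zero h1 h2)) <;>
  fun_prop

theorem contDiffOn_phc : ContDiffOn ℝ ∞ phc (B \ Z) := by
  intro x hx
  apply ContDiffAt.contDiffWithinAt
  have hr := rad_sq_pos hx.2
  have h1 := one_sub_normSq_pos hx.1
  unfold phc rad
  refine (contDiff_arctan.contDiffAt).comp x (ContDiffAt.div
    (contDiffAt_const.mul (ContDiffAt.sqrt ?_ hr.ne')) ?_ h1.ne')
  · fun_prop
  · exact contDiffAt_const.sub (contDiff_norm_sq ℝ).contDiffAt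

theorem gradient_eq_of_comp_P {f : E3 → ℝ} {t φ θ a b : ℝ} (hφ : φ ∈ Iφ)
    (hf : DifferentiableAt ℝ f (P t φ θ))
    (h1 : HasDerivAt (fun s => f (P s φ θ)) a t) (h2 : HasDerivAt (fun s => f (P t s θ)) b φ)
    (h3 : HasDerivAt (fun s => f (P t φ s)) 0 θ) :
    gradient f (P t φ θ) = (kap t φ)⁻¹ • (a • et t φ θ + b • ep t φ θ) := by
  have hc := cos_pos_of_mem hφ
  have hk := kap_pos (t := t) hc.le
  have hs := sin_pos_of_mem hφ
  have hd := denom_pos (t := t) hc.le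
  have c1 : ⟪et t φ θ, gradient f (P t φ θ)⟫ = (kap t φ)⁻¹ * a := by
    have := (hf.hasFDerivAt.comp_hasDerivAt t (hasDerivAt_P_t hd θ)).unique h1
    rw [map_smul, smul_eq_mul, ← inner_gradient, real_inner_comm] at this
    rw [← this]; field_simp
  have c2 : ⟪ep t φ θ, gradient f (P t φ θ)⟫ = (kap t φ)⁻¹ * b := by
    have := (hf.hasFDerivAt.comp_hasDerivAt φ (hasDerivAt_P_phi hd θ)).unique h2
    rw [map_smul, smul_eq_mul, ← inner_gradient, real_inner_comm] at this
    rw [← this]; field_simp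
  have c3 : ⟪eth θ, gradient f (P t φ θ)⟫ = 0 := by
    have := (hf.hasFDerivAt.comp_hasDerivAt θ (hasDerivAt_P_theta t φ θ)).unique h3
    rw [map_smul, smul_eq_mul, ← inner_gradient, real_inner_comm] at this
    exact (mul_eq_zero.1 this).resolve_left (mul_pos hk hs).ne'
  rw [frame_expand (t := t) (φ := φ) (θ := θ) hc.le (gradient f (P t φ θ)), c1, c2, c3]
  simp [smul_smul]

/-- Differentiation under the integral sign for jointly continuous derivatives. -/
theorem hasDerivAt_integral_of_continuousOn {F F' : ℝ → ℝ → ℝ} {a b s0 δ : ℝ} (hδ : 0 < δ)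
    (hab : a ≤ b) (hF : ∀ s ∈ Ioo (s0 - δ) (s0 + δ), ContinuousOn (F s) (Icc a b))
    (hd : ∀ s ∈ Ioo (s0 - δ) (s0 + δ), ∀ θ ∈ Icc a b, HasDerivAt (fun s => F s θ) (F' s θ) s)
    (hF' : ContinuousOn (fun p : ℝ × ℝ => F' p.1 p.2) (Ioo (s0 - δ) (s0 + δ) ×ˢ Icc a b)) :
    HasDerivAt (fun s => ∫ θ in a..b, F s θ) (∫ θ in a..b, F' s0 θ) s0 := by
  have hK : IsCompact (Icc (s0 - δ / 2) (s0 + δ / 2) ×ˢ Icc a b) := isCompact_Icc.prod isCompact_Icc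
  have hsub : Icc (s0 - δ / 2) (s0 + δ / 2) ⊆ Ioo (s0 - δ) (s0 + δ) := fun s hs =>
    ⟨by linarith [hs.1], by linarith [hs.2]⟩
  obtain ⟨C, hC⟩ := hK.exists_bound_of_continuousOn (hF'.mono (prod_mono hsub subset_rfl))
  have hs0 : s0 ∈ Ioo (s0 - δ) (s0 + δ) := ⟨by linarith, by linarith⟩
  have hI : uIoc a b ⊆ Icc a b := by rw [uIoc_of_le hab]; exact Ioc_subset_Icc_self
  have hnb : Ioo (s0 - δ / 2) (s0 + δ / 2) ∈ 𝓝 s0 := Ioo_mem_nhds (by linarith) (by linarith)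
  refine (intervalIntegral.hasDerivAt_integral_of_dominated_loc_of_deriv_le (bound := fun _ => C)
    hnb ?_ ?_ ?_ ?_ intervalIntegrable_const ?_).2
  · filter_upwards [hnb] with s hs
    exact ((hF s (hsub (Ioo_subset_Icc_self hs))).mono hI).aestronglyMeasurable measurableSet_uIoc
  · exact (hF s0 hs0).intervalIntegrable_of_Icc hab
  · refine ContinuousOn.aestronglyMeasurable (fun θ hθ => ?_) measurableSet_uIoc
    have := (hF' (s0, θ) ⟨hs0, hI hθ⟩).comp (f := fun θ => (s0, θ)) (s := uIoc a b) (x := θ)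
      (by fun_prop) (fun y hy => ⟨hs0, hI hy⟩)
    exact this
  · refine ae_of_all _ fun θ hθ s hs => ?_
    exact hC (s, θ) ⟨Ioo_subset_Icc_self hs, hI hθ⟩
  · refine ae_of_all _ fun θ hθ s hs => ?_
    exact hd s (hsub (Ioo_subset_Icc_self hs)) θ (hI hθ)

/-! ### Surfaces of revolution -/

/-- A regular injective `C¹` curve `s ↦ (γ₁ s, γ₂ s)`, `s ∈ (a, b)`, in the half-disc with
coordinates `(t, φ)`. -/
structure IsProfile (γ₁ γ₂ γ₁' γ₂' : ℝ → ℝ) (a b : ℝ) : Prop where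
  deriv₁ : ∀ s ∈ Ioo a b, HasDerivAt γ₁ (γ₁' s) s
  deriv₂ : ∀ s ∈ Ioo a b, HasDerivAt γ₂ (γ₂' s) s
  cont₁ : ContinuousOn γ₁' (Ioo a b)
  cont₂ : ContinuousOn γ₂' (Ioo a b)
  mem : ∀ s ∈ Ioo a b, γ₂ s ∈ Iφ
  regular : ∀ s ∈ Ioo a b, 0 < γ₁' s ^ 2 + γ₂' s ^ 2
  inj : ∀ s ∈ Ioo a b, ∀ r ∈ Ioo a b, γ₁ s = γ₁ r → γ₂ s = γ₂ r → s = r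

/-- The surface obtained by rotating a curve about the axis. -/
def rev (γ₁ γ₂ : ℝ → ℝ) (a b : ℝ) : Set E3 :=
  {x | ∃ s ∈ Ioo a b, ∃ θ, x = P (γ₁ s) (γ₂ s) θ}

/-- Euclidean length element of a curve in the coordinates `(t, φ)`. -/
def speed (γ₁' γ₂' : ℝ → ℝ) (s : ℝ) : ℝ := √(γ₁' s ^ 2 + γ₂' s ^ 2)

/-- The weight of the hyperbolic area of surfaces of revolution. -/
def hh (φ : ℝ) : ℝ := sin φ / cos φ ^ 2

/-- Jacobian of the parametrization of a surface of revolution. -/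
def jac (γ₁ γ₂ γ₁' γ₂' : ℝ → ℝ) (s : ℝ) : ℝ :=
  kap (γ₁ s) (γ₂ s) ^ 2 * sin (γ₂ s) * speed γ₁' γ₂' s

theorem normDet_orthogonal {A : E2 →L[ℝ] E3} {u v : E3} {c d : ℝ} (hA : ∀ y, A y = y 0 • u + y 1 • v)
    (huv : ⟪u, v⟫ = 0) (hc : 0 ≤ c) (hd : 0 ≤ d) (hu : ⟪u, u⟫ = c ^ 2) (hv : ⟪v, v⟫ = d ^ 2) :
    (A : E2 →ₗ[ℝ] E3).normDet = c * d := by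
  have h := (A : E2 →ₗ[ℝ] E3).normDet_sq_eq_det_gram (EuclideanSpace.basisFun (Fin 2) ℝ)
  have h2 : (A : E2 →ₗ[ℝ] E3).normDet ^ 2 = (c * d) ^ 2 := by
    refine Eq.trans (by simpa using h) ?_
    rw [Matrix.det_fin_two]
    simp only [Matrix.gram_apply, hA]
    have e1 : ⟪v, u⟫ = 0 := by rw [real_inner_comm]; exact huv
    simp only [PiLp.single_apply, if_true, one_smul, Fin.isValue, one_ne_zero, zero_ne_one,
      if_false, zero_smul, add_zero, zero_add, huv, e1, hu, hv]
    ring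
  exact (sq_eq_sq₀ (LinearMap.normDet_nonneg _) (by positivity)).1 h2

/-- Identification of `ℝ × ℝ` with the Euclidean plane. -/
def toE2 : ℝ × ℝ ≃ᵐ E2 :=
  MeasurableEquiv.finTwoArrow.symm.trans (MeasurableEquiv.toLp 2 (Fin 2 → ℝ))

theorem toE2_apply_zero (p : ℝ × ℝ) : toE2 p 0 = p.1 := rfl
theorem toE2_apply_one (p : ℝ × ℝ) : toE2 p 1 = p.2 := rfl

theorem measurePreserving_toE2 : MeasurePreserving toE2 volume volume :=
  ((volume_preserving_finTwoArrow ℝ).symm).trans (PiLp.volume_preserving_toLp (Fin 2))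

theorem toE2_preimage (a b c d : ℝ) :
    toE2 ⁻¹' {y : E2 | y 0 ∈ Ioo a b ∧ y 1 ∈ Ioo c d} = Ioo a b ×ˢ Ioo c d := by
  ext p; simp [toE2_apply_zero, toE2_apply_one]

namespace IsProfile

variable {γ₁ γ₂ γ₁' γ₂' : ℝ → ℝ} {a b : ℝ}

theorem speed_pos (h : IsProfile γ₁ γ₂ γ₁' γ₂' a b) {s : ℝ} (hs : s ∈ Ioo a b) :
    0 < speed γ₁' γ₂' s := sqrt_pos.2 (h.regular s hs)

theorem speed_sq (h : IsProfile γ₁ γ₂ γ₁' γ₂' a b) {s : ℝ} (hs : s ∈ Ioo a b) :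
    speed γ₁' γ₂' s ^ 2 = γ₁' s ^ 2 + γ₂' s ^ 2 := sq_sqrt (h.regular s hs).le

theorem continuousOn_speed (h : IsProfile γ₁ γ₂ γ₁' γ₂' a b) :
    ContinuousOn (speed γ₁' γ₂') (Ioo a b) :=
  ((h.cont₁.pow 2).add (h.cont₂.pow 2)).sqrt

theorem continuousOn₁ (h : IsProfile γ₁ γ₂ γ₁' γ₂' a b) : ContinuousOn γ₁ (Ioo a b) := fun s hs =>
  (h.deriv₁ s hs).continuousAt.continuousWithinAt

theorem continuousOn₂ (h : IsProfile γ₁ γ₂ γ₁' γ₂' a b) : ContinuousOn γ₂ (Ioo a b) := fun s hs =>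
  (h.deriv₂ s hs).continuousAt.continuousWithinAt

theorem continuousOn_kap (h : IsProfile γ₁ γ₂ γ₁' γ₂' a b) :
    ContinuousOn (fun s => kap (γ₁ s) (γ₂ s)) (Ioo a b) :=
  ContinuousOn.inv₀ ((continuous_cosh.comp_continuousOn h.continuousOn₁).add
    (continuous_cos.comp_continuousOn h.continuousOn₂))
    fun s hs => (denom_pos (cos_pos_of_mem (h.mem s hs)).le).ne'

theorem continuousOn_jac (h : IsProfile γ₁ γ₂ γ₁' γ₂' a b) :
    ContinuousOn (jac γ₁ γ₂ γ₁' γ₂') (Ioo a b) :=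
  ((h.continuousOn_kap.pow 2).mul (continuous_sin.comp_continuousOn h.continuousOn₂)).mul
    h.continuousOn_speed

theorem jac_pos (h : IsProfile γ₁ γ₂ γ₁' γ₂' a b) {s : ℝ} (hs : s ∈ Ioo a b) :
    0 < jac γ₁ γ₂ γ₁' γ₂' s :=
  mul_pos (mul_pos (pow_pos (kap_pos (cos_pos_of_mem (h.mem s hs)).le) 2)
    (sin_pos_of_mem (h.mem s hs))) (h.speed_pos hs)

theorem jac_le_speed (h : IsProfile γ₁ γ₂ γ₁' γ₂' a b) {s : ℝ} (hs : s ∈ Ioo a b) :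
    jac γ₁ γ₂ γ₁' γ₂' s ≤ speed γ₁' γ₂' s := by
  have hc := cos_pos_of_mem (h.mem s hs)
  have h1 := kap_pos (t := γ₁ s) hc.le
  have h2 := kap_le_one (t := γ₁ s) hc.le
  have h3 := sin_pos_of_mem (h.mem s hs)
  have h4 := sin_le_one (γ₂ s)
  refine mul_le_of_le_one_left (h.speed_pos hs).le ?_
  have : kap (γ₁ s) (γ₂ s) ^ 2 ≤ 1 := pow_le_one₀ h1.le h2
  exact mul_le_one₀ this h3.le h4

/-- The parametrization of a surface of revolution cut open along a half-plane. -/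
theorem isParam (h : IsProfile γ₁ γ₂ γ₁' γ₂' a b) (θ₀ : ℝ) :
    IsParam (fun y : E2 => P (γ₁ (y 0)) (γ₂ (y 0)) (y 1))
      (fun y => (proj (0 : Fin 2) : E2 →L[ℝ] ℝ).smulRight
          (kap (γ₁ (y 0)) (γ₂ (y 0)) • (γ₁' (y 0) • et (γ₁ (y 0)) (γ₂ (y 0)) (y 1) +
            γ₂' (y 0) • ep (γ₁ (y 0)) (γ₂ (y 0)) (y 1))) + (proj (1 : Fin 2) : E2 →L[ℝ] ℝ).smulRight
          ((kap (γ₁ (y 0)) (γ₂ (y 0)) * sin (γ₂ (y 0))) • eth (y 1)))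
      (fun y => jac γ₁ γ₂ γ₁' γ₂' (y 0)) {y : E2 | y 0 ∈ Ioo a b ∧ y 1 ∈ Ioo θ₀ (θ₀ + 2 * π)} := by
  have c0 : Continuous fun y : E2 => y 0 := by fun_prop
  have c1 : Continuous fun y : E2 => y 1 := by fun_prop
  have hinn : ∀ y : E2, y 0 ∈ Ioo a b →
      ⟪kap (γ₁ (y 0)) (γ₂ (y 0)) • (γ₁' (y 0) • et (γ₁ (y 0)) (γ₂ (y 0)) (y 1) +
            γ₂' (y 0) • ep (γ₁ (y 0)) (γ₂ (y 0)) (y 1)),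
        (kap (γ₁ (y 0)) (γ₂ (y 0)) * sin (γ₂ (y 0))) • eth (y 1)⟫ = 0 := by
    intro y hy
    simp [inner_smul_left, inner_smul_right, inner_add_left, inner_et_eth, inner_ep_eth]
  have hdet : ∀ y : E2, y 0 ∈ Ioo a b → jac γ₁ γ₂ γ₁' γ₂' (y 0) =
      (((proj (0 : Fin 2) : E2 →L[ℝ] ℝ).smulRight
          (kap (γ₁ (y 0)) (γ₂ (y 0)) • (γ₁' (y 0) • et (γ₁ (y 0)) (γ₂ (y 0)) (y 1) +
            γ₂' (y 0) • ep (γ₁ (y 0)) (γ₂ (y 0)) (y 1))) +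
        (proj (1 : Fin 2) : E2 →L[ℝ] ℝ).smulRight
          ((kap (γ₁ (y 0)) (γ₂ (y 0)) * sin (γ₂ (y 0))) • eth (y 1)) :
            E2 →L[ℝ] E3) : E2 →ₗ[ℝ] E3).normDet := by
    intro y hy
    have hc := cos_pos_of_mem (h.mem _ hy)
    have h1 := kap_pos (t := γ₁ (y 0)) hc.le
    have h3 := sin_pos_of_mem (h.mem _ hy)
    rw [normDet_orthogonal (c := kap (γ₁ (y 0)) (γ₂ (y 0)) * speed γ₁' γ₂' (y 0))
      (d := kap (γ₁ (y 0)) (γ₂ (y 0)) * sin (γ₂ (y 0))) (fun z => by simp) (hinn y hy)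
      (mul_pos h1 (h.speed_pos hy)).le (mul_pos h1 h3).le]
    · rw [jac]; ring
    · have e1 := inner_et_et (t := γ₁ (y 0)) (θ := y 1) hc.le
      have e2 := inner_ep_ep (t := γ₁ (y 0)) (θ := y 1) hc.le
      simp only [inner_smul_left, inner_smul_right, inner_add_left, inner_add_right, inner_et_ep,
        inner_ep_et, e1, e2, mul_pow, h.speed_sq hy]
      simp; ring
    · simp only [inner_smul_left, inner_smul_right, inner_eth_eth]
      simp; ring
  refine ⟨?_, ?_, ?_, ?_, fun y hy => hdet y hy.1, fun y hy => h.jac_pos hy.1, ?_⟩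
  · exact (isOpen_Ioo.preimage c0).inter (isOpen_Ioo.preimage c1)
  · intro y hy
    have hn : Ioo a b ∈ 𝓝 (y 0) := isOpen_Ioo.mem_nhds hy.1
    have d1 : HasStrictDerivAt γ₁ (γ₁' (y 0)) (y 0) :=
      hasStrictDerivAt_of_hasDerivAt_of_continuousAt
        (by filter_upwards [hn] with s hs using h.deriv₁ s hs) (h.cont₁.continuousAt hn)
    have d2 : HasStrictDerivAt γ₂ (γ₂' (y 0)) (y 0) :=
      hasStrictDerivAt_of_hasDerivAt_of_continuousAt
        (by filter_upwards [hn] with s hs using h.deriv₂ s hs) (h.cont₂.continuousAt hn)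
    have p0 := (proj (0 : Fin 2) : E2 →L[ℝ] ℝ).hasStrictFDerivAt (x := y)
    have p1 := (proj (1 : Fin 2) : E2 →L[ℝ] ℝ).hasStrictFDerivAt (x := y)
    have q1 := d1.comp_hasStrictFDerivAt y p0
    have q2 := d2.comp_hasStrictFDerivAt y p0
    have hP := hasStrictFDerivAt_P (t := γ₁ (y 0)) (φ := γ₂ (y 0)) (y 1)
      (denom_pos (cos_pos_of_mem (h.mem _ hy.1)).le)
    have := HasStrictFDerivAt.comp (g := fun p : ℝ × ℝ × ℝ => P p.1 p.2.1 p.2.2) y hP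
      (q1.prodMk (q2.prodMk p1))
    refine HasStrictFDerivAt.congr_fderiv this ?_
    ext1 z
    simp only [ContinuousLinearMap.comp_apply, ContinuousLinearMap.prod_apply, dP_apply,
      add_apply, ContinuousLinearMap.smulRight_apply,
      smul_apply, PiLp.proj_apply, smul_eq_mul]
    module
  · intro y hy
    have hpos := h.jac_pos hy.1
    rw [hdet y hy.1] at hpos
    have := (LinearMap.normDet_eq_zero_iff_ker_ne_bot.not.1 hpos.ne')
    rw [not_not] at this
    exact LinearMap.ker_eq_bot.1 this
  · intro y hy z hz hyz
    obtain ⟨h1, h2, h3, h4⟩ := P_inj (h.mem _ hy.1) (h.mem _ hz.1) hyz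
    have h0 := h.inj _ hy.1 _ hz.1 h1 h2
    have h5 : y 1 = z 1 := by
      have : (y 1 : Real.Angle) = (z 1 : Real.Angle) := Real.Angle.cos_sin_inj h3 h4
      rw [Real.Angle.angle_eq_iff_two_pi_dvd_sub] at this
      obtain ⟨k, hk⟩ := this
      have b1 := hy.2.1
      have b2 := hy.2.2
      have b3 := hz.2.1
      have b4 := hz.2.2
      have hk0 : k = 0 := by
        have u1 : (k : ℝ) < 1 := by
          by_contra hcon
          push Not at hcon
          nlinarith [pi_pos]
        have u2 : (-1 : ℝ) < k := by
          by_contra hcon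
          push Not at hcon
          nlinarith [pi_pos]
        have u1' : k < 1 := by exact_mod_cast u1
        have u2' : -1 < k := by exact_mod_cast u2
        omega
      rw [hk0] at hk
      simp at hk
      linarith
    ext i
    fin_cases i
    exacts [h0, h5]
  · exact h.continuousOn_jac.comp c0.continuousOn fun y hy => hy.1

/-- Up to a null set, the surface of revolution is the image of its parametrization. -/
theorem rev_ae_eq (h : IsProfile γ₁ γ₂ γ₁' γ₂' a b) :
    rev γ₁ γ₂ a b =ᵐ[μHE[2]] (fun y : E2 => P (γ₁ (y 0)) (γ₂ (y 0)) (y 1)) ''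
      {y : E2 | y 0 ∈ Ioo a b ∧ y 1 ∈ Ioo (-π) (-π + 2 * π)} := by
  have hsub : (fun y : E2 => P (γ₁ (y 0)) (γ₂ (y 0)) (y 1)) ''
      {y : E2 | y 0 ∈ Ioo a b ∧ y 1 ∈ Ioo (-π) (-π + 2 * π)} ⊆ rev γ₁ γ₂ a b := by
    rintro _ ⟨y, hy, rfl⟩
    exact ⟨y 0, hy.1, y 1, rfl⟩
  refine ae_eq_set.2 ⟨?_, by rw [sdiff_eq_empty.2 hsub]; exact measure_empty⟩
  set S : Set E2 := {y : E2 | y 0 ∈ Ioo a b ∧ y 1 ∈ Ioo 0 (0 + 2 * π)} ∩ {y | y 1 = π}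
  have c1 : Continuous fun y : E2 => y 1 := by fun_prop
  have hSm : MeasurableSet S := (h.isParam 0).isOpen.measurableSet.inter
    (isClosed_eq c1 continuous_const).measurableSet
  have hS0 : volume S = 0 := by
    have : volume ({y : E2 | y 1 = π}) = 0 := by
      rw [← measurePreserving_toE2.measure_preimage_equiv]
      have : toE2 ⁻¹' {y : E2 | y 1 = π} = univ ×ˢ {π} := by
        ext p; simp [toE2_apply_one]
      rw [this, Measure.volume_eq_prod, Measure.prod_prod]
      simp
    exact measure_mono_null inter_subset_right this
  refine measure_mono_null (t := (fun y : E2 => P (γ₁ (y 0)) (γ₂ (y 0)) (y 1)) '' S) ?_ ?_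
  · rintro x ⟨⟨s, hs, θ, rfl⟩, hx2⟩
    obtain ⟨k, hk⟩ : ∃ k : ℤ, θ + k * (2 * π) ∈ Ioc (-π) (-π + 2 * π) := by
      obtain ⟨k, hk, -⟩ := existsUnique_add_zsmul_mem_Ioc (a := 2 * π)
        (by positivity) θ (-π)
      exact ⟨k, by simpa using hk⟩
    have hP : P (γ₁ s) (γ₂ s) θ = P (γ₁ s) (γ₂ s) (θ + k * (2 * π)) := by
      simp [P, cos_add_int_mul_two_pi, sin_add_int_mul_two_pi]
    rw [hP] at hx2 ⊢
    set θ' := θ + k * (2 * π)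
    have hθ' : θ' = π := by
      by_contra hne
      apply hx2
      refine ⟨toE2 (s, θ'), ⟨hs, hk.1, lt_of_le_of_ne hk.2 ?_⟩, rfl⟩
      rw [toE2_apply_one]
      exact fun hcon => hne (Eq.trans hcon (by ring))
    exact ⟨toE2 (s, θ'), ⟨⟨hs, by rw [toE2_apply_one, hθ']; exact
      ⟨pi_pos, by linarith [pi_pos]⟩⟩, hθ'⟩, rfl⟩
  · rw [(h.isParam 0).measure_image inter_subset_left hSm, Measure.restrict_eq_zero.2 hS0,
      lintegral_zero_measure]

theorem lintegral_rev (h : IsProfile γ₁ γ₂ γ₁' γ₂' a b) (g : E3 → ENNReal) :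
    ∫⁻ x in rev γ₁ γ₂ a b, g x ∂μHE[2] = ∫⁻ p in Ioo a b ×ˢ Ioo (-π) π,
      ofReal (jac γ₁ γ₂ γ₁' γ₂' p.1) * g (P (γ₁ p.1) (γ₂ p.1) p.2) := by
  rw [setLIntegral_congr h.rev_ae_eq, (h.isParam _).lintegral_image,
    ← measurePreserving_toE2.setLIntegral_comp_preimage_emb toE2.measurableEmbedding,
    toE2_preimage, show -π + 2 * π = π by ring]
  rfl

theorem integrableOn_rev_iff (h : IsProfile γ₁ γ₂ γ₁' γ₂' a b) (g : E3 → ℝ) :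
    IntegrableOn g (rev γ₁ γ₂ a b) μHE[2] ↔ IntegrableOn (fun p : ℝ × ℝ =>
      jac γ₁ γ₂ γ₁' γ₂' p.1 * g (P (γ₁ p.1) (γ₂ p.1) p.2)) (Ioo a b ×ˢ Ioo (-π) π) := by
  rw [integrableOn_congr_set_ae h.rev_ae_eq, (h.isParam _).integrableOn_image_iff,
    ← measurePreserving_toE2.integrableOn_comp_preimage toE2.measurableEmbedding,
    toE2_preimage, show -π + 2 * π = π by ring]
  rfl

theorem integral_rev (h : IsProfile γ₁ γ₂ γ₁' γ₂' a b) (g : E3 → ℝ) :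
    ∫ x in rev γ₁ γ₂ a b, g x ∂μHE[2] = ∫ p in Ioo a b ×ˢ Ioo (-π) π,
      jac γ₁ γ₂ γ₁' γ₂' p.1 * g (P (γ₁ p.1) (γ₂ p.1) p.2) := by
  rw [setIntegral_congr_set h.rev_ae_eq, (h.isParam _).integral_image,
    ← measurePreserving_toE2.setIntegral_preimage_emb toE2.measurableEmbedding,
    toE2_preimage, show -π + 2 * π = π by ring]
  rfl

theorem lintegral_rev_of_rotInv (h : IsProfile γ₁ γ₂ γ₁' γ₂' a b) {g : E3 → ENNReal}
    {G : ℝ → ENNReal} (hG : AEMeasurable G (volume.restrict (Ioo a b)))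
    (hg : ∀ s ∈ Ioo a b, ∀ θ, ofReal (jac γ₁ γ₂ γ₁' γ₂' s) * g (P (γ₁ s) (γ₂ s) θ) = G s) :
    ∫⁻ x in rev γ₁ γ₂ a b, g x ∂μHE[2] = ofReal (2 * π) * ∫⁻ s in Ioo a b, G s := by
  rw [h.lintegral_rev, setLIntegral_congr_fun (g := fun p : ℝ × ℝ => G p.1 * 1)
    (measurableSet_Ioo.prod measurableSet_Ioo) (fun p hp => by simpa using hg p.1 hp.1 p.2),
    Measure.volume_eq_prod, ← Measure.prod_restrict,
    lintegral_prod_mul hG aemeasurable_const]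
  simp only [lintegral_const, MeasurableSet.univ, Measure.restrict_apply, univ_inter,
    volume_Ioo, one_mul]
  rw [mul_comm]; congr 2; ring

theorem jac_mul_lam_sq (h : IsProfile γ₁ γ₂ γ₁' γ₂' a b) {s : ℝ} (hs : s ∈ Ioo a b) (θ : ℝ) :
    jac γ₁ γ₂ γ₁' γ₂' s * lam (P (γ₁ s) (γ₂ s) θ) ^ 2 = hh (γ₂ s) * speed γ₁' γ₂' s := by
  have hc := cos_pos_of_mem (h.mem _ hs)
  have h1 := kap_pos (t := γ₁ s) hc.le
  rw [lam_P hc, jac, hh]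
  field_simp

/-- Hyperbolic area of a surface of revolution. -/
theorem hypArea_rev (h : IsProfile γ₁ γ₂ γ₁' γ₂' a b) : hypArea (rev γ₁ γ₂ a b) = ofReal (2 * π) *
      ∫⁻ s in Ioo a b, ofReal (hh (γ₂ s) * speed γ₁' γ₂' s) := by
  refine h.lintegral_rev_of_rotInv (G := fun s => ofReal (hh (γ₂ s) * speed γ₁' γ₂' s))
    ?_ fun s hs θ => ?_
  · refine (ContinuousOn.aemeasurable ?_ measurableSet_Ioo).ennreal_ofReal
    refine ContinuousOn.mul (ContinuousOn.div
      (continuous_sin.comp_continuousOn h.continuousOn₂)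
      ((continuous_cos.comp_continuousOn h.continuousOn₂).pow 2) fun s hs => ?_)
      h.continuousOn_speed
    exact (pow_pos (cos_pos_of_mem (h.mem s hs)) 2).ne'
  · rw [← h.jac_mul_lam_sq hs θ, ENNReal.ofReal_mul (h.jac_pos hs).le]

/-- Euclidean area of a surface of revolution. -/
theorem measure_rev_le (h : IsProfile γ₁ γ₂ γ₁' γ₂' a b) : μHE[2] (rev γ₁ γ₂ a b) ≤
    ofReal (2 * π) * ∫⁻ s in Ioo a b, ofReal (speed γ₁' γ₂' s) := by
  rw [← setLIntegral_one, h.lintegral_rev_of_rotInv (g := fun _ => 1)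
    (G := fun s => ofReal (jac γ₁ γ₂ γ₁' γ₂' s))
    (h.continuousOn_jac.aemeasurable measurableSet_Ioo).ennreal_ofReal (fun s hs θ => by simp)]
  gcongr 1
  exact setLIntegral_mono' measurableSet_Ioo fun s hs =>
    ENNReal.ofReal_le_ofReal (h.jac_le_speed hs)

end IsProfile

/-! ### Circulation along latitude circles and the theorem of Stokes -/

theorem continuousOn_toLp_three {X : Type*} [TopologicalSpace X] {S : Set X} {a b c : X → ℝ}
    (ha : ContinuousOn a S) (hb : ContinuousOn b S) (hc : ContinuousOn c S) :
    ContinuousOn (fun p => (!₂[a p, b p, c p] : E3)) S := by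
  refine (PiLp.continuous_toLp 2 _).comp_continuousOn (continuousOn_pi.2 fun i => ?_)
  fin_cases i
  exacts [ha, hb, hc]

section continuity

variable {X : Type*} [TopologicalSpace X] {S : Set X} {t φ θ : X → ℝ}

theorem continuousOn_kap_comp (ht : ContinuousOn t S) (hφ : ContinuousOn φ S)
    (h : ∀ p ∈ S, 0 < cosh (t p) + cos (φ p)) : ContinuousOn (fun p => kap (t p) (φ p)) S :=
  ContinuousOn.inv₀ ((continuous_cosh.comp_continuousOn ht).add
    (continuous_cos.comp_continuousOn hφ)) fun p hp => (h p hp).ne'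

theorem continuousOn_P (ht : ContinuousOn t S) (hφ : ContinuousOn φ S) (hθ : ContinuousOn θ S)
    (h : ∀ p ∈ S, 0 < cosh (t p) + cos (φ p)) : ContinuousOn (fun p => P (t p) (φ p) (θ p)) S := by
  have hk := continuousOn_kap_comp ht hφ h
  apply continuousOn_toLp_three <;> fun_prop

theorem continuousOn_et (ht : ContinuousOn t S) (hφ : ContinuousOn φ S) (hθ : ContinuousOn θ S)
    (h : ∀ p ∈ S, 0 < cosh (t p) + cos (φ p)) : ContinuousOn (fun p => et (t p) (φ p) (θ p)) S := by
  have hk := continuousOn_kap_comp ht hφ h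
  apply continuousOn_toLp_three <;> fun_prop

theorem continuousOn_ep (ht : ContinuousOn t S) (hφ : ContinuousOn φ S) (hθ : ContinuousOn θ S)
    (h : ∀ p ∈ S, 0 < cosh (t p) + cos (φ p)) : ContinuousOn (fun p => ep (t p) (φ p) (θ p)) S := by
  have hk := continuousOn_kap_comp ht hφ h
  apply continuousOn_toLp_three <;> fun_prop

theorem continuousOn_eth (hθ : ContinuousOn θ S) : ContinuousOn (fun p => eth (θ p)) S := by
  apply continuousOn_toLp_three <;> fun_prop

end continuity

theorem continuous_eth : Continuous eth :=
  continuousOn_univ.1 (continuousOn_eth (θ := id) continuousOn_id)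

attribute [local irreducible] P et ep eth

/-- The circulation of `Y` along the circle with coordinates `(t, φ)`. -/
def circ (Y : E3 → E3) (t φ : ℝ) : ℝ :=
  ∫ θ in (-π)..Real.pi, ⟪Y (P t φ θ), (kap t φ * sin φ) • eth θ⟫

theorem circ_zero_right (Y : E3 → E3) (t : ℝ) : circ Y t 0 = 0 := by simp [circ]

theorem tendsto_circ {Y : E3 → E3} (hY : Continuous Y) {C : ℝ} (hC : ∀ x, ‖Y x‖ ≤ C)
    {X : Type*} {l : Filter X} [l.IsCountablyGenerated] {t φ : X → ℝ} {t0 φ₀ : ℝ}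
    (h : 0 ≤ cos φ₀) (ht : Tendsto t l (𝓝 t0)) (hφ : Tendsto φ l (𝓝 φ₀)) :
    Tendsto (fun s => circ Y (t s) (φ s)) l (𝓝 (circ Y t0 φ₀)) := by
  have hd := denom_pos (t := t0) h
  have hk : ContinuousAt (fun p : ℝ × ℝ => kap p.1 p.2) (t0, φ₀) :=
    ContinuousAt.inv₀ (f := fun p : ℝ × ℝ => cosh p.1 + cos p.2) (by fun_prop) hd.ne'
  have htφ : Tendsto (fun s => (t s, φ s)) l (𝓝 (t0, φ₀)) := ht.prodMk_nhds hφ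
  have hk2 : Tendsto (fun s => kap (t s) (φ s)) l (𝓝 (kap t0 φ₀)) := by
    have := hk.tendsto.comp htφ
    simpa only [Function.comp_def] using this
  have hr : Tendsto (fun s => kap (t s) (φ s) * sin (φ s)) l
      (𝓝 (kap t0 φ₀ * sin φ₀)) :=
    hk2.mul ((continuous_sin.tendsto φ₀).comp hφ)
  have hden : ∀ᶠ s in l, 0 < cosh (t s) + cos (φ s) :=
    (((continuous_cosh.tendsto t0).comp ht).add
      ((continuous_cos.tendsto φ₀).comp hφ)).eventually_const_lt hd
  have hec := continuous_eth
  refine intervalIntegral.tendsto_integral_filter_of_dominated_convergence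
    (F := fun s θ => ⟪Y (P (t s) (φ s) θ), (kap (t s) (φ s) * sin (φ s)) • eth θ⟫)
    (f := fun θ => ⟪Y (P t0 φ₀ θ), (kap t0 φ₀ * sin φ₀) • eth θ⟫)
    (fun _ => C * (kap t0 φ₀ + 1)) ?_ ?_ intervalIntegrable_const ?_
  · filter_upwards [hden] with s hs
    have : Continuous fun θ => P (t s) (φ s) θ :=
      continuousOn_univ.1 (continuousOn_P continuousOn_const continuousOn_const continuousOn_id
        fun _ _ => hs)
    refine Continuous.aestronglyMeasurable ?_
    fun_prop
  · filter_upwards [hk2.eventually_lt_const (lt_add_one _), hden] with s hs hs2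
    refine ae_of_all _ fun θ _ => ?_
    have h1 : 0 < kap (t s) (φ s) := inv_pos.2 hs2
    refine (norm_inner_le_norm _ _).trans ?_
    have h2 : ‖(kap (t s) (φ s) * sin (φ s)) • eth θ‖ ≤ kap t0 φ₀ + 1 := by
      rw [norm_smul, norm_eth, mul_one, norm_mul, norm_eq_abs, norm_eq_abs,
        abs_of_pos h1]
      have := abs_sin_le_one (φ s)
      nlinarith [abs_nonneg (sin (φ s))]
    exact mul_le_mul (hC _) h2 (norm_nonneg _) ((norm_nonneg _).trans (hC 0))
  · refine ae_of_all _ fun θ _ => ?_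
    have hp : Tendsto (fun s => P (t s) (φ s) θ) l (𝓝 (P t0 φ₀ θ)) :=
      Tendsto.comp (g := fun p : ℝ × ℝ × ℝ => P p.1 p.2.1 p.2.2)
        (continuousAt_P (p := (t0, φ₀, θ)) hd)
        (ht.prodMk_nhds (hφ.prodMk_nhds (tendsto_const_nhds (x := θ))))
    have hp2 : Tendsto (fun s => Y (P (t s) (φ s) θ)) l (𝓝 (Y (P t0 φ₀ θ))) :=
      (hY.tendsto _).comp hp
    exact hp2.inner (hr.smul_const (eth θ))

/-- Derivative of the circulation along a profile curve, before integration over the circle. -/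
def fluxDensity (Y : E3 → E3) (γ₁ γ₂ γ₁' γ₂' : ℝ → ℝ) (s θ : ℝ) : ℝ :=
  ⟪curl Y (P (γ₁ s) (γ₂ s) θ), (kap (γ₁ s) (γ₂ s) ^ 2 * sin (γ₂ s)) •
    (γ₂' s • et (γ₁ s) (γ₂ s) θ - γ₁' s • ep (γ₁ s) (γ₂ s) θ)⟫

theorem curl_continuous {Y : E3 → E3} (hY : ContDiff ℝ 1 Y) : Continuous (curl Y) := by
  have hc : Continuous (fderiv ℝ Y) := hY.continuous_fderiv (by simp)
  have hp : ∀ i j, Continuous (pd i Y j) := fun i j => by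
    unfold pd
    have : Continuous fun x => fderiv ℝ Y x (single i 1) := by fun_prop
    fun_prop
  rw [← continuousOn_univ]
  apply continuousOn_toLp_three
  · exact ((hp 1 2).sub (hp 2 1)).continuousOn
  · exact ((hp 2 0).sub (hp 0 2)).continuousOn
  · exact ((hp 0 1).sub (hp 1 0)).continuousOn

theorem curl_bounded {Y : E3 → E3} (hY : IsTestField Y) : ∃ C, ∀ x, ‖curl Y x‖ ≤ C := by
  have hc := curl_continuous (hY.1.of_le (by simp))
  have hs : HasCompactSupport (curl Y) := by
    refine HasCompactSupport.intro (hY.2.fderiv ℝ) fun x hx => ?_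
    have : fderiv ℝ Y x = 0 := image_eq_zero_of_notMem_tsupport hx
    apply ext_E3 <;> simp [curl, pd, this]
  exact hc.bounded_above_of_compact_support hs

namespace IsProfile

variable {γ₁ γ₂ γ₁' γ₂' : ℝ → ℝ} {a b : ℝ}

theorem denom_pos (h : IsProfile γ₁ γ₂ γ₁' γ₂' a b) {s : ℝ} (hs : s ∈ Ioo a b) :
    0 < cosh (γ₁ s) + cos (γ₂ s) :=
  HypFoliation.denom_pos (cos_pos_of_mem (h.mem s hs)).le

theorem hasDerivAt_P (h : IsProfile γ₁ γ₂ γ₁' γ₂' a b) {s : ℝ} (hs : s ∈ Ioo a b) (θ : ℝ) :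
    HasDerivAt (fun s => P (γ₁ s) (γ₂ s) θ) (kap (γ₁ s) (γ₂ s) •
      (γ₁' s • et (γ₁ s) (γ₂ s) θ + γ₂' s • ep (γ₁ s) (γ₂ s) θ)) s := by
  have hP := (hasStrictFDerivAt_P θ (h.denom_pos hs)).hasFDerivAt
  have hg : HasDerivAt (fun s => (γ₁ s, γ₂ s, θ)) (γ₁' s, γ₂' s, 0) s :=
    (h.deriv₁ s hs).prodMk ((h.deriv₂ s hs).prodMk (hasDerivAt_const s θ))
  have := HasFDerivAt.comp_hasDerivAt (x := s) (l := fun p : ℝ × ℝ × ℝ => P p.1 p.2.1 p.2.2)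
    (f := fun s => (γ₁ s, γ₂ s, θ)) hP hg
  refine HasDerivAt.congr_deriv this ?_
  rw [dP_apply]; module

/-- Derivative of the radius along a profile curve. -/
def radialDeriv (γ₁ γ₂ γ₁' γ₂' : ℝ → ℝ) (s : ℝ) : ℝ :=
  kap (γ₁ s) (γ₂ s) * (γ₁' s * -(kap (γ₁ s) (γ₂ s) * (sinh (γ₁ s) * sin (γ₂ s))) +
    γ₂' s * (kap (γ₁ s) (γ₂ s) * (1 + cosh (γ₁ s) * cos (γ₂ s))))

theorem hasDerivAt_radius (h : IsProfile γ₁ γ₂ γ₁' γ₂' a b) {s : ℝ} (hs : s ∈ Ioo a b) :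
    HasDerivAt (fun s => kap (γ₁ s) (γ₂ s) * sin (γ₂ s)) (radialDeriv γ₁ γ₂ γ₁' γ₂' s) s := by
  have := (proj (0 : Fin 3) : E3 →L[ℝ] ℝ).hasFDerivAt.comp_hasDerivAt s
    (h.hasDerivAt_P hs 0)
  refine (this.congr_deriv ?_).congr_of_eventuallyEq (.of_forall fun s => ?_)
  · simp [et, ep, radialDeriv]; ring
  · simp [P]

theorem continuousOn_fluxDensity (h : IsProfile γ₁ γ₂ γ₁' γ₂' a b) {Y : E3 → E3}
    (hY : ContDiff ℝ 1 Y) (S : Set ℝ) :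
    ContinuousOn (fun p : ℝ × ℝ => fluxDensity Y γ₁ γ₂ γ₁' γ₂' p.1 p.2) (Ioo a b ×ˢ S) := by
  have m : MapsTo Prod.fst (Ioo a b ×ˢ S) (Ioo a b) := fun p hp => hp.1
  have k1 := h.continuousOn₁.comp continuousOn_fst m
  have k2 := h.continuousOn₂.comp continuousOn_fst m
  have k1' := h.cont₁.comp continuousOn_fst m
  have k2' := h.cont₂.comp continuousOn_fst m
  have k3 : ContinuousOn (fun p : ℝ × ℝ => p.2) (Ioo a b ×ˢ S) := continuousOn_snd
  have hd : ∀ p ∈ Ioo a b ×ˢ S, 0 < cosh (γ₁ p.1) + cos (γ₂ p.1) :=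
    fun p hp => h.denom_pos hp.1
  refine ContinuousOn.inner ((curl_continuous hY).comp_continuousOn
    (continuousOn_P k1 k2 k3 hd)) ?_
  refine ContinuousOn.smul (((continuousOn_kap_comp k1 k2 hd).pow 2).mul
    (continuous_sin.comp_continuousOn k2)) ?_
  exact (k2'.smul (continuousOn_et k1 k2 k3 hd)).sub (k1'.smul (continuousOn_ep k1 k2 k3 hd))

theorem hasDerivAt_circ (h : IsProfile γ₁ γ₂ γ₁' γ₂' a b) {Y : E3 → E3} (hY : ContDiff ℝ 1 Y)
    {s : ℝ} (hs : s ∈ Ioo a b) : HasDerivAt (fun s => circ Y (γ₁ s) (γ₂ s))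
      (∫ θ in (-π)..Real.pi, fluxDensity Y γ₁ γ₂ γ₁' γ₂' s θ) s := by
  obtain ⟨δ, hδ, hball⟩ := Metric.isOpen_iff.1 isOpen_Ioo s hs
  rw [ball_eq_Ioo] at hball
  set X₁ : ℝ → ℝ → E3 := fun s θ => kap (γ₁ s) (γ₂ s) •
      (γ₁' s • et (γ₁ s) (γ₂ s) θ + γ₂' s • ep (γ₁ s) (γ₂ s) θ) with hX₁
  set X₂ : ℝ → ℝ → E3 := fun s θ => (kap (γ₁ s) (γ₂ s) * sin (γ₂ s)) • eth θ with hX₂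
  set m := radialDeriv γ₁ γ₂ γ₁' γ₂' with hm
  set F' : ℝ → ℝ → ℝ := fun s θ => ⟪Y (P (γ₁ s) (γ₂ s) θ), m s • eth θ⟫ +
    ⟪fderiv ℝ Y (P (γ₁ s) (γ₂ s) θ) (X₁ s θ), X₂ s θ⟫ with hF'
  have hYd : ∀ x, HasFDerivAt Y (fderiv ℝ Y x) x := fun x =>
    (hY.differentiable (by simp) x).hasFDerivAt
  have hYc : Continuous (fderiv ℝ Y) := hY.continuous_fderiv (by simp)
  have hS : ContinuousOn (fun p : ℝ × ℝ => F' p.1 p.2)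
      (Ioo (s - δ) (s + δ) ×ˢ Icc (-π) π) := by
    have mm : MapsTo Prod.fst (Ioo (s - δ) (s + δ) ×ˢ Icc (-π) π) (Ioo a b) :=
      fun p hp => hball hp.1
    have k1 := h.continuousOn₁.comp continuousOn_fst mm
    have k2 := h.continuousOn₂.comp continuousOn_fst mm
    have k1' := h.cont₁.comp continuousOn_fst mm
    have k2' := h.cont₂.comp continuousOn_fst mm
    have k3 : ContinuousOn (fun p : ℝ × ℝ => p.2) (Ioo (s - δ) (s + δ) ×ˢ Icc (-π) π) :=
      continuousOn_snd
    have hd : ∀ p ∈ Ioo (s - δ) (s + δ) ×ˢ Icc (-π) π,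
      0 < cosh (γ₁ p.1) + cos (γ₂ p.1) := fun p hp => h.denom_pos (mm hp)
    have kk := continuousOn_kap_comp k1 k2 hd
    have ke := continuousOn_eth k3
    have kP := continuousOn_P k1 k2 k3 hd
    have k4 := continuousOn_et k1 k2 k3 hd
    have k5 := continuousOn_ep k1 k2 k3 hd
    simp only [Function.comp_apply, Function.comp_def] at *
    refine ContinuousOn.add (ContinuousOn.inner (hY.continuous.comp_continuousOn kP)
      (ContinuousOn.fun_smul ?_ ke)) (ContinuousOn.inner (ContinuousOn.clm_apply
      (hYc.comp_continuousOn kP) ?_) ((kk.mul (continuous_sin.comp_continuousOn k2)).smul ke))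
    · simp only [hm, radialDeriv]
      have f1 := continuous_sin.comp_continuousOn k2
      have f2 := continuous_cos.comp_continuousOn k2
      have f3 := continuous_sinh.comp_continuousOn k1
      have f4 := continuous_cosh.comp_continuousOn k1
      exact kk.mul ((k1'.mul (kk.mul (f3.mul f1)).neg).add
        (k2'.mul (kk.mul (continuousOn_const.add (f4.mul f2)))))
    · exact kk.smul ((k1'.smul k4).add (k2'.smul k5))
  have key := hasDerivAt_integral_of_continuousOn (a := -π) (b := π)
    (F := fun s θ => ⟪Y (P (γ₁ s) (γ₂ s) θ), X₂ s θ⟫) (F' := F') hδ (by linarith [pi_pos])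
    (fun s' hs' => by
      have : Continuous fun θ => P (γ₁ s') (γ₂ s') θ :=
        continuousOn_univ.1 (continuousOn_P continuousOn_const continuousOn_const continuousOn_id
        fun _ _ => h.denom_pos (hball hs'))
      have hec := continuous_eth
      have hYc := hY.continuous
      simp only [hX₂]
      fun_prop)
    (fun s' hs' θ _ => ((hYd _).comp_hasDerivAt s' (h.hasDerivAt_P (hball hs') θ)).inner ℝ
      ((h.hasDerivAt_radius (hball hs')).smul_const (eth θ))) hS
  refine key.congr_deriv ?_
  set G' : ℝ → ℝ := fun θ => ⟪Y (P (γ₁ s) (γ₂ s) θ), m s • eth θ⟫ +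
    ⟪fderiv ℝ Y (P (γ₁ s) (γ₂ s) θ) (X₂ s θ), X₁ s θ⟫ with hG'
  have hX₁d : ∀ θ, HasDerivAt (fun θ => X₁ s θ) (m s • eth θ) θ := by
    intro θ
    have d1 := (hasDerivAt_cos θ)
    have d2 := (hasDerivAt_sin θ)
    apply hasDerivAt_E3 <;> simp only [hX₁, et, ep, eth, hm, radialDeriv, PiLp.smul_apply,
      PiLp.add_apply, Matrix.cons_val, smul_eq_mul]
    · refine HasDerivAt.congr_deriv ((((d1.const_mul _).neg.const_mul _).add
        ((d1.const_mul _).const_mul _)).const_mul _) ?_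
      ring
    · refine HasDerivAt.congr_deriv ((((d2.const_mul _).neg.const_mul _).add
        ((d2.const_mul _).const_mul _)).const_mul _) ?_
      ring
    · simpa using hasDerivAt_const θ _
  have hGd : ∀ θ, HasDerivAt (fun θ => ⟪Y (P (γ₁ s) (γ₂ s) θ), X₁ s θ⟫) (G' θ) θ := fun θ =>
    ((hYd _).comp_hasDerivAt θ (hasDerivAt_P_theta (γ₁ s) (γ₂ s) θ)).inner ℝ (hX₁d θ)
  have hPc : Continuous fun θ => P (γ₁ s) (γ₂ s) θ :=
        continuousOn_univ.1 (continuousOn_P continuousOn_const continuousOn_const continuousOn_id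
        fun _ _ => h.denom_pos hs)
  have hX₁c : Continuous (X₁ s) := continuous_iff_continuousAt.2 fun θ => (hX₁d θ).continuousAt
  have hec := continuous_eth
  have hX₂c : Continuous (X₂ s) := by simp only [hX₂]; fun_prop
  have hYcc := hY.continuous
  have hG'c : Continuous G' := by fun_prop
  have hF'c : Continuous (F' s) := by fun_prop
  have hG0 : ∫ θ in (-π)..Real.pi, G' θ = 0 := by
    rw [integral_eq_sub_of_hasDerivAt (fun θ _ => hGd θ)
      (hG'c.intervalIntegrable _ _)]
    simp [hX₁, P, et, ep]
  rw [← sub_zero (∫ θ in (-π)..Real.pi, F' s θ), ← hG0,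
    ← intervalIntegral.integral_sub (hF'c.intervalIntegrable _ _) (hG'c.intervalIntegrable _ _)]
  refine intervalIntegral.integral_congr fun θ _ => ?_
  have e1 : X₁ s θ = (kap (γ₁ s) (γ₂ s) * γ₁' s) • et (γ₁ s) (γ₂ s) θ +
      (kap (γ₁ s) (γ₂ s) * γ₂' s) • ep (γ₁ s) (γ₂ s) θ := by
    simp only [hX₁]; module
  have e2 : crs (X₁ s θ) (X₂ s θ) = (kap (γ₁ s) (γ₂ s) ^ 2 * sin (γ₂ s)) •
    (γ₂' s • et (γ₁ s) (γ₂ s) θ - γ₁' s • ep (γ₁ s) (γ₂ s) θ) := by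
    rw [e1, crs_et_eth]; module
  simp only [hF', hG', fluxDensity, ← e2, inner_curl_crs]
  ring

theorem norm_normal_le (h : IsProfile γ₁ γ₂ γ₁' γ₂' a b) {s : ℝ} (hs : s ∈ Ioo a b) (θ : ℝ) :
    ‖γ₂' s • et (γ₁ s) (γ₂ s) θ - γ₁' s • ep (γ₁ s) (γ₂ s) θ‖ = speed γ₁' γ₂' s := by
  have hc := (cos_pos_of_mem (h.mem s hs)).le
  have e1 := inner_et_et (t := γ₁ s) (θ := θ) hc
  have e2 := inner_ep_ep (t := γ₁ s) (θ := θ) hc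
  rw [← sq_eq_sq₀ (norm_nonneg _) (h.speed_pos hs).le, h.speed_sq hs, ← real_inner_self_eq_norm_sq]
  simp only [inner_sub_left, inner_sub_right, inner_smul_left, inner_smul_right, inner_et_ep,
    inner_ep_et, e1, e2]
  simp; ring

theorem abs_fluxDensity_le (h : IsProfile γ₁ γ₂ γ₁' γ₂' a b) {Y : E3 → E3} {C : ℝ}
    (hC : ∀ x, ‖curl Y x‖ ≤ C) {s : ℝ} (hs : s ∈ Ioo a b) (θ : ℝ) :
    |fluxDensity Y γ₁ γ₂ γ₁' γ₂' s θ| ≤ C * speed γ₁' γ₂' s := by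
  have hc := cos_pos_of_mem (h.mem s hs)
  have h1 := kap_pos (t := γ₁ s) hc.le
  have h2 := h.jac_le_speed hs
  refine (abs_real_inner_le_norm _ _).trans (mul_le_mul (hC _) ?_ (norm_nonneg _)
    ((norm_nonneg _).trans (hC 0)))
  rw [norm_smul, h.norm_normal_le hs, norm_eq_abs,
    abs_of_pos (mul_pos (pow_pos h1 2) (sin_pos_of_mem (h.mem s hs)))]
  exact h2

/-- Flux of a curl through a weighted surface of revolution. -/
theorem flux_rev (h : IsProfile γ₁ γ₂ γ₁' γ₂' a b) {Y : E3 → E3} (hY : IsTestField Y)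
    (hInt : IntegrableOn (speed γ₁' γ₂') (Ioo a b)) {w : ℝ → ℝ} (hw : Measurable w)
    {D : ℝ} (hD : ∀ s, |w s| ≤ D) {g : E3 → ℝ}
    (hg : ∀ s ∈ Ioo a b, ∀ θ, speed γ₁' γ₂' s * g (P (γ₁ s) (γ₂ s) θ) =
      w s * ⟪curl Y (P (γ₁ s) (γ₂ s) θ), γ₂' s • et (γ₁ s) (γ₂ s) θ - γ₁' s • ep (γ₁ s) (γ₂ s) θ⟫) :
    IntegrableOn g (rev γ₁ γ₂ a b) μHE[2] ∧
    ∫ x in rev γ₁ γ₂ a b, g x ∂μHE[2] = ∫ s in Ioo a b, w s *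
      ∫ θ in (-π)..Real.pi, fluxDensity Y γ₁ γ₂ γ₁' γ₂' s θ := by
  have hY1 : ContDiff ℝ 1 Y := hY.1.of_le (by simp)
  obtain ⟨C, hC⟩ := curl_bounded hY
  have hC0 : 0 ≤ C := (norm_nonneg _).trans (hC 0)
  have hD0 : 0 ≤ D := (abs_nonneg _).trans (hD 0)
  have hms : MeasurableSet (Ioo a b ×ˢ Ioo (-π) π) :=
    measurableSet_Ioo.prod measurableSet_Ioo
  have heq : ∀ p ∈ Ioo a b ×ˢ Ioo (-π) π,
      jac γ₁ γ₂ γ₁' γ₂' p.1 * g (P (γ₁ p.1) (γ₂ p.1) p.2) =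
        w p.1 * fluxDensity Y γ₁ γ₂ γ₁' γ₂' p.1 p.2 := by
    intro p hp
    rw [jac, mul_assoc, hg p.1 hp.1 p.2, fluxDensity, inner_smul_right]
    ring
  have hbound : Integrable (fun p : ℝ × ℝ => (D * (C * speed γ₁' γ₂' p.1)))
      ((volume.restrict (Ioo a b)).prod (volume.restrict (Ioo (-π) π))) := by
    have : IntegrableOn (fun s => D * (C * speed γ₁' γ₂' s)) (Ioo a b) :=
      (hInt.const_mul C).const_mul D
    exact Integrable.comp_fst this _
  have hIn : IntegrableOn (fun p : ℝ × ℝ => w p.1 * fluxDensity Y γ₁ γ₂ γ₁' γ₂' p.1 p.2)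
      (Ioo a b ×ˢ Ioo (-π) π) := by
    rw [IntegrableOn, Measure.volume_eq_prod, ← Measure.prod_restrict]
    refine hbound.mono' ?_ ?_
    · refine AEStronglyMeasurable.mul (hw.comp measurable_fst).aestronglyMeasurable ?_
      rw [Measure.prod_restrict]
      exact (h.continuousOn_fluxDensity hY1 _).aestronglyMeasurable hms
    · rw [Measure.prod_restrict]
      refine (ae_restrict_iff' hms).2 (ae_of_all _ fun p hp => ?_)
      rw [norm_mul, norm_eq_abs, norm_eq_abs]
      exact mul_le_mul (hD _) (h.abs_fluxDensity_le hC hp.1 _) (abs_nonneg _) hD0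
  refine ⟨(h.integrableOn_rev_iff g).2 ((integrableOn_congr_fun heq hms).2 hIn), ?_⟩
  rw [h.integral_rev, setIntegral_congr_fun hms heq]
  rw [IntegrableOn, Measure.volume_eq_prod] at hIn
  rw [Measure.volume_eq_prod, setIntegral_prod _ hIn]
  refine setIntegral_congr_fun measurableSet_Ioo fun s _ => ?_
  simp only
  rw [integral_const_mul, integral_of_le (by linarith [pi_pos]),
    integral_Ioc_eq_integral_Ioo]

/-- Integration of the derivative of the circulation along a profile curve. -/
theorem integral_flux_eq_sub (h : IsProfile γ₁ γ₂ γ₁' γ₂' a b) {Y : E3 → E3} (hY : IsTestField Y)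
    (hab : a < b) (hInt : IntegrableOn (speed γ₁' γ₂') (Ioo a b)) {t0 φ₀ t₁ φ₁ : ℝ}
    (h0 : 0 ≤ cos φ₀) (h1 : 0 ≤ cos φ₁)
    (ht0 : Tendsto γ₁ (𝓝[>] a) (𝓝 t0)) (hφ0 : Tendsto γ₂ (𝓝[>] a) (𝓝 φ₀))
    (ht1 : Tendsto γ₁ (𝓝[<] b) (𝓝 t₁)) (hφ1 : Tendsto γ₂ (𝓝[<] b) (𝓝 φ₁)) :
    ∫ s in Ioo a b, ∫ θ in (-π)..Real.pi, fluxDensity Y γ₁ γ₂ γ₁' γ₂' s θ =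
      circ Y t₁ φ₁ - circ Y t0 φ₀ := by
  have hY1 : ContDiff ℝ 1 Y := hY.1.of_le (by simp)
  obtain ⟨C, hC⟩ := curl_bounded hY
  obtain ⟨C', hC'⟩ := hY.1.continuous.bounded_above_of_compact_support hY.2
  rw [← integral_Ioc_eq_integral_Ioo, ← integral_of_le hab.le]
  refine intervalIntegral.integral_eq_sub_of_hasDerivAt_of_tendsto hab
    (fun s hs => h.hasDerivAt_circ hY1 hs) ?_ (tendsto_circ hY.1.continuous hC' h0 ht0 hφ0)
    (tendsto_circ hY.1.continuous hC' h1 ht1 hφ1)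
  rw [intervalIntegrable_iff_integrableOn_Ioo_of_le hab.le]
  refine Integrable.mono' (hInt.const_mul (C * (2 * π))) ?_ ?_
  · have := (h.continuousOn_fluxDensity hY1 (Ioo (-π) π)).aestronglyMeasurable
      (μ := volume) (measurableSet_Ioo.prod measurableSet_Ioo)
    rw [Measure.volume_eq_prod, ← Measure.prod_restrict] at this
    have h2 := this.integral_prod_right'
    refine h2.congr (ae_of_all _ fun s => ?_)
    simp only
    rw [integral_of_le (by linarith [pi_pos]), integral_Ioc_eq_integral_Ioo]
  · refine (ae_restrict_iff' measurableSet_Ioo).2 (ae_of_all _ fun s hs => ?_)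
    have := intervalIntegral.norm_integral_le_of_norm_le_const (a := -π) (b := π)
      (f := fluxDensity Y γ₁ γ₂ γ₁' γ₂' s) (C := C * speed γ₁' γ₂' s)
      fun θ _ => h.abs_fluxDensity_le hC hs θ
    refine this.trans (le_of_eq ?_)
    rw [abs_of_pos (by linarith [pi_pos])]
    ring

/-- The theorem of Stokes for surfaces of revolution. -/
theorem stokes (h : IsProfile γ₁ γ₂ γ₁' γ₂' a b) {Y : E3 → E3} (hY : IsTestField Y)
    (hab : a < b) (hInt : IntegrableOn (speed γ₁' γ₂') (Ioo a b)) {t0 φ₀ t₁ φ₁ : ℝ}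
    (h0 : 0 ≤ cos φ₀) (h1 : 0 ≤ cos φ₁)
    (ht0 : Tendsto γ₁ (𝓝[>] a) (𝓝 t0)) (hφ0 : Tendsto γ₂ (𝓝[>] a) (𝓝 φ₀))
    (ht1 : Tendsto γ₁ (𝓝[<] b) (𝓝 t₁)) (hφ1 : Tendsto γ₂ (𝓝[<] b) (𝓝 φ₁))
    {σ : ℝ} {n : E3 → E3} (hn : ∀ s ∈ Ioo a b, ∀ θ, n (P (γ₁ s) (γ₂ s) θ) = (σ / speed γ₁' γ₂' s) •
        (γ₂' s • et (γ₁ s) (γ₂ s) θ - γ₁' s • ep (γ₁ s) (γ₂ s) θ)) :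
    IntegrableOn (fun x => ⟪curl Y x, n x⟫) (rev γ₁ γ₂ a b) μHE[2] ∧
    ∫ x in rev γ₁ γ₂ a b, ⟪curl Y x, n x⟫ ∂μHE[2] = σ * (circ Y t₁ φ₁ - circ Y t0 φ₀) := by
  have key := h.flux_rev hY hInt (w := fun _ => σ) measurable_const (D := |σ|) (fun _ => le_rfl)
    (g := fun x => ⟪curl Y x, n x⟫) (fun s hs θ => by
      rw [hn s hs θ, inner_smul_right]
      have := (h.speed_pos hs).ne'
      field_simp)
  refine ⟨key.1, ?_⟩
  rw [key.2, integral_const_mul, h.integral_flux_eq_sub hY hab hInt h0 h1 ht0 hφ0 ht1 hφ1]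

end IsProfile

/-! ### Normals of surfaces -/

theorem IsDefiningFunction.of_le {k l : WithTop ℕ∞} {N V : Set E3} {f : E3 → ℝ} (hkl : l ≤ k)
    (h : IsDefiningFunction k N V f) : IsDefiningFunction l N V f :=
  ⟨h.1, h.2.1.of_le hkl, h.2.2⟩

theorem IsDefiningFunction.inter {k : WithTop ℕ∞} {N N' V V' : Set E3} {f : E3 → ℝ}
    (h : IsDefiningFunction k N V f) (hV' : IsOpen V') (hN : N ∩ V' = N' ∩ V') :
    IsDefiningFunction k N' (V ∩ V') f := by
  refine ⟨h.1.inter hV', h.2.1.mono inter_subset_left, fun x hx => h.2.2.1 x hx.1, ?_⟩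
  ext x
  have h1 := Set.ext_iff.1 h.2.2.2 x
  have h2 := Set.ext_iff.1 hN x
  simp only [mem_inter_iff, mem_ofPred_eq] at *
  tauto

theorem IsDefiningFunction.hasStrictFDerivAt {N V : Set E3} {f : E3 → ℝ}
    (h : IsDefiningFunction 1 N V f) {y : E3} (hy : y ∈ V) : HasStrictFDerivAt f (fderiv ℝ f y) y :=
  (h.2.1.contDiffAt (h.1.mem_nhds hy)).hasStrictFDerivAt (by simp)

theorem IsDefiningFunction.range_eq_top {N V : Set E3} {f : E3 → ℝ}
    (h : IsDefiningFunction 1 N V f) {y : E3} (hy : y ∈ V) :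
    (fderiv ℝ f y : E3 →L[ℝ] ℝ).range = ⊤ := by
  have hg := h.2.2.1 y hy
  refine LinearMap.range_eq_top.2 fun c => ⟨(c / ‖gradient f y‖ ^ 2) • gradient f y, ?_⟩
  have hne : ‖gradient f y‖ ^ 2 ≠ 0 := pow_ne_zero 2 (norm_ne_zero_iff.2 hg)
  change fderiv ℝ f y _ = c
  rw [← inner_gradient, inner_smul_right, real_inner_self_eq_norm_sq]
  field_simp

/-- Every tangent vector of a surface is the velocity of a curve in the surface. -/
theorem IsDefiningFunction.exists_curve {N V : Set E3} {f : E3 → ℝ}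
    (h : IsDefiningFunction 1 N V f) {y : E3} (hyN : y ∈ N) (hy : y ∈ V) {v : E3}
    (hv : ⟪gradient f y, v⟫ = 0) :
    ∃ γ : ℝ → E3, HasDerivAt γ v 0 ∧ γ 0 = y ∧ ∀ᶠ s in 𝓝 0, γ s ∈ N := by
  have hs := h.hasStrictFDerivAt hy
  have hr := h.range_eq_top hy
  have hfy : f y = 0 := by
    have : y ∈ N ∩ V := ⟨hyN, hy⟩
    rw [h.2.2.2] at this; exact this.2
  have hker : v ∈ (fderiv ℝ f y : E3 →L[ℝ] ℝ).ker := by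
    rw [inner_gradient] at hv; exact hv
  set vk : (fderiv ℝ f y : E3 →L[ℝ] ℝ).ker := ⟨v, hker⟩
  have hline : HasDerivAt (fun s : ℝ => s • vk) vk 0 := by
    simpa using (hasDerivAt_id (0 : ℝ)).smul_const vk
  have hl0 : (fun s : ℝ => s • vk) 0 = 0 := by simp
  have hd : HasDerivAt (fun s : ℝ => hs.implicitFunction f _ hr (f y) (s • vk)) v 0 := by
    have h1 := (hs.to_implicitFunction hr).hasFDerivAt
    rw [← hl0] at h1
    exact h1.comp_hasDerivAt (0 : ℝ) hline
  refine ⟨_, hd, ?_, ?_⟩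
  · simp only [zero_smul]; exact hs.implicitFunction_apply_image hr
  · have hc := hd.continuousAt
    have e0 : (fun s : ℝ => hs.implicitFunction f _ hr (f y) (s • vk)) 0 = y := by
      simp only [zero_smul]; exact hs.implicitFunction_apply_image hr
    have hV : ∀ᶠ s in 𝓝 (0 : ℝ), hs.implicitFunction f _ hr (f y) (s • vk) ∈ V :=
      hc.eventually_mem (by
        have := h.1.mem_nhds hy
        rw [← e0] at this
        exact this)
    have ht : Tendsto (fun s : ℝ => (f y, s • vk)) (𝓝 0) (𝓝 (f y, 0)) := by
      have : ContinuousAt (fun s : ℝ => (f y, s • vk)) 0 :=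
        continuousAt_const.prodMk hline.continuousAt
      simpa [ContinuousAt] using this
    have hz := ht.eventually (hs.map_implicitFunction_eq hr)
    filter_upwards [hV, hz] with s h1 h2
    have : hs.implicitFunction f _ hr (f y) (s • vk) ∈ N ∩ V := by
      rw [h.2.2.2]; exact ⟨h1, h2.trans hfy⟩
    exact this.1

/-- Curves in a surface have velocity orthogonal to the normal. -/
theorem IsUnitNormal.inner_eq_zero {N : Set E3} {y n v : E3} (hn : IsUnitNormal N y n) {γ : ℝ → E3}
    {s0 : ℝ} (hγ : HasDerivAt γ v s0) (hy : γ s0 = y) (hN : ∀ᶠ s in 𝓝 s0, γ s ∈ N) :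
    ⟪n, v⟫ = 0 := by
  obtain ⟨-, V, f, hyV, hf, c, hc⟩ := hn
  have hc0 : c ≠ 0 := by
    rintro rfl
    exact hf.2.2.1 y hyV (by simpa using hc)
  have hV : ∀ᶠ s in 𝓝 s0, γ s ∈ V := hγ.continuousAt.eventually_mem (by
    rw [hy]; exact hf.1.mem_nhds hyV)
  have h0 : (fun s => f (γ s)) =ᶠ[𝓝 s0] fun _ => 0 := by
    filter_upwards [hN, hV] with s h1 h2
    have : γ s ∈ N ∩ V := ⟨h1, h2⟩
    rw [hf.2.2.2] at this
    exact this.2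
  have hd : HasDerivAt (fun s => f (γ s)) (fderiv ℝ f y v) s0 := by
    have := (hf.hasStrictFDerivAt hyV).hasFDerivAt
    rw [← hy] at this ⊢
    exact this.comp_hasDerivAt s0 hγ
  have h1 := hd.unique ((hasDerivAt_const s0 (0 : ℝ)).congr_of_eventuallyEq h0)
  rw [← inner_gradient, hc, inner_smul_left] at h1
  simpa [hc0] using h1

theorem IsDefiningFunction.unitNormal_eq {N V : Set E3} {f : E3 → ℝ}
    (h : IsDefiningFunction 1 N V f) {y n : E3} (hyN : y ∈ N) (hy : y ∈ V)
    (hn : IsUnitNormal N y n) :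
    n = ‖gradient f y‖⁻¹ • gradient f y ∨ n = -(‖gradient f y‖⁻¹ • gradient f y) := by
  have hg := h.2.2.1 y hy
  have hne : ‖gradient f y‖ ≠ 0 := norm_ne_zero_iff.2 hg
  set g := gradient f y with hgdef
  set v := n - (⟪g, n⟫ / ‖g‖ ^ 2) • g with hv
  have hv1 : ⟪g, v⟫ = 0 := by
    rw [hv, inner_sub_right, inner_smul_right, real_inner_self_eq_norm_sq]
    field_simp; ring
  obtain ⟨γ, hγ, hγ0, hγN⟩ := h.exists_curve hyN hy hv1
  have hv2 : ⟪n, v⟫ = 0 := hn.inner_eq_zero hγ hγ0 hγN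
  have hv0 : v = 0 := by
    rw [← inner_self_eq_zero (𝕜 := ℝ)]
    nth_rewrite 1 [hv]
    rw [inner_sub_left, inner_smul_left, hv1, hv2]; simp
  have hn1 : n = (⟪g, n⟫ / ‖g‖ ^ 2) • g := sub_eq_zero.1 hv0
  set c := ⟪g, n⟫ / ‖g‖ ^ 2
  have hnorm : |c| * ‖g‖ = 1 := by
    rw [← norm_eq_abs, ← norm_smul, ← hn1, hn.1]
  have hc : |c| = ‖g‖⁻¹ := by field_simp; exact hnorm
  rcases abs_choice c with h1 | h1
  · left; rw [hn1, ← hc, h1]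
  · right; rw [hn1, ← hc, h1]; simp

/-! ### The calibrating field is divergence free -/

theorem trace_eq_zero_of_rank_one {D : E3 →L[ℝ] E3} {n : E3} (hn : ‖n‖ = 1)
    (h1 : ∀ v, ⟪n, v⟫ = 0 → D v = 0) (h2 : ∀ w, ⟪D w, n⟫ = 0) : ∑ i, D (single i 1) i = 0 := by
  have key : ∀ i, D (single i 1) = n i • D n := by
    intro i
    have := h1 (single i 1 - n i • n) (by
      rw [inner_sub_right, inner_smul_right, real_inner_self_eq_norm_sq, hn]
      simp [EuclideanSpace.inner_single_right])
    rw [map_sub, map_smul, sub_eq_zero] at this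
    exact this
  have h3 := h2 n
  rw [inner_E3] at h3
  simp only [key, Fin.sum_univ_three, PiLp.smul_apply, smul_eq_mul]
  linarith

theorem div_eq_sum {X : E3 → E3} (x : E3) : div X x = ∑ i, fderiv ℝ X x (single i 1) i := rfl

theorem lam_pos {x : E3} (hx : x ∈ B) : 0 < lam x := div_pos two_pos (one_sub_normSq_pos hx)

theorem contDiffAt_lam {x : E3} (hx : x ∈ B) : ContDiffAt ℝ ∞ lam x :=
  contDiffAt_const.div (contDiffAt_const.sub (contDiff_norm_sq ℝ).contDiffAt)
    (one_sub_normSq_pos hx).ne'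

theorem contDiffAt_unitGradient {f : E3 → ℝ} {V : Set E3} (hV : IsOpen V)
    (hf : ContDiffOn ℝ ∞ f V) {x : E3} (hx : x ∈ V) (hg : gradient f x ≠ 0) :
    ContDiffAt ℝ ∞ (fun y => ‖gradient f y‖⁻¹ • gradient f y) x := by
  have h1 : ContDiffAt ℝ ∞ (fderiv ℝ f) x :=
    (hf.contDiffAt (hV.mem_nhds hx)).fderiv_right (by simp)
  have h2 : ContDiffAt ℝ ∞ (gradient f) x := by
    unfold gradient
    exact ((InnerProductSpace.toDual ℝ E3).symm.toContinuousLinearEquiv.contDiff.contDiffAt).comp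
      x h1
  exact ((h2.norm ℝ hg).inv (norm_ne_zero_iff.2 hg)).smul h2

variable (R : OrientedMinimalFoliation)

/-- The vector field whose flux calibrates the leaves. -/
def OrientedMinimalFoliation.calib (x : E3) : E3 :=
  lam x ^ 2 • R.ν x

open OrientedMinimalFoliation (calib)

theorem OrientedMinimalFoliation.norm_nu {x : E3} (hx : x ∈ B \ Z) : ‖R.ν x‖ = 1 := by
  obtain ⟨φ, hφ, hxφ⟩ := R.cover x hx
  exact (R.normal φ hφ _ x ⟨hxφ, rfl⟩).1

theorem OrientedMinimalFoliation.continuousOn_nu :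
    ContinuousOn R.ν (B \ Z) := R.lipschitz.continuousOn

theorem hasFDerivAt_normSq_eq {X : E3 → E3} {X' : E3 →L[ℝ] E3} {x : E3} {g : E3 → ℝ}
    {g' : E3 →L[ℝ] ℝ} (hX : HasFDerivAt X X' x) (hg : HasFDerivAt g g' x)
    (h : (fun y => ⟪X y, X y⟫) =ᶠ[𝓝 x] g) (w : E3) : 2 * ⟪X' w, X x⟫ = g' w := by
  have h1 := (hX.inner ℝ hX).unique (hg.congr_of_eventuallyEq h)
  have h2 := congrArg (fun L : E3 →L[ℝ] ℝ => L w) h1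
  simp only [ContinuousLinearMap.comp_apply, fderivInnerCLM_apply,
    ContinuousLinearMap.prod_apply] at h2
  rw [← h2, real_inner_comm (X' w) (X x)]; ring

/-- Minimality of the leaves: the calibrating field has zero divergence wherever it is
differentiable. -/
theorem OrientedMinimalFoliation.div_calib {x : E3}
    (hx : x ∈ B \ Z) (hd : DifferentiableAt ℝ R.calib x) : div R.calib x = 0 := by
  obtain ⟨φ, hφ, hxφ⟩ := R.cover x hx
  set N := plaque φ (φ x).2
  have hxN : x ∈ N := ⟨hxφ, rfl⟩
  obtain ⟨V, f, hxV, hf, hmc⟩ := R.minimal φ hφ _ x hxN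
  have hf1 : IsDefiningFunction 1 N V f := hf.of_le (by simp)
  have hg0 := hf.2.2.1 x hxV
  set nf : E3 → E3 := fun y => ‖gradient f y‖⁻¹ • gradient f y with hnf
  have hnfd : ContDiffAt ℝ ∞ nf x := contDiffAt_unitGradient hf.1 hf.2.1 hxV hg0
  set Wf : E3 → E3 := fun y => lam y ^ 2 • nf y with hWf
  have hWfd : DifferentiableAt ℝ Wf x :=
    (((contDiffAt_lam hx.1).pow 2).smul hnfd).differentiableAt (by simp)
  have hnhds : ∀ᶠ y in 𝓝 x, y ∈ V ∧ y ∈ B \ Z :=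
    Filter.Eventually.and (hf.1.mem_nhds hxV) (isOpen_B_diff_Z.mem_nhds hx)
  have hdivf : div Wf x = 0 := by
    have h0 := hmc x ⟨hxN, hxV⟩
    rw [hypMeanCurvature, hypDiv] at h0
    have hl := lam_pos hx.1
    have h1 := (mul_eq_zero.1 h0).resolve_left (inv_ne_zero (pow_ne_zero 3 hl.ne'))
    have h2 : (fun y => lam y ^ 3 • hypUnitGrad f y) =ᶠ[𝓝 x] Wf := by
      filter_upwards [hnhds] with y hy
      have hly := lam_pos hy.2.1
      simp only [hWf, hnf, hypUnitGrad, smul_smul]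
      congr 1
      have := norm_ne_zero_iff.2 (hf.2.2.1 y hy.1)
      field_simp
    rw [div_eq_sum] at h1 ⊢
    rwa [h2.fderiv_eq] at h1
  have hcν : ContinuousAt R.ν x :=
    R.continuousOn_nu.continuousAt (isOpen_B_diff_Z.mem_nhds hx)
  have hnormal : ∀ y ∈ N, y ∈ V → R.ν y = nf y ∨ R.ν y = -nf y := fun y hyN hyV =>
    hf1.unitNormal_eq hyN hyV (R.normal φ hφ _ y hyN)
  have hnf1 : ∀ y ∈ V, ‖nf y‖ = 1 := fun y hy => by
    rw [hnf]; simp only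
    rw [norm_smul, norm_inv, norm_norm, inv_mul_cancel₀ (norm_ne_zero_iff.2 (hf.2.2.1 y hy))]
  obtain ⟨σ, hσ2, hσ⟩ : ∃ σ : ℝ, σ * σ = 1 ∧ R.ν x = σ • nf x := by
    rcases hnormal x hxN hxV with h | h
    · exact ⟨1, by norm_num, by simpa using h⟩
    · exact ⟨-1, by norm_num, by simpa using h⟩
  have hloc : ∀ᶠ y in 𝓝 x, y ∈ N → R.ν y = σ • nf y := by
    have hin : ContinuousAt (fun y => ⟪R.ν y, σ • nf y⟫) x :=
      hcν.inner (hnfd.continuousAt.const_smul σ)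
    have hx1 : ⟪R.ν x, σ • nf x⟫ = 1 := by
      rw [← hσ, real_inner_self_eq_norm_sq, R.norm_nu hx]; norm_num
    have hpos : ∀ᶠ y in 𝓝 x, 0 < ⟪R.ν y, σ • nf y⟫ :=
      continuousAt_const.eventually_lt hin (by rw [hx1]; norm_num)
    have hσc : σ = 1 ∨ σ = -1 := mul_self_eq_one_iff.1 hσ2
    filter_upwards [hnhds, hpos] with y hy hp hyN
    have hny := hnf1 y hy.1
    have hself : ⟪nf y, nf y⟫ = 1 := by rw [real_inner_self_eq_norm_sq, hny]; norm_num
    rcases hnormal y hyN hy.1 with h | h <;> rcases hσc with h' | h' <;>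
      rw [h, h'] at hp <;> rw [h, h'] <;>
      simp only [one_smul, neg_smul, inner_neg_right, inner_neg_left, neg_neg, hself] at hp ⊢ <;>
      norm_num at hp
  set D : E3 →L[ℝ] E3 := fderiv ℝ R.calib x - σ • fderiv ℝ Wf x with hD
  have hWx : R.calib x = σ • Wf x := by
    simp only [calib, hWf, hσ]; rw [smul_comm]
  have c1 : ∀ v, ⟪R.ν x, v⟫ = 0 → D v = 0 := by
    intro v hv
    have hv' : ⟪gradient f x, v⟫ = 0 := by
      rw [hσ, hnf] at hv
      simp only [inner_smul_left] at hv
      have : σ ≠ 0 := by rintro rfl; norm_num at hσ2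
      have h3 := norm_ne_zero_iff.2 hg0
      simpa [this, h3] using hv
    obtain ⟨γ, hγ, hγ0, hγN⟩ := hf1.exists_curve hxN hxV hv'
    have e1 : HasDerivAt (fun s => R.calib (γ s)) (fderiv ℝ R.calib x v) 0 := by
      have := hd.hasFDerivAt
      rw [← hγ0] at this ⊢
      exact this.comp_hasDerivAt 0 hγ
    have e2 : HasDerivAt (fun s => σ • Wf (γ s)) (σ • fderiv ℝ Wf x v) 0 := by
      have := hWfd.hasFDerivAt
      rw [← hγ0] at this ⊢
      exact (this.comp_hasDerivAt 0 hγ).const_smul σ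
    have e3 : (fun s => R.calib (γ s)) =ᶠ[𝓝 0] fun s => σ • Wf (γ s) := by
      have ht : Tendsto γ (𝓝 0) (𝓝 x) := by
        have := hγ.continuousAt.tendsto; rwa [hγ0] at this
      filter_upwards [ht.eventually hloc, hγN] with s h1 h2
      simp only [calib, hWf, h1 h2]; rw [smul_comm]
    have e4 := e1.unique (e2.congr_of_eventuallyEq e3)
    rw [hD, sub_apply, smul_apply, e4, sub_self]
  have c2 : ∀ w, ⟪D w, R.ν x⟫ = 0 := by
    intro w
    have hlam : DifferentiableAt ℝ (fun y => lam y ^ 4) x :=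
      ((contDiffAt_lam hx.1).pow 4).differentiableAt (by simp)
    have e1 : (fun y => ⟪R.calib y, R.calib y⟫) =ᶠ[𝓝 x] fun y => lam y ^ 4 := by
      filter_upwards [hnhds] with y hy
      simp only [calib, inner_smul_left, inner_smul_right,
        real_inner_self_eq_norm_sq, R.norm_nu hy.2]
      simp; ring
    have e2 : (fun y => ⟪Wf y, Wf y⟫) =ᶠ[𝓝 x] fun y => lam y ^ 4 := by
      filter_upwards [hnhds] with y hy
      simp only [hWf, inner_smul_left, inner_smul_right,
        real_inner_self_eq_norm_sq, hnf1 y hy.1]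
      simp; ring
    have f1 := hasFDerivAt_normSq_eq hd.hasFDerivAt hlam.hasFDerivAt e1 w
    have f2 := hasFDerivAt_normSq_eq hWfd.hasFDerivAt hlam.hasFDerivAt e2 w
    have f3 : ⟪D w, R.calib x⟫ = 0 := by
      rw [hD, sub_apply, smul_apply, inner_sub_left]
      nth_rewrite 2 [hWx]
      rw [inner_smul_left, inner_smul_right]
      simp only [conj_trivial]
      rw [← mul_assoc, hσ2]; linarith
    rw [calib, inner_smul_right] at f3
    exact (mul_eq_zero.1 f3).resolve_left (pow_ne_zero 2 (lam_pos hx.1).ne')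
  have key := trace_eq_zero_of_rank_one (R.norm_nu hx) c1 c2
  rw [div_eq_sum] at hdivf ⊢
  simp only [hD, sub_apply, smul_apply, PiLp.sub_apply,
    PiLp.smul_apply, smul_eq_mul, Finset.sum_sub_distrib, ← Finset.mul_sum, hdivf, mul_zero,
    sub_zero] at key
  exact key

/-! ### The calibrating field is weakly divergence free -/

theorem OrientedMinimalFoliation.locallyLipschitzOn_calib : LocallyLipschitzOn (B \ Z) R.calib := by
  intro x hx
  obtain ⟨K₁, t₁, ht₁, h₁⟩ := R.lipschitz hx
  obtain ⟨K₂, t₂, ht₂, h₂⟩ := (((contDiffAt_lam hx.1).pow 2).of_le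
    (m := 1) (by simp)).exists_lipschitzOnWith
  have hbd : ∀ᶠ y in 𝓝 x, lam y ^ 2 < lam x ^ 2 + 1 :=
    ((contDiffAt_lam hx.1).pow 2).continuousAt.eventually_lt continuousAt_const (by simp)
  refine ⟨toNNReal (lam x ^ 2 + 1) * K₁ + K₂,
    t₁ ∩ t₂ ∩ {y | lam y ^ 2 < lam x ^ 2 + 1} ∩ (B \ Z), ?_, ?_⟩
  · exact inter_mem (inter_mem (inter_mem ht₁ (mem_nhdsWithin_of_mem_nhds ht₂))
      (mem_nhdsWithin_of_mem_nhds hbd)) self_mem_nhdsWithin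
  · refine LipschitzOnWith.of_dist_le_mul fun y hy z hz => ?_
    have e1 := h₁.dist_le_mul y hy.1.1.1 z hz.1.1.1
    have e2 := h₂.dist_le_mul y hy.1.1.2 z hz.1.1.2
    have e3 : R.calib y - R.calib z =
        lam y ^ 2 • (R.ν y - R.ν z) + (lam y ^ 2 - lam z ^ 2) • R.ν z := by
      simp only [calib]; module
    rw [dist_eq_norm] at e1 e2
    rw [dist_eq_norm, e3]
    refine (norm_add_le _ _).trans ?_
    rw [norm_smul, norm_smul, R.norm_nu hz.2, mul_one, norm_of_nonneg (sq_nonneg _)]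
    push_cast
    rw [coe_toNNReal _ (by positivity), add_mul, mul_assoc]
    have h4 : lam y ^ 2 ≤ lam x ^ 2 + 1 := le_of_lt hy.1.2
    gcongr

/-- The calibrating field, extended by zero. -/
def OrientedMinimalFoliation.calibExt : E3 → E3 :=
  (B \ Z).indicator R.calib

theorem OrientedMinimalFoliation.calibExt_of_mem {x : E3}
    (hx : x ∈ B \ Z) : R.calibExt x = R.calib x := indicator_of_mem hx _

theorem OrientedMinimalFoliation.calibExt_of_notMem {x : E3}
    (hx : x ∉ B \ Z) : R.calibExt x = 0 := indicator_of_notMem hx _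

theorem OrientedMinimalFoliation.continuousOn_calib :
    ContinuousOn R.calib (B \ Z) := R.locallyLipschitzOn_calib.continuousOn

theorem OrientedMinimalFoliation.measurable_calibExt : Measurable R.calibExt := by
  classical
  rw [OrientedMinimalFoliation.calibExt, ← piecewise_eq_indicator]
  exact R.continuousOn_calib.measurable_piecewise continuousOn_const isOpen_B_diff_Z.measurableSet

theorem lam_sq_le {ρ : ℝ} (hρ : ρ < 1) {x : E3} (hx : ‖x‖ ≤ ρ) :
    lam x ^ 2 ≤ (2 / (1 - ρ ^ 2)) ^ 2 := by
  have h0 := norm_nonneg x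
  have h1 : 0 < 1 - ρ ^ 2 := by nlinarith
  have h2 : 1 - ρ ^ 2 ≤ 1 - ‖x‖ ^ 2 := by nlinarith
  unfold lam
  have h3 : 0 < 1 - ‖x‖ ^ 2 := h1.trans_le h2
  gcongr

theorem mem_B_of_norm_le {ρ : ℝ} (hρ : ρ < 1) {x : E3} (hx : ‖x‖ ≤ ρ) : x ∈ B := by
  simpa [B] using hx.trans_lt hρ

theorem OrientedMinimalFoliation.norm_calibExt_le {ρ : ℝ}
    (hρ : ρ < 1) {x : E3} (hx : ‖x‖ ≤ ρ) : ‖R.calibExt x‖ ≤ (2 / (1 - ρ ^ 2)) ^ 2 := by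
  by_cases h : x ∈ B \ Z
  · rw [R.calibExt_of_mem h, calib, norm_smul, R.norm_nu h, mul_one,
      norm_of_nonneg (sq_nonneg _)]
    exact lam_sq_le hρ hx
  · rw [R.calibExt_of_notMem h, norm_zero]; positivity

theorem fderiv_apply_eq_sum (η : E3 → ℝ) (x v : E3) :
    fderiv ℝ η x v = ∑ i, v i * fderiv ℝ η x (single i 1) := by
  conv_lhs => rw [sum_single v]
  simp [map_add, Fin.sum_univ_three]

theorem OrientedMinimalFoliation.integral_fderiv_calibExt_of_subset
    {η : E3 → ℝ} (hη : ContDiff ℝ ∞ η) (hc : HasCompactSupport η) (hs : tsupport η ⊆ B \ Z) :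
    ∫ x, fderiv ℝ η x (R.calibExt x) = 0 := by
  obtain ⟨K, hK, hsK, hKB⟩ := exists_compact_between hc.isCompact isOpen_B_diff_Z hs
  obtain ⟨C, hC⟩ := (R.locallyLipschitzOn_calib.mono hKB).exists_lipschitzOnWith_of_compact hK
  have hcomp : ∀ i : Fin 3, LipschitzOnWith C (fun x => R.calib x i) K := fun i =>
    LipschitzOnWith.of_dist_le_mul fun y hy z hz => by
      refine le_trans ?_ (hC.dist_le_mul y hy z hz)
      rw [dist_eq_norm, dist_eq_norm]
      exact PiLp.norm_apply_le (R.calib y - R.calib z) i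
  choose w hw hwK using fun i => (hcomp i).extend_real
  obtain ⟨D, hD⟩ := (hη.of_le (m := 1) (by simp)).lipschitzWith_of_hasCompactSupport hc (by simp)
  have hη0 : ∀ x, x ∉ interior K → η x = 0 := fun x hx =>
    image_eq_zero_of_notMem_tsupport fun h => hx (hsK h)
  have hη0' : ∀ x, x ∉ interior K → fderiv ℝ η x = 0 := fun x hx => by
    by_contra h
    exact hx (hsK (support_fderiv_subset ℝ h))
  have hcont : ∀ v, Continuous fun x => fderiv ℝ η x v := fun v =>
    (hη.continuous_fderiv (by simp)).clm_apply continuous_const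
  have hint1 : ∀ i, Integrable fun x =>
      w i x * fderiv ℝ η x (single i 1) := fun i =>
    ((hw i).continuous.mul (hcont _)).integrable_of_hasCompactSupport
      ((hc.fderiv_apply ℝ _).mul_left)
  have hint2 : ∀ i, Integrable fun x =>
      lineDeriv ℝ (w i) x (single i 1) * η x := fun i => by
    have h1 : Integrable η := hη.continuous.integrable_of_hasCompactSupport hc
    exact h1.bdd_mul (c := C * ‖(single i 1 : E3)‖)
      (aestronglyMeasurable_lineDeriv (hw i).continuous _)
      (.of_forall fun x => norm_lineDeriv_le_of_lipschitz ℝ (hw i))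
  have key : ∀ i, ∫ x, lineDeriv ℝ (w i) x (single i 1) * η x =
      - ∫ x, w i x * fderiv ℝ η x (single i 1) := fun i => by
    rw [(hw i).integral_lineDeriv_mul_eq hD hc, ← integral_neg]
    congr 1; ext x
    rw [((hη.differentiable (by simp)).differentiableAt (x := x)).lineDeriv_eq_fderiv, map_neg]
    ring
  have e1 : ∫ x, fderiv ℝ η x (R.calibExt x) =
      ∑ i, ∫ x, w i x * fderiv ℝ η x (single i 1) := by
    rw [← integral_finsetSum _ fun i _ => hint1 i]
    congr 1; ext x
    by_cases hx : x ∈ interior K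
    · have hxK := interior_subset hx
      rw [fderiv_apply_eq_sum, R.calibExt_of_mem (hKB hxK)]
      exact Finset.sum_congr rfl fun i _ => by rw [← hwK i hxK]
    · simp [hη0' x hx]
  have e2 : ∫ x, ∑ i, lineDeriv ℝ (w i) x (single i 1) * η x = 0 := by
    have hdiff : ∀ᵐ x : E3, ∀ i, DifferentiableAt ℝ (w i) x :=
      ae_all_iff.2 fun i => (hw i).ae_differentiableAt
    rw [integral_eq_zero_of_ae]
    filter_upwards [hdiff] with x hx
    simp only [Pi.zero_apply]
    by_cases hxK : x ∈ interior K
    · have hnear : ∀ i, (fun y => R.calib y i) =ᶠ[𝓝 x] w i := fun i => by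
        filter_upwards [isOpen_interior.mem_nhds hxK] with y hy
        exact hwK i (interior_subset hy)
      have hdc : DifferentiableAt ℝ R.calib x := by
        rw [differentiableAt_euclidean]
        exact fun i => (hx i).congr_of_eventuallyEq (hnear i)
      have h0 := R.div_calib (hKB (interior_subset hxK)) hdc
      rw [div_eq_sum] at h0
      rw [← Finset.sum_mul]
      convert zero_mul (η x) using 2
      rw [← h0]
      refine Finset.sum_congr rfl fun i _ => ?_
      rw [(hx i).lineDeriv_eq_fderiv, ← (hnear i).fderiv_eq]
      have h1 : HasFDerivAt (fun y => R.calib y i) _ x :=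
        (proj i : E3 →L[ℝ] ℝ).hasFDerivAt.comp x hdc.hasFDerivAt
      rw [h1.fderiv]; rfl
    · simp [hη0 x hxK]
  rw [integral_finsetSum _ fun i _ => hint2 i] at e2
  simp only [key, Finset.sum_neg_distrib, neg_eq_zero] at e2
  rw [e1, e2]

/-! ### The axis is removable -/

theorem exists_bound_deriv_smoothTransition : ∃ C, 0 ≤ C ∧ ∀ x, |deriv smoothTransition x| ≤ C := by
  have hcd : ContDiff ℝ 1 smoothTransition := smoothTransition.contDiff
  obtain ⟨C, hC⟩ := (isCompact_Icc (a := (0 : ℝ)) (b := 1)).exists_bound_of_continuousOn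
    (hcd.continuous_deriv le_rfl).continuousOn
  refine ⟨max C 0, le_max_right _ _, fun x => ?_⟩
  rcases lt_or_ge x 0 with h | h
  · have : smoothTransition =ᶠ[𝓝 x] fun _ => 0 := by
      filter_upwards [gt_mem_nhds h] with y hy
      exact smoothTransition.zero_of_nonpos hy.le
    rw [this.deriv_eq]; simp
  rcases lt_or_ge 1 x with h' | h'
  · have : smoothTransition =ᶠ[𝓝 x] fun _ => 1 := by
      filter_upwards [lt_mem_nhds h'] with y hy
      exact smoothTransition.one_of_one_le hy.le
    rw [this.deriv_eq]; simp
  · exact (hC x ⟨h, h'⟩).trans (le_max_left _ _)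

/-- The squared distance to the axis. -/
def radSq (x : E3) : ℝ := x 0 ^ 2 + x 1 ^ 2

theorem contDiff_coord {n : WithTop ℕ∞} (i : Fin 3) : ContDiff ℝ n fun x : E3 => x i :=
  (proj i : E3 →L[ℝ] ℝ).contDiff

theorem contDiff_radSq : ContDiff ℝ ∞ radSq :=
  ((contDiff_coord 0).pow 2).add ((contDiff_coord 1).pow 2)

theorem fderiv_radSq (x v : E3) : fderiv ℝ radSq x v = 2 * (x 0 * v 0 + x 1 * v 1) := by
  have h : ∀ i : Fin 3, HasFDerivAt (fun y : E3 => y i) (proj i : E3 →L[ℝ] ℝ) x :=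
    fun i => (proj i : E3 →L[ℝ] ℝ).hasFDerivAt
  have h1 : HasFDerivAt radSq _ x := ((h 0).pow 2).add ((h 1).pow 2)
  rw [h1.fderiv]
  simp; ring

theorem abs_fderiv_radSq_le (x v : E3) : |fderiv ℝ radSq x v| ≤ 2 * √(radSq x) * ‖v‖ := by
  rw [fderiv_radSq, abs_mul, abs_two, mul_assoc]
  gcongr
  rw [← sqrt_sq (norm_nonneg v), ← sqrt_mul (by unfold radSq; positivity)]
  refine abs_le_sqrt ?_
  rw [norm_sq_E3, radSq]
  nlinarith [sq_nonneg (x 0 * v 1 - x 1 * v 0), mul_nonneg (sq_nonneg (x 0)) (sq_nonneg (v 2)),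
    mul_nonneg (sq_nonneg (x 1)) (sq_nonneg (v 2))]

theorem radSq_eq_zero {x : E3} : radSq x = 0 ↔ x ∈ Z := by
  unfold radSq Z
  constructor
  · intro h
    exact ⟨by nlinarith [sq_nonneg (x 0), sq_nonneg (x 1)],
      by nlinarith [sq_nonneg (x 0), sq_nonneg (x 1)]⟩
  · rintro ⟨h0, h1⟩; simp [h0, h1]

theorem volume_tube_le (a : ℝ) (ha : 0 ≤ a) :
    volume {x : E3 | ‖x‖ ≤ 1 ∧ radSq x ≤ a ^ 2} ≤ ofReal (8 * a ^ 2) := by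
  set l : Fin 3 → ℝ := ![a, a, 1]
  have hsub : {x : E3 | ‖x‖ ≤ 1 ∧ radSq x ≤ a ^ 2} ⊆
      (MeasurableEquiv.toLp 2 (Fin 3 → ℝ)).symm ⁻¹' Icc (-l) l := by
    rintro x ⟨h1, h2⟩
    have h3 : ‖x‖ ^ 2 ≤ 1 := by nlinarith [norm_nonneg x]
    rw [norm_sq_E3] at h3
    unfold radSq at h2
    have e0 : |x 0| ≤ a := abs_le_of_sq_le_sq (by nlinarith [sq_nonneg (x 1)]) ha
    have e1 : |x 1| ≤ a := abs_le_of_sq_le_sq (by nlinarith [sq_nonneg (x 0)]) ha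
    have e2 : |x 2| ≤ 1 :=
      abs_le_of_sq_le_sq (by nlinarith [sq_nonneg (x 0), sq_nonneg (x 1)]) one_pos.le
    constructor <;> intro i <;> fin_cases i
    exacts [(abs_le.1 e0).1, (abs_le.1 e1).1, (abs_le.1 e2).1, (abs_le.1 e0).2, (abs_le.1 e1).2,
      (abs_le.1 e2).2]
  refine (measure_mono hsub).trans ?_
  rw [(EuclideanSpace.volume_preserving_symm_measurableEquiv_toLp (Fin 3)).measure_preimage_equiv,
    volume_Icc_pi, Fin.prod_univ_three]
  rw [← ENNReal.ofReal_mul (by simp [l]; linarith), ← ENNReal.ofReal_mul (by simp [l]; positivity)]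
  apply ENNReal.ofReal_le_ofReal
  simp [l]; nlinarith

theorem OrientedMinimalFoliation.integral_fderiv_calibExt
    {η : E3 → ℝ} (hη : ContDiff ℝ ∞ η) (hc : HasCompactSupport η) (hs : tsupport η ⊆ B) :
    ∫ x, fderiv ℝ η x (R.calibExt x) = 0 := by
  obtain ⟨C, hC0, hC⟩ := exists_bound_deriv_smoothTransition
  obtain ⟨ρ, hρ0, hρ1, hsρ⟩ : ∃ ρ, 0 ≤ ρ ∧ ρ < 1 ∧ ∀ x ∈ tsupport η, ‖x‖ ≤ ρ := by
    rcases (tsupport η).eq_empty_or_nonempty with h | h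
    · exact ⟨0, le_rfl, one_pos, by simp [h]⟩
    · obtain ⟨z, hz, hzm⟩ := hc.isCompact.exists_isMaxOn h continuous_norm.continuousOn
      exact ⟨‖z‖, norm_nonneg z, by simpa [B] using hs hz, fun x hx => hzm hx⟩
  set b : ℝ := (2 / (1 - ρ ^ 2)) ^ 2
  have hb0 : 0 ≤ b := by positivity
  obtain ⟨D, hD⟩ := hη.continuous.bounded_above_of_compact_support hc
  have hD0 : 0 ≤ D := (norm_nonneg _).trans (hD 0)
  have hDf : Continuous (fderiv ℝ η) := hη.continuous_fderiv (by simp)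
  obtain ⟨D', hD'⟩ := hDf.bounded_above_of_compact_support (hc.fderiv ℝ)
  have hη0 : ∀ x, x ∉ tsupport η → η x = 0 := fun x hx => image_eq_zero_of_notMem_tsupport hx
  have hη0' : ∀ x, x ∉ tsupport η → fderiv ℝ η x = 0 := fun x hx => by
    by_contra h
    exact hx (support_fderiv_subset ℝ h)
  set ψ : ℕ → E3 → ℝ := fun k x => smoothTransition ((k : ℝ) ^ 2 * radSq x - 1)
  have hψ : ∀ k, ContDiff ℝ ∞ (ψ k) := fun k =>
    smoothTransition.contDiff.comp ((contDiff_const.mul contDiff_radSq).sub contDiff_const)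
  have hψ' : ∀ k x v, fderiv ℝ (ψ k) x v =
      deriv smoothTransition ((k : ℝ) ^ 2 * radSq x - 1) * (k ^ 2 * fderiv ℝ radSq x v) := by
    intro k x v
    have h1 : HasFDerivAt (fun y => (k : ℝ) ^ 2 * radSq y - 1) _ x :=
      (((contDiff_radSq.differentiable (by simp)).differentiableAt (x := x)).hasFDerivAt.const_mul
        ((k : ℝ) ^ 2)).sub_const 1
    have h2 := (((smoothTransition.contDiff (n := 1)).differentiable
      (by simp)).differentiableAt (x := (k : ℝ) ^ 2 * radSq x - 1)).hasDerivAt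
    have h3 := h2.comp_hasFDerivAt x h1
    have h4 : fderiv ℝ (ψ k) x = _ := h3.fderiv
    rw [h4]; simp
  have hcalm : AEStronglyMeasurable R.calibExt (volume : Measure E3) :=
    R.measurable_calibExt.aestronglyMeasurable
  have hmeas : ∀ f : E3 → ℝ, ContDiff ℝ ∞ f →
      AEStronglyMeasurable (fun x => fderiv ℝ f x (R.calibExt x)) volume := fun f hf =>
    (ContinuousLinearMap.id ℝ (E3 →L[ℝ] ℝ)).aestronglyMeasurable_comp₂
      (hf.continuous_fderiv (by simp)).aestronglyMeasurable hcalm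
  have hprod : ∀ k, ∫ x, (ψ k x * fderiv ℝ η x (R.calibExt x) +
      η x * fderiv ℝ (ψ k) x (R.calibExt x)) = 0 := by
    intro k
    have h1 : tsupport (fun x => ψ k x * η x) ⊆ B \ Z := by
      intro x hx
      have hx1 : x ∈ tsupport η := tsupport_mul_subset_right hx
      have hx2 : x ∈ tsupport (ψ k) := tsupport_mul_subset_left hx
      refine ⟨hs hx1, fun hz => ?_⟩
      have hcl : tsupport (ψ k) ⊆ {y | 0 ≤ (k : ℝ) ^ 2 * radSq y - 1} := by
        refine closure_minimal (fun y hy => ?_) (isClosed_le continuous_const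
          ((continuous_const.mul contDiff_radSq.continuous).sub continuous_const))
        by_contra hneg
        exact hy (smoothTransition.zero_of_nonpos (le_of_not_ge hneg))
      have := hcl hx2
      rw [mem_ofPred_eq, radSq_eq_zero.2 hz] at this
      norm_num at this
    rw [← R.integral_fderiv_calibExt_of_subset ((hψ k).mul hη) hc.mul_left h1]
    congr 1; ext x
    rw [fderiv_fun_mul ((hψ k).differentiable (by simp)).differentiableAt
      (hη.differentiable (by simp)).differentiableAt]
    simp
  have hbK : Integrable (fun x => (tsupport η).indicator (fun _ => D' * b) x) (volume : Measure E3) :=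
    (integrable_indicator_iff hc.isCompact.measurableSet).2
      (integrableOn_const hc.isCompact.measure_lt_top.ne)
  have hb1 : ∀ x, ‖fderiv ℝ η x (R.calibExt x)‖ ≤ (tsupport η).indicator (fun _ => D' * b) x := by
    intro x
    by_cases hx : x ∈ tsupport η
    · rw [indicator_of_mem hx]
      refine (ContinuousLinearMap.le_opNorm _ _).trans ?_
      have := R.norm_calibExt_le hρ1 (hsρ x hx)
      exact mul_le_mul (hD' x) this (norm_nonneg _) ((norm_nonneg _).trans (hD' x))
    · rw [indicator_of_notMem hx, hη0' x hx]; simp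
  have hψb : ∀ k x, ‖ψ k x‖ ≤ 1 := fun k x => by
    rw [norm_of_nonneg (smoothTransition.nonneg _)]
    exact smoothTransition.le_one _
  have hb1' : ∀ k x, ‖ψ k x * fderiv ℝ η x (R.calibExt x)‖ ≤
      (tsupport η).indicator (fun _ => D' * b) x := fun k x => by
    rw [norm_mul]
    exact (mul_le_of_le_one_left (norm_nonneg _) (hψb k x)).trans (hb1 x)
  have hm1 : ∀ k, AEStronglyMeasurable (fun x => ψ k x * fderiv ℝ η x (R.calibExt x)) volume :=
    fun k => (hψ k).continuous.aestronglyMeasurable.mul (hmeas η hη)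
  have lim1 : Tendsto (fun k => ∫ x, ψ k x * fderiv ℝ η x (R.calibExt x)) atTop
      (𝓝 (∫ x, fderiv ℝ η x (R.calibExt x))) := by
    refine tendsto_integral_of_dominated_convergence _ hm1 hbK
      (fun k => .of_forall (hb1' k)) (.of_forall fun x => ?_)
    by_cases hx : x ∈ B \ Z
    · have hr : 0 < radSq x := by
        refine lt_of_le_of_ne (by unfold radSq; positivity) fun h => hx.2 (radSq_eq_zero.1 h.symm)
      have : ∀ᶠ k : ℕ in atTop, ψ k x = 1 := by
        have ht : Tendsto (fun k : ℕ => (k : ℝ) ^ 2 * radSq x - 1) atTop atTop :=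
          tendsto_atTop_add_const_right _ _ (((tendsto_pow_atTop two_ne_zero).comp
            tendsto_natCast_atTop_atTop).atTop_mul_const hr)
        filter_upwards [ht.eventually_ge_atTop 1] with k hk
        exact smoothTransition.one_of_one_le hk
      refine tendsto_const_nhds.congr' ?_
      filter_upwards [this] with k hk
      rw [hk, one_mul]
    · simp [R.calibExt_of_notMem hx]
  set tube : ℕ → Set E3 := fun k => {x | ‖x‖ ≤ 1 ∧ radSq x ≤ (2 / (k : ℝ)) ^ 2}
  have htm : ∀ k, MeasurableSet (tube k) := fun k =>
    ((isClosed_le continuous_norm continuous_const).inter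
      (isClosed_le contDiff_radSq.continuous continuous_const)).measurableSet
  have hvol : ∀ k, volume (tube k) ≤ ofReal (8 * (2 / (k : ℝ)) ^ 2) := fun k =>
    volume_tube_le _ (by positivity)
  have hb2 : ∀ k : ℕ, 0 < k → ∀ x, ‖η x * fderiv ℝ (ψ k) x (R.calibExt x)‖ ≤
      (tube k).indicator (fun _ => D * (C * (4 * k * b))) x := by
    intro k hk x
    have hk' : (0 : ℝ) < k := by exact_mod_cast hk
    by_cases hx : x ∈ tsupport η
    swap
    · rw [hη0 x hx, zero_mul, norm_zero]
      exact indicator_nonneg (fun _ _ => by positivity) _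
    by_cases hxt : x ∈ tube k
    · rw [indicator_of_mem hxt, norm_mul, hψ', norm_mul]
      gcongr
      · exact hD x
      · exact hC _
      · rw [norm_eq_abs, abs_mul, abs_of_nonneg (by positivity : (0 : ℝ) ≤ k ^ 2)]
        have h1 := abs_fderiv_radSq_le x (R.calibExt x)
        have h2 := R.norm_calibExt_le hρ1 (hsρ x hx)
        have h3 : √(radSq x) ≤ 2 / k := sqrt_le_iff.2 ⟨by positivity, hxt.2⟩
        calc (k : ℝ) ^ 2 * |fderiv ℝ radSq x (R.calibExt x)|
            ≤ k ^ 2 * (2 * (2 / k) * b) := by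
              gcongr
              refine h1.trans ?_
              gcongr
          _ = 4 * k * b := by field_simp; ring
    · rw [indicator_of_notMem hxt, hψ']
      have h1 : (2 / (k : ℝ)) ^ 2 < radSq x := by
        by_contra h
        exact hxt ⟨(hsρ x hx).trans hρ1.le, not_lt.1 h⟩
      have h2 : 1 < (k : ℝ) ^ 2 * radSq x - 1 := by
        rw [div_pow, div_lt_iff₀ (by positivity)] at h1
        linarith
      have : smoothTransition =ᶠ[𝓝 ((k : ℝ) ^ 2 * radSq x - 1)] fun _ => 1 := by
        filter_upwards [lt_mem_nhds h2] with y hy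
        exact smoothTransition.one_of_one_le hy.le
      rw [this.deriv_eq]; simp
  have htfin : ∀ k, volume (tube k) ≠ ⊤ := fun k => ((hvol k).trans_lt ENNReal.ofReal_lt_top).ne
  have hi2 : ∀ k, Integrable (fun x => (tube k).indicator (fun _ => D * (C * (4 * k * b))) x)
      (volume : Measure E3) := fun k =>
    (integrable_indicator_iff (htm k)).2 (integrableOn_const (htfin k))
  have hm2 : ∀ k, AEStronglyMeasurable (fun x => η x * fderiv ℝ (ψ k) x (R.calibExt x)) volume :=
    fun k => hη.continuous.aestronglyMeasurable.mul (hmeas _ (hψ k))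
  have lim2 : Tendsto (fun k : ℕ => ∫ x, η x * fderiv ℝ (ψ k) x (R.calibExt x)) atTop (𝓝 0) := by
    have hmaj : ∀ k : ℕ, 0 < k → ‖∫ x, η x * fderiv ℝ (ψ k) x (R.calibExt x)‖ ≤
        128 * D * C * b * (k : ℝ)⁻¹ := by
      intro k hk
      have hk' : (0 : ℝ) < k := by exact_mod_cast hk
      refine (norm_integral_le_of_norm_le (hi2 k) (.of_forall (hb2 k hk))).trans ?_
      rw [integral_indicator (htm k), setIntegral_const, smul_eq_mul]
      have h1 : volume.real (tube k) ≤ 8 * (2 / (k : ℝ)) ^ 2 :=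
        ENNReal.toReal_le_of_le_ofReal (by positivity) (hvol k)
      calc volume.real (tube k) * (D * (C * (4 * k * b)))
          ≤ (8 * (2 / (k : ℝ)) ^ 2) * (D * (C * (4 * k * b))) := by gcongr
        _ = _ := by field_simp; ring
    have h0 : Tendsto (fun k : ℕ => 128 * D * C * b * (k : ℝ)⁻¹) atTop (𝓝 0) := by
      simpa using tendsto_inv_atTop_nhds_zero_nat.const_mul (128 * D * C * b)
    refine squeeze_zero_norm' ?_ h0
    filter_upwards [eventually_gt_atTop 0] with k hk using hmaj k hk
  have hsum := lim1.add lim2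
  rw [add_zero] at hsum
  refine tendsto_nhds_unique hsum (tendsto_const_nhds.congr' ?_)
  filter_upwards [eventually_gt_atTop 0] with k hk
  rw [← integral_add (hbK.mono' (hm1 k) (.of_forall (hb1' k)))
    ((hi2 k).mono' (hm2 k) (.of_forall (hb2 k hk)))]
  exact (hprod k).symm

/-! ### The Poincaré lemma on a ball -/

section
variable {F : Type} [NormedAddCommGroup F] [NormedSpace ℝ F]

/-- The radial average of order `k` of a function. -/
def radialMean (k : ℕ) (f : E3 → F) (x : E3) : F := ∫ t in (0 : ℝ)..1, t ^ k • f (t • x)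

theorem hasFDerivAt_radialMean (k : ℕ) {f : E3 → F} (hf : ContDiff ℝ 1 f) (x : E3) :
    HasFDerivAt (radialMean k f) (radialMean (k + 1) (fderiv ℝ f) x) x := by
  have hf' : Continuous (fderiv ℝ f) := hf.continuous_fderiv (by simp)
  obtain ⟨C, hC⟩ := (isCompact_closedBall (0 : E3) (‖x‖ + 1)).exists_bound_of_continuousOn
    hf'.continuousOn
  have hc1 : ∀ y : E3, Continuous fun t : ℝ => t ^ k • f (t • y) := fun y =>
    (continuous_pow k).smul (hf.continuous.comp (continuous_id.smul continuous_const))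
  have hc2 : Continuous fun t : ℝ => t ^ (k + 1) • fderiv ℝ f (t • x) :=
    (continuous_pow _).smul (hf'.comp (continuous_id.smul continuous_const))
  refine intervalIntegral.hasFDerivAt_integral_of_dominated_of_fderiv_le
    (F := fun y t => t ^ k • f (t • y)) (F' := fun y t => t ^ (k + 1) • fderiv ℝ f (t • y))
    (bound := fun _ => C) (ball_mem_nhds x one_pos) (.of_forall fun y =>
      (hc1 y).aestronglyMeasurable)
    ((hc1 x).intervalIntegrable _ _) hc2.aestronglyMeasurable (.of_forall fun t ht y hy => ?_)
    intervalIntegrable_const (.of_forall fun t ht y hy => ?_)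
  · rw [uIoc_of_le zero_le_one] at ht
    have h1 : ‖y‖ ≤ ‖x‖ + 1 := by
      have := norm_sub_norm_le y x
      rw [mem_ball_iff_norm] at hy; linarith
    have h2 : ‖t • y‖ ≤ ‖x‖ + 1 := by
      rw [norm_smul, norm_of_nonneg ht.1.le]
      exact (mul_le_of_le_one_left (norm_nonneg _) ht.2).trans h1
    have h3 := hC (t • y) (by simpa using h2)
    rw [norm_smul, norm_of_nonneg (pow_nonneg ht.1.le _)]
    exact (mul_le_of_le_one_left (norm_nonneg _) (pow_le_one₀ ht.1.le ht.2)).trans h3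
  · have h1 : HasFDerivAt (fun z : E3 => t • z) (t • ContinuousLinearMap.id ℝ E3) y :=
      (hasFDerivAt_id y).const_smul t
    have h2 := ((((hf.differentiable (by simp)).differentiableAt (x := t • y)).hasFDerivAt.comp y
      h1).const_smul (t ^ k))
    refine h2.congr_fderiv ?_
    ext v; simp [pow_succ, mul_smul]

theorem contDiff_radialMean (n : ℕ) : ∀ {F : Type} [NormedAddCommGroup F] [NormedSpace ℝ F]
    (k : ℕ) {f : E3 → F}, ContDiff ℝ ∞ f → ContDiff ℝ n (radialMean k f) := by
  induction n with
  | zero =>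
    intro F _ _ k f hf
    have : Differentiable ℝ (radialMean k f) := fun x =>
      (hasFDerivAt_radialMean k (hf.of_le (by simp)) x).differentiableAt
    exact contDiff_zero.2 this.continuous
  | succ n ih =>
    intro F _ _ k f hf
    push_cast
    refine contDiff_succ_iff_fderiv.2 ⟨fun x =>
      (hasFDerivAt_radialMean k (hf.of_le (by simp)) x).differentiableAt, by simp, ?_⟩
    have : fderiv ℝ (radialMean k f) = radialMean (k + 1) (fderiv ℝ f) := by
      ext1 x
      exact (hasFDerivAt_radialMean k (hf.of_le (by simp)) x).fderiv
    rw [this]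
    exact ih (k + 1) (hf.fderiv_right (by simp))

end

/-- The cross product as a continuous bilinear map. -/
def crsL : E3 →L[ℝ] E3 →L[ℝ] E3 :=
  LinearMap.toContinuousLinearMap
    { toFun := fun a => LinearMap.toContinuousLinearMap
        { toFun := fun b => crs a b
          map_add' := fun b c => by apply ext_E3 <;> simp [crs] <;> ring
          map_smul' := fun r b => by apply ext_E3 <;> simp [crs] <;> ring }
      map_add' := fun a c => by ext1 b; apply ext_E3 <;> simp [crs] <;> ring
      map_smul' := fun r a => by ext1 b; apply ext_E3 <;> simp [crs] <;> ring }

theorem crsL_apply (a b : E3) : crsL a b = crs a b := rfl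

theorem crs_apply_zero (a b : E3) : crs a b 0 = a 1 * b 2 - a 2 * b 1 := rfl
theorem crs_apply_one (a b : E3) : crs a b 1 = a 2 * b 0 - a 0 * b 2 := rfl
theorem crs_apply_two (a b : E3) : crs a b 2 = a 0 * b 1 - a 1 * b 0 := rfl

/-- A field that is divergence free on a ball is a curl there. -/
theorem curl_potential {V : E3 → E3} (hV : ContDiff ℝ ∞ V) {r : ℝ}
    (hdiv : ∀ x ∈ ball (0 : E3) r, div V x = 0) {x : E3} (hx : x ∈ ball (0 : E3) r) :
    curl (fun y => crs (radialMean 1 V y) y) x = V x := by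
  set A := radialMean 1 V with hA
  set D := radialMean 2 (fderiv ℝ V) x with hD
  have hAd : HasFDerivAt A D x := hasFDerivAt_radialMean 1 (hV.of_le (by simp)) x
  have hf' : Continuous (fderiv ℝ V) := hV.continuous_fderiv (by simp)
  have hline : Continuous fun t : ℝ => t • x := continuous_id.smul continuous_const
  have hDc : Continuous fun t : ℝ => t ^ 2 • fderiv ℝ V (t • x) :=
    (continuous_pow _).smul (hf'.comp hline)
  have hDapp : ∀ v, D v = ∫ t in (0 : ℝ)..1, t ^ 2 • fderiv ℝ V (t • x) v := fun v => by
    rw [hD, radialMean, ContinuousLinearMap.intervalIntegral_apply (hDc.intervalIntegrable _ _)]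
    rfl
  have hDdiv : D (single 0 1) 0 + D (single 1 1) 1 +
      D (single 2 1) 2 = 0 := by
    have hci : ∀ i : Fin 3, Continuous fun t : ℝ =>
        t ^ 2 * fderiv ℝ V (t • x) (single i 1) i := fun i =>
      (continuous_pow _).mul ((proj i : E3 →L[ℝ] ℝ).continuous.comp
        ((hf'.comp hline).clm_apply continuous_const))
    have h1 : ∀ i : Fin 3, D (single i 1) i =
        ∫ t in (0 : ℝ)..1, t ^ 2 * fderiv ℝ V (t • x) (single i 1) i := fun i => by
      rw [hDapp]
      have hcc : Continuous fun t : ℝ =>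
          t ^ 2 • fderiv ℝ V (t • x) (single i 1) :=
        (continuous_pow _).smul ((hf'.comp hline).clm_apply continuous_const)
      have := ((proj i : E3 →L[ℝ] ℝ).intervalIntegral_comp_comm
        (hcc.intervalIntegrable (μ := volume) 0 1)).symm
      simpa using this
    rw [h1, h1, h1, ← intervalIntegral.integral_add ((hci 0).intervalIntegrable _ _)
      ((hci 1).intervalIntegrable _ _), ← intervalIntegral.integral_add
      (((hci 0).fun_add (hci 1)).intervalIntegrable _ _) ((hci 2).intervalIntegrable _ _)]
    refine intervalIntegral.integral_zero_ae (.of_forall fun t ht => ?_)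
    rw [uIoc_of_le zero_le_one] at ht
    have h2 : t • x ∈ ball (0 : E3) r := by
      rw [mem_ball_zero_iff] at hx ⊢
      rw [norm_smul, norm_of_nonneg ht.1.le]
      exact (mul_le_of_le_one_left (norm_nonneg _) ht.2).trans_lt hx
    have h3 := hdiv _ h2
    rw [div_eq_sum, Fin.sum_univ_three] at h3
    linear_combination t ^ 2 * h3
  have hrad : (2 : ℝ) • A x + D x = V x := by
    have hder : ∀ t : ℝ, HasDerivAt (fun t : ℝ => t ^ 2 • V (t • x))
        ((2 * t) • V (t • x) + t ^ 2 • fderiv ℝ V (t • x) x) t := by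
      intro t
      have h1 : HasDerivAt (fun t : ℝ => t • x) x t := by
        simpa using (hasDerivAt_id t).smul_const x
      have h2 := ((hV.differentiable (by simp)).differentiableAt (x := t • x)).hasFDerivAt
      have h3 := (hasDerivAt_pow 2 t).smul (h2.comp_hasDerivAt t h1)
      refine h3.congr_deriv ?_
      simp [add_comm]
    have hc1 : Continuous fun t : ℝ => (2 * t) • V (t • x) :=
      (continuous_const.mul continuous_id).smul (hV.continuous.comp hline)
    have hc2 : Continuous fun t : ℝ => t ^ 2 • fderiv ℝ V (t • x) x :=
      (continuous_pow _).smul ((hf'.comp hline).clm_apply continuous_const)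
    have h4 := integral_eq_sub_of_hasDerivAt (a := (0 : ℝ)) (b := 1)
      (fun t _ => hder t) ((hc1.add hc2).intervalIntegrable _ _)
    rw [intervalIntegral.integral_add (hc1.intervalIntegrable _ _) (hc2.intervalIntegrable _ _),
      ← hDapp] at h4
    simp only [mul_smul, intervalIntegral.integral_smul] at h4
    simpa [hA, radialMean] using h4
  have hY : ∀ v, fderiv ℝ (fun y => crs (A y) y) x v = crs (D v) x + crs (A x) v := by
    intro v
    have h1 := crsL.hasFDerivAt_of_bilinear hAd (hasFDerivAt_id x)
    have h2 : fderiv ℝ (fun y => crs (A y) y) x = _ := h1.fderiv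
    rw [h2]
    simp [crsL_apply, add_comm]
  have hDx : ∀ j : Fin 3, D x j = x 0 * D (single 0 1) j +
      x 1 * D (single 1 1) j + x 2 * D (single 2 1) j := by
    intro j
    conv_lhs => rw [sum_single x]
    simp
  have hV0 : ∀ j : Fin 3, V x j = 2 * A x j + D x j := fun j => by rw [← hrad]; simp
  apply ext_E3
  · rw [hV0, hDx]
    simp only [curl, pd, hY, PiLp.add_apply, crs_apply_zero, crs_apply_one, crs_apply_two,
      PiLp.toLp_apply, Matrix.cons_val, PiLp.single_apply]
    simp
    linear_combination (-x 0) * hDdiv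
  · rw [hV0, hDx]
    simp only [curl, pd, hY, PiLp.add_apply, crs_apply_zero, crs_apply_one, crs_apply_two,
      PiLp.toLp_apply, Matrix.cons_val, PiLp.single_apply]
    simp
    linear_combination (-x 1) * hDdiv
  · rw [hV0, hDx]
    simp only [curl, pd, hY, PiLp.add_apply, crs_apply_zero, crs_apply_one, crs_apply_two,
      PiLp.toLp_apply, Matrix.cons_val, PiLp.single_apply]
    simp
    linear_combination (-x 2) * hDdiv

theorem contDiff_potential {V : E3 → E3} (hV : ContDiff ℝ ∞ V) :
    ContDiff ℝ ∞ fun y => crs (radialMean 1 V y) y :=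
  crsL.isBoundedBilinearMap.contDiff.comp
    ((contDiff_infty.2 fun n => contDiff_radialMean n 1 hV).prodMk contDiff_id)

theorem curl_congr {Y Y' : E3 → E3} {x : E3} (h : Y =ᶠ[𝓝 x] Y') : curl Y x = curl Y' x := by
  simp only [curl, pd, h.fderiv_eq]

theorem exists_testField_curl_eq {V : E3 → E3} (hV : ContDiff ℝ ∞ V) {r : ℝ} (hr : 0 < r)
    (hdiv : ∀ x ∈ ball (0 : E3) r, div V x = 0) :
    ∃ Y, IsTestField Y ∧ ∀ x ∈ ball (0 : E3) r, curl Y x = V x := by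
  let χ : ContDiffBump (0 : E3) := ⟨r, r + 1, hr, by linarith⟩
  refine ⟨fun y => χ y • crs (radialMean 1 V y) y, ⟨χ.contDiff.smul (contDiff_potential hV),
    χ.hasCompactSupport.smul_right⟩, fun x hx => ?_⟩
  rw [← curl_potential hV hdiv hx]
  refine curl_congr ?_
  filter_upwards [isOpen_ball.mem_nhds hx] with y hy
  rw [χ.one_of_mem_closedBall (ball_subset_closedBall hy), one_smul]

section

/-! ### Approximation of the calibrating field by curls -/

open scoped Convolution in
theorem OrientedMinimalFoliation.exists_smooth_approx {ρ r : ℝ} (hρ : ρ + r < 1)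
    (φ : ContDiffBump (0 : E3)) (hφ : φ.rOut ≤ r) :
    ∃ V : E3 → E3, ContDiff ℝ ∞ V ∧ (∀ x ∈ ball (0 : E3) ρ, div V x = 0) ∧
      (∀ x, ‖V x‖ ≤ (2 / (1 - (ρ + r) ^ 2)) ^ 2) ∧ ∀ x ∈ ball (0 : E3) ρ, ∀ ε, (∀ y ∈ ball x φ.rOut,
        dist (R.calibExt y) (R.calibExt x) ≤ ε) → dist (V x) (R.calibExt x) ≤ ε := by
  set g : E3 → E3 := (ball (0 : E3) (ρ + r)).indicator R.calibExt with hg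
  have hgm : Measurable g := R.measurable_calibExt.indicator isOpen_ball.measurableSet
  set b : ℝ := (2 / (1 - (ρ + r) ^ 2)) ^ 2
  have hb0 : 0 ≤ b := by positivity
  have hgb : ∀ x, ‖g x‖ ≤ b := fun x => by
    by_cases hx : x ∈ ball (0 : E3) (ρ + r)
    · rw [hg, indicator_of_mem hx]
      exact R.norm_calibExt_le hρ (mem_ball_zero_iff.1 hx).le
    · rw [hg, indicator_of_notMem hx, norm_zero]; exact hb0
  have hgl : LocallyIntegrable g volume :=
    (memLp_top_of_bound hgm.aestronglyMeasurable b (.of_forall hgb)).locallyIntegrable le_top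
  have hgeq : ∀ x ∈ ball (0 : E3) ρ, ∀ y ∈ closedBall x φ.rOut,
      y ∈ ball (0 : E3) (ρ + r) := by
    intro x hx y hy
    rw [mem_ball_zero_iff] at hx ⊢
    rw [mem_closedBall_iff_norm] at hy
    have := norm_sub_norm_le y x
    linarith
  set f : E3 → ℝ := φ.normed volume with hf
  have hfc : ContDiff ℝ ∞ f := φ.contDiff_normed
  have hfs : HasCompactSupport f := φ.hasCompactSupport_normed
  refine ⟨f ⋆[ContinuousLinearMap.lsmul ℝ ℝ, volume] g,
    hfs.contDiff_convolution_left _ hfc hgl, fun x hx => ?_, fun x => ?_, fun x hx ε hε => ?_⟩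
  · have h1 := hfs.hasFDerivAt_convolution_left (ContinuousLinearMap.lsmul ℝ ℝ)
      (hfc.of_le (by simp)) hgl x
    rw [div_eq_sum, h1.fderiv]
    have hconv : ConvolutionExists (fderiv ℝ f) g
        ((ContinuousLinearMap.lsmul ℝ ℝ).precompL E3) volume :=
      (hfs.fderiv ℝ).convolutionExists_left _ (hfc.continuous_fderiv (by simp)) hgl
    have hi : ∀ i : Fin 3, (((fderiv ℝ f) ⋆[(ContinuousLinearMap.lsmul ℝ ℝ).precompL E3, volume] g)
        x) (single i 1) i =
        ∫ t, fderiv ℝ f t (single i 1) * g (x - t) i := by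
      intro i
      rw [convolution_def, ← ContinuousLinearMap.apply_apply (single i (1 : ℝ))]
      have hInt := (hconv x).integrable
      set T : (E3 →L[ℝ] E3) →L[ℝ] ℝ := (proj i : E3 →L[ℝ] ℝ).comp
        (ContinuousLinearMap.apply ℝ E3 (single i (1 : ℝ)))
      exact (T.integral_comp_comm hInt).symm
    have hinti : ∀ i : Fin 3, Integrable fun t =>
        fderiv ℝ f t (single i 1) * g (x - t) i := by
      intro i
      set T : (E3 →L[ℝ] E3) →L[ℝ] ℝ := (proj i : E3 →L[ℝ] ℝ).comp
        (ContinuousLinearMap.apply ℝ E3 (single i (1 : ℝ)))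
      exact T.integrable_comp (hconv x).integrable
    simp only [hi]
    rw [← integral_finsetSum _ fun i _ => hinti i]
    have e1 : ∀ t, ∑ i, fderiv ℝ f t (single i 1) * g (x - t) i =
        fderiv ℝ f t (g (x - t)) := fun t => by
      rw [fderiv_apply_eq_sum]
      exact Finset.sum_congr rfl fun i _ => mul_comm _ _
    simp only [e1]
    set η : E3 → ℝ := fun y => f (x - y) with hη
    have hηd : ∀ y v, fderiv ℝ η y v = -fderiv ℝ f (x - y) v := fun y v => by
      have h2 : HasFDerivAt (fun y : E3 => x - y) (-ContinuousLinearMap.id ℝ E3) y :=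
        (hasFDerivAt_id y).const_sub x
      have h3 := ((hfc.differentiable (by simp)).differentiableAt (x := x - y)).hasFDerivAt.comp y h2
      have h4 : fderiv ℝ η y = _ := h3.fderiv
      rw [h4]; simp
    have hηc : ContDiff ℝ ∞ η := hfc.comp (contDiff_const.sub contDiff_id)
    have hηs : tsupport η ⊆ closedBall x φ.rOut := by
      refine closure_minimal (fun y hy => ?_) Metric.isClosed_closedBall
      have : x - y ∈ Function.support f := hy
      rw [hf, φ.support_normed_eq, mem_ball_zero_iff] at this
      rw [mem_closedBall_iff_norm, norm_sub_rev]; exact this.le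
    have hηk : HasCompactSupport η :=
      (isCompact_closedBall x φ.rOut).of_isClosed_subset (isClosed_tsupport _) hηs
    have key := R.integral_fderiv_calibExt hηc hηk (hηs.trans fun y hy => by
      have := hgeq x hx y hy
      rw [mem_ball_zero_iff] at this
      simpa [B] using this.trans hρ)
    have e2 : ∀ t, fderiv ℝ f t (g (x - t)) = -fderiv ℝ η (x - t) (R.calibExt (x - t)) := by
      intro t
      rw [hηd, sub_sub_cancel, neg_neg]
      by_cases ht : x - t ∈ tsupport η
      · rw [hg, indicator_of_mem (hgeq x hx _ (hηs ht))]
      · have h5 : fderiv ℝ η (x - t) = 0 := by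
          by_contra h
          exact ht (support_fderiv_subset ℝ h)
        have h6 : fderiv ℝ f t = 0 := by
          ext v
          have := hηd (x - t) v
          rw [h5, sub_sub_cancel] at this
          simpa using this.symm
        rw [h6]; rfl
    simp only [e2]
    rw [integral_neg, integral_sub_left_eq_self (fun y => fderiv ℝ η y (R.calibExt y)) volume x,
      key, neg_zero]
  · have := dist_convolution_le (g := g) (x₀ := x) (z₀ := 0) hb0 φ.support_normed_eq.subset
      φ.nonneg_normed φ.integral_normed (hgm.aestronglyMeasurable (μ := volume))
      (fun y _ => by simpa using hgb y)
    simpa using this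
  · have hx' : g x = R.calibExt x := by
      rw [hg, indicator_of_mem (hgeq x hx x (Metric.mem_closedBall_self φ.rOut_pos.le))]
    rw [← hx']
    refine φ.dist_normed_convolution_le hgm.aestronglyMeasurable fun y hy => ?_
    rw [hx', hg, indicator_of_mem (hgeq x hx y (ball_subset_closedBall hy))]
    exact hε y hy

/-- On balls the calibrating field is a bounded pointwise limit of curls of test fields. -/
theorem OrientedMinimalFoliation.exists_testField_seq {ρ : ℝ}
    (hρ : ρ < 1) : ∃ (Y : ℕ → E3 → E3) (C : ℝ), (∀ n, IsTestField (Y n)) ∧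
      (∀ n, ∀ x, ‖x‖ ≤ ρ → ‖curl (Y n) x‖ ≤ C) ∧
      ∀ x, ‖x‖ ≤ ρ → x ∉ Z → Tendsto (fun n => curl (Y n) x) atTop (𝓝 (R.calib x)) := by
  set r : ℝ := (1 - max ρ 0) / 3 with hr
  have hm : max ρ 0 < 1 := max_lt hρ one_pos
  have hr0 : 0 < r := by rw [hr]; linarith
  set ρ' : ℝ := max ρ 0 + r with hρ'
  have hρ'0 : 0 < ρ' := by have := le_max_right ρ 0; linarith
  have hρ'1 : ρ' + r < 1 := by rw [hρ', hr]; linarith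
  have hsub : ∀ x : E3, ‖x‖ ≤ ρ → x ∈ ball (0 : E3) ρ' := fun x hx => by
    rw [mem_ball_zero_iff]; have := le_max_left ρ 0; linarith
  let φ : ℕ → ContDiffBump (0 : E3) := fun n =>
    ⟨r / (n + 1) / 2, r / (n + 1), by positivity, by linarith [show 0 < r / (n + 1) by positivity]⟩
  have hφ : ∀ n, (φ n).rOut ≤ r := fun n => div_le_self hr0.le (by simp)
  choose V hV1 hV2 hV3 hV4 using fun n => R.exists_smooth_approx hρ'1 (φ n) (hφ n)
  choose Y hY1 hY2 using fun n => exists_testField_curl_eq (hV1 n) hρ'0 (hV2 n)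
  refine ⟨Y, _, hY1, fun n x hx => by rw [hY2 n x (hsub x hx)]; exact hV3 n x, fun x hx hxZ => ?_⟩
  have hxB : x ∈ B \ Z := ⟨mem_B_of_norm_le hρ hx, hxZ⟩
  have hcont : ContinuousAt R.calibExt x := by
    refine (R.continuousOn_calib.continuousAt (isOpen_B_diff_Z.mem_nhds hxB)).congr ?_
    filter_upwards [isOpen_B_diff_Z.mem_nhds hxB] with y hy using (R.calibExt_of_mem hy).symm
  rw [← R.calibExt_of_mem hxB, Metric.tendsto_atTop]
  intro ε hε
  obtain ⟨δ, hδ, hδε⟩ := Metric.continuousAt_iff.1 hcont (ε / 2) (by linarith)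
  have hlim : Tendsto (fun n : ℕ => r / ((n : ℝ) + 1)) atTop (𝓝 0) :=
    tendsto_const_div_atTop_nhds_zero_nat r |>.comp (tendsto_add_atTop_nat 1) |>.congr
      fun n => by simp
  obtain ⟨N, hN⟩ := eventually_atTop.1 (hlim.eventually_lt_const hδ)
  refine ⟨N, fun n hn => ?_⟩
  rw [hY2 n x (hsub x hx)]
  refine (hV4 n x (hsub x hx) (ε / 2) fun y hy => (hδε ?_).le).trans_lt (by linarith)
  exact (Metric.mem_ball.1 hy).trans (hN n hn)

end

section

/-! ### Null sets -/

theorem measure_range_curve {f : ℝ → E3} (hf : ContDiff ℝ 1 f) : μHE[2] (range f) = 0 := by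
  have h1 := hf.dimH_range_le
  have h2 : dimH (range f) < (2 : NNReal) := by
    refine h1.trans_lt ?_
    simp
  rw [Measure.euclideanHausdorffMeasure_def, Measure.smul_apply]
  have := hausdorffMeasure_of_dimH_lt h2
  simp only [NNReal.coe_ofNat] at this
  simp [this]

theorem measure_Z : μHE[2] Z = 0 := by
  have hsub : Z ⊆ range fun s : ℝ => s • (single 2 1 : E3) := by
    intro x hx
    refine ⟨x 2, ?_⟩
    apply ext_E3 <;> simp [hx.1, hx.2]
  exact measure_mono_null hsub (measure_range_curve (contDiff_id.smul contDiff_const))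

theorem measure_circle (t φ : ℝ) : μHE[2] (range (P t φ)) = 0 := by
  refine measure_range_curve ?_
  unfold P
  rw [contDiff_euclidean]
  intro i
  fin_cases i
  · exact contDiff_const.mul contDiff_cos
  · exact contDiff_const.mul contDiff_sin
  · exact contDiff_const

theorem isClosed_Z : IsClosed Z :=
  (isClosed_eq (contDiff_coord (n := 0) 0).continuous continuous_const).inter
    (isClosed_eq (contDiff_coord (n := 0) 1).continuous continuous_const)

theorem ae_notMem_Z (S : Set E3) : ∀ᵐ x ∂(μHE[2] : Measure E3).restrict S, x ∉ Z :=
  ae_restrict_of_ae (measure_eq_zero_iff_ae_notMem.1 measure_Z)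

theorem aemeasurable_of_continuousOn_diff {F : Type*} [TopologicalSpace F] [MeasurableSpace F]
    [BorelSpace F] [TopologicalSpace.PseudoMetrizableSpace F] {n : E3 → F} {S : Set E3}
    (hS : MeasurableSet S) (hn : ContinuousOn n (S \ Z)) :
    AEMeasurable n ((μHE[2] : Measure E3).restrict S) := by
  have h1 : (S \ Z : Set E3) =ᵐ[μHE[2]] S := by
    refine ae_eq_set.2 ⟨by simp, measure_mono_null (fun x hx => ?_) measure_Z⟩
    by_contra h
    exact hx.2 ⟨hx.1, h⟩
  rw [← Measure.restrict_congr_set h1]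
  exact hn.aemeasurable (hS.diff isClosed_Z.measurableSet)

/-! ### The calibration inequality -/

theorem lam_ge_two {x : E3} (hx : x ∈ B) : 2 ≤ lam x := by
  have := one_sub_normSq_pos hx
  rw [lam, le_div_iff₀ this]
  nlinarith [sq_nonneg ‖x‖]

/-- An integer current of finite mass supported in a smaller ball. -/
structure IsFluxData (ρ : ℝ) (S : Set E3) (n : E3 → E3) (m : E3 → ℕ) : Prop where
  measurableSet : MeasurableSet S
  norm_le : ∀ x ∈ S, ‖x‖ ≤ ρ
  aemeasurable_normal : AEMeasurable n ((μHE[2] : Measure E3).restrict S)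
  norm_normal : ∀ᵐ x ∂(μHE[2] : Measure E3).restrict S, ‖n x‖ = 1
  measurable_mult : Measurable m
  finite_mass : ∫⁻ x in S, (m x : ENNReal) ∂μHE[2] < ⊤

variable {ρ : ℝ} {S S' : Set E3} {n n' : E3 → E3} {m m' : E3 → ℕ}

theorem IsFluxData.integrable_mult (h : IsFluxData ρ S n m) :
    IntegrableOn (fun x => (m x : ℝ)) S μHE[2] := by
  refine ⟨(measurable_from_nat.comp h.measurable_mult).aestronglyMeasurable, ?_⟩
  rw [hasFiniteIntegral_iff_enorm]
  refine lt_of_le_of_lt (le_of_eq ?_) h.finite_mass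
  congr 1; ext x
  rw [enorm_of_nonneg (by positivity)]; simp

theorem IsFluxData.aestronglyMeasurable_mul_inner (h : IsFluxData ρ S n m) {X : E3 → E3}
    (hX : AEStronglyMeasurable X ((μHE[2] : Measure E3).restrict S)) :
    AEStronglyMeasurable (fun x => (m x : ℝ) * ⟪X x, n x⟫) ((μHE[2] : Measure E3).restrict S) :=
  (measurable_from_nat.comp h.measurable_mult).aestronglyMeasurable.mul
    (hX.inner h.aemeasurable_normal.aestronglyMeasurable)

theorem OrientedMinimalFoliation.aestronglyMeasurable_calib (hρ : ρ < 1) (h : IsFluxData ρ S n m) :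
    AEStronglyMeasurable R.calib ((μHE[2] : Measure E3).restrict S) :=
  (aemeasurable_of_continuousOn_diff h.measurableSet (R.continuousOn_calib.mono fun _ hx =>
    ⟨mem_B_of_norm_le hρ (h.norm_le _ hx.1), hx.2⟩)).aestronglyMeasurable

theorem IsFluxData.ae_abs_le (h : IsFluxData ρ S n m) {X : E3 → E3} {C : ℝ}
    (hC : ∀ x ∈ S, x ∉ Z → ‖X x‖ ≤ C) : ∀ᵐ x ∂(μHE[2] : Measure E3).restrict S,
      ‖(m x : ℝ) * ⟪X x, n x⟫‖ ≤ C * m x := by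
  filter_upwards [h.norm_normal, ae_notMem_Z S, ae_restrict_mem h.measurableSet] with x h1 h2 h3
  rw [norm_mul, norm_of_nonneg (by positivity : (0 : ℝ) ≤ m x), mul_comm]
  gcongr
  refine (abs_real_inner_le_norm _ _).trans ?_
  rw [h1, mul_one]
  exact hC x h3 h2

theorem OrientedMinimalFoliation.norm_calib_le (hρ : ρ < 1) {x : E3}
    (hx : ‖x‖ ≤ ρ) (hZ : x ∉ Z) : ‖R.calib x‖ ≤ (2 / (1 - ρ ^ 2)) ^ 2 := by
  rw [← R.calibExt_of_mem ⟨mem_B_of_norm_le hρ hx, hZ⟩]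
  exact R.norm_calibExt_le hρ hx

theorem IsFluxData.integrableOn_calib (h : IsFluxData ρ S n m) (hρ : ρ < 1)
    (R : OrientedMinimalFoliation) :
    IntegrableOn (fun x => (m x : ℝ) * ⟪R.calib x, n x⟫) S μHE[2] :=
  (h.integrable_mult.const_mul _).mono'
    (h.aestronglyMeasurable_mul_inner (R.aestronglyMeasurable_calib hρ h))
    (h.ae_abs_le fun x hx hZ => R.norm_calib_le hρ (h.norm_le x hx) hZ)

theorem IsFluxData.tendsto_bdry (h : IsFluxData ρ S n m) (R : OrientedMinimalFoliation)
    {Y : ℕ → E3 → E3} {C : ℝ} (hY : ∀ k, IsTestField (Y k))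
    (hC : ∀ k, ∀ x, ‖x‖ ≤ ρ → ‖curl (Y k) x‖ ≤ C)
    (hlim : ∀ x, ‖x‖ ≤ ρ → x ∉ Z → Tendsto (fun k => curl (Y k) x) atTop (𝓝 (R.calib x))) :
    Tendsto (fun k => bdry S n m (Y k)) atTop
      (𝓝 (∫ x in S, (m x : ℝ) * ⟪R.calib x, n x⟫ ∂μHE[2])) := by
  refine tendsto_integral_of_dominated_convergence (fun x => C * m x)
    (fun k => h.aestronglyMeasurable_mul_inner
      (curl_continuous ((hY k).1.of_le (by simp))).aestronglyMeasurable)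
    (h.integrable_mult.const_mul C)
    (fun k => h.ae_abs_le fun x hx _ => hC k x (h.norm_le x hx)) ?_
  filter_upwards [ae_notMem_Z S, ae_restrict_mem h.measurableSet] with x h2 h3
  exact ((hlim x (h.norm_le x h3) h2).inner tendsto_const_nhds).const_mul _

/-- Currents with the same boundary have the same flux of the calibrating field. -/
theorem OrientedMinimalFoliation.flux_eq (hρ : ρ < 1)
    (h : IsFluxData ρ S n m) (h' : IsFluxData ρ S' n' m')
    (hb : ∀ Y, IsTestField Y → bdry S n m Y = bdry S' n' m' Y) :
    ∫ x in S, (m x : ℝ) * ⟪R.calib x, n x⟫ ∂μHE[2] =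
      ∫ x in S', (m' x : ℝ) * ⟪R.calib x, n' x⟫ ∂μHE[2] := by
  obtain ⟨Y, C, hY, hC, hlim⟩ := R.exists_testField_seq hρ
  refine tendsto_nhds_unique (h.tendsto_bdry R hY hC hlim) ?_
  simp only [fun k => hb (Y k) (hY k)]
  exact h'.tendsto_bdry R hY hC hlim

theorem exists_norm_le_of_isCompact {K : Set E3} (hK : IsCompact K) (hKB : K ⊆ B) :
    ∃ ρ < 1, ∀ x ∈ K, ‖x‖ ≤ ρ := by
  rcases K.eq_empty_or_nonempty with h | h
  · exact ⟨0, one_pos, by simp [h]⟩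
  · obtain ⟨z, hz, hzm⟩ := hK.exists_isMaxOn h continuous_norm.continuousOn
    exact ⟨‖z‖, by simpa [B] using hKB hz, fun x hx => hzm hx⟩

theorem IsFluxData.mono (h : IsFluxData ρ S n m) {ρ' : ℝ} (hρ : ρ ≤ ρ') : IsFluxData ρ' S n m :=
  { h with norm_le := fun x hx => (h.norm_le x hx).trans hρ }

theorem RectCurrent.exists_isFluxData (T : RectCurrent) :
    ∃ ρ < 1, IsFluxData ρ T.carrier T.normal T.mult := by
  obtain ⟨K, hK, hKB, hsub⟩ := T.compact_support
  obtain ⟨ρ, hρ, hle⟩ := exists_norm_le_of_isCompact hK hKB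
  refine ⟨ρ, hρ, T.measurableSet_carrier, fun x hx => hle x (hsub hx),
    T.measurable_normal.aemeasurable, ?_, T.measurable_mult, T.finite_mass⟩
  obtain ⟨N, -, hN0, hN⟩ := T.rectifiable
  have h1 : ∀ᵐ x ∂(μHE[2] : Measure E3).restrict (T.carrier ∩ ⋃ i, N i), ‖T.normal x‖ = 1 := by
    rw [inter_iUnion]
    rw [ae_restrict_iUnion_iff]
    intro i
    filter_upwards [hN i] with x hx using hx.1
  have h2 : (T.carrier ∩ ⋃ i, N i : Set E3) =ᵐ[μHE[2]] T.carrier :=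
    ae_eq_set.2 ⟨by rw [sdiff_eq_empty.2 inter_subset_left]; exact measure_empty,
      by rw [sdiff_self_inter]; exact hN0⟩
  rwa [Measure.restrict_congr_set h2] at h1

theorem measure_le_hypArea {S : Set E3} (hm : MeasurableSet S) (hS : S ⊆ B) :
    μHE[2] S ≤ hypArea S := by
  rw [← setLIntegral_one, hypArea]
  refine setLIntegral_mono' hm fun x hx => ?_
  rw [← ENNReal.ofReal_one]
  exact ENNReal.ofReal_le_ofReal (by nlinarith [lam_ge_two (hS hx)])

theorem isFluxData_one (hρ : ρ < 1) (hm : MeasurableSet S) (hS : ∀ x ∈ S, ‖x‖ ≤ ρ)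
    (ha : hypArea S < ⊤) (hn : ContinuousOn n (S \ Z)) (hn1 : ∀ x ∈ S \ Z, ‖n x‖ = 1) :
    IsFluxData ρ S n fun _ => 1 := by
  refine ⟨hm, hS, aemeasurable_of_continuousOn_diff hm hn, ?_, measurable_const, ?_⟩
  · filter_upwards [ae_notMem_Z S, ae_restrict_mem hm] with x h1 h2 using hn1 x ⟨h2, h1⟩
  · simpa using (measure_le_hypArea hm fun x hx => mem_B_of_norm_le hρ (hS x hx)).trans_lt ha

theorem continuousOn_lam : ContinuousOn lam B := fun _ hx =>
  (contDiffAt_lam hx).continuousAt.continuousWithinAt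

/-- The mass of a current, as a real integral. -/
theorem IsFluxData.ofReal_integral_lam (h : IsFluxData ρ S n m) (hρ : ρ < 1) :
    IntegrableOn (fun x => (m x : ℝ) * lam x ^ 2) S μHE[2] ∧
    ofReal (∫ x in S, (m x : ℝ) * lam x ^ 2 ∂μHE[2]) =
      ∫⁻ x in S, (m x : ENNReal) * ofReal (lam x ^ 2) ∂μHE[2] := by
  have hB : S ⊆ B := fun x hx => mem_B_of_norm_le hρ (h.norm_le x hx)
  have hi : IntegrableOn (fun x => (m x : ℝ) * lam x ^ 2) S μHE[2] := by
    refine (h.integrable_mult.const_mul ((2 / (1 - ρ ^ 2)) ^ 2)).mono'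
      ((measurable_from_nat.comp h.measurable_mult).aestronglyMeasurable.mul
        (((continuousOn_lam.mono hB).pow 2).aestronglyMeasurable h.measurableSet)) ?_
    filter_upwards [ae_restrict_mem h.measurableSet] with x hx
    rw [norm_of_nonneg (by positivity), mul_comm]
    refine mul_le_mul_of_nonneg_right ?_ (by positivity)
    exact lam_sq_le hρ (h.norm_le x hx)
  refine ⟨hi, ?_⟩
  rw [ofReal_integral_eq_lintegral_ofReal hi (.of_forall fun x => by positivity)]
  congr 1; ext x
  rw [ENNReal.ofReal_mul (by positivity)]; simp

theorem IsFluxData.flux_le (h : IsFluxData ρ S n m) (hρ : ρ < 1) (R : OrientedMinimalFoliation) :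
    ∫ x in S, (m x : ℝ) * ⟪R.calib x, n x⟫ ∂μHE[2] ≤ ∫ x in S, (m x : ℝ) * lam x ^ 2 ∂μHE[2] := by
  refine integral_mono_ae (h.integrableOn_calib hρ R) (h.ofReal_integral_lam hρ).1 ?_
  filter_upwards [h.norm_normal, ae_notMem_Z S, ae_restrict_mem h.measurableSet] with x h1 h2 h3
  have h4 : x ∈ B \ Z := ⟨mem_B_of_norm_le hρ (h.norm_le x h3), h2⟩
  gcongr
  refine (real_inner_le_norm _ _).trans ?_
  rw [h1, mul_one, calib, norm_smul, R.norm_nu h4, mul_one,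
    norm_of_nonneg (sq_nonneg _)]

theorem OrientedMinimalFoliation.inner_calib_nu {x : E3}
    (hx : x ∈ B \ Z) : ⟪R.calib x, R.ν x⟫ = lam x ^ 2 := by
  rw [calib, inner_smul_left, real_inner_self_eq_norm_sq, R.norm_nu hx]
  simp

theorem IsFluxData.flux_nu (h : IsFluxData ρ S n m) (hρ : ρ < 1) (R : OrientedMinimalFoliation)
    (hn : ∀ x ∈ S \ Z, n x = R.ν x) :
    ∫ x in S, (m x : ℝ) * ⟪R.calib x, n x⟫ ∂μHE[2] = ∫ x in S, (m x : ℝ) * lam x ^ 2 ∂μHE[2] := by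
  refine integral_congr_ae ?_
  filter_upwards [ae_notMem_Z S, ae_restrict_mem h.measurableSet] with x h2 h3
  have h4 : x ∈ B \ Z := ⟨mem_B_of_norm_le hρ (h.norm_le x h3), h2⟩
  rw [hn x ⟨h3, h2⟩, R.inner_calib_nu h4]

/-- Surfaces orthogonal to the foliation minimize area. -/
theorem OrientedMinimalFoliation.hypArea_le_hypMass (hρ : ρ < 1)
    (hm : MeasurableSet S) (hS : ∀ x ∈ S, ‖x‖ ≤ ρ) (ha : hypArea S < ⊤) (T : RectCurrent)
    (hb : ∀ Y, IsTestField Y → bdry T.carrier T.normal T.mult Y = bdry S R.ν (fun _ => 1) Y) :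
    hypArea S ≤ T.hypMass := by
  obtain ⟨ρ', hρ', hT⟩ := T.exists_isFluxData
  have hSB : S \ Z ⊆ B \ Z := fun x hx => ⟨mem_B_of_norm_le hρ (hS x hx.1), hx.2⟩
  have hM := isFluxData_one hρ hm hS ha (R.continuousOn_nu.mono hSB) fun x hx => R.norm_nu (hSB hx)
  have h1 : max ρ ρ' < 1 := max_lt hρ hρ'
  have hT' := hT.mono (le_max_right ρ ρ')
  have hM' := hM.mono (le_max_left ρ ρ')
  have e1 := R.flux_eq h1 hT' hM' hb
  have e2 := hT'.flux_le h1 R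
  rw [e1, hM'.flux_nu h1 R fun _ _ => rfl] at e2
  have e3 := (hM'.ofReal_integral_lam h1).2
  have e4 := (hT'.ofReal_integral_lam h1).2
  have e5 : hypArea S = ofReal (∫ x in S, ((1 : ℕ) : ℝ) * lam x ^ 2 ∂μHE[2]) := by
    rw [e3, hypArea]; simp
  rw [e5, RectCurrent.hypMass, ← e4]
  exact ENNReal.ofReal_le_ofReal e2

end

section

/-! ### Local structure of unions of leaves -/

/-- A set that contains every plaque it meets. -/
def OrientedMinimalFoliation.IsSaturated (N : Set E3) : Prop :=
  ∀ φ ∈ R.atlas, ∀ t, (plaque φ t ∩ N).Nonempty → plaque φ t ⊆ N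

theorem ConsistsOfRotLeaves.isSaturated {R : OrientedMinimalFoliation} {M : Set E3}
    (h : ConsistsOfRotLeaves R M) : R.IsSaturated (M \ Z) := by
  obtain ⟨𝓛, h𝓛, hM⟩ := h
  rintro φ hφ t ⟨x, hx, hxN⟩ y hy
  rw [hM] at hxN ⊢
  obtain ⟨L, hL, hxL⟩ := hxN
  obtain ⟨p, hp, rfl⟩ := (h𝓛 hL).1
  exact ⟨_, hL, Relation.ReflTransGen.tail hxL ⟨φ, hφ, t, hx, hy⟩⟩

variable {R : OrientedMinimalFoliation}

theorem continuousOn_height (φ : OpenPartialHomeomorph E3 (EuclideanSpace ℝ (Fin 2) × ℝ)) :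
    ContinuousOn (fun x => (φ x).2) φ.source := continuous_snd.comp_continuousOn φ.continuousOn

theorem isConnected_plaque {φ : OpenPartialHomeomorph E3 (EuclideanSpace ℝ (Fin 2) × ℝ)}
    (hφ : φ ∈ R.atlas) (t : ℝ) : IsConnected (plaque φ t) := by
  have h1 : plaque φ t = φ.symm '' (univ ×ˢ {t}) := by
    ext x
    constructor
    · rintro ⟨hx, rfl⟩
      exact ⟨φ x, by simp, φ.left_inv hx⟩
    · rintro ⟨y, hy, rfl⟩
      have hyt : y ∈ φ.target := by rw [R.target_eq φ hφ]; trivial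
      exact ⟨φ.map_target hyt, by rw [φ.right_inv hyt]; exact hy.2⟩
  rw [h1]
  refine (isConnected_univ.prod isConnected_singleton).image _ (φ.continuousOn_symm.mono ?_)
  rw [R.target_eq φ hφ]; exact subset_univ _

theorem exists_mem_frontier_of_isPreconnected {S U : Set E3} (hS : IsPreconnected S)
    (hU : IsOpen U) (h1 : (S ∩ U).Nonempty) (h2 : (S ∩ Uᶜ).Nonempty) : ∃ y ∈ S, y ∈ frontier U := by
  by_contra! h
  have hcov : S ⊆ U ∪ (closure U)ᶜ := by
    intro y hy
    by_cases hyU : y ∈ U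
    · exact Or.inl hyU
    · refine Or.inr fun hyc => h y hy ?_
      rw [hU.frontier_eq]; exact ⟨hyc, hyU⟩
  obtain ⟨x, hx, hxU⟩ := h2
  have h3 : (S ∩ (closure U)ᶜ).Nonempty := ⟨x, hx, (hcov hx).resolve_left hxU⟩
  obtain ⟨z, -, hz1, hz2⟩ := hS U (closure U)ᶜ hU isClosed_closure.isOpen_compl hcov h1 h3
  exact hz2 (subset_closure hz1)

/-- A saturated frontier with the normal field pointing outwards is locally a single plaque. -/
theorem exists_isOpen_inter_eq_plaque {U M : Set E3} (hU : IsOpen U)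
    (hM : M = frontier U ∩ B) (hsat : R.IsSaturated (M \ Z))
    (hout : ∀ p ∈ M \ Z, PointsOut U p (R.ν p)) {p : E3} (hp : p ∈ M \ Z) :
    ∃ φ ∈ R.atlas, ∃ O, IsOpen O ∧ p ∈ O ∧ O ⊆ φ.source ∧ (M \ Z) ∩ O = plaque φ (φ p).2 ∩ O := by
  have hpB : p ∈ B \ Z := ⟨(hM ▸ hp.1 : p ∈ frontier U ∩ B).2, hp.2⟩
  obtain ⟨φ, hφ, hpφ⟩ := R.cover p hpB
  set t0 := (φ p).2 with ht₀
  set H : E3 → ℝ := fun x => (φ x).2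
  have hHc : ContinuousOn H φ.source := continuousOn_height φ
  have hpp : p ∈ plaque φ t0 := ⟨hpφ, rfl⟩
  have hnotM : ∀ x, x ∈ U ∨ x ∉ closure U → x ∉ M := by
    intro x hx hxM
    rw [hM] at hxM
    rcases hx with h | h
    · have := hxM.1
      rw [hU.frontier_eq] at this
      exact this.2 h
    · exact h (frontier_subset_closure hxM.1)
  obtain ⟨-, V, f, hpV, hf, c, hc⟩ := R.normal φ hφ t0 p hpp
  have hc0 : c ≠ 0 := by rintro rfl; exact hf.2.2.1 p hpV (by simpa using hc)
  have hline : ∀ ε : ℝ, ε ≠ 0 → ∀ᶠ s in 𝓝[>] (0 : ℝ), p + (ε * s) • R.ν p ∈ φ.source ∧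
      H (p + (ε * s) • R.ν p) ≠ t0 := by
    intro ε hε
    have hd : HasDerivAt (fun s : ℝ => p + (ε * s) • R.ν p) (ε • R.ν p) 0 := by
      have := (((hasDerivAt_id (0 : ℝ)).const_mul ε).smul_const (R.ν p)).const_add p
      simpa using this
    have h0 : p + (ε * 0) • R.ν p = p := by simp
    have hfd : HasDerivAt (fun s : ℝ => f (p + (ε * s) • R.ν p)) (ε * c) 0 := by
      have h1 := (hf.hasStrictFDerivAt hpV).hasFDerivAt
      rw [← h0] at h1
      have h2 := h1.comp_hasDerivAt (0 : ℝ) hd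
      refine h2.congr_deriv ?_
      rw [h0, ← inner_gradient, hc, inner_smul_left, inner_smul_right,
        real_inner_self_eq_norm_sq, R.norm_nu hpB]
      simp [mul_comm]
    have hne := hfd.eventually_ne (c := 0) (mul_ne_zero hε hc0)
    have hsrc : ∀ᶠ s in 𝓝 (0 : ℝ), p + (ε * s) • R.ν p ∈ φ.source ∩ V :=
      hd.continuousAt.eventually_mem (by
        rw [h0]; exact (φ.open_source.inter hf.1).mem_nhds ⟨hpφ, hpV⟩)
    filter_upwards [nhdsGT_le_nhdsNE 0 hne, nhdsWithin_le_nhds hsrc] with s h1 h2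
    refine ⟨h2.1, fun h3 => h1 ?_⟩
    have : p + (ε * s) • R.ν p ∈ plaque φ t0 ∩ V := ⟨⟨h2.1, h3⟩, h2.2⟩
    rw [hf.2.2.2] at this
    exact this.2
  have hev := ((hline 1 one_ne_zero).and (hline (-1) (by norm_num))).and (hout p hp)
  obtain ⟨δ, hδ, hδ'⟩ := mem_nhdsGT_iff_exists_Ioo_subset.1 hev
  have hδ0 : (0 : ℝ) < δ := hδ
  simp only [one_mul, neg_mul, neg_smul] at hδ'
  have hside : ∀ ε : ℝ, (∀ s ∈ Ioo 0 δ, p + (ε * s) • R.ν p ∈ φ.source ∧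
      H (p + (ε * s) • R.ν p) ≠ t0) → ∃ a, a ≠ t0 ∧ ∀ t ∈ uIcc t0 a, t ≠ t0 →
        ∃ s ∈ Ioo 0 δ, H (p + (ε * s) • R.ν p) = t := by
    intro ε hε
    have hδ2 : δ / 2 ∈ Ioo 0 δ := ⟨by linarith, by linarith⟩
    refine ⟨H (p + (ε * (δ / 2)) • R.ν p), (hε _ hδ2).2, fun t ht htne => ?_⟩
    have hcont : ContinuousOn (fun s : ℝ => H (p + (ε * s) • R.ν p)) (uIcc 0 (δ / 2)) := by
      refine hHc.comp (by fun_prop) fun s hs => ?_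
      rw [uIcc_of_le hδ2.1.le] at hs
      rcases hs.1.eq_or_lt with h | h
      · simpa [← h] using hpφ
      · exact (hε s ⟨h, by linarith [hs.2]⟩).1
    have h1 := intermediate_value_uIcc hcont
    have h2 : H (p + (ε * 0) • R.ν p) = t0 := by simp [ht₀, H]
    simp only [h2] at h1
    obtain ⟨s, hs, hst⟩ := h1 ht
    rw [uIcc_of_le hδ2.1.le] at hs
    refine ⟨s, ⟨hs.1.lt_of_ne ?_, by linarith [hs.2]⟩, hst⟩
    rintro rfl
    exact htne (by rw [← hst]; exact h2)
  obtain ⟨a, ha, ha'⟩ := hside 1 fun s hs => by simpa using (hδ' hs).1.1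
  obtain ⟨b, hb, hb'⟩ := hside (-1) fun s hs => by simpa using (hδ' hs).1.2
  simp only [one_mul, neg_mul, neg_smul] at ha' hb'
  have hsat' : ∀ x ∈ φ.source, x ∉ M → ∀ y ∈ φ.source, H y = H x → y ∉ M \ Z := by
    intro x hx hxM y hy hyx hyM
    exact hxM (hsat φ hφ (H x) ⟨y, ⟨hy, hyx⟩, hyM⟩ ⟨hx, rfl⟩).1
  have hA : ∀ t, t ≠ t0 → t ∈ uIcc t0 a ∨ t ∈ uIcc t0 b → ∀ y ∈ φ.source, H y = t → y ∉ M \ Z := by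
    intro t htne ht y hy hyt
    rcases ht with ht | ht
    · obtain ⟨s, hs, hst⟩ := ha' t ht htne
      exact hsat' _ (by simpa using (hδ' hs).1.1.1) (hnotM _ (Or.inr (hδ' hs).2.2)) y hy
        (hyt.trans hst.symm)
    · obtain ⟨s, hs, hst⟩ := hb' t ht htne
      refine hsat' _ (by simpa using (hδ' hs).1.2.1) (hnotM _ (Or.inl ?_)) y hy
        (hyt.trans hst.symm)
      have := (hδ' hs).2.1
      rwa [sub_eq_add_neg] at this
  have hopp : ∀ t, t ≠ t0 → t ∈ uIcc t0 a → t ∉ uIcc t0 b := by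
    intro t htne hta htb
    obtain ⟨s, hs, hst⟩ := ha' t hta htne
    obtain ⟨s', hs', hst'⟩ := hb' t htb htne
    have h1 : (plaque φ t ∩ U).Nonempty := by
      refine ⟨_, ⟨by simpa using (hδ' hs').1.2.1, hst'⟩, ?_⟩
      have := (hδ' hs').2.1
      rwa [sub_eq_add_neg] at this
    have h2 : (plaque φ t ∩ Uᶜ).Nonempty :=
      ⟨_, ⟨by simpa using (hδ' hs).1.1.1, hst⟩, fun h => (hδ' hs).2.2 (subset_closure h)⟩
    obtain ⟨y, hy, hyF⟩ :=
      exists_mem_frontier_of_isPreconnected (isConnected_plaque hφ t).isPreconnected hU h1 h2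
    have hyBZ := R.source_subset φ hφ hy.1
    exact hA t htne (Or.inl hta) y hy.1 hy.2 ⟨by rw [hM]; exact ⟨hyF, hyBZ.1⟩, hyBZ.2⟩
  obtain ⟨lo, hi, hlo, hhi, hInt⟩ : ∃ lo hi, lo < t0 ∧ t0 < hi ∧
      ∀ t ∈ Ioo lo hi, t ≠ t0 → t ∈ uIcc t0 a ∨ t ∈ uIcc t0 b := by
    rcases lt_or_gt_of_ne ha with h1 | h1 <;> rcases lt_or_gt_of_ne hb with h2 | h2
    · exfalso
      refine hopp (max a b) (max_lt h1 h2).ne ?_ ?_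
      · rw [uIcc_of_ge h1.le]; exact ⟨le_max_left _ _, (max_lt h1 h2).le⟩
      · rw [uIcc_of_ge h2.le]; exact ⟨le_max_right _ _, (max_lt h1 h2).le⟩
    · refine ⟨a, b, h1, h2, fun t ht htne => ?_⟩
      rw [uIcc_of_ge h1.le, uIcc_of_le h2.le]
      rcases le_total t t0 with h | h
      exacts [Or.inl ⟨ht.1.le, h⟩, Or.inr ⟨h, ht.2.le⟩]
    · refine ⟨b, a, h2, h1, fun t ht htne => ?_⟩
      rw [uIcc_of_le h1.le, uIcc_of_ge h2.le]
      rcases le_total t t0 with h | h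
      exacts [Or.inr ⟨ht.1.le, h⟩, Or.inl ⟨h, ht.2.le⟩]
    · exfalso
      refine hopp (min a b) (lt_min h1 h2).ne' ?_ ?_
      · rw [uIcc_of_le h1.le]; exact ⟨(lt_min h1 h2).le, min_le_left _ _⟩
      · rw [uIcc_of_le h2.le]; exact ⟨(lt_min h1 h2).le, min_le_right _ _⟩
  refine ⟨φ, hφ, φ.source ∩ H ⁻¹' Ioo lo hi, hHc.isOpen_inter_preimage φ.open_source isOpen_Ioo,
    ⟨hpφ, hlo, hhi⟩, inter_subset_left, ?_⟩
  ext x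
  constructor
  · rintro ⟨hxM, hx, hxI⟩
    refine ⟨⟨hx, ?_⟩, hx, hxI⟩
    by_contra hne
    exact hA (H x) hne (hInt _ hxI hne) x hx rfl hxM
  · rintro ⟨hxp, hx⟩
    exact ⟨hsat φ hφ t0 ⟨p, hpp, hp⟩ hxp, hx⟩

theorem IsUnitNormal.congr {N N' O : Set E3} {x v : E3} (h : IsUnitNormal N x v) (hO : IsOpen O)
    (hx : x ∈ O) (hN : N ∩ O = N' ∩ O) : IsUnitNormal N' x v := by
  obtain ⟨h1, V, f, hxV, hf, hc⟩ := h
  exact ⟨h1, V ∩ O, f, ⟨hxV, hx⟩, hf.inter hO hN, hc⟩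

/-- What the classification of rotationally invariant surfaces needs to know about them. -/
structure IsAdmissible (N : Set E3) (n : E3 → E3) : Prop where
  subset : N ⊆ B \ Z
  closed : closure N ∩ (B \ Z) ⊆ N
  rot : ∀ α, ∀ x ∈ N, rotZ α x ∈ N
  surface : IsSurface 1 N
  continuousOn_normal : ContinuousOn n N
  normal : ∀ x ∈ N, IsUnitNormal N x (n x)
  minimizing : ∀ K, IsCompact K → K ⊆ B \ Z → hypArea (N ∩ K) < ⊤ → ∀ T : RectCurrent,
    (∀ Y, IsTestField Y → bdry T.carrier T.normal T.mult Y = bdry (N ∩ K) n (fun _ => 1) Y) →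
    hypArea (N ∩ K) ≤ T.hypMass

theorem measurableSet_inter_of_closed {N K : Set E3} (hK : IsClosed K) (hKB : K ⊆ B \ Z)
    (hN : closure N ∩ (B \ Z) ⊆ N) : IsClosed (N ∩ K) := by
  have : N ∩ K = closure N ∩ K := by
    ext x
    exact ⟨fun h => ⟨subset_closure h.1, h.2⟩, fun h => ⟨hN ⟨h.1, hKB h.2⟩, h.2⟩⟩
  rw [this]
  exact isClosed_closure.inter hK

theorem isAdmissible_of_leaves {U M : Set E3} (hU : IsOpen U)
    (hM : M = frontier U ∩ B) (hleaves : ConsistsOfRotLeaves R M)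
    (hout : ∀ p ∈ M \ Z, PointsOut U p (R.ν p)) : IsAdmissible (M \ Z) R.ν := by
  have hsub : M \ Z ⊆ B \ Z := fun x hx => ⟨(hM ▸ hx.1 : x ∈ frontier U ∩ B).2, hx.2⟩
  have hcl : closure (M \ Z) ∩ (B \ Z) ⊆ M \ Z := by
    rintro x ⟨hx, hxB⟩
    refine ⟨?_, hxB.2⟩
    rw [hM]
    refine ⟨?_, hxB.1⟩
    have : closure (M \ Z) ⊆ frontier U :=
      closure_minimal (fun y hy => (hM ▸ hy.1 : y ∈ frontier U ∩ B).1) isClosed_frontier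
    exact this hx
  have hloc := fun p hp =>
    exists_isOpen_inter_eq_plaque (R := R) (p := p) hU hM hleaves.isSaturated hout hp
  refine ⟨hsub, hcl, fun α x hx => ?_, fun p hp => ?_, R.continuousOn_nu.mono hsub,
    fun p hp => ?_, fun K hK hKB ha T hb => ?_⟩
  · obtain ⟨𝓛, h𝓛, hL⟩ := hleaves
    rw [hL] at hx ⊢
    obtain ⟨L, hL1, hxL⟩ := hx
    exact ⟨L, hL1, by rw [← (h𝓛 hL1).2 α]; exact mem_image_of_mem _ hxL⟩
  · obtain ⟨φ, hφ, O, hO, hpO, hOs, hOM⟩ := hloc p hp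
    obtain ⟨-, V, f, hxV, hf, -⟩ := R.normal φ hφ (φ p).2 p ⟨hOs hpO, rfl⟩
    exact ⟨V ∩ O, f, ⟨hxV, hpO⟩, hf.inter hO hOM.symm⟩
  · obtain ⟨φ, hφ, O, hO, hpO, hOs, hOM⟩ := hloc p hp
    exact (R.normal φ hφ (φ p).2 p ⟨hOs hpO, rfl⟩).congr hO hpO hOM.symm
  · obtain ⟨ρ, hρ, hle⟩ := exists_norm_le_of_isCompact hK (hKB.trans sdiff_subset)
    exact R.hypArea_le_hypMass hρ
      (measurableSet_inter_of_closed hK.isClosed hKB hcl).measurableSet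
      (fun x hx => hle x hx.2) ha T hb

theorem mem_Z_of_rotZ {α : ℝ} {x : E3} (h : rotZ α x ∈ Z) : x ∈ Z := by
  obtain ⟨h1, h2⟩ := h
  simp only [rotZ, PiLp.toLp_apply, Matrix.cons_val] at h1 h2
  have h3 := sin_sq_add_cos_sq α
  constructor
  · linear_combination cos α * h1 + sin α * h2 - x 0 * h3
  · linear_combination -sin α * h1 + cos α * h2 - x 1 * h3

theorem isAdmissible_of_properSurface {M : Set E3} {n : E3 → E3}
    (hM : IsProperOrientedSurface M n) (hrot : ∀ α, rotZ α '' M = M) (hmin : IsAreaMinimizing M n) :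
    IsAdmissible (M \ Z) n := by
  have hO : IsOpen (Zᶜ : Set E3) := isClosed_Z.isOpen_compl
  have hMZ : M ∩ Zᶜ = (M \ Z) ∩ Zᶜ := by ext x; simp
  have hsub : M \ Z ⊆ B \ Z := fun x hx => ⟨hM.subset_ball hx.1, hx.2⟩
  refine ⟨hsub, fun x hx => ⟨hM.closed ⟨closure_mono sdiff_subset hx.1, hx.2.1⟩, hx.2.2⟩,
    fun α x hx => ⟨by rw [← hrot α]; exact mem_image_of_mem _ hx.1, fun h => hx.2 (mem_Z_of_rotZ h)⟩,
    fun p hp => ?_, hM.continuousOn_normal.mono sdiff_subset,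
    fun p hp => (hM.normal p hp.1).congr hO hp.2 hMZ, fun K hK hKB ha T hb => ?_⟩
  · obtain ⟨V, f, hpV, hf⟩ := hM.smooth p hp.1
    exact ⟨V ∩ Zᶜ, f, ⟨hpV, hp.2⟩, (hf.of_le (by simp)).inter hO hMZ⟩
  · have e : M \ Z ∩ K = M ∩ K := by
      ext x
      exact ⟨fun h => ⟨h.1.1, h.2⟩, fun h => ⟨⟨h.1, (hKB h.2).2⟩, h.2⟩⟩
    rw [e] at hb ⊢
    exact hmin K hK (hKB.trans sdiff_subset) T hb

end

section

/-! ### Profiles of rotationally invariant surfaces -/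

/-- The profile of a rotationally invariant set, in the coordinates `(t, φ)`. -/
def prof (N : Set E3) : Set (ℝ × ℝ) := {q | q.2 ∈ Iφ ∧ P q.1 q.2 0 ∈ N}

variable {N : Set E3} {n : E3 → E3}

theorem IsAdmissible.P_mem_iff (h : IsAdmissible N n) {t φ : ℝ} (hφ : φ ∈ Iφ) (θ : ℝ) :
    P t φ θ ∈ N ↔ (t, φ) ∈ prof N := by
  constructor
  · intro hP
    refine ⟨hφ, ?_⟩
    have := h.rot (-θ) _ hP
    rwa [rotZ_P, add_neg_cancel] at this
  · rintro ⟨-, hP⟩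
    have := h.rot θ _ hP
    rwa [rotZ_P, zero_add] at this

theorem continuousAt_P_pair {q : ℝ × ℝ} (hq : q.2 ∈ Iφ) (θ : ℝ) :
    ContinuousAt (fun q : ℝ × ℝ => P q.1 q.2 θ) q := by
  have h1 := continuousAt_P (p := (q.1, q.2, θ)) (denom_pos (cos_pos_of_mem hq).le)
  have h2 : ContinuousAt (fun q : ℝ × ℝ => (q.1, q.2, θ)) q := by fun_prop
  exact ContinuousAt.comp (f := fun q : ℝ × ℝ => (q.1, q.2, θ))
    (g := fun p : ℝ × ℝ × ℝ => P p.1 p.2.1 p.2.2) h1 h2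

theorem IsAdmissible.mem_prof_of_mem_closure (h : IsAdmissible N n) {q : ℝ × ℝ}
    (hq : q ∈ closure (prof N)) (hφ : q.2 ∈ Iφ) : q ∈ prof N := by
  refine ⟨hφ, h.closed ⟨?_, P_mem hφ⟩⟩
  have hc := (continuousAt_P_pair hφ 0).continuousWithinAt (s := prof N)
  exact closure_mono (image_subset_iff.2 fun x hx => hx.2) (hc.mem_closure_image hq)

/-- The point with first and second coordinate exchanged when `b` is true. -/
def pt : Bool → ℝ → ℝ → ℝ × ℝ
  | false, s, y => (s, y)
  | true, s, y => (y, s)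

theorem continuous_pt (b : Bool) : Continuous fun v : ℝ × ℝ => pt b v.1 v.2 := by
  cases b
  · exact continuous_id
  · exact continuous_swap

theorem exists_implicit_graph {F : ℝ × ℝ → ℝ} {u : ℝ × ℝ} (hF : ContDiffAt ℝ 1 F u)
    (hu : F u = 0) (hd : fderiv ℝ F u (0, 1) ≠ 0) : ∃ ψ : ℝ → ℝ, ContDiffAt ℝ 1 ψ u.1 ∧
      ψ u.1 = u.2 ∧ ∀ᶠ v in 𝓝 u, F v = 0 ↔ ψ v.1 = v.2 := by
  have hinv : (fderiv ℝ F u ∘L .inr ℝ ℝ ℝ).IsInvertible := by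
    refine ⟨ContinuousLinearEquiv.unitsEquivAut ℝ (Units.mk0 _ hd), ?_⟩
    ext
    simp [ContinuousLinearMap.inr_apply]
  refine ⟨hF.implicitFunction one_ne_zero hinv, hF.contDiffAt_implicitFunction one_ne_zero hinv,
    hF.implicitFunction_apply_self one_ne_zero hinv, ?_⟩
  have := hF.eventually_apply_eq_iff_implicitFunction one_ne_zero hinv
  rwa [hu] at this

theorem IsAdmissible.exists_chart (h : IsAdmissible N n) {q : ℝ × ℝ} (hq : q ∈ prof N) :
    ∃ b s0, ∃ ψ : ℝ → ℝ, q = pt b s0 (ψ s0) ∧ ContDiffAt ℝ 1 ψ s0 ∧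
      ∀ᶠ v in 𝓝 (s0, ψ s0), pt b v.1 v.2 ∈ prof N ↔ ψ v.1 = v.2 := by
  obtain ⟨t, φ⟩ := q
  obtain ⟨hφ, hP⟩ := hq
  simp only at hφ hP
  obtain ⟨V, f, hpV, hf⟩ := h.surface _ hP
  have hc := cos_pos_of_mem hφ
  have hk := kap_pos (t := t) hc.le
  have hfd := (hf.hasStrictFDerivAt hpV).hasFDerivAt
  set F : ℝ × ℝ → ℝ := fun v => f (P v.1 v.2 0) with hF
  have hPc : ContDiffAt ℝ 1 (fun v : ℝ × ℝ => P v.1 v.2 0) (t, φ) := by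
    have h1 := (contDiffAt_P (p := (t, φ, 0)) (denom_pos hc.le)).of_le (m := 1) (by simp)
    have h2 : ContDiffAt ℝ 1 (fun q : ℝ × ℝ => (q.1, q.2, (0 : ℝ))) (t, φ) := by fun_prop
    exact ContDiffAt.comp (f := fun q : ℝ × ℝ => (q.1, q.2, (0 : ℝ)))
      (g := fun p : ℝ × ℝ × ℝ => P p.1 p.2.1 p.2.2) (t, φ) h1 h2
  have hFc : ContDiffAt ℝ 1 F (t, φ) :=
    ContDiffAt.comp (g := f) (f := fun v : ℝ × ℝ => P v.1 v.2 0) (t, φ)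
      (hf.2.1.contDiffAt (hf.1.mem_nhds hpV)) hPc
  have hFd := (hFc.differentiableAt (by simp)).hasFDerivAt
  have d1 : fderiv ℝ F (t, φ) (1, 0) = kap t φ * ⟪et t φ 0, gradient f (P t φ 0)⟫ := by
    have e1 : HasDerivAt (fun s : ℝ => (s, φ)) (1, 0) t :=
      (hasDerivAt_id t).prodMk (hasDerivAt_const t φ)
    have e2 := HasFDerivAt.comp_hasDerivAt (l := F) (f := fun s : ℝ => (s, φ)) t hFd e1
    have e3 := hfd.comp_hasDerivAt t (hasDerivAt_P_t (denom_pos hc.le) 0)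
    rw [e2.unique e3, map_smul, ← inner_gradient, real_inner_comm]; rfl
  have d2 : fderiv ℝ F (t, φ) (0, 1) = kap t φ * ⟪ep t φ 0, gradient f (P t φ 0)⟫ := by
    have e1 : HasDerivAt (fun s : ℝ => (t, s)) (0, 1) φ :=
      (hasDerivAt_const φ t).prodMk (hasDerivAt_id φ)
    have e2 := HasFDerivAt.comp_hasDerivAt (l := F) (f := fun s : ℝ => (t, s)) φ hFd e1
    have e3 := hfd.comp_hasDerivAt φ (hasDerivAt_P_phi (denom_pos hc.le) 0)
    rw [e2.unique e3, map_smul, ← inner_gradient, real_inner_comm]; rfl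
  have d3 : ⟪eth 0, gradient f (P t φ 0)⟫ = 0 := by
    have e1 := hfd.comp_hasDerivAt (0 : ℝ) (hasDerivAt_P_theta t φ 0)
    have e2 : (f ∘ fun θ => P t φ θ) =ᶠ[𝓝 0] fun _ => 0 := by
      have hV : ∀ᶠ θ in 𝓝 (0 : ℝ), P t φ θ ∈ V :=
        (hasDerivAt_P_theta t φ 0).continuousAt.eventually_mem (hf.1.mem_nhds hpV)
      filter_upwards [hV] with θ hθ
      have : P t φ θ ∈ N ∩ V := ⟨(h.P_mem_iff hφ θ).2 ⟨hφ, hP⟩, hθ⟩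
      rw [hf.2.2.2] at this
      exact this.2
    have e3 := e1.unique ((hasDerivAt_const (0 : ℝ) (0 : ℝ)).congr_of_eventuallyEq e2)
    rw [map_smul, ← inner_gradient, smul_eq_mul, real_inner_comm] at e3
    exact (mul_eq_zero.1 e3).resolve_left (mul_pos hk (sin_pos_of_mem hφ)).ne'
  have hF0 : F (t, φ) = 0 := by
    have : P t φ 0 ∈ N ∩ V := ⟨hP, hpV⟩
    rw [hf.2.2.2] at this
    exact this.2
  have hloc : ∀ᶠ v in 𝓝 (t, φ), v ∈ prof N ↔ F v = 0 := by
    have hV : ∀ᶠ v : ℝ × ℝ in 𝓝 (t, φ), P v.1 v.2 0 ∈ V :=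
      (continuousAt_P_pair (q := (t, φ)) hφ 0).eventually_mem (hf.1.mem_nhds hpV)
    have hI : ∀ᶠ v : ℝ × ℝ in 𝓝 (t, φ), v.2 ∈ Iφ :=
      continuousAt_snd.eventually_mem (isOpen_Ioo.mem_nhds hφ)
    filter_upwards [hV, hI] with v h1 h2
    constructor
    · intro h3
      have : P v.1 v.2 0 ∈ N ∩ V := ⟨h3.2, h1⟩
      rw [hf.2.2.2] at this
      exact this.2
    · intro h3
      have : P v.1 v.2 0 ∈ N ∩ V := by rw [hf.2.2.2]; exact ⟨h1, h3⟩
      exact ⟨h2, this.1⟩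
  by_cases h2 : fderiv ℝ F (t, φ) (0, 1) = 0
  swap
  · obtain ⟨ψ, p1, p2, p3⟩ := exists_implicit_graph hFc hF0 h2
    simp only at p1 p2
    refine ⟨false, t, ψ, by rw [p2]; rfl, p1, ?_⟩
    rw [p2]
    filter_upwards [p3, hloc] with v hv1 hv2
    exact hv2.trans hv1
  · have h1 : fderiv ℝ F (t, φ) (1, 0) ≠ 0 := by
      intro h1
      rw [d1, mul_eq_zero] at h1
      rw [d2, mul_eq_zero] at h2
      apply hf.2.2.1 _ hpV
      rw [frame_expand (t := t) (φ := φ) (θ := 0) hc.le (gradient f (P t φ 0)),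
        h1.resolve_left hk.ne', h2.resolve_left hk.ne', d3]
      simp
    set F' : ℝ × ℝ → ℝ := fun v => F v.swap with hF'
    have hswap : ContDiff ℝ 1 (Prod.swap : ℝ × ℝ → ℝ × ℝ) := contDiff_snd.prodMk contDiff_fst
    have hF'c : ContDiffAt ℝ 1 F' (φ, t) :=
      ContDiffAt.comp (g := F) (f := Prod.swap) (φ, t) hFc hswap.contDiffAt
    have d4 : fderiv ℝ F' (φ, t) (0, 1) = fderiv ℝ F (t, φ) (1, 0) := by
      have e1 : HasDerivAt (fun s : ℝ => (φ, s)) (0, 1) t :=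
        (hasDerivAt_const t φ).prodMk (hasDerivAt_id t)
      have e2 := HasFDerivAt.comp_hasDerivAt (l := F') (f := fun s : ℝ => (φ, s)) t
        (hF'c.differentiableAt (by simp)).hasFDerivAt e1
      have e3 : HasDerivAt (fun s : ℝ => (s, φ)) (1, 0) t :=
        (hasDerivAt_id t).prodMk (hasDerivAt_const t φ)
      have e4 := HasFDerivAt.comp_hasDerivAt (l := F) (f := fun s : ℝ => (s, φ)) t hFd e3
      exact e2.unique e4
    obtain ⟨ψ, p1, p2, p3⟩ := exists_implicit_graph hF'c hF0 (by rw [d4]; exact h1)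
    simp only at p1 p2
    refine ⟨true, φ, ψ, by rw [p2]; rfl, p1, ?_⟩
    rw [p2]
    have hsw : Tendsto (Prod.swap : ℝ × ℝ → ℝ × ℝ) (𝓝 (φ, t)) (𝓝 (t, φ)) :=
      continuous_swap.tendsto (φ, t)
    filter_upwards [p3, hsw.eventually hloc] with v hv1 hv2
    exact hv2.trans hv1

/-- A closed box in which the profile is a `C¹` graph. -/
structure IsGraphBox (N : Set E3) (b : Bool) (ψ ψ' : ℝ → ℝ) (s0 r d : ℝ) : Prop where
  r_pos : 0 < r
  d_pos : 0 < d
  deriv : ∀ s ∈ Icc (s0 - r) (s0 + r), HasDerivAt ψ (ψ' s) s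
  cont : ContinuousOn ψ' (Icc (s0 - r) (s0 + r))
  close : ∀ s ∈ Icc (s0 - r) (s0 + r), |ψ s - ψ s0| < d
  mem : ∀ s ∈ Icc (s0 - r) (s0 + r), ∀ y, |y - ψ s0| ≤ d → (pt b s y).2 ∈ Iφ
  iff : ∀ s ∈ Icc (s0 - r) (s0 + r), ∀ y, |y - ψ s0| ≤ d → (pt b s y ∈ prof N ↔ ψ s = y)

theorem IsAdmissible.exists_graphBox (h : IsAdmissible N n) {q : ℝ × ℝ} (hq : q ∈ prof N) :
    ∃ b s0 ψ ψ' r d, q = pt b s0 (ψ s0) ∧ IsGraphBox N b ψ ψ' s0 r d := by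
  obtain ⟨b, s0, ψ, hqp, hψ, hev⟩ := h.exists_chart hq
  have hI : ∀ᶠ v : ℝ × ℝ in 𝓝 (s0, ψ s0), (pt b v.1 v.2).2 ∈ Iφ := by
    have : ContinuousAt (fun v : ℝ × ℝ => (pt b v.1 v.2).2) (s0, ψ s0) :=
      (continuous_snd.comp (continuous_pt b)).continuousAt
    exact this.eventually_mem (isOpen_Ioo.mem_nhds (by
      change (pt b s0 (ψ s0)).2 ∈ Iφ
      rw [← hqp]; exact hq.1))
  obtain ⟨d', hd', hball⟩ := Metric.eventually_nhds_iff.1 (hev.and hI)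
  set d := d' / 2
  have hd : 0 < d := by positivity
  have hdiff : ∀ᶠ s in 𝓝 s0, ContDiffAt ℝ 1 ψ s := hψ.eventually (by simp)
  have hclose : ∀ᶠ s in 𝓝 s0, |ψ s - ψ s0| < d :=
    Metric.tendsto_nhds.1 hψ.continuousAt.tendsto d hd
  obtain ⟨r', hr', hball'⟩ := Metric.eventually_nhds_iff.1 (hdiff.and hclose)
  set r := min (r' / 2) d with hr
  have hr0 : 0 < r := lt_min (by positivity) hd
  have hmem : ∀ s ∈ Icc (s0 - r) (s0 + r), dist s s0 < r' ∧ |s - s0| ≤ d := by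
    intro s hs
    have : |s - s0| ≤ r := abs_le.2 ⟨by linarith [hs.1], by linarith [hs.2]⟩
    have h1 := min_le_left (r' / 2) d
    have h2 := min_le_right (r' / 2) d
    exact ⟨by rw [dist_eq]; linarith, by linarith⟩
  have hbox : ∀ s ∈ Icc (s0 - r) (s0 + r), ∀ y, |y - ψ s0| ≤ d →
      dist (s, y) (s0, ψ s0) < d' := by
    intro s hs y hy
    rw [Prod.dist_eq, max_lt_iff, dist_eq, dist_eq]
    have := (hmem s hs).2
    constructor <;> simp only [d] at * <;> linarith
  refine ⟨b, s0, ψ, deriv ψ, r, d, hqp, hr0, hd, fun s hs => ?_, fun s hs => ?_, fun s hs => ?_,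
    fun s hs y hy => (hball (hbox s hs y hy)).2, fun s hs y hy => (hball (hbox s hs y hy)).1⟩
  · exact ((hball' (hmem s hs).1).1.differentiableAt (by simp)).hasDerivAt
  · have h1 := (hball' (hmem s hs).1).1
    have h2 := (h1.fderiv_right (m := 0) (by simp)).continuousAt
    exact (h2.clm_apply continuousAt_const).continuousWithinAt
  · exact (hball' (hmem s hs).1).2

/-! ### Normals along profiles -/

theorem IsAdmissible.exists_sign (h : IsAdmissible N n) {γ₁ γ₂ γ₁' γ₂' : ℝ → ℝ} {a b : ℝ}
    (hγ : IsProfile γ₁ γ₂ γ₁' γ₂' a b) (hN : ∀ s ∈ Ioo a b, (γ₁ s, γ₂ s) ∈ prof N) :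
    ∃ σ : ℝ, (σ = 1 ∨ σ = -1) ∧ ∀ s ∈ Ioo a b, ∀ θ, n (P (γ₁ s) (γ₂ s) θ) =
      (σ / speed γ₁' γ₂' s) • (γ₂' s • et (γ₁ s) (γ₂ s) θ - γ₁' s • ep (γ₁ s) (γ₂ s) θ) := by
  rcases le_or_gt b a with hab | hab
  · exact ⟨1, Or.inl rfl, fun s hs => by simp [Ioo_eq_empty (not_lt.2 hab)] at hs⟩
  set Nγ : ℝ → ℝ → E3 := fun s θ =>
    γ₂' s • et (γ₁ s) (γ₂ s) θ - γ₁' s • ep (γ₁ s) (γ₂ s) θ with hNγ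
  have hPN : ∀ s ∈ Ioo a b, ∀ θ, P (γ₁ s) (γ₂ s) θ ∈ N := fun s hs θ =>
    (h.P_mem_iff (hγ.mem s hs) θ).2 (hN s hs)
  set τ : ℝ → ℝ → ℝ := fun s θ => ⟪n (P (γ₁ s) (γ₂ s) θ), Nγ s θ⟫ / speed γ₁' γ₂' s with hτ
  have hpt : ∀ s ∈ Ioo a b, ∀ θ, (τ s θ = 1 ∨ τ s θ = -1) ∧
      n (P (γ₁ s) (γ₂ s) θ) = (τ s θ / speed γ₁' γ₂' s) • Nγ s θ := by
    intro s hs θ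
    have hc := cos_pos_of_mem (hγ.mem s hs)
    have hk := kap_pos (t := γ₁ s) hc.le
    have hsp := hγ.speed_pos hs
    have hn := h.normal _ (hPN s hs θ)
    set v := n (P (γ₁ s) (γ₂ s) θ) with hv
    have e1 : ⟪v, eth θ⟫ = 0 := by
      have := hn.inner_eq_zero (hasDerivAt_P_theta (γ₁ s) (γ₂ s) θ) rfl
        (.of_forall fun θ' => hPN s hs θ')
      rw [inner_smul_right] at this
      exact (mul_eq_zero.1 this).resolve_left (mul_pos hk (sin_pos_of_mem (hγ.mem s hs))).ne'
    have e2 : γ₁' s * ⟪v, et (γ₁ s) (γ₂ s) θ⟫ + γ₂' s * ⟪v, ep (γ₁ s) (γ₂ s) θ⟫ = 0 := by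
      have := hn.inner_eq_zero (hγ.hasDerivAt_P hs θ) rfl (by
        filter_upwards [isOpen_Ioo.mem_nhds hs] with s' hs' using hPN s' hs' θ)
      rw [inner_smul_right, inner_add_right, inner_smul_right, inner_smul_right] at this
      exact (mul_eq_zero.1 this).resolve_left hk.ne'
    have e3 := frame_expand (t := γ₁ s) (φ := γ₂ s) (θ := θ) hc.le v
    rw [real_inner_comm, real_inner_comm v, real_inner_comm v, e1, zero_smul, add_zero] at e3
    set A := ⟪v, et (γ₁ s) (γ₂ s) θ⟫ with hA
    set B' := ⟪v, ep (γ₁ s) (γ₂ s) θ⟫ with hB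
    have e4 : A ^ 2 + B' ^ 2 = 1 := by
      have h1 : ⟪v, v⟫ = 1 := by rw [real_inner_self_eq_norm_sq, hn.1]; norm_num
      conv_lhs at h1 => rw [e3]
      rw [inner_add_right, inner_smul_right, inner_smul_right] at h1
      simp only [inner_add_left, inner_smul_left, inner_et_et hc.le, inner_ep_et, inner_et_ep,
        inner_ep_ep hc.le] at h1
      simp at h1
      linarith
    have hsq := hγ.speed_sq hs
    have e5 : τ s θ = (γ₂' s * A - γ₁' s * B') / speed γ₁' γ₂' s := by
      rw [hτ, hNγ]
      simp only
      rw [inner_sub_right, inner_smul_right, inner_smul_right]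
    have e6 : τ s θ ^ 2 = 1 := by
      rw [e5, div_pow, hsq, div_eq_one_iff_eq (hγ.regular s hs).ne']
      linear_combination (γ₁' s ^ 2 + γ₂' s ^ 2) * e4 - (γ₁' s * A + γ₂' s * B') * e2
    refine ⟨mul_self_eq_one_iff.1 (by rw [← sq]; exact e6), ?_⟩
    have hne := (hγ.regular s hs).ne'
    have e7 : τ s θ / speed γ₁' γ₂' s = (γ₂' s * A - γ₁' s * B') / (γ₁' s ^ 2 + γ₂' s ^ 2) := by
      rw [e5, div_div, ← sq, hsq]
    rw [e7, e3, hNγ]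
    simp only
    have c1 : A = (γ₂' s * A - γ₁' s * B') / (γ₁' s ^ 2 + γ₂' s ^ 2) * γ₂' s := by
      field_simp
      linear_combination (γ₁' s) * e2
    have c2 : B' = -((γ₂' s * A - γ₁' s * B') / (γ₁' s ^ 2 + γ₂' s ^ 2) * γ₁' s) := by
      field_simp
      linear_combination (γ₂' s) * e2
    rw [smul_sub, smul_smul, smul_smul, ← c1, sub_eq_add_neg, ← neg_smul, ← c2]
  have hcont : ContinuousOn (fun p : ℝ × ℝ => τ p.1 p.2) (Ioo a b ×ˢ univ) := by
    have m : MapsTo Prod.fst (Ioo a b ×ˢ (univ : Set ℝ)) (Ioo a b) := fun p hp => hp.1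
    have k1 := hγ.continuousOn₁.comp continuousOn_fst m
    have k2 := hγ.continuousOn₂.comp continuousOn_fst m
    have k1' := hγ.cont₁.comp continuousOn_fst m
    have k2' := hγ.cont₂.comp continuousOn_fst m
    have k3 : ContinuousOn (fun p : ℝ × ℝ => p.2) (Ioo a b ×ˢ univ) := continuousOn_snd
    have hd : ∀ p ∈ Ioo a b ×ˢ (univ : Set ℝ), 0 < cosh (γ₁ p.1) + cos (γ₂ p.1) :=
      fun p hp => hγ.denom_pos hp.1
    have hPc := continuousOn_P k1 k2 k3 hd
    have hnc := h.continuousOn_normal.comp hPc fun p hp => hPN p.1 hp.1 p.2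
    have hNc := (k2'.fun_smul (continuousOn_et k1 k2 k3 hd)).fun_sub
      (k1'.fun_smul (continuousOn_ep k1 k2 k3 hd))
    exact (hnc.inner hNc).div (hγ.continuousOn_speed.comp continuousOn_fst m)
      fun p hp => (hγ.speed_pos hp.1).ne'
  have hconst : ∀ s ∈ Ioo a b, ∀ θ, τ s θ = τ ((a + b) / 2) 0 := by
    have hpre : IsPreconnected (Ioo a b ×ˢ (univ : Set ℝ)) :=
      isPreconnected_Ioo.prod isPreconnected_univ
    have hmid : (a + b) / 2 ∈ Ioo a b := ⟨by linarith, by linarith⟩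
    intro s hs θ
    by_contra hne
    have himg := (hpre.image _ hcont).ordConnected
    have i1 : τ s θ ∈ (fun p : ℝ × ℝ => τ p.1 p.2) '' (Ioo a b ×ˢ univ) :=
      ⟨(s, θ), ⟨hs, trivial⟩, rfl⟩
    have i2 : τ ((a + b) / 2) 0 ∈ (fun p : ℝ × ℝ => τ p.1 p.2) '' (Ioo a b ×ˢ univ) :=
      ⟨(_, 0), ⟨hmid, trivial⟩, rfl⟩
    have i3 : (0 : ℝ) ∈ (fun p : ℝ × ℝ => τ p.1 p.2) '' (Ioo a b ×ˢ univ) := by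
      rcases (hpt s hs θ).1 with h1 | h1 <;> rcases (hpt _ hmid 0).1 with h2 | h2
      · exact absurd (h1.trans h2.symm) hne
      · exact himg.out i2 i1 ⟨by rw [h2]; norm_num, by rw [h1]; norm_num⟩
      · exact himg.out i1 i2 ⟨by rw [h1]; norm_num, by rw [h2]; norm_num⟩
      · exact absurd (h1.trans h2.symm) hne
    obtain ⟨p, hp, hp0⟩ := i3
    simp only at hp0
    rcases (hpt p.1 hp.1 p.2).1 with h1 | h1 <;> rw [hp0] at h1 <;> norm_num at h1
  refine ⟨τ ((a + b) / 2) 0, (hpt _ ⟨by linarith, by linarith⟩ 0).1, fun s hs θ => ?_⟩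
  rw [← hconst s hs θ]
  exact (hpt s hs θ).2

end

section

/-! ### Surfaces of revolution of graphs -/

/-- First coordinate of the graph of `ψ`. -/
def gr₁ : Bool → (ℝ → ℝ) → ℝ → ℝ
  | false, _ => fun s => s
  | true, ψ => ψ

/-- Second coordinate of the graph of `ψ`. -/
def gr₂ : Bool → (ℝ → ℝ) → ℝ → ℝ
  | false, ψ => ψ
  | true, _ => fun s => s

/-- Derivative of the first coordinate of a graph. -/
def gr₁' : Bool → (ℝ → ℝ) → ℝ → ℝ
  | false, _ => fun _ => 1
  | true, ψ => ψ

/-- Derivative of the second coordinate of a graph. -/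
def gr₂' : Bool → (ℝ → ℝ) → ℝ → ℝ
  | false, ψ' => ψ'
  | true, _ => fun _ => 1

theorem pt_eq_gr (b : Bool) (ψ : ℝ → ℝ) (s : ℝ) : pt b s (ψ s) = (gr₁ b ψ s, gr₂ b ψ s) := by
  cases b <;> rfl

theorem speed_gr (b : Bool) (ψ' : ℝ → ℝ) (s : ℝ) :
    speed (gr₁' b ψ') (gr₂' b ψ') s = √(1 + ψ' s ^ 2) := by
  cases b
  · simp [speed, gr₁', gr₂']
  · simp [speed, gr₁', gr₂', add_comm]

variable {b : Bool} {ψ ψ' : ℝ → ℝ} {a c : ℝ}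

theorem isProfile_graph (h1 : ∀ s ∈ Ioo a c, HasDerivAt ψ (ψ' s) s)
    (h2 : ContinuousOn ψ' (Ioo a c)) (h3 : ∀ s ∈ Ioo a c, gr₂ b ψ s ∈ Iφ) :
    IsProfile (gr₁ b ψ) (gr₂ b ψ) (gr₁' b ψ') (gr₂' b ψ') a c := by
  cases b
  · exact ⟨fun s _ => hasDerivAt_id s, h1, continuousOn_const, h2, h3,
      fun s _ => by simp only [gr₁', gr₂']; positivity, fun s _ s' _ h _ => h⟩
  · exact ⟨h1, fun s _ => hasDerivAt_id s, h2, continuousOn_const, h3,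
      fun s _ => by simp only [gr₁', gr₂']; positivity, fun s _ s' _ _ h => h⟩

/-- The independent variable of a graph, as a function in space. -/
def sc : Bool → E3 → ℝ
  | false => tc
  | true => phc

/-- The dependent variable of a graph, as a function in space. -/
def yc : Bool → E3 → ℝ
  | false => phc
  | true => tc

theorem contDiffOn_sc (b : Bool) : ContDiffOn ℝ ∞ (sc b) (B \ Z) := by
  cases b
  exacts [contDiffOn_tc, contDiffOn_phc]

theorem contDiffOn_yc (b : Bool) : ContDiffOn ℝ ∞ (yc b) (B \ Z) := by
  cases b
  exacts [contDiffOn_phc, contDiffOn_tc]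

/-- The defining function of the surface of revolution of a graph. -/
def graphFun (b : Bool) (ψ : ℝ → ℝ) (x : E3) : ℝ := yc b x - ψ (sc b x)

/-- The domain of the defining function of the surface of revolution of a graph. -/
def graphDom (b : Bool) (a c : ℝ) : Set E3 := (B \ Z) ∩ sc b ⁻¹' Ioo a c

theorem isOpen_graphDom : IsOpen (graphDom b a c) :=
  (contDiffOn_sc b).continuousOn.isOpen_inter_preimage isOpen_B_diff_Z isOpen_Ioo

theorem contDiffOn_graphFun (hψ : ContDiffOn ℝ 1 ψ (Ioo a c)) :
    ContDiffOn ℝ 1 (graphFun b ψ) (graphDom b a c) := by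
  have h1 := ((contDiffOn_sc b).of_le (m := 1) (by simp)).mono
    (inter_subset_left (t := sc b ⁻¹' Ioo a c))
  have h2 := ((contDiffOn_yc b).of_le (m := 1) (by simp)).mono
    (inter_subset_left (t := sc b ⁻¹' Ioo a c))
  exact h2.sub (hψ.comp h1 fun x hx => hx.2)

/-- The orientation of the gradient of the defining function of a graph. -/
def gsgn : Bool → ℝ
  | false => -1
  | true => 1

theorem gsgn_mul_self (b : Bool) : gsgn b * gsgn b = 1 := by cases b <;> simp [gsgn]

theorem contDiffOn_one_of_hasDerivAt (h1 : ∀ s ∈ Ioo a c, HasDerivAt ψ (ψ' s) s)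
    (h2 : ContinuousOn ψ' (Ioo a c)) : ContDiffOn ℝ 1 ψ (Ioo a c) := by
  rw [show (1 : WithTop ℕ∞) = 0 + 1 by simp, contDiffOn_succ_iff_deriv_of_isOpen isOpen_Ioo]
  refine ⟨fun s hs => (h1 s hs).differentiableAt.differentiableWithinAt, by simp, ?_⟩
  rw [contDiffOn_zero]
  exact h2.congr fun s hs => (h1 s hs).deriv

theorem gradient_graphFun (h1 : ∀ s ∈ Ioo a c, HasDerivAt ψ (ψ' s) s)
    (h2 : ContinuousOn ψ' (Ioo a c)) {t φ : ℝ} (θ : ℝ) (hφ : φ ∈ Iφ)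
    (hs : sc b (P t φ θ) ∈ Ioo a c) : gradient (graphFun b ψ) (P t φ θ) = ((kap t φ)⁻¹ * gsgn b) •
      (gr₂' b ψ' (sc b (P t φ θ)) • et t φ θ - gr₁' b ψ' (sc b (P t φ θ)) • ep t φ θ) := by
  have hd : DifferentiableAt ℝ (graphFun b ψ) (P t φ θ) :=
    ((contDiffOn_graphFun (b := b) (contDiffOn_one_of_hasDerivAt h1 h2)).contDiffAt
      (isOpen_graphDom.mem_nhds ⟨P_mem hφ, hs⟩)).differentiableAt (by simp)
  have hnear : ∀ᶠ s in 𝓝 φ, s ∈ Iφ := isOpen_Ioo.mem_nhds hφ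
  cases b
  · simp only [sc, tc_P hφ] at hs
    have e1 : HasDerivAt (fun s => graphFun false ψ (P s φ θ)) (-ψ' t) t := by
      have : (fun s => graphFun false ψ (P s φ θ)) = fun s => φ - ψ s := by
        ext s; simp [graphFun, yc, sc, tc_P hφ, phc_P hφ]
      rw [this]
      exact (h1 t hs).const_sub φ
    have e2 : HasDerivAt (fun s => graphFun false ψ (P t s θ)) 1 φ := by
      have : (fun s => graphFun false ψ (P t s θ)) =ᶠ[𝓝 φ] fun s => s - ψ t := by
        filter_upwards [hnear] with s hs
        simp [graphFun, yc, sc, tc_P hs, phc_P hs]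
      exact ((hasDerivAt_id φ).sub_const _).congr_of_eventuallyEq this
    have e3 : HasDerivAt (fun s => graphFun false ψ (P t φ s)) 0 θ := by
      have : (fun s => graphFun false ψ (P t φ s)) = fun _ => φ - ψ t := by
        ext s; simp [graphFun, yc, sc, tc_P hφ, phc_P hφ]
      rw [this]; exact hasDerivAt_const _ _
    rw [gradient_eq_of_comp_P hφ hd e1 e2 e3]
    simp only [gr₁', gr₂', sc, tc_P hφ, gsgn]
    module
  · simp only [sc, phc_P hφ] at hs
    have e1 : HasDerivAt (fun s => graphFun true ψ (P s φ θ)) 1 t := by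
      have : (fun s => graphFun true ψ (P s φ θ)) = fun s => s - ψ φ := by
        ext s; simp [graphFun, yc, sc, tc_P hφ, phc_P hφ]
      rw [this]
      exact (hasDerivAt_id t).sub_const _
    have e2 : HasDerivAt (fun s => graphFun true ψ (P t s θ)) (-ψ' φ) φ := by
      have : (fun s => graphFun true ψ (P t s θ)) =ᶠ[𝓝 φ] fun s => t - ψ s := by
        filter_upwards [hnear] with s hs
        simp [graphFun, yc, sc, tc_P hs, phc_P hs]
      exact ((h1 φ hs).const_sub t).congr_of_eventuallyEq this
    have e3 : HasDerivAt (fun s => graphFun true ψ (P t φ s)) 0 θ := by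
      have : (fun s => graphFun true ψ (P t φ s)) = fun _ => t - ψ φ := by
        ext s; simp [graphFun, yc, sc, tc_P hφ, phc_P hφ]
      rw [this]; exact hasDerivAt_const _ _
    rw [gradient_eq_of_comp_P hφ hd e1 e2 e3]
    simp only [gr₁', gr₂', sc, phc_P hφ, gsgn]
    module

theorem sc_P_gr {s : ℝ} (hs : gr₂ b ψ s ∈ Iφ) (θ : ℝ) : sc b (P (gr₁ b ψ s) (gr₂ b ψ s) θ) = s := by
  cases b
  exacts [tc_P hs, phc_P hs]

theorem norm_normal_gr {t φ θ : ℝ} (hφ : φ ∈ Iφ) (s : ℝ) :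
    ‖gr₂' b ψ' s • et t φ θ - gr₁' b ψ' s • ep t φ θ‖ = √(1 + ψ' s ^ 2) := by
  have hc := (cos_pos_of_mem hφ).le
  rw [← sq_eq_sq₀ (norm_nonneg _) (sqrt_nonneg _), sq_sqrt (by positivity),
    ← real_inner_self_eq_norm_sq]
  simp only [inner_sub_left, inner_sub_right, inner_smul_left, inner_smul_right, inner_et_ep,
    inner_ep_et, inner_et_et hc, inner_ep_ep hc]
  cases b
  · simp [gr₁', gr₂']; ring
  · simp [gr₁', gr₂']; ring

theorem isDefiningFunction_graph (h1 : ∀ s ∈ Ioo a c, HasDerivAt ψ (ψ' s) s)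
    (h2 : ContinuousOn ψ' (Ioo a c)) (h3 : ∀ s ∈ Ioo a c, gr₂ b ψ s ∈ Iφ) :
    IsDefiningFunction 1 (rev (gr₁ b ψ) (gr₂ b ψ) a c) (graphDom b a c) (graphFun b ψ) := by
  refine ⟨isOpen_graphDom, contDiffOn_graphFun (contDiffOn_one_of_hasDerivAt h1 h2),
    fun x hx => ?_, ?_⟩
  · obtain ⟨θ, -, hxP⟩ := P_surj hx.1
    have hφ := phc_mem hx.1
    have hs := hx.2
    rw [mem_preimage, hxP] at hs
    have hk := kap_pos (t := tc x) (cos_pos_of_mem hφ).le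
    rw [hxP, gradient_graphFun h1 h2 θ hφ hs]
    refine smul_ne_zero (mul_ne_zero (inv_ne_zero hk.ne') ?_) ?_
    · cases b <;> simp [gsgn]
    · rw [← norm_ne_zero_iff, norm_normal_gr hφ]
      exact (sqrt_pos.2 (by positivity)).ne'
  · ext x
    constructor
    · rintro ⟨⟨s, hs, θ, rfl⟩, hx⟩
      refine ⟨hx, ?_⟩
      have := h3 s hs
      cases b
      · have h4 : ψ s ∈ Iφ := this
        simp [graphFun, yc, sc, gr₁, gr₂, phc_P h4, tc_P h4]
      · have h4 : s ∈ Iφ := this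
        simp [graphFun, yc, sc, gr₁, gr₂, phc_P h4, tc_P h4]
    · rintro ⟨hx, h0⟩
      refine ⟨⟨sc b x, hx.2, ?_⟩, hx⟩
      obtain ⟨θ, -, hxP⟩ := P_surj hx.1
      refine ⟨θ, ?_⟩
      have h0' : yc b x = ψ (sc b x) := sub_eq_zero.1 h0
      cases b
      · simp only [gr₁, gr₂, ← h0']; exact hxP
      · simp only [gr₁, gr₂, ← h0']; exact hxP

/-- A measurable unit normal field of the surface of revolution of a graph. -/
theorem exists_measurable_normal (h1 : ∀ s ∈ Ioo a c, HasDerivAt ψ (ψ' s) s)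
    (h2 : ContinuousOn ψ' (Ioo a c)) (h3 : ∀ s ∈ Ioo a c, gr₂ b ψ s ∈ Iφ) :
    ∃ nn : E3 → E3, Measurable nn ∧ (∀ s ∈ Ioo a c, ∀ θ, nn (P (gr₁ b ψ s) (gr₂ b ψ s) θ) =
        (1 / speed (gr₁' b ψ') (gr₂' b ψ') s) • (gr₂' b ψ' s • et (gr₁ b ψ s) (gr₂ b ψ s) θ -
          gr₁' b ψ' s • ep (gr₁ b ψ s) (gr₂ b ψ s) θ)) ∧
      ∀ x ∈ rev (gr₁ b ψ) (gr₂ b ψ) a c, ∀ σ : ℝ, σ = 1 ∨ σ = -1 →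
        IsUnitNormal (rev (gr₁ b ψ) (gr₂ b ψ) a c) x (σ • nn x) := by
  classical
  have hdef := isDefiningFunction_graph h1 h2 h3
  set f := graphFun b ψ with hf
  set V := graphDom b a c with hV
  set g : E3 → E3 := fun x => (gsgn b * ‖gradient f x‖⁻¹) • gradient f x with hg
  have hgc : ContinuousOn g V := by
    have hgr : ContinuousOn (gradient f) V := by
      have := hdef.2.1.continuousOn_fderiv_of_isOpen hdef.1 le_rfl
      exact (InnerProductSpace.toDual ℝ E3).symm.continuous.comp_continuousOn this
    exact (continuousOn_const.mul (hgr.norm.inv₀ fun x hx =>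
      norm_ne_zero_iff.2 (hdef.2.2.1 x hx))).fun_smul hgr
  have hmemV : ∀ x ∈ rev (gr₁ b ψ) (gr₂ b ψ) a c, x ∈ V := by
    rintro _ ⟨s, hs, θ, rfl⟩
    exact ⟨P_mem (h3 s hs), by rw [mem_preimage, sc_P_gr (h3 s hs)]; exact hs⟩
  refine ⟨V.piecewise g 0, hgc.measurable_piecewise continuousOn_const hdef.1.measurableSet,
    fun s hs θ => ?_, fun x hx σ hσ => ?_⟩
  · have hφ := h3 s hs
    have hk := kap_pos (t := gr₁ b ψ s) (cos_pos_of_mem hφ).le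
    have hsc := sc_P_gr hφ θ
    rw [piecewise_eq_of_mem _ _ _ (hmemV _ ⟨s, hs, θ, rfl⟩), hg]
    simp only
    rw [hf, gradient_graphFun h1 h2 θ hφ (by rw [hsc]; exact hs), hsc, norm_smul, norm_normal_gr hφ,
      speed_gr, smul_smul]
    congr 1
    have hb : |gsgn b| = 1 := by cases b <;> simp [gsgn]
    have hsq : 0 < √(1 + ψ' s ^ 2) := sqrt_pos.2 (by positivity)
    rw [norm_mul, norm_eq_abs, norm_eq_abs, hb, mul_one, abs_of_pos (inv_pos.2 hk)]
    have h5 := gsgn_mul_self b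
    field_simp
    linear_combination h5
  · have hxV := hmemV x hx
    rw [piecewise_eq_of_mem _ _ _ hxV]
    have hb : |gsgn b| = 1 := by cases b <;> simp [gsgn]
    have hσ1 : |σ| = 1 := by rcases hσ with h | h <;> simp [h]
    have hne := norm_ne_zero_iff.2 (hdef.2.2.1 x hxV)
    refine ⟨?_, V, f, hxV, hdef, σ * gsgn b * ‖gradient f x‖, ?_⟩
    · rw [hg]
      simp only
      rw [norm_smul, norm_smul, norm_mul, norm_eq_abs, norm_eq_abs, hb, hσ1, norm_inv,
        norm_norm]
      field_simp
    · have h5 := gsgn_mul_self b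
      have h6 : σ * σ = 1 := by rcases hσ with h | h <;> simp [h]
      rw [hg]
      simp only
      rw [smul_smul, smul_smul]
      have : σ * gsgn b * ‖gradient f x‖ * σ * (gsgn b * ‖gradient f x‖⁻¹) = 1 := by
        field_simp
        linear_combination gsgn b * gsgn b * h6 + h5
      rw [this, one_smul]

theorem measurableSet_rev_graph (h1 : ∀ s ∈ Ioo a c, HasDerivAt ψ (ψ' s) s)
    (h2 : ContinuousOn ψ' (Ioo a c)) (h3 : ∀ s ∈ Ioo a c, gr₂ b ψ s ∈ Iφ) :
    MeasurableSet (rev (gr₁ b ψ) (gr₂ b ψ) a c) := by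
  have hdef := isDefiningFunction_graph h1 h2 h3
  have hsub : rev (gr₁ b ψ) (gr₂ b ψ) a c ⊆ graphDom b a c := by
    rintro _ ⟨s, hs, θ, rfl⟩
    exact ⟨P_mem (h3 s hs), by rw [mem_preimage, sc_P_gr (h3 s hs)]; exact hs⟩
  have h4 := hdef.2.2.2
  rw [inter_eq_left.2 hsub] at h4
  rw [h4]
  obtain ⟨u, hu, hue⟩ := (continuousOn_iff_isClosed.1 hdef.2.1.continuousOn) {0} isClosed_singleton
  have : {x | x ∈ graphDom b a c ∧ graphFun b ψ x = 0} = u ∩ graphDom b a c := by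
    rw [← hue]; ext x; exact and_comm
  rw [this]
  exact hu.measurableSet.inter hdef.1.measurableSet

theorem isSurface_rev_graph (h1 : ∀ s ∈ Ioo a c, HasDerivAt ψ (ψ' s) s)
    (h2 : ContinuousOn ψ' (Ioo a c)) (h3 : ∀ s ∈ Ioo a c, gr₂ b ψ s ∈ Iφ) :
    IsSurface 1 (rev (gr₁ b ψ) (gr₂ b ψ) a c) := by
  rintro _ ⟨s, hs, θ, rfl⟩
  exact ⟨graphDom b a c, graphFun b ψ, ⟨P_mem (h3 s hs), by rw [mem_preimage, sc_P_gr (h3 s hs)]; exact hs⟩,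
    isDefiningFunction_graph h1 h2 h3⟩

end

/-! ### The Euler–Lagrange equation -/

/-- A minimizer of `∫ H(s, y) √(1 + y'²)` with fixed ends satisfies the Euler–Lagrange equation in
integrated form. -/
theorem euler_lagrange {H Hy : ℝ → ℝ → ℝ} {ψ ψ' : ℝ → ℝ} {a c y0 d : ℝ} (hac : a < c)
    (hH : ContinuousOn (fun p : ℝ × ℝ => H p.1 p.2) (Icc a c ×ˢ Icc (y0 - d) (y0 + d)))
    (hHy : ContinuousOn (fun p : ℝ × ℝ => Hy p.1 p.2) (Icc a c ×ˢ Icc (y0 - d) (y0 + d)))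
    (hd : ∀ s ∈ Icc a c, ∀ y ∈ Ioo (y0 - d) (y0 + d), HasDerivAt (H s) (Hy s y) y)
    (hψ : ∀ s ∈ Icc a c, HasDerivAt ψ (ψ' s) s) (hψ' : ContinuousOn ψ' (Icc a c))
    (hclose : ∀ s ∈ Icc a c, |ψ s - y0| < d)
    (hmin : ∀ χ χ' : ℝ → ℝ, (∀ s ∈ Icc a c, HasDerivAt χ (χ' s) s) → ContinuousOn χ' (Icc a c) →
      χ a = ψ a → χ c = ψ c → (∀ s ∈ Icc a c, |χ s - y0| < d) →
      ∫ s in a..c, H s (ψ s) * √(1 + ψ' s ^ 2) ≤ ∫ s in a..c, H s (χ s) * √(1 + χ' s ^ 2)) :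
    ∃ C, ∀ s ∈ Icc a c, H s (ψ s) * (ψ' s / √(1 + ψ' s ^ 2)) =
      C + ∫ x in a..s, Hy x (ψ x) * √(1 + ψ' x ^ 2) := by
  have hψc : ContinuousOn ψ (Icc a c) := fun s hs => (hψ s hs).continuousAt.continuousWithinAt
  have hsq : ∀ x : ℝ, 0 < √(1 + x ^ 2) := fun x => sqrt_pos.2 (by positivity)
  have hin : ∀ y, |y - y0| < d → y ∈ Ioo (y0 - d) (y0 + d) := fun y hy => by
    have := abs_lt.1 hy; exact ⟨by linarith, by linarith⟩
  have hmaps : MapsTo (fun s => (s, ψ s)) (Icc a c) (Icc a c ×ˢ Icc (y0 - d) (y0 + d)) :=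
    fun s hs => ⟨hs, Ioo_subset_Icc_self (hin _ (hclose s hs))⟩
  have hHψ : ContinuousOn (fun s => H s (ψ s)) (Icc a c) :=
    hH.comp (continuousOn_id.prodMk hψc) hmaps
  have hHyψ : ContinuousOn (fun s => Hy s (ψ s)) (Icc a c) :=
    hHy.comp (continuousOn_id.prodMk hψc) hmaps
  have hrt : ContinuousOn (fun s => √(1 + ψ' s ^ 2)) (Icc a c) :=
    (continuousOn_const.add (hψ'.pow 2)).sqrt
  set k : ℝ → ℝ := fun s => Hy s (ψ s) * √(1 + ψ' s ^ 2) with hk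
  have hkc : ContinuousOn k (Icc a c) := hHyψ.mul hrt
  set w : ℝ → ℝ := fun s => H s (ψ s) * (ψ' s / √(1 + ψ' s ^ 2)) with hw
  have hwc : ContinuousOn w (Icc a c) := hHψ.mul (hψ'.div hrt fun s _ => (hsq _).ne')
  set K : ℝ → ℝ := IccExtend hac.le ((Icc a c).domRestrict k) with hK
  have hKc : Continuous K := hkc.domRestrict.Icc_extend'
  have hKeq : ∀ s ∈ Icc a c, K s = k s := fun s hs => by
    rw [hK, IccExtend_of_mem _ _ hs]; rfl
  set W : ℝ → ℝ := IccExtend hac.le ((Icc a c).domRestrict w) with hW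
  have hWc : Continuous W := hwc.domRestrict.Icc_extend'
  have hWeq : ∀ s ∈ Icc a c, W s = w s := fun s hs => by
    rw [hW, IccExtend_of_mem _ _ hs]; rfl
  set q : ℝ → ℝ := fun s => ∫ x in a..s, K x with hq
  have hqd : ∀ s, HasDerivAt q (K s) s := fun s =>
    integral_hasDerivAt_right (hKc.intervalIntegrable _ _)
      hKc.aestronglyMeasurable.stronglyMeasurableAtFilter hKc.continuousAt
  have hqc : Continuous q := continuous_iff_continuousAt.2 fun s => (hqd s).continuousAt
  set m : ℝ := (∫ s in a..c, (W s - q s)) / (c - a) with hm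
  set η' : ℝ → ℝ := fun s => W s - q s - m with hη'
  have hη'c : Continuous η' := (hWc.sub hqc).sub continuous_const
  set η : ℝ → ℝ := fun s => ∫ x in a..s, η' x with hη
  have hηd : ∀ s, HasDerivAt η (η' s) s := fun s =>
    integral_hasDerivAt_right (hη'c.intervalIntegrable _ _)
      hη'c.aestronglyMeasurable.stronglyMeasurableAtFilter hη'c.continuousAt
  have hηc : Continuous η := continuous_iff_continuousAt.2 fun s => (hηd s).continuousAt
  have hca : c - a ≠ 0 := (sub_pos.2 hac).ne'
  have hη0 : η a = 0 := by simp [hη]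
  have hη1 : η c = 0 := by
    have : η c = (∫ s in a..c, (W s - q s)) - ∫ s in a..c, m :=
      intervalIntegral.integral_sub ((hWc.sub hqc).intervalIntegrable _ _)
        (intervalIntegrable_const)
    rw [this, intervalIntegral.integral_const, hm, smul_eq_mul, mul_div_cancel₀ _ hca, sub_self]
  obtain ⟨D, hD⟩ := isCompact_Icc.exists_bound_of_continuousOn (hηc.continuousOn (s := Icc a c))
  obtain ⟨z, hz, hzmax⟩ := isCompact_Icc.exists_isMaxOn (nonempty_Icc.2 hac.le)
    ((hψc.sub (continuousOn_const (c := y0))).abs)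
  set gap := d - |ψ z - y0| with hgap
  have hgap0 : 0 < gap := sub_pos.2 (hclose z hz)
  set D' := max D 0 + 1
  have hD'0 : 0 < D' := by positivity
  set δ := gap / D' with hδ
  have hδ0 : 0 < δ := div_pos hgap0 hD'0
  have hstay : ∀ ε ∈ Ioo (0 - δ) (0 + δ), ∀ s ∈ Icc a c, |ψ s + ε * η s - y0| < d := by
    intro ε hε s hs
    have h1 : |ε| < δ := abs_lt.2 ⟨by linarith [hε.1], by linarith [hε.2]⟩
    have h2 : |η s| < D' := by
      have := hD s hs
      rw [norm_eq_abs] at this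
      exact (this.trans (le_max_left D 0)).trans_lt (lt_add_one _)
    have h3 : |ψ s - y0| ≤ |ψ z - y0| := hzmax hs
    have h4 : |ε * η s| < gap := by
      rw [abs_mul]
      calc |ε| * |η s| ≤ |ε| * D' := by gcongr
        _ < δ * D' := by gcongr
        _ = gap := by rw [hδ]; field_simp
    calc |ψ s + ε * η s - y0| = |(ψ s - y0) + ε * η s| := by ring_nf
      _ ≤ |ψ s - y0| + |ε * η s| := abs_add_le _ _
      _ < |ψ z - y0| + gap := by linarith
      _ = d := by rw [hgap]; ring
  set F : ℝ → ℝ → ℝ := fun ε s => H s (ψ s + ε * η s) * √(1 + (ψ' s + ε * η' s) ^ 2) with hF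
  set F' : ℝ → ℝ → ℝ := fun ε s => Hy s (ψ s + ε * η s) * η s * √(1 + (ψ' s + ε * η' s) ^ 2) +
    H s (ψ s + ε * η s) * ((ψ' s + ε * η' s) * η' s / √(1 + (ψ' s + ε * η' s) ^ 2)) with hF'
  have hm2 : MapsTo (fun p : ℝ × ℝ => (p.2, ψ p.2 + p.1 * η p.2)) (Ioo (0 - δ) (0 + δ) ×ˢ Icc a c)
      (Icc a c ×ˢ Icc (y0 - d) (y0 + d)) := fun p hp =>
    ⟨hp.2, Ioo_subset_Icc_self (hin _ (hstay p.1 hp.1 p.2 hp.2))⟩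
  have k1 : ContinuousOn (fun p : ℝ × ℝ => ψ p.2) (Ioo (0 - δ) (0 + δ) ×ˢ Icc a c) :=
    hψc.comp continuousOn_snd fun p hp => hp.2
  have k2 : ContinuousOn (fun p : ℝ × ℝ => ψ' p.2) (Ioo (0 - δ) (0 + δ) ×ˢ Icc a c) :=
    hψ'.comp continuousOn_snd fun p hp => hp.2
  have k3 : ContinuousOn (fun p : ℝ × ℝ => (p.2, ψ p.2 + p.1 * η p.2))
      (Ioo (0 - δ) (0 + δ) ×ˢ Icc a c) :=
    continuousOn_snd.prodMk (k1.fun_add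
      (continuousOn_fst.fun_mul (hηc.comp_continuousOn continuousOn_snd)))
  have k7 : ContinuousOn (fun p : ℝ × ℝ => ψ' p.2 + p.1 * η' p.2)
      (Ioo (0 - δ) (0 + δ) ×ˢ Icc a c) :=
    k2.fun_add (continuousOn_fst.fun_mul (hη'c.comp_continuousOn continuousOn_snd))
  have k4 := hH.comp k3 hm2
  have k5 := hHy.comp k3 hm2
  have k6 : ContinuousOn (fun p : ℝ × ℝ => √(1 + (ψ' p.2 + p.1 * η' p.2) ^ 2))
      (Ioo (0 - δ) (0 + δ) ×ˢ Icc a c) := (continuousOn_const.fun_add (k7.fun_pow 2)).sqrt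
  have hFder : HasDerivAt (fun ε => ∫ s in a..c, F ε s) (∫ s in a..c, F' 0 s) 0 := by
    refine hasDerivAt_integral_of_continuousOn hδ0 hac.le (fun ε hε => ?_) (fun ε hε s hs => ?_) ?_
    · have m3 : MapsTo (fun s : ℝ => (ε, s)) (Icc a c) (Ioo (0 - δ) (0 + δ) ×ˢ Icc a c) :=
        fun s hs => ⟨hε, hs⟩
      exact (k4.mul k6).comp (by fun_prop : ContinuousOn (fun s : ℝ => (ε, s)) (Icc a c)) m3
    · have e1 : HasDerivAt (fun ε => ψ s + ε * η s) (η s) ε := by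
        simpa using ((hasDerivAt_id ε).mul_const (η s)).const_add (ψ s)
      have e2 : HasDerivAt (fun ε => ψ' s + ε * η' s) (η' s) ε := by
        simpa using ((hasDerivAt_id ε).mul_const (η' s)).const_add (ψ' s)
      have e3 := (hd s hs _ (hin _ (hstay ε hε s hs))).comp ε e1
      have e4 : HasDerivAt (fun ε => 1 + (ψ' s + ε * η' s) ^ 2)
          (2 * (ψ' s + ε * η' s) * η' s) ε :=
        ((e2.pow 2).const_add 1).congr_deriv (by simp)
      have e5 := e4.sqrt (by positivity)
      refine (e3.mul e5).congr_deriv ?_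
      simp only [hF', Function.comp]
      have := hsq (ψ' s + ε * η' s)
      field_simp
    · refine ContinuousOn.add ((k5.mul (hηc.comp_continuousOn continuousOn_snd)).mul k6)
        (k4.mul (ContinuousOn.div (k7.fun_mul (hη'c.comp_continuousOn continuousOn_snd)) k6
          fun p _ => (hsq _).ne'))
  have hloc : IsLocalMin (fun ε => ∫ s in a..c, F ε s) 0 := by
    filter_upwards [Ioo_mem_nhds (by linarith : 0 - δ < 0) (by linarith : 0 < 0 + δ)] with ε hε
    have := hmin (fun s => ψ s + ε * η s) (fun s => ψ' s + ε * η' s)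
      (fun s hs => (hψ s hs).add ((hηd s).const_mul ε))
      (hψ'.add (continuousOn_const.mul hη'c.continuousOn)) (by simp [hη0]) (by simp [hη1])
      (fun s hs => hstay ε hε s hs)
    simpa [hF] using this
  have hzero := hloc.hasDerivAt_eq_zero hFder
  have e1 : ∫ s in a..c, F' 0 s = ∫ s in a..c, (K s * η s + W s * η' s) := by
    refine intervalIntegral.integral_congr fun s hs => ?_
    rw [uIcc_of_le hac.le] at hs
    simp only [hF', hKeq s hs, hWeq s hs, hk, hw]
    simp only [zero_mul, add_zero]
    ring
  have hKη : Continuous fun s => K s * η s := hKc.mul hηc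
  have hWη : Continuous fun s => W s * η' s := hWc.mul hη'c
  have hqη : Continuous fun s => q s * η' s := hqc.mul hη'c
  have e2 : ∫ s in a..c, K s * η s = -∫ s in a..c, q s * η' s := by
    have := intervalIntegral.integral_mul_deriv_eq_deriv_mul (a := a) (b := c) (u := q) (v := η)
      (u' := K) (v' := η') (fun s _ => hqd s) (fun s _ => hηd s) (hKc.intervalIntegrable _ _)
      (hη'c.intervalIntegrable _ _)
    rw [hη0, hη1] at this
    linarith
  have e3 : ∫ s in a..c, η' s * η' s = 0 := by
    have h1 : ∫ s in a..c, (W s * η' s - q s * η' s) = 0 := by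
      rw [intervalIntegral.integral_sub (hWη.intervalIntegrable _ _) (hqη.intervalIntegrable _ _)]
      rw [e1, intervalIntegral.integral_add (hKη.intervalIntegrable _ _)
        (hWη.intervalIntegrable _ _), e2] at hzero
      linarith
    have h2 : ∫ s in a..c, m * η' s = 0 := by
      rw [intervalIntegral.integral_const_mul]
      have : ∫ s in a..c, η' s = 0 := hη1
      rw [this, mul_zero]
    have h3 : ∫ s in a..c, η' s * η' s =
        (∫ s in a..c, (W s * η' s - q s * η' s)) - ∫ s in a..c, m * η' s := by
      rw [← intervalIntegral.integral_sub ((hWη.fun_sub hqη).intervalIntegrable _ _)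
        ((continuous_const.fun_mul hη'c).intervalIntegrable _ _)]
      refine intervalIntegral.integral_congr fun s _ => ?_
      simp only [hη']; ring
    rw [h3, h1, h2, sub_zero]
  have hzero' : ∀ s ∈ Icc a c, η' s = 0 := by
    by_contra! hne
    obtain ⟨s, hs, hs0⟩ := hne
    have := intervalIntegral.integral_pos hac ((hη'c.mul hη'c).continuousOn)
      (fun x _ => mul_self_nonneg _) ⟨s, hs, mul_self_pos.2 hs0⟩
    exact this.ne' e3
  refine ⟨m, fun s hs => ?_⟩
  have h1 := hzero' s hs
  have h2 : q s = ∫ x in a..s, k x := by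
    refine intervalIntegral.integral_congr fun x hx => ?_
    rw [uIcc_of_le hs.1] at hx
    exact hKeq x ⟨hx.1, hx.2.trans hs.2⟩
  rw [← h2]
  have h3 := hWeq s hs
  simp only [hη'] at h1
  have : w s = m + q s := by rw [← h3]; linarith
  exact this

section

/-! ### Minimizing graphs satisfy the Euler–Lagrange equation -/

variable {b : Bool} {ψ ψ' : ℝ → ℝ} {a c : ℝ} {N : Set E3} {n : E3 → E3}

theorem continuousOn_gr₂ {S : Set ℝ} (h : ContinuousOn ψ S) : ContinuousOn (gr₂ b ψ) S := by
  cases b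
  exacts [h, continuousOn_id]

theorem continuousAt_gr₁ {s : ℝ} (h : ContinuousAt ψ s) : ContinuousAt (gr₁ b ψ) s := by
  cases b
  exacts [continuousAt_id, h]

theorem continuousAt_gr₂ {s : ℝ} (h : ContinuousAt ψ s) : ContinuousAt (gr₂ b ψ) s := by
  cases b
  exacts [h, continuousAt_id]

theorem contDiffAt_hh {φ : ℝ} (h : φ ∈ Iφ) : ContDiffAt ℝ ∞ hh φ :=
  contDiff_sin.contDiffAt.div (contDiff_cos.contDiffAt.pow 2)
    (pow_ne_zero 2 (cos_pos_of_mem h).ne')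

theorem continuousOn_hh : ContinuousOn hh Iφ := fun _ h =>
  (contDiffAt_hh h).continuousAt.continuousWithinAt

theorem hh_pos {φ : ℝ} (h : φ ∈ Iφ) : 0 < hh φ :=
  div_pos (sin_pos_of_mem h) (pow_pos (cos_pos_of_mem h) 2)

theorem hypArea_rev_graph (hac : a ≤ c) (h1 : ∀ s ∈ Icc a c, HasDerivAt ψ (ψ' s) s)
    (h2 : ContinuousOn ψ' (Icc a c)) (h3 : ∀ s ∈ Icc a c, gr₂ b ψ s ∈ Iφ) :
    hypArea (rev (gr₁ b ψ) (gr₂ b ψ) a c) =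
      ofReal (2 * π * ∫ s in a..c, hh (gr₂ b ψ s) * √(1 + ψ' s ^ 2)) := by
  have hp := isProfile_graph (b := b) (fun s hs => h1 s (Ioo_subset_Icc_self hs))
    (h2.mono Ioo_subset_Icc_self) fun s hs => h3 s (Ioo_subset_Icc_self hs)
  have hψ : ContinuousOn ψ (Icc a c) := fun s hs => (h1 s hs).continuousAt.continuousWithinAt
  have hc : ContinuousOn (fun s => hh (gr₂ b ψ s) * √(1 + ψ' s ^ 2)) (Icc a c) :=
    (continuousOn_hh.comp (continuousOn_gr₂ hψ) h3).mul
      (continuousOn_const.add (h2.pow 2)).sqrt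
  rw [hp.hypArea_rev, ENNReal.ofReal_mul (p := 2 * π) (by positivity), integral_of_le hac,
    integral_Ioc_eq_integral_Ioo]
  congr 1
  rw [ofReal_integral_eq_lintegral_ofReal
    ((hc.integrableOn_Icc).mono_set Ioo_subset_Icc_self)]
  · simp only [speed_gr]
  · filter_upwards [ae_restrict_mem measurableSet_Ioo] with s hs
    exact mul_nonneg (hh_pos (h3 s (Ioo_subset_Icc_self hs))).le (sqrt_nonneg _)

theorem integrableOn_speed_graph (h2 : ContinuousOn ψ' (Icc a c)) :
    IntegrableOn (speed (gr₁' b ψ') (gr₂' b ψ')) (Ioo a c) := by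
  have hc : ContinuousOn (fun s => √(1 + ψ' s ^ 2)) (Icc a c) :=
    (continuousOn_const.add (h2.pow 2)).sqrt
  refine (hc.integrableOn_Icc.mono_set Ioo_subset_Icc_self).congr_fun (fun s _ => ?_)
    measurableSet_Ioo
  exact (speed_gr b ψ' s).symm

/-- The closed solid of revolution over a coordinate box. -/
def boxSet (b : Bool) (a c y0 d : ℝ) : Set E3 :=
  (fun p : ℝ × ℝ × ℝ => P (pt b p.1 p.2.1).1 (pt b p.1 p.2.1).2 p.2.2) ''
    (Icc a c ×ˢ Icc (y0 - d) (y0 + d) ×ˢ Icc (-π) π)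

theorem isCompact_boxSet {y0 d : ℝ}
    (h : ∀ s ∈ Icc a c, ∀ y ∈ Icc (y0 - d) (y0 + d), (pt b s y).2 ∈ Iφ) :
    IsCompact (boxSet b a c y0 d) := by
  refine (isCompact_Icc.prod (isCompact_Icc.prod isCompact_Icc)).image_of_continuousOn ?_
  have hcpt : Continuous fun p : ℝ × ℝ × ℝ => pt b p.1 p.2.1 :=
    (continuous_pt b).comp (by fun_prop : Continuous fun p : ℝ × ℝ × ℝ => (p.1, p.2.1))
  exact continuousOn_P (continuous_fst.comp hcpt).continuousOn
    (continuous_snd.comp hcpt).continuousOn (by fun_prop)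
    fun p hp => denom_pos (cos_pos_of_mem (h _ hp.1 _ hp.2.1)).le

theorem boxSet_subset {y0 d : ℝ}
    (h : ∀ s ∈ Icc a c, ∀ y ∈ Icc (y0 - d) (y0 + d), (pt b s y).2 ∈ Iφ) :
    boxSet b a c y0 d ⊆ B \ Z := by
  rintro _ ⟨p, hp, rfl⟩
  exact P_mem (h _ hp.1 _ hp.2.1)

theorem exists_angle {t φ : ℝ} (hφ : φ ∈ Iφ) (θ : ℝ) : ∃ θ' ∈ Icc (-π) π, P t φ θ = P t φ θ' := by
  obtain ⟨θ', hθ', he⟩ := P_surj (P_mem (t := t) (θ := θ) hφ)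
  rw [tc_P hφ, phc_P hφ] at he
  exact ⟨θ', Ioc_subset_Icc_self hθ', he⟩

theorem rev_graph_subset_boxSet {y0 d : ℝ}
    (h : ∀ s ∈ Icc a c, ∀ y ∈ Icc (y0 - d) (y0 + d), (pt b s y).2 ∈ Iφ)
    (hψ : ∀ s ∈ Ioo a c, ψ s ∈ Icc (y0 - d) (y0 + d)) :
    rev (gr₁ b ψ) (gr₂ b ψ) a c ⊆ boxSet b a c y0 d := by
  rintro _ ⟨s, hs, θ, rfl⟩
  have h1 := h s (Ioo_subset_Icc_self hs) _ (hψ s hs)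
  have e := pt_eq_gr b ψ s
  rw [e] at h1
  obtain ⟨θ', hθ', he⟩ := exists_angle (t := gr₁ b ψ s) h1 θ
  refine ⟨(s, ψ s, θ'), ⟨Ioo_subset_Icc_self hs, hψ s hs, hθ'⟩, ?_⟩
  simp only [e]
  exact he.symm

theorem exists_graphCurrent (h1 : ∀ s ∈ Ioo a c, HasDerivAt ψ (ψ' s) s)
    (h2 : ContinuousOn ψ' (Ioo a c)) (h3 : ∀ s ∈ Ioo a c, gr₂ b ψ s ∈ Iφ)
    (hInt : IntegrableOn (speed (gr₁' b ψ') (gr₂' b ψ')) (Ioo a c)) {K : Set E3}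
    (hK : IsCompact K) (hKB : K ⊆ B) (hsub : rev (gr₁ b ψ) (gr₂ b ψ) a c ⊆ K) {σ : ℝ}
    (hσ : σ = 1 ∨ σ = -1) : ∃ T : RectCurrent, T.carrier = rev (gr₁ b ψ) (gr₂ b ψ) a c ∧
      (T.mult = fun _ => 1) ∧ ∀ s ∈ Ioo a c, ∀ θ, T.normal (P (gr₁ b ψ s) (gr₂ b ψ s) θ) =
        (σ / speed (gr₁' b ψ') (gr₂' b ψ') s) • (gr₂' b ψ' s • et (gr₁ b ψ s) (gr₂ b ψ s) θ -
          gr₁' b ψ' s • ep (gr₁ b ψ s) (gr₂ b ψ s) θ) := by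
  obtain ⟨nn, hnn, hnn1, hnn2⟩ := exists_measurable_normal h1 h2 h3
  have hmeas := measurableSet_rev_graph h1 h2 h3
  have hp := isProfile_graph h1 h2 h3
  refine ⟨⟨rev (gr₁ b ψ) (gr₂ b ψ) a c, fun x => σ • nn x, fun _ => 1, hmeas, hnn.const_smul σ,
    measurable_const, ⟨K, hK, hKB, hsub⟩, ⟨fun _ => rev (gr₁ b ψ) (gr₂ b ψ) a c,
      fun _ => isSurface_rev_graph h1 h2 h3, ?_, fun i => ?_⟩, ?_⟩, rfl, rfl, fun s hs θ => ?_⟩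
  · have : rev (gr₁ b ψ) (gr₂ b ψ) a c \ ⋃ _ : ℕ, rev (gr₁ b ψ) (gr₂ b ψ) a c = ∅ := by
      rw [iUnion_const, sdiff_self]
    rw [this]; exact measure_empty
  · rw [inter_self]
    filter_upwards [ae_restrict_mem hmeas] with x hx using hnn2 x hx σ hσ
  · simp only [Nat.cast_one, setLIntegral_one]
    refine hp.measure_rev_le.trans_lt (ENNReal.mul_lt_top ENNReal.ofReal_lt_top ?_)
    have h4 := hInt.2
    rw [hasFiniteIntegral_iff_ofReal (by
      filter_upwards with s using sqrt_nonneg _)] at h4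
    exact h4
  · simp only
    rw [hnn1 s hs θ, smul_smul]
    congr 1; ring

theorem RectCurrent.hypMass_of_mult_one {T : RectCurrent} (h : T.mult = fun _ => 1) :
    T.hypMass = hypArea T.carrier := by
  simp [RectCurrent.hypMass, hypArea, h]

theorem bdry_congr_set {S S' : Set E3} (h : S =ᵐ[μHE[2]] S') (n : E3 → E3) (m : E3 → ℕ)
    (Y : E3 → E3) : bdry S n m Y = bdry S' n m Y := setIntegral_congr_set h

theorem hypArea_congr_set {S S' : Set E3} (h : S =ᵐ[μHE[2]] S') : hypArea S = hypArea S' :=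
  setLIntegral_congr h

theorem bdry_graph (hac : a < c) (h1 : ∀ s ∈ Icc a c, HasDerivAt ψ (ψ' s) s)
    (h2 : ContinuousOn ψ' (Icc a c)) (h3 : ∀ s ∈ Icc a c, gr₂ b ψ s ∈ Iφ) {σ : ℝ}
    (hn : ∀ s ∈ Ioo a c, ∀ θ, n (P (gr₁ b ψ s) (gr₂ b ψ s) θ) =
        (σ / speed (gr₁' b ψ') (gr₂' b ψ') s) • (gr₂' b ψ' s • et (gr₁ b ψ s) (gr₂ b ψ s) θ -
          gr₁' b ψ' s • ep (gr₁ b ψ s) (gr₂ b ψ s) θ)) {Y : E3 → E3} (hY : IsTestField Y) :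
    bdry (rev (gr₁ b ψ) (gr₂ b ψ) a c) n (fun _ => 1) Y =
      σ * (circ Y (gr₁ b ψ c) (gr₂ b ψ c) - circ Y (gr₁ b ψ a) (gr₂ b ψ a)) := by
  have hp := isProfile_graph (b := b) (fun s hs => h1 s (Ioo_subset_Icc_self hs))
    (h2.mono Ioo_subset_Icc_self) fun s hs => h3 s (Ioo_subset_Icc_self hs)
  have ha := left_mem_Icc.2 hac.le
  have hc := right_mem_Icc.2 hac.le
  have := (hp.stokes hY hac (integrableOn_speed_graph h2)
    (cos_pos_of_mem (h3 a ha)).le (cos_pos_of_mem (h3 c hc)).le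
    ((continuousAt_gr₁ (h1 a ha).continuousAt).tendsto.mono_left nhdsWithin_le_nhds)
    ((continuousAt_gr₂ (h1 a ha).continuousAt).tendsto.mono_left nhdsWithin_le_nhds)
    ((continuousAt_gr₁ (h1 c hc).continuousAt).tendsto.mono_left nhdsWithin_le_nhds)
    ((continuousAt_gr₂ (h1 c hc).continuousAt).tendsto.mono_left nhdsWithin_le_nhds) hn).2
  rw [← this, bdry]
  simp

/-- In a box the minimizing surface is, up to a null set, a surface of revolution of a graph. -/
theorem IsGraphBox.inter_boxSet_ae_eq (h : IsAdmissible N n) {s0 r d : ℝ}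
    (hb : IsGraphBox N b ψ ψ' s0 r d) :
    (N ∩ boxSet b (s0 - r) (s0 + r) (ψ s0) d : Set E3) =ᵐ[μHE[2]]
      rev (gr₁ b ψ) (gr₂ b ψ) (s0 - r) (s0 + r) := by
  have habs : ∀ y ∈ Icc (ψ s0 - d) (ψ s0 + d), |y - ψ s0| ≤ d := fun y hy =>
    abs_le.2 ⟨by linarith [hy.1], by linarith [hy.2]⟩
  have hmem : ∀ s ∈ Icc (s0 - r) (s0 + r), ∀ y ∈ Icc (ψ s0 - d) (ψ s0 + d), (pt b s y).2 ∈ Iφ :=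
    fun s hs y hy => hb.mem s hs y (habs y hy)
  have hψin : ∀ s ∈ Icc (s0 - r) (s0 + r), ψ s ∈ Icc (ψ s0 - d) (ψ s0 + d) := fun s hs => by
    have := abs_lt.1 (hb.close s hs)
    exact ⟨by linarith, by linarith⟩
  have hsub : rev (gr₁ b ψ) (gr₂ b ψ) (s0 - r) (s0 + r) ⊆
      N ∩ boxSet b (s0 - r) (s0 + r) (ψ s0) d := by
    intro x hx
    refine ⟨?_, rev_graph_subset_boxSet hmem (fun s hs => hψin s (Ioo_subset_Icc_self hs)) hx⟩
    obtain ⟨s, hs, θ, rfl⟩ := hx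
    have hs' := Ioo_subset_Icc_self hs
    have h1 := hmem s hs' _ (hψin s hs')
    have h2 := (hb.iff s hs' _ (habs _ (hψin s hs'))).2 rfl
    rw [pt_eq_gr] at h1 h2
    exact (h.P_mem_iff h1 θ).2 h2
  refine ae_eq_set.2 ⟨measure_mono_null (t := range (P (gr₁ b ψ (s0 - r)) (gr₂ b ψ (s0 - r))) ∪
    range (P (gr₁ b ψ (s0 + r)) (gr₂ b ψ (s0 + r)))) ?_
      (measure_union_null (measure_circle _ _) (measure_circle _ _)),
    by rw [sdiff_eq_empty.2 hsub]; exact measure_empty⟩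
  rintro x ⟨⟨hxN, p, ⟨hp1, hp2, hp3⟩, rfl⟩, hxr⟩
  have hI := hmem _ hp1 _ hp2
  simp only at hxN hxr ⊢
  have h1 : pt b p.1 p.2.1 ∈ prof N := (h.P_mem_iff hI p.2.2).1 hxN
  have h2 : ψ p.1 = p.2.1 := (hb.iff _ hp1 _ (habs _ hp2)).1 h1
  rw [← h2, pt_eq_gr] at hxr ⊢
  rcases hp1.1.eq_or_lt with h3 | h3
  · left; rw [h3]; exact mem_range_self _
  rcases hp1.2.eq_or_lt with h4 | h4
  · right; rw [← h4]; exact mem_range_self _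
  · exact absurd ⟨p.1, ⟨h3, h4⟩, p.2.2, rfl⟩ hxr

theorem IsGraphBox.integral_le (h : IsAdmissible N n) {s0 r d : ℝ}
    (hb : IsGraphBox N b ψ ψ' s0 r d) {χ χ' : ℝ → ℝ}
    (h1 : ∀ s ∈ Icc (s0 - r) (s0 + r), HasDerivAt χ (χ' s) s)
    (h2 : ContinuousOn χ' (Icc (s0 - r) (s0 + r))) (ha : χ (s0 - r) = ψ (s0 - r))
    (hc : χ (s0 + r) = ψ (s0 + r)) (hd : ∀ s ∈ Icc (s0 - r) (s0 + r), |χ s - ψ s0| < d) :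
    ∫ s in (s0 - r)..(s0 + r), hh (gr₂ b ψ s) * √(1 + ψ' s ^ 2) ≤
      ∫ s in (s0 - r)..(s0 + r), hh (gr₂ b χ s) * √(1 + χ' s ^ 2) := by
  have hr := hb.r_pos
  have hac : s0 - r < s0 + r := by linarith
  have habs : ∀ y ∈ Icc (ψ s0 - d) (ψ s0 + d), |y - ψ s0| ≤ d := fun y hy =>
    abs_le.2 ⟨by linarith [hy.1], by linarith [hy.2]⟩
  have hmem : ∀ s ∈ Icc (s0 - r) (s0 + r), ∀ y ∈ Icc (ψ s0 - d) (ψ s0 + d), (pt b s y).2 ∈ Iφ :=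
    fun s hs y hy => hb.mem s hs y (habs y hy)
  have hχin : ∀ s ∈ Icc (s0 - r) (s0 + r), χ s ∈ Icc (ψ s0 - d) (ψ s0 + d) := fun s hs => by
    have := abs_lt.1 (hd s hs)
    exact ⟨by linarith, by linarith⟩
  have h3ψ : ∀ s ∈ Icc (s0 - r) (s0 + r), gr₂ b ψ s ∈ Iφ := fun s hs => by
    have := hb.mem s hs (ψ s) (hb.close s hs).le
    rwa [pt_eq_gr] at this
  have h3χ : ∀ s ∈ Icc (s0 - r) (s0 + r), gr₂ b χ s ∈ Iφ := fun s hs => by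
    have := hmem s hs (χ s) (hχin s hs)
    rwa [pt_eq_gr] at this
  have hae := hb.inter_boxSet_ae_eq h
  set K := boxSet b (s0 - r) (s0 + r) (ψ s0) d
  have hKc : IsCompact K := isCompact_boxSet hmem
  have hKB : K ⊆ B \ Z := boxSet_subset hmem
  have hpψ := isProfile_graph (b := b) (fun s hs => hb.deriv s (Ioo_subset_Icc_self hs))
    (hb.cont.mono Ioo_subset_Icc_self) fun s hs => h3ψ s (Ioo_subset_Icc_self hs)
  obtain ⟨σ, hσ, hnσ⟩ := h.exists_sign hpψ fun s hs => by
    have hs' := Ioo_subset_Icc_self hs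
    have := (hb.iff s hs' (ψ s) (hb.close s hs').le).2 rfl
    rwa [pt_eq_gr] at this
  obtain ⟨T, hT1, hT2, hT3⟩ := exists_graphCurrent (b := b)
    (fun s hs => h1 s (Ioo_subset_Icc_self hs)) (h2.mono Ioo_subset_Icc_self)
    (fun s hs => h3χ s (Ioo_subset_Icc_self hs)) (integrableOn_speed_graph h2) hKc
    (hKB.trans sdiff_subset)
    (rev_graph_subset_boxSet hmem fun s hs => hχin s (Ioo_subset_Icc_self hs)) hσ
  have hareaψ := hypArea_rev_graph hac.le hb.deriv hb.cont h3ψ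
  have hareaχ := hypArea_rev_graph hac.le h1 h2 h3χ
  have hend : ∀ s, χ s = ψ s → gr₁ b χ s = gr₁ b ψ s ∧ gr₂ b χ s = gr₂ b ψ s := by
    intro s hs
    cases b
    exacts [⟨rfl, hs⟩, ⟨hs, rfl⟩]
  have key := h.minimizing K hKc hKB (by
    rw [hypArea_congr_set hae, hareaψ]; exact ENNReal.ofReal_lt_top) T (fun Y hY => by
      rw [hT1, hT2, bdry_congr_set hae, bdry_graph hac h1 h2 h3χ hT3 hY,
        bdry_graph hac hb.deriv hb.cont h3ψ hnσ hY, (hend _ ha).1, (hend _ ha).2, (hend _ hc).1,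
        (hend _ hc).2])
  rw [hypArea_congr_set hae, RectCurrent.hypMass_of_mult_one hT2, hT1, hareaψ, hareaχ] at key
  have hnn : 0 ≤ ∫ s in (s0 - r)..(s0 + r), hh (gr₂ b χ s) * √(1 + χ' s ^ 2) :=
    intervalIntegral.integral_nonneg hac.le fun s hs =>
      mul_nonneg (hh_pos (h3χ s hs)).le (sqrt_nonneg _)
  have h2pi : (0 : ℝ) < 2 * π := by positivity
  rw [ENNReal.ofReal_le_ofReal_iff (by positivity)] at key
  exact le_of_mul_le_mul_left key h2pi

/-- In a chart over `φ` the profile satisfies Clairaut's relation. -/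
theorem IsGraphBox.clairaut_true (h : IsAdmissible N n) {s0 r d : ℝ}
    (hb : IsGraphBox N true ψ ψ' s0 r d) :
    ∃ C, ∀ s ∈ Icc (s0 - r) (s0 + r), hh s * (ψ' s / √(1 + ψ' s ^ 2)) = C := by
  have hr := hb.r_pos
  have hmem : ∀ s ∈ Icc (s0 - r) (s0 + r), s ∈ Iφ := fun s hs =>
    hb.mem s hs (ψ s0) (by simpa using hb.d_pos.le)
  obtain ⟨C, hC⟩ := euler_lagrange (H := fun s _ => hh s) (Hy := fun _ _ => 0) (ψ := ψ) (ψ' := ψ')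
    (a := s0 - r) (c := s0 + r) (y0 := ψ s0) (d := d) (by linarith)
    (continuousOn_hh.comp continuousOn_fst fun p hp => hmem _ hp.1) continuousOn_const
    (fun s _ y _ => hasDerivAt_const _ _) hb.deriv hb.cont hb.close
    (fun χ χ' h1 h2 h3 h4 h5 => hb.integral_le h h1 h2 h3 h4 h5)
  exact ⟨C, fun s hs => by simpa using hC s hs⟩

/-- In a chart over `t` the profile satisfies the Euler–Lagrange equation. -/
theorem IsGraphBox.eulerLagrange_false (h : IsAdmissible N n) {s0 r d : ℝ}
    (hb : IsGraphBox N false ψ ψ' s0 r d) :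
    ∃ C, ∀ s ∈ Icc (s0 - r) (s0 + r), hh (ψ s) * (ψ' s / √(1 + ψ' s ^ 2)) =
      C + ∫ x in (s0 - r)..s, _root_.deriv hh (ψ x) * √(1 + ψ' x ^ 2) := by
  have hr := hb.r_pos
  have hs0 : s0 ∈ Icc (s0 - r) (s0 + r) := ⟨by linarith, by linarith⟩
  have hmem : ∀ y ∈ Icc (ψ s0 - d) (ψ s0 + d), y ∈ Iφ := fun y hy =>
    hb.mem s0 hs0 y (abs_le.2 ⟨by linarith [hy.1], by linarith [hy.2]⟩)
  have hd : ContinuousOn (_root_.deriv hh) Iφ := fun φ hφ => by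
    have h2 := ((contDiffAt_hh hφ).fderiv_right (m := 0) (by simp)).continuousAt
    exact (h2.clm_apply continuousAt_const).continuousWithinAt
  exact euler_lagrange (H := fun _ y => hh y) (Hy := fun _ y => _root_.deriv hh y) (ψ := ψ) (ψ' := ψ')
    (a := s0 - r) (c := s0 + r) (y0 := ψ s0) (d := d) (by linarith)
    (continuousOn_hh.comp continuousOn_snd fun p hp => hmem _ hp.2)
    (hd.comp continuousOn_snd fun p hp => hmem _ hp.2)
    (fun s _ y hy => ((contDiffAt_hh (hmem y (Ioo_subset_Icc_self hy))).differentiableAt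
      (by simp)).hasDerivAt) hb.deriv hb.cont hb.close
    (fun χ χ' h1 h2 h3 h4 h5 => hb.integral_le h h1 h2 h3 h4 h5)

end

section

/-- The derivative of `hh`. -/
def dh (φ : ℝ) : ℝ := (1 + sin φ ^ 2) / cos φ ^ 3

theorem hasDerivAt_hh {φ : ℝ} (h : φ ∈ Iφ) : HasDerivAt hh (dh φ) φ := by
  have hc := (cos_pos_of_mem h).ne'
  have h1 : HasDerivAt (fun φ => cos φ ^ 2) (2 * cos φ * -sin φ) φ := by
    simpa using (hasDerivAt_cos φ).fun_pow 2
  have := (hasDerivAt_sin φ).fun_div h1 (pow_ne_zero 2 hc)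
  refine this.congr_deriv ?_
  rw [dh, div_eq_div_iff (by positivity) (by positivity)]
  linear_combination cos φ ^ 4 * sin_sq_add_cos_sq φ

theorem dh_pos {φ : ℝ} (h : φ ∈ Iφ) : 0 < dh φ :=
  div_pos (by positivity) (pow_pos (cos_pos_of_mem h) 3)

theorem continuousOn_dh : ContinuousOn dh Iφ :=
  (by fun_prop : ContinuousOn (fun φ => 1 + sin φ ^ 2) Iφ).div (by fun_prop) fun _ h =>
    pow_ne_zero 3 (cos_pos_of_mem h).ne'

theorem inv_cos_cube_le_dh {φ : ℝ} (h : φ ∈ Iφ) : (cos φ ^ 3)⁻¹ ≤ dh φ := by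
  rw [dh, ← one_div]
  have := cos_pos_of_mem h
  gcongr
  nlinarith [sq_nonneg (sin φ)]

theorem hh_le_dh {φ : ℝ} (h : φ ∈ Iφ) : hh φ ≤ dh φ := by
  have hc := cos_pos_of_mem h
  refine le_trans ?_ (inv_cos_cube_le_dh h)
  rw [hh, ← one_div, div_le_div_iff₀ (by positivity) (by positivity), one_mul]
  have h1 : sin φ * cos φ ≤ 1 := by
    nlinarith [sin_sq_add_cos_sq φ, sq_nonneg (sin φ - cos φ)]
  nlinarith [mul_le_mul_of_nonneg_right h1 (sq_nonneg (cos φ))]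

theorem hh_strictMonoOn : StrictMonoOn hh Iφ :=
  strictMonoOn_of_deriv_pos (convex_Ioo _ _) continuousOn_hh fun φ h => by
    replace h : φ ∈ Iφ := interior_subset h
    rw [(hasDerivAt_hh h).deriv]
    exact dh_pos h

/-- The inverse of `hh`. -/
def hinv (y : ℝ) : ℝ := arcsin (2 * y / (1 + √(1 + 4 * y ^ 2)))

theorem hinv_mem {y : ℝ} (hy : 0 < y) : hinv y ∈ Iφ := by
  have hD : 0 < 1 + √(1 + 4 * y ^ 2) := by positivity
  refine ⟨arcsin_pos.2 (by positivity), arcsin_lt_pi_div_two.2 ?_⟩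
  rw [div_lt_one hD]
  have : 2 * y ≤ √(1 + 4 * y ^ 2) := le_sqrt_of_sq_le (by nlinarith)
  linarith

theorem hh_hinv {y : ℝ} (hy : 0 < y) : hh (hinv y) = y := by
  have hD : 0 < 1 + √(1 + 4 * y ^ 2) := by positivity
  have h2 : √(1 + 4 * y ^ 2) ^ 2 = 1 + 4 * y ^ 2 := sq_sqrt (by positivity)
  have hlt : 2 * y / (1 + √(1 + 4 * y ^ 2)) ≤ 1 := arcsin_lt_pi_div_two.1 (hinv_mem hy).2 |>.le
  have hs : sin (hinv y) = 2 * y / (1 + √(1 + 4 * y ^ 2)) :=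
    sin_arcsin (le_trans (by norm_num) (by positivity : (0 : ℝ) ≤ _)) hlt
  have hc := cos_pos_of_mem (hinv_mem hy)
  rw [hh, div_eq_iff (by positivity), cos_sq', hs]
  set D := √(1 + 4 * y ^ 2)
  field_simp
  nlinarith

theorem hinv_hh {φ : ℝ} (h : φ ∈ Iφ) : hinv (hh φ) = φ :=
  hh_strictMonoOn.injOn (hinv_mem (hh_pos h)) h (hh_hinv (hh_pos h))

theorem continuous_hinv : Continuous hinv := by
  unfold hinv
  refine continuous_arcsin.comp (Continuous.div (by fun_prop) (by fun_prop) fun y => ?_)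
  positivity

theorem hasDerivAt_hinv {y : ℝ} (hy : 0 < y) : HasDerivAt hinv (dh (hinv y))⁻¹ y :=
  HasDerivAt.of_local_left_inverse continuous_hinv.continuousAt (hasDerivAt_hh (hinv_mem hy))
    (dh_pos (hinv_mem hy)).ne' (by filter_upwards [lt_mem_nhds hy] with x hx using hh_hinv hx)

theorem hinv_lt_hinv {x y : ℝ} (hx : 0 < x) (hy : 0 < y) : hinv x < hinv y ↔ x < y := by
  rw [← hh_strictMonoOn.lt_iff_lt (hinv_mem hx) (hinv_mem hy), hh_hinv hx, hh_hinv hy]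

/-- Data of a geodesic of the weighted metric of profile curves. -/
structure IsGeod (α β c : ℝ) : Prop where
  nonneg₁ : 0 ≤ α
  nonneg₂ : 0 ≤ β
  pos : 0 < α + β
  sq : c ^ 2 = 4 * α * β

/-- The weight along a geodesic. -/
def gy (α β s : ℝ) : ℝ := α * exp s + β * exp (-s)

/-- The derivative of the weight along a geodesic. -/
def gz (α β s : ℝ) : ℝ := α * exp s - β * exp (-s)

/-- The coordinate `φ` along a geodesic. -/
def g₂ (α β s : ℝ) : ℝ := hinv (gy α β s)

/-- The coordinate `t` along a geodesic. -/
def g₁ (α β c t0 s : ℝ) : ℝ := t0 + ∫ x in (0 : ℝ)..s, c / dh (g₂ α β x)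

/-- A profile geodesic. -/
def geo (α β c t0 s : ℝ) : ℝ × ℝ := (g₁ α β c t0 s, g₂ α β s)

theorem hasDerivAt_gy (α β s : ℝ) : HasDerivAt (gy α β) (gz α β s) s := by
  have h1 : HasDerivAt (fun s => exp (-s)) (-exp (-s)) s := by
    simpa using (hasDerivAt_neg s).exp
  refine (((hasDerivAt_exp s).const_mul α).fun_add (h1.const_mul β)).congr_deriv ?_
  rw [gz]; ring

theorem continuous_gz (α β : ℝ) : Continuous (gz α β) := by unfold gz; fun_prop

variable {α β c t0 : ℝ}

theorem gy_sq_sub (h : IsGeod α β c) (s : ℝ) : gz α β s ^ 2 + c ^ 2 = gy α β s ^ 2 := by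
  have : exp s * exp (-s) = 1 := by rw [← exp_add]; simp
  rw [gz, gy, h.sq]; linear_combination (-4 * α * β) * this

namespace IsGeod

theorem gy_pos (h : IsGeod α β c) (s : ℝ) : 0 < gy α β s := by
  have h1 := exp_pos s
  have h2 := exp_pos (-s)
  have h3 := h.nonneg₁
  have h4 := h.nonneg₂
  rcases h3.eq_or_lt with h5 | h5
  · have : 0 < β := by have := h.pos; linarith
    unfold gy; positivity
  · unfold gy; positivity

theorem mem (h : IsGeod α β c) (s : ℝ) : g₂ α β s ∈ Iφ := hinv_mem (h.gy_pos s)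

theorem hh_g₂ (h : IsGeod α β c) (s : ℝ) : hh (g₂ α β s) = gy α β s := hh_hinv (h.gy_pos s)

theorem hasDerivAt_g₂ (h : IsGeod α β c) (s : ℝ) :
    HasDerivAt (g₂ α β) (gz α β s / dh (g₂ α β s)) s := by
  refine ((hasDerivAt_hinv (h.gy_pos s)).comp s (hasDerivAt_gy α β s)).congr_deriv ?_
  rw [div_eq_inv_mul]; rfl

theorem continuous_g₂ (h : IsGeod α β c) : Continuous (g₂ α β) :=
  continuous_iff_continuousAt.2 fun s => (h.hasDerivAt_g₂ s).continuousAt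

theorem continuous_dh (h : IsGeod α β c) : Continuous fun s => dh (g₂ α β s) :=
  continuousOn_dh.comp_continuous h.continuous_g₂ h.mem

theorem dh_pos' (h : IsGeod α β c) (s : ℝ) : 0 < dh (g₂ α β s) := dh_pos (h.mem s)

theorem continuous_div_dh (h : IsGeod α β c) : Continuous fun s => c / dh (g₂ α β s) :=
  continuous_const.div h.continuous_dh fun s => (h.dh_pos' s).ne'

theorem hasDerivAt_g₁ (h : IsGeod α β c) (s : ℝ) : HasDerivAt (g₁ α β c t0) (c / dh (g₂ α β s)) s :=
  (h.continuous_div_dh.integral_hasStrictDerivAt 0 s).hasDerivAt.const_add t0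

theorem continuous_geo (h : IsGeod α β c) : Continuous (geo α β c t0) :=
  (continuous_iff_continuousAt.2 fun s => (h.hasDerivAt_g₁ s).continuousAt).prodMk h.continuous_g₂

theorem geo_injective (h : IsGeod α β c) : Function.Injective (geo α β c t0) := by
  have key : ∀ {f f' : ℝ → ℝ}, (∀ s, HasDerivAt f (f' s) s) →
      ((∀ s, 0 < f' s) ∨ ∀ s, f' s < 0) → Function.Injective f := by
    rintro f f' hf (hp | hp)
    · exact (strictMono_of_deriv_pos fun s => by rw [(hf s).deriv]; exact hp s).injective
    · exact (strictAnti_of_deriv_neg fun s => by rw [(hf s).deriv]; exact hp s).injective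
  intro s s' hs
  rw [geo, geo, Prod.mk.injEq] at hs
  rcases lt_trichotomy c 0 with hc | hc | hc
  · exact key (fun s => h.hasDerivAt_g₁ (t0 := t0) s)
      (.inr fun s => div_neg_of_neg_of_pos hc (h.dh_pos' s)) hs.1
  · have h0 : α = 0 ∨ β = 0 := by
      have := h.sq; rw [hc] at this
      have : α * β = 0 := by linarith
      exact mul_eq_zero.1 this
    refine key (fun s => h.hasDerivAt_g₂ s) ?_ hs.2
    rcases h0 with h0 | h0
    · refine .inr fun s => div_neg_of_neg_of_pos ?_ (h.dh_pos' s)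
      have h1 := h.pos; have := exp_pos (-s)
      rw [gz, h0]; rw [h0] at h1; nlinarith
    · refine .inl fun s => div_pos ?_ (h.dh_pos' s)
      have h1 := h.pos; have := exp_pos s
      rw [gz, h0]; rw [h0] at h1; nlinarith
  · exact key (fun s => h.hasDerivAt_g₁ (t0 := t0) s)
      (.inl fun s => div_pos hc (h.dh_pos' s)) hs.1

theorem isProfile (h : IsGeod α β c) (a b : ℝ) : IsProfile (g₁ α β c t0) (g₂ α β)
    (fun s => c / dh (g₂ α β s)) (fun s => gz α β s / dh (g₂ α β s)) a b where
  deriv₁ s _ := h.hasDerivAt_g₁ s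
  deriv₂ s _ := h.hasDerivAt_g₂ s
  cont₁ := h.continuous_div_dh.continuousOn
  cont₂ := ((continuous_gz α β).div h.continuous_dh fun s => (h.dh_pos' s).ne').continuousOn
  mem s _ := h.mem s
  regular s _ := by
    have h1 := h.dh_pos' s
    have h2 := h.gy_pos s
    have h3 := gy_sq_sub h s
    rw [div_pow, div_pow, ← add_div, add_comm (c ^ 2), h3]
    positivity
  inj s _ s' _ h1 h2 := h.geo_injective (t0 := t0) (Prod.ext h1 h2)

theorem speed_eq (h : IsGeod α β c) (s : ℝ) :
    speed (fun s => c / dh (g₂ α β s)) (fun s => gz α β s / dh (g₂ α β s)) s =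
      gy α β s / dh (g₂ α β s) := by
  rw [speed, div_pow, div_pow, ← add_div, add_comm (c ^ 2), gy_sq_sub h s, ← div_pow,
    sqrt_sq (div_pos (h.gy_pos s) (h.dh_pos' s)).le]

/-- Geodesics with the same initial state agree, up to the direction. -/
theorem geo_shift (h : IsGeod α β c) {α' β' c' t₁ e s : ℝ} (h' : IsGeod α' β' c')
    (he : e = 1 ∨ e = -1) (h0 : geo α β c t0 s = geo α' β' c' t₁ 0) (hc : c = e * c')
    (hz : gz α β s = e * (α' - β')) (x : ℝ) : geo α β c t0 (s + x) = geo α' β' c' t₁ (e * x) := by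
  rw [geo, geo, Prod.mk.injEq] at h0
  have hy : gy α β s = α' + β' := by
    rw [← h.hh_g₂, h0.2, h'.hh_g₂]; simp [gy]
  have hgy : ∀ x, gy α β (s + x) = gy α' β' (e * x) := by
    intro x
    have e1 := hy; have e2 := hz
    rw [gy] at e1 ⊢; rw [gz] at e2
    rw [gy, neg_add, exp_add, exp_add]
    rcases he with rfl | rfl
    · rw [one_mul] at e2 ⊢
      linear_combination (exp x + exp (-x)) / 2 * e1 + (exp x - exp (-x)) / 2 * e2
    · rw [neg_one_mul] at e2 ⊢; rw [neg_neg]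
      linear_combination (exp x + exp (-x)) / 2 * e1 + (exp x - exp (-x)) / 2 * e2
  have hg2 : ∀ x, g₂ α β (s + x) = g₂ α' β' (e * x) := fun x => by rw [g₂, g₂, hgy]
  refine Prod.ext ?_ (hg2 x)
  have hd : ∀ x, HasDerivAt (fun x => g₁ α β c t0 (s + x) - g₁ α' β' c' t₁ (e * x)) 0 x := by
    intro x
    have h1 : HasDerivAt (fun x => g₁ α β c t0 (s + x)) (c / dh (g₂ α β (s + x))) x :=
      (h.hasDerivAt_g₁ (s + x)).comp_const_add s x
    have h2 := (h'.hasDerivAt_g₁ (t0 := t₁) (e * x)).comp x ((hasDerivAt_id x).const_mul e)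
    refine (h1.fun_sub h2).congr_deriv ?_
    rw [hg2, hc]; ring
  have := is_const_of_deriv_eq_zero (fun x => (hd x).differentiableAt) (fun x => (hd x).deriv) x 0
  simp only [add_zero, mul_zero] at this
  simp only [geo]
  linarith [h0.1]

end IsGeod

/-- A curve satisfying the Clairaut relation and the Euler–Lagrange equation is a geodesic. -/
theorem exists_geod_of_clairaut {p₁ p₂ p₁' p₂' : ℝ → ℝ} {x0 r : ℝ} (hr : 0 < r)
    (h1 : ∀ x ∈ Icc (x0 - r) (x0 + r), HasDerivAt p₁ (p₁' x) x)
    (h2 : ∀ x ∈ Icc (x0 - r) (x0 + r), HasDerivAt p₂ (p₂' x) x)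
    (hm : ∀ x ∈ Icc (x0 - r) (x0 + r), p₂ x ∈ Iφ) {v w : ℝ → ℝ}
    (hv : ContinuousOn v (Icc (x0 - r) (x0 + r))) (hv0 : ∀ x ∈ Icc (x0 - r) (x0 + r), 0 < v x)
    (hvv : ∀ x ∈ Ioo (x0 - r) (x0 + r), v x ^ 2 = p₁' x ^ 2 + p₂' x ^ 2) {c : ℝ}
    (hc : ∀ x ∈ Ioo (x0 - r) (x0 + r), hh (p₂ x) * p₁' x = c * v x)
    (hw : ∀ x ∈ Ioo (x0 - r) (x0 + r), hh (p₂ x) * p₂' x = w x * v x)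
    (hw' : ∀ x ∈ Ioo (x0 - r) (x0 + r), HasDerivAt w (dh (p₂ x) * v x) x) :
    ∃ α β, IsGeod α β c ∧ gy α β 0 = hh (p₂ x0) ∧ α - β = w x0 ∧ ∃ a b, a < 0 ∧ 0 < b ∧
      (∀ x ∈ Ioo (x0 - r) (x0 + r), ∃ s ∈ Ioo a b, (p₁ x, p₂ x) = geo α β c (p₁ x0) s) ∧
      ∀ s ∈ Ioo a b, ∃ x ∈ Ioo (x0 - r) (x0 + r), geo α β c (p₁ x0) s = (p₁ x, p₂ x) := by
  set I := Icc (x0 - r) (x0 + r)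
  have hx₀ : x0 ∈ I := ⟨by linarith, by linarith⟩
  have hx₀' : x0 ∈ Ioo (x0 - r) (x0 + r) := ⟨by linarith, by linarith⟩
  have hy2 : w x0 ^ 2 + c ^ 2 = hh (p₂ x0) ^ 2 := by
    have e1 := hc x0 hx₀'; have e2 := hw x0 hx₀'; have e3 := hvv x0 hx₀'; have e4 := hv0 x0 hx₀
    have : v x0 ^ 2 * (w x0 ^ 2 + c ^ 2) = v x0 ^ 2 * hh (p₂ x0) ^ 2 := by
      rw [mul_add, ← mul_pow, ← mul_pow, mul_comm (v x0), mul_comm (v x0) c, ← e1, ← e2, e3]; ring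
    exact mul_left_cancel₀ (by positivity) this
  set y0 := hh (p₂ x0) with hy₀
  have hy₀p : 0 < y0 := hh_pos (hm x0 hx₀)
  have hG : IsGeod ((y0 + w x0) / 2) ((y0 - w x0) / 2) c := by
    have h3 := hy2
    have h4 : |w x0| ≤ y0 := abs_le_of_sq_le_sq (by nlinarith [sq_nonneg c]) hy₀p.le
    exact ⟨by linarith [(abs_le.1 h4).1], by linarith [(abs_le.1 h4).2], by linarith,
      by linear_combination h3⟩
  have hp2c : ContinuousOn p₂ I := fun x hx => (h2 x hx).continuousAt.continuousWithinAt
  set f : ℝ → ℝ := fun x => dh (p₂ x) * v x / hh (p₂ x) with hf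
  have hfc : ContinuousOn f I := ((continuousOn_dh.comp hp2c hm).mul hv).div
    (continuousOn_hh.comp hp2c hm) fun x hx => (hh_pos (hm x hx)).ne'
  have hfp : ∀ x ∈ I, 0 < f x := fun x hx =>
    div_pos (mul_pos (dh_pos (hm x hx)) (hv0 x hx)) (hh_pos (hm x hx))
  set σ : ℝ → ℝ := fun x => ∫ u in x0..x, f u with hσ
  have hfi : ∀ a ∈ I, ∀ b ∈ I, IntervalIntegrable f volume a b := fun a ha b hb =>
    (hfc.mono (ordConnected_Icc.uIcc_subset ha hb)).intervalIntegrable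
  have hσd : ∀ x ∈ Ioo (x0 - r) (x0 + r), HasDerivAt σ (f x) x := fun x hx =>
    integral_hasDerivAt_right (hfi _ hx₀ _ (Ioo_subset_Icc_self hx))
      (ContinuousOn.stronglyMeasurableAtFilter isOpen_Ioo (hfc.mono Ioo_subset_Icc_self) x hx)
      ((hfc x (Ioo_subset_Icc_self hx)).continuousAt (Icc_mem_nhds hx.1 hx.2))
  have hσc : ContinuousOn σ I := by
    have := intervalIntegral.continuousOn_primitive_interval'
      (hfi (x0 - r) ⟨le_rfl, by linarith⟩ (x0 + r) ⟨by linarith, le_rfl⟩) (a := x0)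
      (by rw [uIcc_of_le (by linarith)]; exact hx₀)
    rwa [uIcc_of_le (by linarith)] at this
  have hσm : StrictMonoOn σ I := strictMonoOn_of_deriv_pos (convex_Icc _ _) hσc fun x hx => by
    rw [interior_Icc] at hx
    rw [(hσd x hx).deriv]
    exact hfp x (Ioo_subset_Icc_self hx)
  have hσ0 : σ x0 = 0 := intervalIntegral.integral_same
  have hcst : ∀ {F : ℝ → ℝ}, (∀ x ∈ Ioo (x0 - r) (x0 + r), HasDerivAt F 0 x) →
      ∀ x ∈ Ioo (x0 - r) (x0 + r), F x = F x0 := fun {F} hF x hx =>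
    isOpen_Ioo.is_const_of_deriv_eq_zero isPreconnected_Ioo
      (fun y hy => (hF y hy).differentiableAt.differentiableWithinAt) (fun y hy => (hF y hy).deriv)
      hx hx₀'
  have hE : ∀ x, exp (σ x) * exp (-σ x) = 1 := fun x => by rw [← exp_add]; simp
  have hyd : ∀ x ∈ Ioo (x0 - r) (x0 + r), HasDerivAt (fun x => hh (p₂ x)) (w x * f x) x :=
    fun x hx => by
      have hx' := Ioo_subset_Icc_self hx
      refine ((hasDerivAt_hh (hm x hx')).comp x (h2 x hx')).congr_deriv ?_
      have e2 := hw x hx; have := hh_pos (hm x hx')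
      simp only [hf]
      field_simp
      linear_combination dh (p₂ x) * e2
  have hwd : ∀ x ∈ Ioo (x0 - r) (x0 + r), HasDerivAt w (hh (p₂ x) * f x) x := fun x hx => by
    have hx' := Ioo_subset_Icc_self hx
    refine (hw' x hx).congr_deriv ?_
    have := hh_pos (hm x hx')
    simp only [hf]
    field_simp
  have hexp : ∀ x ∈ Ioo (x0 - r) (x0 + r), hh (p₂ x) + w x = (y0 + w x0) * exp (σ x) := fun x hx => by
    have := hcst (F := fun x => (hh (p₂ x) + w x) * exp (-σ x))
      (fun x hx => by
        refine (((hyd x hx).fun_add (hwd x hx)).fun_mul (hσd x hx).fun_neg.exp).congr_deriv ?_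
        ring) x hx
    simp only [hσ0, neg_zero, exp_zero, mul_one] at this
    rw [← hy₀] at this
    rw [← this, mul_assoc, mul_comm (exp (-σ x)), hE, mul_one]
  have hexp' : ∀ x ∈ Ioo (x0 - r) (x0 + r), hh (p₂ x) - w x = (y0 - w x0) * exp (-σ x) := fun x hx => by
    have := hcst (F := fun x => (hh (p₂ x) - w x) * exp (σ x))
      (fun x hx => by
        refine (((hyd x hx).fun_sub (hwd x hx)).fun_mul (hσd x hx).exp).congr_deriv ?_
        ring) x hx
    simp only [hσ0, exp_zero, mul_one] at this
    rw [← hy₀] at this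
    rw [← this, mul_assoc, hE, mul_one]
  have hg2 : ∀ x ∈ Ioo (x0 - r) (x0 + r), g₂ ((y0 + w x0) / 2) ((y0 - w x0) / 2) (σ x) = p₂ x := fun x hx => by
    rw [g₂, ← hinv_hh (hm x (Ioo_subset_Icc_self hx))]
    congr 1
    rw [gy]; linear_combination (-(1:ℝ)/2) * hexp x hx - (1/2 : ℝ) * hexp' x hx
  have hg1 : ∀ x ∈ Ioo (x0 - r) (x0 + r), g₁ ((y0 + w x0) / 2) ((y0 - w x0) / 2) c (p₁ x0) (σ x) = p₁ x := fun x hx => by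
    have := hcst (F := fun x => g₁ ((y0 + w x0) / 2) ((y0 - w x0) / 2) c (p₁ x0) (σ x) - p₁ x)
      (fun x hx => by
        have hx' := Ioo_subset_Icc_self hx
        refine (((hG.hasDerivAt_g₁ (σ x)).comp x (hσd x hx)).fun_sub (h1 x hx')).congr_deriv ?_
        have e1 := hc x hx; have h3 := hh_pos (hm x hx'); have h4 := dh_pos (hm x hx')
        rw [hg2 x hx]
        simp only [hf]
        field_simp
        linear_combination -e1) x hx
    simp only [hσ0] at this
    have h0 : g₁ ((y0 + w x0) / 2) ((y0 - w x0) / 2) c (p₁ x0) 0 = p₁ x0 := by simp [g₁]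
    linarith
  have hgeo : ∀ x ∈ Ioo (x0 - r) (x0 + r), geo ((y0 + w x0) / 2) ((y0 - w x0) / 2) c (p₁ x0) (σ x) = (p₁ x, p₂ x) :=
    fun x hx => Prod.ext (hg1 x hx) (hg2 x hx)
  have hl : x0 - r ∈ I := ⟨le_rfl, by linarith⟩
  have hu : x0 + r ∈ I := ⟨by linarith, le_rfl⟩
  refine ⟨_, _, hG, by simp only [gy, neg_zero, exp_zero]; ring, by ring, σ (x0 - r), σ (x0 + r), ?_, ?_, fun x hx => ?_,
    fun s hs => ?_⟩
  · rw [← hσ0]; exact hσm hl hx₀ (by linarith)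
  · rw [← hσ0]; exact hσm hx₀ hu (by linarith)
  · have hx' := Ioo_subset_Icc_self hx
    exact ⟨σ x, ⟨hσm hl hx' hx.1, hσm hx' hu hx.2⟩, (hgeo x hx).symm⟩
  · obtain ⟨x, hx, rfl⟩ := intermediate_value_Ioo (by linarith) hσc hs
    exact ⟨x, hx, hgeo x hx⟩

end

section

variable {N : Set E3} {n : E3 → E3} {b : Bool} {ψ ψ' : ℝ → ℝ} {s0 r d : ℝ}

/-- The profile in a graph box is an arc of a geodesic. -/
theorem IsGraphBox.exists_geod (h : IsAdmissible N n) (hb : IsGraphBox N b ψ ψ' s0 r d) :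
    ∃ α β c, IsGeod α β c ∧ gy α β 0 = hh (gr₂ b ψ s0) ∧
      c * √(1 + ψ' s0 ^ 2) = hh (gr₂ b ψ s0) * gr₁' b ψ' s0 ∧
      (α - β) * √(1 + ψ' s0 ^ 2) = hh (gr₂ b ψ s0) * gr₂' b ψ' s0 ∧ ∃ x y, x < 0 ∧ 0 < y ∧
      (∀ u ∈ Ioo (s0 - r) (s0 + r), ∃ s ∈ Ioo x y,
        (gr₁ b ψ u, gr₂ b ψ u) = geo α β c (gr₁ b ψ s0) s) ∧
      ∀ s ∈ Ioo x y, ∃ u ∈ Ioo (s0 - r) (s0 + r),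
        geo α β c (gr₁ b ψ s0) s = (gr₁ b ψ u, gr₂ b ψ u) := by
  have hr := hb.r_pos
  have hs0 : s0 ∈ Ioo (s0 - r) (s0 + r) := ⟨by linarith, by linarith⟩
  have hm : ∀ s ∈ Icc (s0 - r) (s0 + r), gr₂ b ψ s ∈ Iφ := fun s hs => by
    have := hb.mem s hs (ψ s) (hb.close s hs).le
    rwa [pt_eq_gr] at this
  have hvc : ContinuousOn (fun s => √(1 + ψ' s ^ 2)) (Icc (s0 - r) (s0 + r)) :=
    (continuousOn_const.add (hb.cont.pow 2)).sqrt
  have hv0 : ∀ s, 0 < √(1 + ψ' s ^ 2) := fun s => by positivity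
  have hv2 : ∀ s, √(1 + ψ' s ^ 2) ^ 2 = 1 + ψ' s ^ 2 := fun s => sq_sqrt (by positivity)
  cases b with
  | true =>
    obtain ⟨C, hC⟩ := hb.clairaut_true h
    simp only [gr₁, gr₂, gr₁', gr₂'] at hm ⊢
    have hC' : ∀ s ∈ Icc (s0 - r) (s0 + r), hh s * ψ' s = C * √(1 + ψ' s ^ 2) := fun s hs => by
      rw [← hC s hs]; field_simp [(hv0 s).ne']
    have hD : ∀ s ∈ Icc (s0 - r) (s0 + r), hh s ^ 2 - C ^ 2 = (hh s / √(1 + ψ' s ^ 2)) ^ 2 :=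
      fun s hs => by
        rw [← hC s hs, mul_pow, div_pow, div_pow, hv2]
        field_simp; ring
    have hw : ∀ s ∈ Icc (s0 - r) (s0 + r), √(hh s ^ 2 - C ^ 2) = hh s / √(1 + ψ' s ^ 2) :=
      fun s hs => by
        rw [hD s hs, sqrt_sq (div_pos (hh_pos (hm s hs)) (hv0 s)).le]
    obtain ⟨α, β, hG, h1, h2, hrest⟩ := exists_geod_of_clairaut (p₁ := ψ) (p₂ := fun s => s)
      (p₁' := ψ') (p₂' := fun _ => 1) (v := fun s => √(1 + ψ' s ^ 2)) (c := C)
      (w := fun s => √(hh s ^ 2 - C ^ 2)) hr hb.deriv (fun x _ => hasDerivAt_id x) hm hvc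
      (fun s _ => hv0 s) (fun s _ => by rw [hv2]; ring)
      (fun s hs => hC' s (Ioo_subset_Icc_self hs))
      (fun s hs => by rw [hw s (Ioo_subset_Icc_self hs)]; field_simp [(hv0 s).ne']) (fun s hs => by
        have hs' := Ioo_subset_Icc_self hs
        have hp := hh_pos (hm s hs')
        have hd : HasDerivAt (fun s => hh s ^ 2 - C ^ 2) (2 * hh s * dh s) s := by
          simpa using ((hasDerivAt_hh (hm s hs')).fun_pow 2).sub_const (C ^ 2)
        refine (hd.sqrt (by rw [hD s hs']; positivity)).congr_deriv ?_
        rw [hw s hs']; field_simp)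
    refine ⟨α, β, C, hG, h1, (hC' s0 (Ioo_subset_Icc_self hs0)).symm, ?_, hrest⟩
    rw [h2, hw s0 (Ioo_subset_Icc_self hs0)]; field_simp [(hv0 s0).ne']
  | false =>
    obtain ⟨C, hC⟩ := hb.eulerLagrange_false h
    simp only [gr₁, gr₂, gr₁', gr₂'] at hm ⊢
    have hψ : ContinuousOn ψ (Icc (s0 - r) (s0 + r)) := fun s hs =>
      (hb.deriv s hs).continuousAt.continuousWithinAt
    set f : ℝ → ℝ := fun x => _root_.deriv hh (ψ x) * √(1 + ψ' x ^ 2) with hf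
    have hfe : ∀ s ∈ Icc (s0 - r) (s0 + r), f s = dh (ψ s) * √(1 + ψ' s ^ 2) := fun s hs => by
      simp only [hf, (hasDerivAt_hh (hm s hs)).deriv]
    have hfc : ContinuousOn f (Icc (s0 - r) (s0 + r)) :=
      ((continuousOn_dh.comp hψ hm).mul hvc).congr hfe
    set w : ℝ → ℝ := fun s => C + ∫ x in (s0 - r)..s, f x with hw
    have hwd : ∀ s ∈ Ioo (s0 - r) (s0 + r), HasDerivAt w (dh (ψ s) * √(1 + ψ' s ^ 2)) s :=
      fun s hs => by
        have hs' := Ioo_subset_Icc_self hs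
        rw [← hfe s hs']
        refine (integral_hasDerivAt_right (hfc.mono ?_).intervalIntegrable
          (ContinuousOn.stronglyMeasurableAtFilter isOpen_Ioo (hfc.mono Ioo_subset_Icc_self) s hs)
          ((hfc s hs').continuousAt (Icc_mem_nhds hs.1 hs.2))).const_add C
        exact ordConnected_Icc.uIcc_subset ⟨le_rfl, by linarith⟩ hs'
    have hwe : ∀ s ∈ Ioo (s0 - r) (s0 + r), hh (ψ s) * ψ' s = w s * √(1 + ψ' s ^ 2) := fun s hs => by
      rw [hw]; simp only; rw [← hC s (Ioo_subset_Icc_self hs)]; field_simp [(hv0 s).ne']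
    have hcst : ∀ s ∈ Ioo (s0 - r) (s0 + r), hh (ψ s) ^ 2 - w s ^ 2 =
        hh (ψ s0) ^ 2 - w s0 ^ 2 := fun s hs => by
      have hd : ∀ y ∈ Ioo (s0 - r) (s0 + r),
          HasDerivAt (fun s => hh (ψ s) ^ 2 - w s ^ 2) 0 y := fun y hy => by
        have hy' := Ioo_subset_Icc_self hy
        have h1 := ((hasDerivAt_hh (hm y hy')).comp y (hb.deriv y hy')).fun_pow 2
        refine (h1.fun_sub ((hwd y hy).fun_pow 2)).congr_deriv ?_
        simp only [Nat.cast_ofNat, Nat.add_one_sub_one, pow_one, Function.comp_apply]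
        linear_combination 2 * dh (ψ y) * hwe y hy
      exact isOpen_Ioo.is_const_of_deriv_eq_zero isPreconnected_Ioo
        (fun y hy => (hd y hy).differentiableAt.differentiableWithinAt)
        (fun y hy => (hd y hy).deriv) hs hs0
    have hq : ∀ s ∈ Ioo (s0 - r) (s0 + r), hh (ψ s) = √(hh (ψ s0) ^ 2 - w s0 ^ 2) * √(1 + ψ' s ^ 2) :=
      fun s hs => by
        have hp := hh_pos (hm s (Ioo_subset_Icc_self hs))
        have e : hh (ψ s) ^ 2 - w s ^ 2 = (hh (ψ s) / √(1 + ψ' s ^ 2)) ^ 2 := by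
          have e1 := hwe s hs; have e2 := hv2 s; have e3 := hv0 s
          rw [div_pow, eq_div_iff (by positivity), e2, sub_mul, ← e2, ← mul_pow (w s), ← e1, e2]
          ring
        rw [← hcst s hs, e, sqrt_sq (div_pos hp (hv0 s)).le]
        field_simp [(hv0 s).ne']
    obtain ⟨α, β, hG, h1, h2, hrest⟩ := exists_geod_of_clairaut (p₁ := fun s => s) (p₂ := ψ)
      (p₁' := fun _ => 1) (p₂' := ψ') (v := fun s => √(1 + ψ' s ^ 2))
      (c := √(hh (ψ s0) ^ 2 - w s0 ^ 2))
      (w := w) hr (fun x _ => hasDerivAt_id x) hb.deriv hm hvc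
      (fun s _ => hv0 s) (fun s _ => by rw [hv2]; ring)
      (fun s hs => by rw [mul_one]; exact hq s hs) hwe hwd
    refine ⟨α, β, _, hG, h1, by rw [mul_one]; exact (hq s0 hs0).symm, ?_, hrest⟩
    rw [h2, hwe s0 hs0]

theorem pt_pt (b : Bool) (q : ℝ × ℝ) : pt b (pt b q.1 q.2).1 (pt b q.1 q.2).2 = q := by
  cases b <;> rfl

theorem geo_zero (α β c t : ℝ) : (geo α β c t 0).1 = t := by simp [geo, g₁]

/-- Near each of its points, the profile is an arc of a geodesic, and this geodesic is the only
one that runs in the profile near this point. -/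
theorem IsAdmissible.exists_geod (h : IsAdmissible N n) {q : ℝ × ℝ} (hq : q ∈ prof N) :
    ∃ α β c, IsGeod α β c ∧ geo α β c q.1 0 = q ∧ (∃ x y, x < 0 ∧ 0 < y ∧
      (∀ s ∈ Ioo x y, geo α β c q.1 s ∈ prof N) ∧
      ∀ᶠ p in 𝓝 q, p ∈ prof N → p ∈ geo α β c q.1 '' Ioo x y) ∧
      ∀ α' β' c' t₁ s, IsGeod α' β' c' → geo α' β' c' t₁ s = q →
        (∀ᶠ s' in 𝓝 s, geo α' β' c' t₁ s' ∈ prof N) →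
        ∃ e : ℝ, (e = 1 ∨ e = -1) ∧ ∀ x, geo α' β' c' t₁ (s + x) = geo α β c q.1 (e * x) := by
  obtain ⟨b, s0, ψ, ψ', r, d, hqe, hb⟩ := h.exists_graphBox hq
  obtain ⟨α, β, c, hG, h1, h2, h3, x, y, hx, hy, h4, h5⟩ := hb.exists_geod h
  have hr := hb.r_pos
  have hqe' := hqe
  rw [pt_eq_gr] at hqe'
  have hq1 : q.1 = gr₁ b ψ s0 := by rw [hqe']
  have hq2 : q.2 = gr₂ b ψ s0 := by rw [hqe']
  have hg0 : geo α β c q.1 0 = q := by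
    refine Prod.ext (geo_zero _ _ _ _) ?_
    change g₂ α β 0 = q.2
    rw [g₂, h1, ← hq2, hinv_hh hq.1]
  have hev : ∀ᶠ p : ℝ × ℝ in 𝓝 q, (pt b p.1 p.2).1 ∈ Ioo (s0 - r) (s0 + r) ∧
      |(pt b p.1 p.2).2 - ψ s0| < d := by
    have hc1 : Continuous fun p : ℝ × ℝ => (pt b p.1 p.2).1 := (continuous_pt b).fst
    have hc2 : Continuous fun p : ℝ × ℝ => |(pt b p.1 p.2).2 - ψ s0| :=
      ((continuous_pt b).snd.sub continuous_const).abs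
    have e1 : (pt b q.1 q.2).1 = s0 := by rw [hqe]; cases b <;> rfl
    have e2 : (pt b q.1 q.2).2 = ψ s0 := by rw [hqe]; cases b <;> rfl
    refine (hc1.continuousAt.eventually_mem (isOpen_Ioo.mem_nhds ?_)).and
      (hc2.continuousAt.eventually_lt_const ?_)
    · rw [e1]; exact ⟨by linarith, by linarith⟩
    · simp only [e2, sub_self, abs_zero]; exact hb.d_pos
  have hgr : ∀ p ∈ prof N, (pt b p.1 p.2).1 ∈ Ioo (s0 - r) (s0 + r) →
      |(pt b p.1 p.2).2 - ψ s0| < d → ψ (pt b p.1 p.2).1 = (pt b p.1 p.2).2 := fun p hp hp1 hp2 =>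
    (hb.iff _ (Ioo_subset_Icc_self hp1) _ hp2.le).1 (by rw [pt_pt]; exact hp)
  have hs0 : s0 ∈ Icc (s0 - r) (s0 + r) := ⟨by linarith, by linarith⟩
  refine ⟨α, β, c, hG, hg0, ⟨x, y, hx, hy, fun s hs => ?_, ?_⟩, ?_⟩
  · obtain ⟨u, hu, he⟩ := h5 s hs
    have hu' := Ioo_subset_Icc_self hu
    rw [hq1, he, ← pt_eq_gr]
    exact (hb.iff u hu' _ (hb.close u hu').le).2 rfl
  · filter_upwards [hev] with p hp hpN
    obtain ⟨s, hs, he⟩ := h4 _ hp.1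
    refine ⟨s, hs, ?_⟩
    rw [hq1, ← he, ← pt_eq_gr, hgr p hpN hp.1 hp.2, pt_pt]
  · intro α' β' c' t₁ s hG' hs hev'
    have hcont : ContinuousAt (geo α' β' c' t₁) s := hG'.continuous_geo.continuousAt
    have hev2 := hcont.eventually (hs ▸ hev)
    have hd1 := hG'.hasDerivAt_g₁ (t0 := t₁) s
    have hd2 := hG'.hasDerivAt_g₂ s
    have hs1 : g₁ α' β' c' t₁ s = gr₁ b ψ s0 := by rw [← hq1, ← hs]; rfl
    have hs2 : g₂ α' β' s = gr₂ b ψ s0 := by rw [← hq2, ← hs]; rfl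
    have hdh := hG'.dh_pos' s
    have hpar : c' * gr₂' b ψ' s0 = gz α' β' s * gr₁' b ψ' s0 := by
      cases b with
      | true =>
        have hψd := hb.deriv s0 hs0
        have he : (fun s' => ψ (g₂ α' β' s')) =ᶠ[𝓝 s] g₁ α' β' c' t₁ := by
          filter_upwards [hev', hev2] with s' h6 h7 using hgr _ h6 h7.1 h7.2
        have hc := (HasDerivAt.comp (h₂ := ψ) s (by rw [hs2]; exact hψd) hd2).congr_of_eventuallyEq
          he.symm
        have := hc.unique hd1
        simp only [gr₁', gr₂']
        field_simp at this
        linarith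
      | false =>
        have hψd := hb.deriv s0 hs0
        have he : (fun s' => ψ (g₁ α' β' c' t₁ s')) =ᶠ[𝓝 s] g₂ α' β' := by
          filter_upwards [hev', hev2] with s' h6 h7 using hgr _ h6 h7.1 h7.2
        have hc := (HasDerivAt.comp (h₂ := ψ) s (by rw [hs1]; exact hψd) hd1).congr_of_eventuallyEq
          he.symm
        have := hc.unique hd2
        simp only [gr₁', gr₂']
        field_simp at this
        linarith
    have hgy : gy α' β' s = gy α β 0 := by rw [← hG'.hh_g₂, hs2, h1]
    have e1 := gy_sq_sub hG' s
    have e2 := gy_sq_sub hG 0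
    have hz0 : gz α β 0 = α - β := by simp [gz]
    rw [hz0] at e2
    have hv : 0 < √(1 + ψ' s0 ^ 2) := by positivity
    have hp := hG.gy_pos 0
    have hpar2 : c' * (α - β) = gz α' β' s * c := by
      have : √(1 + ψ' s0 ^ 2) * (c' * (α - β)) = √(1 + ψ' s0 ^ 2) * (gz α' β' s * c) := by
        linear_combination c' * h3 - gz α' β' s * h2 + hh (gr₂ b ψ s0) * hpar
      exact mul_left_cancel₀ hv.ne' this
    rw [hgy, ← e2] at e1
    have hsame : ∃ e : ℝ, (e = 1 ∨ e = -1) ∧ c' = e * c ∧ gz α' β' s = e * (α - β) := by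
      have hp2 : 0 < (α - β) ^ 2 + c ^ 2 := by rw [e2]; positivity
      have f1 : c' ^ 2 = c ^ 2 := by
        have : ((α - β) ^ 2 + c ^ 2) * c' ^ 2 = ((α - β) ^ 2 + c ^ 2) * c ^ 2 := by
          linear_combination (c' * (α - β) + gz α' β' s * c) * hpar2 + c ^ 2 * e1
        exact mul_left_cancel₀ hp2.ne' this
      have f2 : gz α' β' s ^ 2 = (α - β) ^ 2 := by linarith
      by_cases hc0 : c = 0
      · have : c' = 0 := by rw [hc0] at f1; simpa using f1
        rcases sq_eq_sq_iff_eq_or_eq_neg.1 f2 with h6 | h6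
        · exact ⟨1, .inl rfl, by rw [this, hc0]; ring, by rw [h6]; ring⟩
        · exact ⟨-1, .inr rfl, by rw [this, hc0]; ring, by rw [h6]; ring⟩
      · rcases sq_eq_sq_iff_eq_or_eq_neg.1 f1 with h6 | h6
        · refine ⟨1, .inl rfl, by rw [h6]; ring, ?_⟩
          rw [h6] at hpar2
          exact mul_left_cancel₀ hc0 (by linarith)
        · refine ⟨-1, .inr rfl, by rw [h6]; ring, ?_⟩
          rw [h6] at hpar2
          exact mul_left_cancel₀ hc0 (by linarith)
    obtain ⟨e, he, hec, hez⟩ := hsame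
    exact ⟨e, he, hG'.geo_shift hG he (hs.trans hg0.symm) hec hez⟩

theorem IsAdmissible.geod_unique (h : IsAdmissible N n) {α β c t0 α' β' c' t₁ s s' : ℝ}
    (hG : IsGeod α β c) (hG' : IsGeod α' β' c') (hs : geo α β c t0 s = geo α' β' c' t₁ s')
    (h1 : ∀ᶠ x in 𝓝 s, geo α β c t0 x ∈ prof N) (h2 : ∀ᶠ x in 𝓝 s', geo α' β' c' t₁ x ∈ prof N) :
    ∃ e : ℝ, (e = 1 ∨ e = -1) ∧ ∀ x, geo α β c t0 (s + x) = geo α' β' c' t₁ (s' + e * x) := by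
  obtain ⟨a, b, k, -, -, -, hu⟩ := h.exists_geod h1.self_of_nhds
  obtain ⟨e, he, hx⟩ := hu _ _ _ _ _ hG rfl h1
  obtain ⟨e', he', hx'⟩ := hu _ _ _ _ _ hG' hs.symm h2
  refine ⟨e' * e, ?_, fun x => ?_⟩
  · rcases he with rfl | rfl <;> rcases he' with rfl | rfl <;> simp
  · rw [hx, hx', ← mul_assoc, ← mul_assoc]
    rcases he' with rfl | rfl <;> simp

/-- Through each point of the profile there runs a complete geodesic. -/
theorem IsAdmissible.exists_geod_subset (h : IsAdmissible N n) {q : ℝ × ℝ} (hq : q ∈ prof N) :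
    ∃ α β c, IsGeod α β c ∧ geo α β c q.1 0 = q ∧ (∀ s, geo α β c q.1 s ∈ prof N) ∧
      ∀ᶠ p in 𝓝 q, p ∈ prof N → p ∈ range (geo α β c q.1) := by
  obtain ⟨α, β, c, hG, h0, ⟨x, y, hx, hy, h1, h2⟩, -⟩ := h.exists_geod hq
  refine ⟨α, β, c, hG, h0, ?_, h2.mono fun p hp hpN => image_subset_range _ _ (hp hpN)⟩
  set A := {s | ∀ᶠ s' in 𝓝 s, geo α β c q.1 s' ∈ prof N} with hA
  have hAo : IsOpen A := isOpen_iff_eventually.2 fun s hs => eventually_eventually_nhds.2 hs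
  have hAc : IsClosed A := by
    refine isClosed_of_closure_subset fun s₁ hs₁ => ?_
    have hq1 : geo α β c q.1 s₁ ∈ prof N := h.mem_prof_of_mem_closure
      (closure_mono (t := prof N) (s := geo α β c q.1 '' A)
        (image_subset_iff.2 fun s (hs : s ∈ A) => hs.self_of_nhds)
        (image_closure_subset_closure_image hG.continuous_geo ⟨s₁, hs₁, rfl⟩)) (hG.mem s₁)
    obtain ⟨α', β', c', hG', h0', ⟨x', y', hx', hy', h1', h2'⟩, -⟩ := h.exists_geod hq1
    have hev := (hG.continuous_geo (t0 := q.1)).continuousAt.eventually h2'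
    obtain ⟨s, hs, hsA⟩ := mem_closure_iff_nhds.1 hs₁ _ hev
    obtain ⟨u, hu, hue⟩ := hs (Eventually.self_of_nhds (p := fun s' => geo α β c q.1 s' ∈ prof N) hsA)
    obtain ⟨e, he, hx⟩ := h.geod_unique hG hG' hue.symm hsA
      (eventually_of_mem (Ioo_mem_nhds hu.1 hu.2) h1')
    have h3 := hx (s₁ - s)
    rw [add_sub_cancel] at h3
    have h4 := hG'.geo_injective (h0'.trans h3)
    have h5 : ∀ v, geo α β c q.1 v = geo α' β' c' (geo α β c q.1 s₁).1 (e * (v - s₁)) := fun v => by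
      have := hx (v - s)
      rw [add_sub_cancel] at this
      rw [this]; congr 1; linarith
    have hcont : ContinuousAt (fun v => e * (v - s₁)) s₁ := by fun_prop
    have := hcont.eventually_mem (s := Ioo x' y') (by simpa using Ioo_mem_nhds hx' hy')
    exact this.mono fun v hv => by rw [h5]; exact h1' _ hv
  have h3 : A = univ := IsClopen.eq_univ ⟨hAc, hAo⟩
    ⟨0, eventually_of_mem (Ioo_mem_nhds hx hy) h1⟩
  exact fun s => (h3 ▸ mem_univ s : s ∈ A).self_of_nhds

/-- The complete geodesics that make up the profile. -/
def geods (N : Set E3) : Set (Set (ℝ × ℝ)) :=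
  {C | C ⊆ prof N ∧ ∃ α β c t0, IsGeod α β c ∧ C = range (geo α β c t0)}

theorem IsAdmissible.exists_mem_geods (h : IsAdmissible N n) {q : ℝ × ℝ} (hq : q ∈ prof N) :
    ∃ C ∈ geods N, q ∈ C ∧ ∀ᶠ p in 𝓝 q, p ∈ prof N → p ∈ C := by
  obtain ⟨α, β, c, hG, h0, h1, h2⟩ := h.exists_geod_subset hq
  exact ⟨_, ⟨range_subset_iff.2 h1, α, β, c, q.1, hG, rfl⟩, ⟨0, h0⟩, h2⟩

theorem IsAdmissible.geods_eq (h : IsAdmissible N n) {C C' : Set (ℝ × ℝ)} (hC : C ∈ geods N)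
    (hC' : C' ∈ geods N) {q : ℝ × ℝ} (hq : q ∈ C) (hq' : q ∈ C') : C = C' := by
  obtain ⟨h1, α, β, c, t0, hG, rfl⟩ := hC
  obtain ⟨h2, α', β', c', t₁, hG', rfl⟩ := hC'
  obtain ⟨s, rfl⟩ := hq
  obtain ⟨s', hs'⟩ := hq'
  have k1 : ∀ x, ∀ᶠ y in 𝓝 x, geo α β c t0 y ∈ prof N := fun x =>
    Eventually.of_forall fun y => h1 ⟨y, rfl⟩
  have k2 : ∀ x, ∀ᶠ y in 𝓝 x, geo α' β' c' t₁ y ∈ prof N := fun x =>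
    Eventually.of_forall fun y => h2 ⟨y, rfl⟩
  apply Subset.antisymm
  · obtain ⟨e, -, hx⟩ := h.geod_unique hG hG' hs'.symm (k1 _) (k2 _)
    rintro _ ⟨y, rfl⟩
    exact ⟨_, by rw [← hx (y - s), add_sub_cancel]⟩
  · obtain ⟨e, -, hx⟩ := h.geod_unique hG' hG hs' (k2 _) (k1 _)
    rintro _ ⟨y, rfl⟩
    exact ⟨_, by rw [← hx (y - s'), add_sub_cancel]⟩

/-- Only finitely many geodesics of the profile meet a given compact set. -/
theorem IsAdmissible.finite_geods_inter (h : IsAdmissible N n) {K : Set (ℝ × ℝ)} (hK : IsCompact K)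
    (hKI : ∀ q ∈ K, q.2 ∈ Iφ) : {C ∈ geods N | (C ∩ K).Nonempty}.Finite := by
  have hKc : IsCompact (prof N ∩ K) := by
    refine hK.of_isClosed_subset (isClosed_of_closure_subset fun q hq => ?_) inter_subset_right
    have hqK : q ∈ K := hK.isClosed.closure_subset_iff.2 inter_subset_right hq
    exact ⟨h.mem_prof_of_mem_closure (closure_mono inter_subset_left hq) (hKI q hqK), hqK⟩
  choose! D hD1 hD2 hD3 using fun q (hq : q ∈ prof N) => h.exists_mem_geods hq
  obtain ⟨F, hF, hcov⟩ := hKc.elim_nhds_subcover (fun q => {p | p ∈ prof N → p ∈ D q})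
    fun q hq => hD3 q hq.1
  refine (F.finite_toSet.image D).subset ?_
  rintro C ⟨hC, p, hpC, hpK⟩
  obtain ⟨q, hqF, hq⟩ := mem_iUnion₂.1 (hcov ⟨hC.1 hpC, hpK⟩)
  exact ⟨q, hqF, h.geods_eq (hD1 q (hF q hqF).1) hC (hq (hC.1 hpC)) hpC⟩

end

section

variable {α β c t0 k : ℝ}

theorem isGeod_cat (hk : 0 < k) : IsGeod (k / 2) (k / 2) k :=
  ⟨by positivity, by positivity, by positivity, by ring⟩

theorem gy_cat (k s : ℝ) : gy (k / 2) (k / 2) s = k * cosh s := by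
  rw [gy, cosh_eq]; ring

/-- Every profile geodesic is a catenary or a vertical line. -/
theorem IsGeod.range_eq (h : IsGeod α β c) :
    (∃ k > 0, ∃ t₁, range (geo α β c t0) = range (geo (k / 2) (k / 2) k t₁)) ∨
      ∃ t₁, range (geo α β c t0) = {t₁} ×ˢ Iφ := by
  by_cases hc : c = 0
  · right
    refine ⟨t0, Subset.antisymm ?_ ?_⟩
    · rintro _ ⟨s, rfl⟩
      exact ⟨by simp [geo, g₁, hc], h.mem s⟩
    · rintro ⟨t, φ⟩ ⟨rfl : t = t0, hφ⟩
      have hp := hh_pos hφ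
      have h1 : α = 0 ∨ β = 0 := by
        have := h.sq; rw [hc] at this
        exact mul_eq_zero.1 (by linarith : α * β = 0)
      have h2 : ∃ s, gy α β s = hh φ := by
        rcases h1 with h1 | h1
        · have hβ : 0 < β := by have := h.pos; linarith
          refine ⟨-log (hh φ / β), ?_⟩
          rw [gy, neg_neg, exp_log (by positivity), h1]; field_simp; ring
        · have hα : 0 < α := by have := h.pos; linarith
          refine ⟨log (hh φ / α), ?_⟩
          rw [gy, exp_log (by positivity), h1]; field_simp; ring
      obtain ⟨s, hs⟩ := h2
      refine ⟨s, Prod.ext (by simp [geo, g₁, hc]) ?_⟩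
      change g₂ α β s = φ
      rw [g₂, hs, hinv_hh hφ]
  · left
    have hαβ : 0 < α * β := by
      have := h.sq; have := sq_pos_of_ne_zero hc; linarith
    have hα : 0 < α := h.nonneg₁.lt_of_ne (by rintro rfl; simp at hαβ)
    have hβ : 0 < β := h.nonneg₂.lt_of_ne (by rintro rfl; simp at hαβ)
    set s := log (β / α) / 2 with hs
    have h1 : gz α β s = 0 := by
      have : exp s = β / α * exp (-s) := by
        rw [← exp_log (div_pos hβ hα), ← exp_add]; congr 1; rw [hs]; ring
      rw [gz, this]; field_simp; ring
    have h2 : gy α β s = |c| := by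
      have := gy_sq_sub h s
      rw [h1] at this
      rw [← abs_of_pos (h.gy_pos s), ← sq_eq_sq_iff_abs_eq_abs]; linarith
    have hk : 0 < |c| := abs_pos.2 hc
    have hG := isGeod_cat hk
    have h0 : geo α β c t0 s = geo (|c| / 2) (|c| / 2) |c| (g₁ α β c t0 s) 0 := by
      refine Prod.ext (by simp [geo, g₁]) ?_
      change g₂ α β s = g₂ (|c| / 2) (|c| / 2) 0
      rw [g₂, g₂, h2, gy_cat, cosh_zero, mul_one]
    obtain ⟨e, he, hce⟩ : ∃ e : ℝ, (e = 1 ∨ e = -1) ∧ c = e * |c| := by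
      rcases abs_choice c with h3 | h3
      · exact ⟨1, .inl rfl, by rw [h3]; ring⟩
      · exact ⟨-1, .inr rfl, by rw [h3]; ring⟩
    have hx := h.geo_shift hG he h0 hce (by rw [h1]; ring)
    refine ⟨|c|, hk, g₁ α β c t0 s, Subset.antisymm ?_ ?_⟩
    · rintro _ ⟨x, rfl⟩
      exact ⟨e * (x - s), by rw [← hx, add_sub_cancel]⟩
    · rintro _ ⟨x, rfl⟩
      refine ⟨s + e * x, ?_⟩
      rw [hx, ← mul_assoc]
      rcases he with rfl | rfl <;> simp

theorem mul_sqrt_le_dh {φ : ℝ} (h : φ ∈ Iφ) : hh φ * √(hh φ) ≤ dh φ := by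
  have hc := cos_pos_of_mem h
  have h1 : hh φ ≤ (cos φ ^ 2)⁻¹ := by
    rw [hh, ← one_div]; gcongr; exact sin_le_one φ
  have h2 : √(hh φ) ≤ (cos φ)⁻¹ :=
    sqrt_le_iff.2 ⟨by positivity, by rw [inv_pow]; exact h1⟩
  refine le_trans ?_ (inv_cos_cube_le_dh h)
  calc hh φ * √(hh φ) ≤ (cos φ ^ 2)⁻¹ * (cos φ)⁻¹ := by gcongr
    _ = (cos φ ^ 3)⁻¹ := by rw [← mul_inv]; ring_nf

theorem tendsto_hh : Tendsto hh (𝓝[<] (π / 2)) atTop := by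
  have h1 : Tendsto (fun φ => cos φ ^ 2) (𝓝[<] (π / 2)) (𝓝[>] 0) := by
    refine tendsto_nhdsWithin_iff.2 ⟨?_, ?_⟩
    · have : ContinuousAt (fun φ => cos φ ^ 2) (π / 2) := by fun_prop
      simpa using this.tendsto.mono_left nhdsWithin_le_nhds
    · filter_upwards [Ioo_mem_nhdsLT (by positivity : (0 : ℝ) < π / 2)] with φ hφ
      exact pow_pos (cos_pos_of_mem hφ) 2
  have h2 : Tendsto sin (𝓝[<] (π / 2)) (𝓝 1) := by
    simpa using continuous_sin.continuousAt.tendsto.mono_left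
      (nhdsWithin_le_nhds (a := π / 2) (s := Iio (π / 2)))
  exact (h2.pos_mul_atTop one_pos (tendsto_inv_nhdsGT_zero.comp h1)).congr fun φ => rfl

/-- Slope of `t` along the catenary with parameter `k`. -/
def cf (k s : ℝ) : ℝ := k / dh (g₂ (k / 2) (k / 2) s)

/-- Displacement in `t` along the catenary with parameter `k`, counted from the neck. -/
def cq (k s : ℝ) : ℝ := ∫ x in (0 : ℝ)..s, cf k x

/-- Half of the distance between the two ends of the catenary with parameter `k`. -/
def cT (k : ℝ) : ℝ := ∫ x in Ioi (0 : ℝ), cf k x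

theorem geo_cat (k t₁ s : ℝ) : geo (k / 2) (k / 2) k t₁ s = (t₁ + cq k s, hinv (k * cosh s)) := by
  rw [geo, g₁, g₂, gy_cat]; rfl

theorem continuous_cf (hk : 0 < k) : Continuous (cf k) := (isGeod_cat hk).continuous_div_dh

theorem cf_pos (hk : 0 < k) (s : ℝ) : 0 < cf k s := div_pos hk ((isGeod_cat hk).dh_pos' s)

theorem inv_cosh_le (s : ℝ) : (cosh s)⁻¹ ≤ 2 * exp (-s) := by
  have h1 := exp_pos s
  rw [exp_neg, ← div_eq_mul_inv, inv_le_comm₀ (cosh_pos s) (by positivity), inv_div,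
    cosh_eq]
  have := exp_pos (-s)
  linarith

theorem sqrt_mul_cf_le (hk : 0 < k) (s : ℝ) : √(k * cosh s) * cf k s ≤ (cosh s)⁻¹ := by
  have hG := isGeod_cat hk
  have h1 := mul_sqrt_le_dh (hG.mem s)
  rw [hG.hh_g₂, gy_cat] at h1
  have h2 := hG.dh_pos' s
  have h3 := cosh_pos s
  rw [cf, ← one_div, mul_div_assoc', div_le_div_iff₀ h2 h3]
  linarith

theorem cf_le (hk : 0 < k) (s : ℝ) : cf k s ≤ (cosh s)⁻¹ := by
  have hG := isGeod_cat hk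
  have h1 := hh_le_dh (hG.mem s)
  rw [hG.hh_g₂, gy_cat] at h1
  rw [cf, ← one_div, div_le_div_iff₀ (hG.dh_pos' s) (cosh_pos s)]
  linarith

theorem integrableOn_two_exp (S : ℝ) : IntegrableOn (fun x => 2 * exp (-x)) (Ioi S) := by
  have := (exp_neg_integrableOn_Ioi S one_pos).const_mul 2
  simpa [IntegrableOn] using this

theorem integrableOn_cf (hk : 0 < k) (S : ℝ) : IntegrableOn (cf k) (Ioi S) :=
  (integrableOn_two_exp S).mono' (continuous_cf hk).aestronglyMeasurable <|
    Eventually.of_forall fun x => by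
      rw [norm_of_nonneg (cf_pos hk x).le]
      exact (cf_le hk x).trans (inv_cosh_le x)

theorem cq_neg (k s : ℝ) : cq k (-s) = -cq k s := by
  have h : ∀ x, cf k (-x) = cf k x := fun x => by
    rw [cf, cf, g₂, g₂, gy_cat, gy_cat, cosh_neg]
  have h1 := intervalIntegral.integral_comp_neg (f := cf k) (a := 0) (b := s)
  simp only [h, neg_zero] at h1
  rw [cq, cq, h1, intervalIntegral.integral_symm]

theorem cT_sub_cq (hk : 0 < k) (S : ℝ) : cT k - cq k S = ∫ x in Ioi S, cf k x := by
  rw [cT, cq, sub_eq_iff_eq_add,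
    ← intervalIntegral.integral_interval_add_Ioi (integrableOn_cf hk 0) (integrableOn_cf hk S),
    add_comm]

theorem cT_sub_cq_nonneg (hk : 0 < k) (S : ℝ) : 0 ≤ cT k - cq k S := by
  rw [cT_sub_cq hk]
  exact setIntegral_nonneg measurableSet_Ioi fun x _ => (cf_pos hk x).le

theorem cT_sub_cq_le (hk : 0 < k) (S : ℝ) : cT k - cq k S ≤ 2 * exp (-S) := by
  rw [cT_sub_cq hk, ← integral_exp_neg_Ioi S, ← integral_const_mul]
  exact setIntegral_mono_on (integrableOn_cf hk S) (integrableOn_two_exp S) measurableSet_Ioi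
    fun x _ => (cf_le hk x).trans (inv_cosh_le x)

theorem sqrt_mul_cT_sub_cq_le (hk : 0 < k) {S : ℝ} (hS : 0 ≤ S) :
    √(k * cosh S) * (cT k - cq k S) ≤ 2 * exp (-S) := by
  rw [cT_sub_cq hk, ← integral_exp_neg_Ioi S, ← integral_const_mul, ← integral_const_mul]
  refine setIntegral_mono_on ((integrableOn_cf hk S).const_mul _) (integrableOn_two_exp S)
    measurableSet_Ioi fun x hx => ?_
  refine le_trans ?_ ((sqrt_mul_cf_le hk x).trans (inv_cosh_le x))
  have h1 : cosh S ≤ cosh x := cosh_le_cosh.2 (by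
    rw [abs_of_nonneg hS, abs_of_nonneg (hS.trans hx.le)]; exact hx.le)
  have := cf_pos hk x
  gcongr

theorem cq_nonneg (hk : 0 < k) {S : ℝ} (hS : 0 ≤ S) : 0 ≤ cq k S :=
  intervalIntegral.integral_nonneg hS fun x _ => (cf_pos hk x).le

theorem cT_pos (hk : 0 < k) : 0 < cT k := by
  have h1 : 0 < cq k 1 := intervalIntegral.intervalIntegral_pos_of_pos_on
    ((continuous_cf hk).intervalIntegrable 0 1) (fun x _ => cf_pos hk x) one_pos
  have := cT_sub_cq_nonneg hk 1
  linarith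

theorem cT_le (hk : 0 < k) : cT k ≤ 2 := by
  have := cT_sub_cq_le hk 0
  simpa [cq] using this

theorem sqrt_mul_cT_le (hk : 0 < k) : √k * cT k ≤ 2 := by
  have := sqrt_mul_cT_sub_cq_le hk le_rfl
  simpa [cq] using this

theorem abs_cq_le (hk : 0 < k) (s : ℝ) : |cq k s| ≤ cT k := by
  rcases le_total 0 s with hs | hs
  · rw [abs_of_nonneg (cq_nonneg hk hs)]; linarith [cT_sub_cq_nonneg hk s]
  · have h1 := cq_nonneg hk (neg_nonneg.2 hs)
    have h2 := cT_sub_cq_nonneg hk (-s)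
    rw [cq_neg] at h1 h2
    rw [abs_of_nonpos (by linarith)]; linarith

/-- The part of the ball over a set of profile coordinates. -/
def spin (C : Set (ℝ × ℝ)) : Set E3 := {x ∈ B \ Z | (tc x, phc x) ∈ C}

theorem P_mem_spin {C : Set (ℝ × ℝ)} {t φ : ℝ} (hφ : φ ∈ Iφ) (θ : ℝ) :
    P t φ θ ∈ spin C ↔ (t, φ) ∈ C := by
  simp only [spin, mem_ofPred_eq, P_mem hφ, tc_P hφ, phc_P hφ, true_and]

theorem rev_eq_spin {γ₁ γ₂ : ℝ → ℝ} {a b : ℝ} (h : ∀ s ∈ Ioo a b, γ₂ s ∈ Iφ) :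
    rev γ₁ γ₂ a b = spin ((fun s => (γ₁ s, γ₂ s)) '' Ioo a b) := by
  ext x
  constructor
  · rintro ⟨s, hs, θ, rfl⟩
    exact (P_mem_spin (h s hs) θ).2 ⟨s, hs, rfl⟩
  · rintro ⟨hx, s, hs, he⟩
    obtain ⟨θ, -, hθ⟩ := P_surj hx
    simp only [Prod.mk.injEq] at he
    exact ⟨s, hs, θ, by rw [he.1, he.2]; exact hθ⟩

theorem spin_mono {C D : Set (ℝ × ℝ)} (h : C ⊆ D) : spin C ⊆ spin D := fun _ hx => ⟨hx.1, h hx.2⟩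

theorem measurableSet_spin {C : Set (ℝ × ℝ)} (hC : MeasurableSet C) : MeasurableSet (spin C) := by
  have h1 : Measurable ((B \ Z).domRestrict fun x => (tc x, phc x)) :=
    (continuousOn_iff_continuous_domRestrict.1
      (contDiffOn_tc.continuousOn.prodMk contDiffOn_phc.continuousOn)).measurable
  have h2 : spin C = Subtype.val '' (((B \ Z).domRestrict fun x => (tc x, phc x)) ⁻¹' C) := by
    ext x
    simp [spin, Set.domRestrict]
    tauto
  rw [h2]
  exact (MeasurableEmbedding.subtype_coe isOpen_B_diff_Z.measurableSet).measurableSet_image.2 (h1 hC)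

theorem measurableSet_of_mem_geods {N : Set E3} {C : Set (ℝ × ℝ)} (hC : C ∈ geods N) :
    MeasurableSet C := by
  obtain ⟨-, α, β, c, t0, hG, rfl⟩ := hC
  rw [← image_univ, ← iUnion_Icc_add_intCast (0 : ℝ), image_iUnion]
  exact MeasurableSet.iUnion fun m => (isCompact_Icc.image hG.continuous_geo).measurableSet

theorem IsAdmissible.eq_spin {N : Set E3} {n : E3 → E3} (h : IsAdmissible N n) :
    N = spin (prof N) := by
  ext x
  constructor
  · intro hx
    obtain ⟨θ, -, hθ⟩ := P_surj (h.subset hx)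
    have h1 := phc_mem (h.subset hx)
    rw [hθ] at hx ⊢
    rw [P_mem_spin h1]
    exact (h.P_mem_iff h1 θ).1 hx
  · rintro ⟨hx, hp⟩
    obtain ⟨θ, -, hθ⟩ := P_surj hx
    rw [hθ]
    exact (h.P_mem_iff (phc_mem hx) θ).2 hp

end

section

variable {N : Set E3} {n : E3 → E3} {α β c t0 k : ℝ}

/-- Behaviour of a profile geodesic `C` near the ideal boundary: it has ends at `τ b`, which it
approaches along `u b`, and its oriented boundary at the level `Φ` is the sum of the circles through
`u b Φ` with the weights `w b`. -/
structure IsEndData (n : E3 → E3) (C : Set (ℝ × ℝ)) (w : Bool → ℤ) (τ : Bool → ℝ)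
    (u : Bool → ℝ → ℝ) (Φ₀ : ℝ) : Prop where
  mem₀ : Φ₀ ∈ Iφ
  iff : ∀ Φ ∈ Ioo Φ₀ (π / 2), ∀ t, (t, Φ) ∈ C ↔ ∃ b, t = u b Φ
  small : ∀ b, Tendsto (fun Φ => hh Φ * |u b Φ - τ b|) (𝓝[<] (π / 2)) (𝓝 0)
  bound : ∀ q ∈ C, |q.1 - τ true| ≤ 4
  cross : ∀ Φ ∈ Iφ, (∃ t, (t, Φ) ∈ C) ∨
    (τ true ≠ τ false ∧ |τ true - τ false| * √(hh Φ) ≤ 4)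
  cross_of_le : ∀ q ∈ C, ∀ Φ ∈ Iφ, q.2 ≤ Φ → ∃ t, (t, Φ) ∈ C
  measure : μHE[2] (spin C) < ⊤
  area : ∀ Φ ∈ Iφ, hypArea (spin (C ∩ {q | q.2 < Φ})) < ⊤
  flux : ∀ Φ ∈ Ioo Φ₀ (π / 2), ∀ Y, IsTestField Y →
    ∫ x in spin (C ∩ {q | q.2 < Φ}), ⟪curl Y x, n x⟫ ∂μHE[2] = ∑ b, (w b : ℝ) * circ Y (u b Φ) Φ

theorem IsGeod.continuous_speed (h : IsGeod α β c) :
    Continuous (speed (fun s => c / dh (g₂ α β s)) (fun s => gz α β s / dh (g₂ α β s))) := by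
  have : Continuous (gy α β) := continuous_iff_continuousAt.2 fun s =>
    (hasDerivAt_gy α β s).continuousAt
  exact (this.div h.continuous_dh fun s => (h.dh_pos' s).ne').congr fun s => (h.speed_eq s).symm

theorem lintegral_lt_top_of_continuousOn {f : ℝ → ℝ} {a b : ℝ} (hf : ContinuousOn f (Icc a b)) :
    ∫⁻ s in Ioo a b, ofReal (f s) < ⊤ :=
  Integrable.lintegral_lt_top (hf.integrableOn_Icc.mono_set Ioo_subset_Icc_self)

theorem IsGeod.hypArea_lt_top (h : IsGeod α β c) (a b : ℝ) :
    hypArea (rev (g₁ α β c t0) (g₂ α β) a b) < ⊤ := by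
  rw [(h.isProfile a b).hypArea_rev]
  refine ENNReal.mul_lt_top ENNReal.ofReal_lt_top (lintegral_lt_top_of_continuousOn ?_)
  exact ((continuousOn_hh.comp_continuous h.continuous_g₂ h.mem).mul h.continuous_speed).continuousOn

theorem IsAdmissible.exists_sign_geo (h : IsAdmissible N n) (hG : IsGeod α β c)
    (hs : ∀ s, geo α β c t0 s ∈ prof N) : ∃ σ : ℤ, ∀ a b, ∀ s ∈ Ioo a b, ∀ θ,
      n (P (g₁ α β c t0 s) (g₂ α β s) θ) =
        ((σ : ℝ) / speed (fun s => c / dh (g₂ α β s)) (fun s => gz α β s / dh (g₂ α β s)) s) •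
        ((gz α β s / dh (g₂ α β s)) • et (g₁ α β c t0 s) (g₂ α β s) θ -
          (c / dh (g₂ α β s)) • ep (g₁ α β c t0 s) (g₂ α β s) θ) := by
  have key : ∀ m : ℝ, ∃ σ : ℤ, ∀ s ∈ Ioo (-m) m, ∀ θ, n (P (g₁ α β c t0 s) (g₂ α β s) θ) =
        ((σ : ℝ) / speed (fun s => c / dh (g₂ α β s)) (fun s => gz α β s / dh (g₂ α β s)) s) •
        ((gz α β s / dh (g₂ α β s)) • et (g₁ α β c t0 s) (g₂ α β s) θ -
          (c / dh (g₂ α β s)) • ep (g₁ α β c t0 s) (g₂ α β s) θ) := fun m => by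
    obtain ⟨σ, hσ, h1⟩ := h.exists_sign (hG.isProfile (t0 := t0) (-m) m) fun s _ => hs s
    rcases hσ with rfl | rfl
    · exact ⟨1, by simpa using h1⟩
    · exact ⟨-1, by simpa using h1⟩
  choose σ hσ using key
  refine ⟨σ 1, fun a b s _ θ => ?_⟩
  have hm : σ (|s| + 1) = σ 1 := by
    have e1 := hσ 1 0 ⟨by norm_num, by norm_num⟩ 0
    have hp : 0 < |s| + 1 := by positivity
    rw [hσ (|s| + 1) 0 ⟨by linarith, hp⟩ 0] at e1
    have hpr := hG.isProfile (t0 := t0) (-1) 1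
    have h0 : (0 : ℝ) ∈ Ioo (-1 : ℝ) 1 := ⟨by norm_num, by norm_num⟩
    have hsp := hpr.speed_pos h0
    set v := ((gz α β 0 / dh (g₂ α β 0)) • et (g₁ α β c t0 0) (g₂ α β 0) 0 -
          (c / dh (g₂ α β 0)) • ep (g₁ α β c t0 0) (g₂ α β 0) 0) with hv
    have hv0 : v ≠ 0 := by
      intro hv0
      have h2 : ⟪v, v⟫ = 0 := by rw [hv0, inner_zero_left]
      have hc := (cos_pos_of_mem (hG.mem 0)).le
      rw [hv] at h2
      simp only [inner_sub_left, inner_sub_right, inner_smul_left, inner_smul_right, inner_et_ep,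
        inner_ep_et, inner_et_et hc, inner_ep_ep hc, RCLike.conj_to_real] at h2
      have := hpr.regular 0 h0
      nlinarith
    have e2 := smul_left_injective ℝ hv0 e1
    rw [div_left_inj' hsp.ne'] at e2
    exact_mod_cast e2
  have := hσ (|s| + 1) s ⟨by linarith [neg_abs_le s], by linarith [le_abs_self s]⟩ θ
  rwa [hm] at this

theorem one_add_sq_le_sqrt_cosh (s : ℝ) : 1 + s ^ 2 ≤ 10 * √(cosh s) := by
  have h1 : s ^ 4 ≤ 48 * cosh s := by
    have h2 := pow_div_factorial_le_exp |s| (abs_nonneg s) 4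
    have h3 : exp |s| ≤ 2 * cosh s := by
      rw [← cosh_abs, cosh_eq]
      have := exp_pos (-|s|)
      linarith
    have h4 : |s| ^ 4 = s ^ 4 := by rw [← abs_pow, abs_of_nonneg (by positivity)]
    rw [h4] at h2
    norm_num [Nat.factorial] at h2
    linarith
  have h5 := one_le_cosh s
  refine (sq_le_sq₀ (by positivity) (by positivity)).1 ?_
  rw [mul_pow, sq_sqrt (by linarith)]
  nlinarith [sq_nonneg (s ^ 2 - 1)]

theorem measure_cat_lt_top (hk : 0 < k) (t₁ : ℝ) :
    μHE[2] (spin (range (geo (k / 2) (k / 2) k t₁))) < ⊤ := by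
  have hG := isGeod_cat hk
  have h1 : spin (range (geo (k / 2) (k / 2) k t₁)) =
      ⋃ m : ℕ, rev (g₁ (k / 2) (k / 2) k t₁) (g₂ (k / 2) (k / 2)) (-m) m := by
    ext x
    constructor
    · rintro ⟨hx, s, hs⟩
      obtain ⟨m, hm⟩ := exists_nat_gt |s|
      refine mem_iUnion.2 ⟨m, ?_⟩
      rw [rev_eq_spin fun s _ => hG.mem s]
      exact ⟨hx, s, abs_lt.1 hm, hs⟩
    · intro hx
      obtain ⟨m, hm⟩ := mem_iUnion.1 hx
      rw [rev_eq_spin fun s _ => hG.mem s] at hm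
      obtain ⟨hx, s, -, hs⟩ := hm
      exact ⟨hx, s, hs⟩
  have hmono : Monotone fun m : ℕ =>
      rev (g₁ (k / 2) (k / 2) k t₁) (g₂ (k / 2) (k / 2)) (-m) m := fun i j hij => by
    rintro x ⟨s, hs, θ, rfl⟩
    have : (i : ℝ) ≤ j := by exact_mod_cast hij
    exact ⟨s, ⟨by linarith [hs.1], by linarith [hs.2]⟩, θ, rfl⟩
  rw [h1, hmono.measure_iUnion]
  have hi : Integrable fun s : ℝ => 10 / √k * (1 + s ^ 2)⁻¹ := integrable_inv_one_add_sq.const_mul _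
  refine lt_of_le_of_lt (iSup_le fun m => ?_) (ENNReal.mul_lt_top
    (ENNReal.ofReal_lt_top (r := 2 * π)) (Integrable.lintegral_lt_top hi))
  refine (hG.isProfile (-m) m).measure_rev_le.trans ?_
  gcongr 1
  refine (setLIntegral_le_lintegral _ _).trans (lintegral_mono fun s => ENNReal.ofReal_le_ofReal ?_)
  have h2 := mul_sqrt_le_dh (hG.mem s)
  have h3 := hG.gy_pos s
  have h4 := one_add_sq_le_sqrt_cosh s
  rw [hG.hh_g₂] at h2
  rw [hG.speed_eq, div_mul_eq_mul_div, le_div_iff₀ (by positivity)]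
  rw [div_mul_eq_mul_div, div_le_iff₀ (hG.dh_pos' s), ← div_eq_mul_inv, div_mul_eq_mul_div,
    le_div_iff₀ (by positivity)]
  calc gy (k / 2) (k / 2) s * √k * (1 + s ^ 2) ≤ gy (k / 2) (k / 2) s * √k * (10 * √(cosh s)) := by
        gcongr
    _ = 10 * (gy (k / 2) (k / 2) s * √(gy (k / 2) (k / 2) s)) := by
        rw [gy_cat, sqrt_mul hk.le]; ring
    _ ≤ 10 * dh (g₂ (k / 2) (k / 2) s) := by gcongr

theorem cat_trunc (hk : 0 < k) (t₁ : ℝ) {Φ : ℝ} (hΦ : Φ ∈ Iφ) (hkΦ : k < hh Φ) :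
    spin (range (geo (k / 2) (k / 2) k t₁) ∩ {q | q.2 < Φ}) =
      rev (g₁ (k / 2) (k / 2) k t₁) (g₂ (k / 2) (k / 2)) (-arcosh (hh Φ / k))
        (arcosh (hh Φ / k)) := by
  have hG := isGeod_cat hk
  have h1 : 1 ≤ hh Φ / k := (one_le_div hk).2 hkΦ.le
  have hS := arcosh_nonneg h1
  have hiff : ∀ s, g₂ (k / 2) (k / 2) s < Φ ↔ s ∈ Ioo (-arcosh (hh Φ / k))
      (arcosh (hh Φ / k)) := fun s => by
    rw [← hh_strictMonoOn.lt_iff_lt (hG.mem s) hΦ, hG.hh_g₂, gy_cat, ← lt_div_iff₀' hk, mem_Ioo,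
      ← abs_lt, ← abs_of_nonneg hS, ← cosh_lt_cosh, cosh_arcosh h1]
  rw [rev_eq_spin fun s _ => hG.mem s]
  congr 1
  ext q
  constructor
  · rintro ⟨⟨s, rfl⟩, hs⟩
    exact ⟨s, (hiff s).1 hs, rfl⟩
  · rintro ⟨s, hs, rfl⟩
    exact ⟨⟨s, rfl⟩, (hiff s).2 hs⟩

/-- End data of a catenary. -/
theorem IsAdmissible.exists_endData_cat (h : IsAdmissible N n) (hk : 0 < k) {t₁ : ℝ}
    (hs : ∀ s, geo (k / 2) (k / 2) k t₁ s ∈ prof N) :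
    ∃ w τ u Φ₀, IsEndData n (range (geo (k / 2) (k / 2) k t₁)) w τ u Φ₀ := by
  have hG := isGeod_cat hk
  obtain ⟨σ, hσ⟩ := h.exists_sign_geo hG hs
  have hbig : ∀ Φ ∈ Ioo (hinv k) (π / 2), Φ ∈ Iφ ∧ k < hh Φ := fun Φ hΦ => by
    have h1 : Φ ∈ Iφ := ⟨(hinv_mem hk).1.trans hΦ.1, hΦ.2⟩
    refine ⟨h1, ?_⟩
    have := hh_strictMonoOn (hinv_mem hk) h1 hΦ.1
    rwa [hh_hinv hk] at this
  have hcross : ∀ Φ ∈ Iφ, k ≤ hh Φ → ∀ s, k * cosh s = hh Φ →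
      geo (k / 2) (k / 2) k t₁ s = (t₁ + cq k s, Φ) := fun Φ hΦ hkΦ s hs => by
    rw [geo_cat, hs, hinv_hh hΦ]
  have hch : ∀ Φ, k ≤ hh Φ → k * cosh (arcosh (hh Φ / k)) = hh Φ := fun Φ hΦ => by
    rw [cosh_arcosh ((one_le_div hk).2 hΦ)]; field_simp
  have hTp := cT_pos hk
  refine ⟨fun b => cond b σ (-σ), fun b => cond b (t₁ + cT k) (t₁ - cT k),
    fun b Φ => cond b (t₁ + cq k (arcosh (hh Φ / k))) (t₁ - cq k (arcosh (hh Φ / k))),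
    hinv k, hinv_mem hk, fun Φ hΦ t => ⟨?_, ?_⟩, fun b => ?_, ?_, fun Φ hΦ => ?_, ?_,
    measure_cat_lt_top hk t₁, fun Φ hΦ => ?_, fun Φ hΦ Y hY => ?_⟩
  · rintro ⟨s, hs⟩
    obtain ⟨h1, h2⟩ := hbig Φ hΦ
    rw [geo_cat, Prod.mk.injEq] at hs
    have h3 : k * cosh s = hh Φ := by
      rw [← hs.2, hh_hinv (mul_pos hk (cosh_pos s))]
    have h4 : arcosh (hh Φ / k) = |s| := by
      rw [← h3, mul_div_cancel_left₀ _ hk.ne', ← cosh_abs, arcosh_cosh (abs_nonneg s)]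
    rcases le_total 0 s with h5 | h5
    · exact ⟨true, by simp only [cond_true]; rw [h4, abs_of_nonneg h5, hs.1]⟩
    · exact ⟨false, by simp only [cond_false]; rw [h4, abs_of_nonpos h5, cq_neg, ← hs.1]; ring⟩
  · obtain ⟨h1, h2⟩ := hbig Φ hΦ
    rintro ⟨b, rfl⟩
    cases b
    · refine ⟨-arcosh (hh Φ / k), ?_⟩
      rw [hcross Φ h1 h2.le _ (by rw [cosh_neg]; exact hch Φ h2.le), cq_neg]
      simp only [cond_false]; congr 1
    · exact ⟨arcosh (hh Φ / k), hcross Φ h1 h2.le _ (hch Φ h2.le)⟩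
  · have hlim : Tendsto (fun Φ => 2 * k / √(hh Φ)) (𝓝[<] (π / 2)) (𝓝 0) :=
      (tendsto_sqrt_atTop.comp tendsto_hh).const_div_atTop _
    refine squeeze_zero' ?_ ?_ hlim
    · filter_upwards [Ioo_mem_nhdsLT (hinv_mem hk).2] with Φ hΦ
      exact mul_nonneg (hh_pos (hbig Φ hΦ).1).le (abs_nonneg _)
    · filter_upwards [Ioo_mem_nhdsLT (hinv_mem hk).2] with Φ hΦ
      obtain ⟨h1, h2⟩ := hbig Φ hΦ
      set S := arcosh (hh Φ / k)
      have hS : 0 ≤ S := arcosh_nonneg ((one_le_div hk).2 h2.le)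
      have e1 : k * cosh S = hh Φ := hch Φ h2.le
      have e2 := sqrt_mul_cT_sub_cq_le hk hS
      have e3 := cT_sub_cq_nonneg hk S
      have e4 : exp (-S) ≤ k / hh Φ := by
        rw [← e1, ← div_div, div_self hk.ne', one_div, exp_neg]
        gcongr
        rw [cosh_eq]
        have : exp (-S) ≤ exp S := exp_le_exp.2 (by linarith)
        linarith
      have e5 : |(cond b (t₁ + cq k S) (t₁ - cq k S)) - cond b (t₁ + cT k) (t₁ - cT k)| =
          cT k - cq k S := by
        cases b
        · simp only [cond_false]; rw [abs_of_nonneg (by linarith)]; ring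
        · simp only [cond_true]; rw [abs_of_nonpos (by linarith)]; ring
      have hp := hh_pos h1
      rw [e5, le_div_iff₀ (by positivity)]
      rw [e1] at e2
      have e6 := mul_le_mul_of_nonneg_left (e2.trans (mul_le_mul_of_nonneg_left e4 zero_le_two))
        hp.le
      have e7 : hh Φ * (2 * (k / hh Φ)) = 2 * k := by field_simp
      linarith
  · rintro _ ⟨s, rfl⟩
    have h1 := abs_cq_le hk s
    have h2 := cT_le hk
    rw [geo_cat]
    simp only [cond_true]
    rw [abs_le] at h1 ⊢
    constructor <;> linarith [h1.1, h1.2]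
  · rcases le_or_gt k (hh Φ) with h1 | h1
    · exact .inl ⟨_, _, hcross Φ hΦ h1 _ (hch Φ h1)⟩
    · refine .inr ⟨by simp only [cond_true, cond_false]; linarith, ?_⟩
      simp only [cond_true, cond_false]
      rw [abs_of_nonneg (by linarith)]
      have h2 := sqrt_mul_cT_le hk
      have h3 : √(hh Φ) ≤ √k := sqrt_le_sqrt h1.le
      nlinarith
  · rintro _ ⟨s, rfl⟩ Φ hΦ hle
    have h1 : k ≤ hh Φ := by
      have h2 := hh_strictMonoOn.monotoneOn (hG.mem s) hΦ hle
      rw [hG.hh_g₂, gy_cat] at h2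
      nlinarith [one_le_cosh s]
    exact ⟨_, _, hcross Φ hΦ h1 _ (hch Φ h1)⟩
  · rcases lt_or_ge k (hh Φ) with h1 | h1
    · rw [cat_trunc hk t₁ hΦ h1]; exact hG.hypArea_lt_top _ _
    · have : spin (range (geo (k / 2) (k / 2) k t₁) ∩ {q | q.2 < Φ}) = ∅ := by
        refine eq_empty_of_forall_notMem ?_
        rintro x ⟨-, ⟨s, hs⟩, hx⟩
        rw [← hs] at hx
        have h2 := hh_strictMonoOn (hG.mem s) hΦ hx
        rw [hG.hh_g₂, gy_cat] at h2
        nlinarith [one_le_cosh s]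
      rw [this, hypArea, Measure.restrict_empty, lintegral_zero_measure]
      exact ENNReal.zero_lt_top
  · obtain ⟨h1, h2⟩ := hbig Φ hΦ
    rw [cat_trunc hk t₁ h1 h2]
    set S := arcosh (hh Φ / k)
    have hS : 0 < S := arcosh_pos ((one_lt_div hk).2 h2)
    have e1 : k * cosh S = hh Φ := hch Φ h2.le
    have hS1 := hcross Φ h1 h2.le S e1
    have hS2 := hcross Φ h1 h2.le (-S) (by rw [cosh_neg]; exact e1)
    have hc := (cos_pos_of_mem h1).le
    have hcont : Continuous (geo (k / 2) (k / 2) k t₁) := hG.continuous_geo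
    have hc1 : ∀ {s t F}, geo (k / 2) (k / 2) k t₁ s = (t, Φ) → F ≤ 𝓝 s →
        Tendsto (g₁ (k / 2) (k / 2) k t₁) F (𝓝 t) := fun {s t F} he hF => by
      have := (hcont.fst.tendsto s).mono_left hF
      rwa [he] at this
    have hc2 : ∀ {s t F}, geo (k / 2) (k / 2) k t₁ s = (t, Φ) → F ≤ 𝓝 s →
        Tendsto (g₂ (k / 2) (k / 2)) F (𝓝 Φ) := fun {s t F} he hF => by
      have := (hcont.snd.tendsto s).mono_left hF
      rwa [he] at this
    have := ((hG.isProfile (t0 := t₁) (-S) S).stokes hY (by linarith)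
      (hG.continuous_speed.continuousOn.integrableOn_Icc.mono_set Ioo_subset_Icc_self) hc hc
      (hc1 hS2 nhdsWithin_le_nhds) (hc2 hS2 nhdsWithin_le_nhds) (hc1 hS1 nhdsWithin_le_nhds)
      (hc2 hS1 nhdsWithin_le_nhds) (hσ (-S) S)).2
    rw [this, Fintype.sum_bool, cq_neg]
    simp only [cond_true, cond_false, Int.cast_neg]
    rw [← sub_eq_add_neg]; ring

/-- End data of a vertical line. -/
theorem IsAdmissible.exists_endData_line (h : IsAdmissible N n) {t₁ : ℝ}
    (hs : {t₁} ×ˢ Iφ ⊆ prof N) : ∃ w τ u Φ₀, IsEndData n ({t₁} ×ˢ Iφ) w τ u Φ₀ := by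
  have hpi : 0 < π / 2 := by positivity
  have hprof : ∀ Φ ≤ π / 2, IsProfile (fun _ => t₁) (fun s => s) (fun _ => 0) (fun _ => 1) 0 Φ :=
    fun Φ hΦ => ⟨fun s _ => hasDerivAt_const _ _, fun s _ => hasDerivAt_id s, continuousOn_const,
      continuousOn_const, fun s hs => ⟨hs.1, hs.2.trans_le hΦ⟩, fun s _ => by norm_num,
      fun s _ s' _ _ h => h⟩
  have hspeed : ∀ s, speed (fun _ => 0) (fun _ => 1) s = 1 := fun s => by simp [speed]
  have htr : ∀ Φ ≤ π / 2, spin ({t₁} ×ˢ Iφ ∩ {q | q.2 < Φ}) =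
      rev (fun _ => t₁) (fun s => s) 0 Φ := fun Φ hΦ => by
    rw [rev_eq_spin (hprof Φ hΦ).mem]
    congr 1
    ext ⟨t, φ⟩
    constructor
    · rintro ⟨⟨rfl : t = t₁, h1⟩, h2⟩
      exact ⟨φ, ⟨h1.1, h2⟩, rfl⟩
    · rintro ⟨s, hs, he⟩
      rw [Prod.mk.injEq] at he
      obtain ⟨rfl, rfl⟩ := he
      exact ⟨⟨rfl, hs.1, hs.2.trans_le hΦ⟩, hs.2⟩
  obtain ⟨σ, hσ, hn⟩ := h.exists_sign (hprof _ le_rfl) fun s hs' => hs ⟨rfl, hs'⟩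
  obtain ⟨z, hz⟩ : ∃ z : ℤ, (z : ℝ) = σ := by
    rcases hσ with rfl | rfl
    exacts [⟨1, by simp⟩, ⟨-1, by simp⟩]
  refine ⟨fun b => cond b z 0, fun _ => t₁, fun _ _ => t₁, hinv 1, hinv_mem one_pos,
    fun Φ hΦ t => ⟨fun h => ⟨true, h.1⟩, ?_⟩, fun b => ?_, ?_, fun Φ hΦ => .inl ⟨t₁, rfl, hΦ⟩,
    fun _ _ Φ hΦ _ => ⟨t₁, rfl, hΦ⟩, ?_,
    fun Φ hΦ => ?_, fun Φ hΦ Y hY => ?_⟩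
  · rintro ⟨-, rfl⟩
    exact ⟨rfl, (hinv_mem one_pos).1.trans hΦ.1, hΦ.2⟩
  · simp
  · rintro q ⟨h1, -⟩
    rw [mem_singleton_iff.1 h1]; simp
  · have : spin ({t₁} ×ˢ Iφ) = rev (fun _ => t₁) (fun s => s) 0 (π / 2) := by
      rw [← htr _ le_rfl]
      congr 1
      exact (inter_eq_left.2 fun q hq => hq.2.2).symm
    rw [this]
    refine (hprof _ le_rfl).measure_rev_le.trans_lt
      (ENNReal.mul_lt_top ENNReal.ofReal_lt_top (lintegral_lt_top_of_continuousOn ?_))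
    exact continuousOn_const.congr fun s _ => hspeed s
  · rw [htr _ hΦ.2.le, (hprof _ hΦ.2.le).hypArea_rev]
    refine ENNReal.mul_lt_top ENNReal.ofReal_lt_top (lintegral_lt_top_of_continuousOn ?_)
    refine ContinuousOn.mul (ContinuousOn.div (by fun_prop) (by fun_prop) fun s hs => ?_)
      (continuousOn_const.congr fun s _ => hspeed s)
    refine (pow_pos (cos_pos_of_mem_Ioo ⟨?_, hs.2.trans_lt hΦ.2⟩) 2).ne'
    linarith [hs.1]
  · have hΦ' : Φ ∈ Iφ := ⟨(hinv_mem one_pos).1.trans hΦ.1, hΦ.2⟩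
    rw [htr _ hΦ.2.le]
    have := ((hprof _ hΦ.2.le).stokes hY hΦ'.1
      ((continuousOn_const.congr fun s _ => hspeed s).integrableOn_Icc.mono_set Ioo_subset_Icc_self)
      (by simp) (cos_pos_of_mem hΦ').le tendsto_const_nhds
      (tendsto_id.mono_left nhdsWithin_le_nhds) tendsto_const_nhds
      (tendsto_id.mono_left nhdsWithin_le_nhds)
      (fun s hs' => hn s ⟨hs'.1, hs'.2.trans hΦ.2⟩)).2
    rw [this, circ_zero_right, Fintype.sum_bool]
    simp [hz]

theorem IsAdmissible.exists_endData (h : IsAdmissible N n) {C : Set (ℝ × ℝ)} (hC : C ∈ geods N) :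
    ∃ w τ u Φ₀, IsEndData n C w τ u Φ₀ := by
  obtain ⟨hCN, α, β, c, t0, hG, rfl⟩ := hC
  rcases hG.range_eq (t0 := t0) with ⟨k, hk, t₁, he⟩ | ⟨t₁, he⟩
  · rw [he] at hCN ⊢
    exact h.exists_endData_cat hk fun s => hCN ⟨s, rfl⟩
  · rw [he] at hCN ⊢
    exact h.exists_endData_line hCN

end

section

variable {N : Set E3} {n : E3 → E3} {α β c t0 k : ℝ}

theorem exists_coord_bound {ρ : ℝ} (hρ : ρ < 1) : ∃ A, ∃ Φ ∈ Iφ, ∀ x ∈ B \ Z, ‖x‖ ≤ ρ →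
    |tc x| ≤ A ∧ phc x < Φ := by
  rcases lt_or_ge ρ 0 with h0 | h0
  · exact ⟨0, hinv 1, hinv_mem one_pos, fun x _ hx => absurd (norm_nonneg x) (by linarith)⟩
  have h1 : 0 < 1 - ρ ^ 2 := by nlinarith
  have h1' : 0 < 1 - ρ := by linarith
  refine ⟨2⁻¹ * log (4 / (1 - ρ) ^ 2), arctan (2 / (1 - ρ ^ 2) + 1),
    ⟨arctan_pos.2 (by positivity), arctan_lt_pi_div_two _⟩, fun x hx hxρ => ⟨?_, ?_⟩⟩
  · have h2 := norm_sq_E3 x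
    have h3 : ‖x‖ ^ 2 ≤ ρ ^ 2 := by gcongr
    have h4 : |x 2| ≤ ρ := abs_le_of_sq_le_sq (by nlinarith [sq_nonneg (x 0), sq_nonneg (x 1)]) h0
    have h5 := abs_le.1 h4
    set r := x 0 ^ 2 + x 1 ^ 2 with hr
    have hr0 : 0 ≤ r := by positivity
    have key : ∀ z : ℝ, |z| ≤ ρ → r + z ^ 2 ≤ ρ ^ 2 → (1 - ρ) ^ 2 ≤ (1 + z) ^ 2 + r ∧
        (1 + z) ^ 2 + r ≤ 4 := fun z hz hz2 => by
      have := abs_le.1 hz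
      constructor <;> nlinarith
    obtain ⟨a1, a2⟩ := key (x 2) h4 (by linarith)
    obtain ⟨b1, b2⟩ := key (-x 2) (by rwa [abs_neg]) (by linarith)
    rw [← sub_eq_add_neg] at b1 b2
    have hp : 0 < (1 - ρ) ^ 2 := by positivity
    have ha : 0 < (1 + x 2) ^ 2 + r := by linarith
    have hb : 0 < (1 - x 2) ^ 2 + r := by linarith
    rw [tc, abs_mul, abs_of_pos (by norm_num : (0 : ℝ) < 2⁻¹)]
    gcongr
    rw [abs_le, ← log_inv, inv_div]
    constructor <;> apply log_le_log (by positivity)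
    · rw [div_le_div_iff₀ (by norm_num) hb]; nlinarith
    · gcongr
  · refine arctan_strictMono ?_
    have h2 : rad x ≤ 1 := by
      refine sqrt_le_one.2 ?_
      have := norm_sq_E3 x
      have h3 : ‖x‖ ^ 2 ≤ 1 := by nlinarith [norm_nonneg x]
      nlinarith [sq_nonneg (x 2)]
    have h3 : 2 * rad x / (1 - ‖x‖ ^ 2) ≤ 2 / (1 - ρ ^ 2) := by
      gcongr
      linarith
    linarith

theorem hypArea_biUnion_lt_top {ι : Type*} {F : Set ι} (hF : F.Finite) {S : ι → Set E3}
    (hS : ∀ i ∈ F, hypArea (S i) < ⊤) : hypArea (⋃ i ∈ F, S i) < ⊤ := by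
  induction F, hF using Set.Finite.induction_on with
  | empty => simp [hypArea]
  | insert _ _ ih =>
    rw [biUnion_insert]
    exact (lintegral_union_le _ _ _).trans_lt (ENNReal.add_lt_top.2
      ⟨hS _ (mem_insert _ _), ih fun i hi => hS i (mem_insert_of_mem _ hi)⟩)

theorem hypArea_mono {S S' : Set E3} (h : S ⊆ S') : hypArea S ≤ hypArea S' :=
  lintegral_mono_set h

theorem IsAdmissible.hypArea_inter_lt_top (h : IsAdmissible N n) {ρ : ℝ} (hρ : ρ < 1) :
    hypArea (N ∩ closedBall 0 ρ) < ⊤ := by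
  obtain ⟨A, Φ, hΦ, hb⟩ := exists_coord_bound hρ
  set K : Set (ℝ × ℝ) := Icc (-(A + 8)) (A + 8) ×ˢ {Φ} with hK
  have hfin := h.finite_geods_inter (K := K) (isCompact_Icc.prod isCompact_singleton)
    fun q hq => by rw [show q.2 = Φ from hq.2]; exact hΦ
  refine (hypArea_mono ?_).trans_lt (hypArea_biUnion_lt_top hfin
    (S := fun C => spin (C ∩ {q | q.2 < Φ})) fun C hC => ?_)
  · rintro x ⟨hxN, hxρ⟩
    obtain ⟨h1, h2⟩ := hb x (h.subset hxN) (by simpa using hxρ)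
    have hxs := hxN
    rw [h.eq_spin] at hxs
    obtain ⟨C, hC, hxC, -⟩ := h.exists_mem_geods hxs.2
    obtain ⟨w, τ, u, Φ₀, hE⟩ := h.exists_endData hC
    obtain ⟨t, ht⟩ := hE.cross_of_le _ hxC Φ hΦ h2.le
    refine mem_biUnion (x := C) ⟨hC, (t, Φ), ht, ?_, rfl⟩ ⟨h.subset hxN, hxC, h2⟩
    have e1 := abs_le.1 (hE.bound _ hxC)
    have e2 := abs_le.1 (hE.bound _ ht)
    have e3 := abs_le.1 h1
    simp only at e1 e2
    constructor <;> simp only <;> linarith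
  · obtain ⟨w, τ, u, Φ₀, hE⟩ := h.exists_endData hC.1
    exact hE.area Φ hΦ

theorem hypArea_diff_Z (S : Set E3) : hypArea (S \ Z) = hypArea S :=
  hypArea_congr_set <| ae_eq_set.2 ⟨by simp [sdiff_eq_empty.2 sdiff_subset],
    measure_mono_null (fun x hx => by by_contra h; exact hx.2 ⟨hx.1, h⟩) measure_Z⟩

theorem isAreaMinimizing_of_isAdmissible {R : OrientedMinimalFoliation} {M : Set E3}
    (hcl : closure M ∩ B ⊆ M) (h : IsAdmissible (M \ Z) R.ν) : IsAreaMinimizing M R.ν := by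
  intro K hK hKB T hT
  obtain ⟨ρ, hρ, hle⟩ := exists_norm_le_of_isCompact hK hKB
  have hm : IsClosed (M ∩ K) := by
    have : M ∩ K = closure M ∩ K := by
      ext x
      exact ⟨fun h => ⟨subset_closure h.1, h.2⟩, fun h => ⟨hcl ⟨h.1, hKB h.2⟩, h.2⟩⟩
    rw [this]
    exact isClosed_closure.inter hK.isClosed
  refine R.hypArea_le_hypMass hρ hm.measurableSet (fun x hx => hle x hx.2) ?_ T hT
  rw [← hypArea_diff_Z]
  exact (hypArea_mono (S' := (M \ Z) ∩ closedBall 0 ρ) fun x hx =>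
    ⟨⟨hx.1.1, hx.2⟩, by simpa using hle x hx.1.2⟩).trans_lt (h.hypArea_inter_lt_top hρ)

theorem sin_sq_div_two_le {φ : ℝ} (h : φ ∈ Iφ) : sin φ ^ 2 / 2 ≤ hh φ * (hh φ / dh φ) := by
  have hc := cos_pos_of_mem h
  have hs := sin_pos_of_mem h
  have h1 := cos_le_one φ
  have h2 := sin_sq_add_cos_sq φ
  have : hh φ * (hh φ / dh φ) = sin φ ^ 2 / (cos φ * (1 + sin φ ^ 2)) := by
    rw [hh, dh]; field_simp
  rw [this]
  gcongr
  nlinarith [sq_nonneg (sin φ), mul_pos hc hc]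

theorem IsGeod.hypArea_eq_top (h : IsGeod α β c) : hypArea (spin (range (geo α β c t0))) = ⊤ := by
  obtain ⟨m, hm, a, b, hab, hy⟩ : ∃ m > 0, ∃ a b : ℕ → ℝ, (∀ j, b j - a j = j) ∧
      ∀ j, ∀ s ∈ Ioo (a j) (b j), m ≤ gy α β s := by
    rcases h.nonneg₁.eq_or_lt with h1 | h1
    · have h2 : 0 < β := by have := h.pos; linarith
      refine ⟨β, h2, fun j => -j, fun _ => 0, fun j => by ring, fun j s hs => ?_⟩
      have : 1 ≤ exp (-s) := one_le_exp (by linarith [hs.2])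
      rw [gy, ← h1]; nlinarith
    · refine ⟨α, h1, fun _ => 0, fun j => j, fun j => by ring, fun j s hs => ?_⟩
      have : 1 ≤ exp s := one_le_exp hs.1.le
      have h2 := h.nonneg₂; have := exp_pos (-s)
      rw [gy]; nlinarith [mul_nonneg h2 this.le]
  set δ := sin (hinv m) ^ 2 / 2 with hδ
  have hδp : 0 < δ := by have := sin_pos_of_mem (hinv_mem hm); positivity
  have hlow : ∀ j : ℕ, ofReal (2 * π) * (ofReal δ * j) ≤
      hypArea (spin (range (geo α β c t0))) := fun j => by
    have hp := h.isProfile (t0 := t0) (a j) (b j)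
    refine le_trans ?_ (hypArea_mono (S := rev (g₁ α β c t0) (g₂ α β) (a j) (b j)) ?_)
    · rw [hp.hypArea_rev]
      gcongr
      have h1 : ofReal δ * j = ∫⁻ _ in Ioo (a j) (b j), ofReal δ := by
        rw [setLIntegral_const, volume_Ioo, hab, ENNReal.ofReal_natCast]
      rw [h1]
      refine setLIntegral_mono' measurableSet_Ioo fun s hs => ENNReal.ofReal_le_ofReal ?_
      rw [h.speed_eq, ← h.hh_g₂]
      refine le_trans ?_ (sin_sq_div_two_le (h.mem s))
      have h2 : hinv m ≤ g₂ α β s := by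
        rw [g₂, ← not_lt, hinv_lt_hinv (h.gy_pos s) hm, not_lt]; exact hy j s hs
      have h3 : sin (hinv m) ≤ sin (g₂ α β s) :=
        strictMonoOn_sin.monotoneOn
          ⟨by linarith [(hinv_mem hm).1, pi_pos], (hinv_mem hm).2.le⟩
          ⟨by linarith [(h.mem s).1, pi_pos], (h.mem s).2.le⟩ h2
      have := sin_pos_of_mem (hinv_mem hm)
      rw [hδ]
      gcongr
    · rw [rev_eq_spin hp.mem]
      exact spin_mono (image_subset_range _ _)
  by_contra hne
  have hq : ofReal (2 * π) * ofReal δ ≠ 0 :=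
    mul_ne_zero (by simpa using pi_pos) (by simpa using hδp)
  obtain ⟨j, hj⟩ := ENNReal.exists_nat_mul_gt hq hne
  have := hlow j
  rw [← mul_assoc, mul_comm] at this
  exact absurd hj (not_lt.2 this)

theorem IsAdmissible.hypArea_eq_top (h : IsAdmissible N n) (hN : N.Nonempty) : hypArea N = ⊤ := by
  obtain ⟨x, hx⟩ := hN
  have hxs := hx
  rw [h.eq_spin] at hxs
  obtain ⟨α, β, c, hG, -, h1, -⟩ := h.exists_geod_subset hxs.2
  refine top_unique ((hG.hypArea_eq_top (t0 := tc x)).ge.trans (hypArea_mono ?_))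
  rw [h.eq_spin]
  exact spin_mono (range_subset_iff.2 h1)

theorem isPreconnected_B_diff_Z : IsPreconnected (B \ Z) := by
  have h1 : B \ Z = (fun p : ℝ × ℝ × ℝ => P p.1 p.2.1 p.2.2) '' (univ ×ˢ Iφ ×ˢ univ) := by
    ext x
    constructor
    · intro hx
      obtain ⟨θ, -, hθ⟩ := P_surj hx
      exact ⟨(tc x, phc x, θ), ⟨trivial, phc_mem hx, trivial⟩, hθ.symm⟩
    · rintro ⟨p, hp, rfl⟩
      exact P_mem hp.2.1
  rw [h1]
  refine (isPreconnected_univ.prod (isPreconnected_Ioo.prod isPreconnected_univ)).image _ ?_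
  exact fun p hp => (continuousAt_P (denom_pos (cos_pos_of_mem hp.2.1).le)).continuousWithinAt

theorem subset_closure_diff_Z {U : Set E3} (hU : IsOpen U) : U ⊆ closure (U \ Z) := by
  intro x hx
  by_cases hxZ : x ∈ Z
  swap
  · exact subset_closure ⟨hx, hxZ⟩
  have hc : Continuous fun ε : ℝ => x + ε • (single 0 1 : E3) := by fun_prop
  have ht : Tendsto (fun ε : ℝ => x + ε • (single 0 1 : E3)) (𝓝[≠] 0) (𝓝 x) := by
    simpa using (hc.tendsto 0).mono_left nhdsWithin_le_nhds
  refine mem_closure_of_tendsto ht ?_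
  filter_upwards [ht.eventually_mem (hU.mem_nhds hx), self_mem_nhdsWithin] with ε h1 h2
  refine ⟨h1, fun h3 => h2 ?_⟩
  have := h3.1
  simpa [hxZ.1] using this

theorem nonempty_diff_Z_of_frontier {U M : Set E3} (hUB : U ⊆ B) (hU : interior (closure U) = U)
    (hM : M = frontier U ∩ B) (hne : M.Nonempty) : (M \ Z).Nonempty := by
  by_contra hemp
  rw [not_nonempty_iff_eq_empty] at hemp
  have hUo : IsOpen U := hU ▸ isOpen_interior
  obtain ⟨p, hp⟩ := hne
  have hp' := hp
  rw [hM, hUo.frontier_eq] at hp'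
  have hcov : B \ Z ⊆ U ∪ (closure U)ᶜ := by
    intro x hx
    by_contra h
    rw [mem_union, not_or, notMem_compl_iff] at h
    have : x ∈ M \ Z := ⟨by rw [hM, hUo.frontier_eq]; exact ⟨⟨h.2, h.1⟩, hx.1⟩, hx.2⟩
    rw [hemp] at this
    exact this
  rcases isPreconnected_B_diff_Z.subset_or_subset hUo isClosed_closure.isOpen_compl
    (disjoint_compl_right.mono_left subset_closure) hcov with h | h
  · have h1 : B ⊆ closure U := (subset_closure_diff_Z isOpen_ball).trans (closure_mono h)
    have h2 : B ⊆ U := hU ▸ interior_maximal h1 isOpen_ball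
    exact hp'.1.2 (h2 hp'.2)
  · have h1 : U \ Z = ∅ := eq_empty_of_forall_notMem fun x hx =>
      h ⟨hUB hx.1, hx.2⟩ (subset_closure hx.1)
    have h2 := subset_closure_diff_Z hUo
    rw [h1, closure_empty, subset_empty_iff] at h2
    have := hp'.1.1
    rw [h2, closure_empty] at this
    exact this

end

section

variable {N : Set E3} {n : E3 → E3} {C : Set (ℝ × ℝ)} {w : Bool → ℤ} {τ : Bool → ℝ}
  {u : Bool → ℝ → ℝ} {Φ₀ : ℝ}

theorem IsAdmissible.eventually_mem_spin_iff (h : IsAdmissible N n) {x : E3} (hx : x ∈ N) :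
    ∀ᶠ y in 𝓝 x, y ∈ N → ∀ C ∈ geods N, x ∈ spin C ↔ y ∈ spin C := by
  have hxs := hx
  rw [h.eq_spin] at hxs
  obtain ⟨D, hD, hxD, hev⟩ := h.exists_mem_geods hxs.2
  have hc : ContinuousAt (fun y => (tc y, phc y)) x :=
    ((contDiffOn_tc.continuousOn.prodMk contDiffOn_phc.continuousOn).continuousAt
      (isOpen_B_diff_Z.mem_nhds hxs.1))
  filter_upwards [hc.eventually hev] with y hy hyN C hC
  have hys := hyN
  rw [h.eq_spin] at hys
  have hyD := hy hys.2
  constructor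
  · rintro ⟨-, hxC⟩
    rw [h.geods_eq hC hD hxC hxD]
    exact ⟨hys.1, hyD⟩
  · rintro ⟨-, hyC⟩
    rw [h.geods_eq hC hD hyC hyD]
    exact ⟨hxs.1, hxD⟩

theorem IsAdmissible.leaf_subset_spin {R : OrientedMinimalFoliation} (h : IsAdmissible N n)
    (hsat : R.IsSaturated N) (hC : C ∈ geods N) {x : E3} (hx : x ∈ spin C) : R.leaf x ⊆ spin C := by
  have hsub : spin C ⊆ N := by rw [h.eq_spin]; exact spin_mono hC.1
  intro y hy
  induction hy with
  | refl => exact hx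
  | tail _ hq ih =>
    obtain ⟨φ, hφ, t, hp, hq⟩ := hq
    have hpl := hsat φ hφ t ⟨_, hp, hsub ih⟩
    refine ((isConnected_plaque hφ t).isPreconnected.induction₂
      (fun x y => x ∈ spin C ↔ y ∈ spin C) (fun z hz => ?_) (fun _ _ _ _ _ _ h1 h2 => h1.trans h2)
      (fun _ _ _ _ h1 => h1.symm) hp hq).1 ih
    rw [eventually_nhdsWithin_iff]
    filter_upwards [h.eventually_mem_spin_iff (hpl hz)] with y hy hyp using hy (hpl hyp) C hC

theorem finite_geods_of_finite_leaves {R : OrientedMinimalFoliation} {M : Set E3}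
    (h : IsAdmissible (M \ Z) n) (hsat : R.IsSaturated (M \ Z))
    (hfin : {L ∈ R.leaves | L ⊆ M}.Finite) : (geods (M \ Z)).Finite := by
  have hpt : ∀ C ∈ geods (M \ Z), ∃ x, x ∈ spin C := fun C hC => by
    obtain ⟨-, α, β, c, t0, hG, rfl⟩ := hC
    exact ⟨P (g₁ α β c t0 0) (g₂ α β 0) 0, (P_mem_spin (hG.mem 0) 0).2 ⟨0, rfl⟩⟩
  choose! x hx using hpt
  refine Finite.of_finite_image (f := fun C => R.leaf (x C)) (hfin.subset ?_) ?_
  · rintro _ ⟨C, hC, rfl⟩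
    have hsub : spin C ⊆ M \ Z := by rw [h.eq_spin]; exact spin_mono hC.1
    exact ⟨⟨_, (hx C hC).1, rfl⟩, ((h.leaf_subset_spin hsat hC (hx C hC)).trans hsub).trans
      sdiff_subset⟩
  · intro C hC C' hC' he
    have h1 : x C' ∈ R.leaf (x C) := by
      simp only at he; rw [he]; exact Relation.ReflTransGen.refl
    exact h.geods_eq hC hC' (h.leaf_subset_spin hsat hC (hx C hC) h1).2 (hx C' hC').2

theorem IsEndData.tendsto (h : IsEndData n C w τ u Φ₀) (b : Bool) :
    Tendsto (u b) (𝓝[<] (π / 2)) (𝓝 (τ b)) := by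
  rw [tendsto_iff_norm_sub_tendsto_zero]
  refine squeeze_zero' (Eventually.of_forall fun _ => norm_nonneg _) ?_ (h.small b)
  filter_upwards [tendsto_hh.eventually_ge_atTop 1] with Φ hΦ
  exact le_mul_of_one_le_left (abs_nonneg _) hΦ

theorem cos_pi_div_two_nonneg : 0 ≤ cos (π / 2) := by rw [cos_pi_div_two]

theorem norm_P_pi_div_two (t θ : ℝ) : ‖P t (π / 2) θ‖ = 1 := by
  have h := normSq_P (t := t) (θ := θ) cos_pi_div_two_nonneg
  rw [cos_pi_div_two, mul_zero, sub_zero] at h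
  exact (pow_eq_one_iff_of_nonneg (norm_nonneg _) two_ne_zero).1 h

theorem P_pi_div_two_notMem_Z (t θ : ℝ) : P t (π / 2) θ ∉ Z :=
  P_notMem_Z cos_pi_div_two_nonneg (by simp)

theorem tendsto_P_pi_div_two {f : ℝ → ℝ} {t : ℝ} (hf : Tendsto f (𝓝[<] (π / 2)) (𝓝 t)) :
    Tendsto (fun Φ => P (f Φ) Φ 0) (𝓝[<] (π / 2)) (𝓝 (P t (π / 2) 0)) :=
  (continuousAt_P (p := (t, π / 2, 0)) (denom_pos cos_pi_div_two_nonneg)).tendsto.comp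
    (hf.prodMk_nhds ((tendsto_id.mono_left nhdsWithin_le_nhds).prodMk_nhds tendsto_const_nhds))

theorem Ioo_mem_nhdsLT_pi {Φ : ℝ} (h : Φ ∈ Iφ) : Ioo Φ (π / 2) ∈ 𝓝[<] (π / 2) :=
  Ioo_mem_nhdsLT h.2

theorem IsEndData.mem_closure (h : IsEndData n C w τ u Φ₀) (b : Bool) :
    P (τ b) (π / 2) 0 ∈ closure (spin C) := by
  refine mem_closure_of_tendsto (tendsto_P_pi_div_two (h.tendsto b)) ?_
  filter_upwards [Ioo_mem_nhdsLT_pi h.mem₀] with Φ hΦ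
  exact (P_mem_spin ⟨h.mem₀.1.trans hΦ.1, hΦ.2⟩ 0).2 ((h.iff Φ hΦ _).2 ⟨b, rfl⟩)

theorem continuousAt_tc {x : E3} (hx : x ∉ Z) : ContinuousAt tc x := by
  have hr := rad_sq_pos hx
  have h1 : (1 + x 2) ^ 2 + (x 0 ^ 2 + x 1 ^ 2) ≠ 0 := by positivity
  have h2 : (1 - x 2) ^ 2 + (x 0 ^ 2 + x 1 ^ 2) ≠ 0 := by positivity
  unfold tc
  exact continuousAt_const.mul (ContinuousAt.log (ContinuousAt.div (by fun_prop) (by fun_prop) h2)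
    (div_ne_zero h1 h2))

theorem tc_P_pi_div_two (t : ℝ) : tc (P t (π / 2) 0) = t := by
  have h1 := (continuousAt_tc (P_pi_div_two_notMem_Z t 0)).tendsto.comp
    (tendsto_P_pi_div_two (tendsto_const_nhds (x := t)))
  refine tendsto_nhds_unique (h1.congr' ?_) (tendsto_const_nhds (x := t))
  filter_upwards [Ioo_mem_nhdsLT_pi (hinv_mem one_pos)] with Φ hΦ
  exact tc_P ⟨(hinv_mem one_pos).1.trans hΦ.1, hΦ.2⟩

theorem IsEndData.end_eq (h : IsEndData n C w τ u Φ₀) {t : ℝ}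
    (ht : P t (π / 2) 0 ∈ closure (spin C)) : ∃ b, t = τ b := by
  set x := P t (π / 2) 0 with hx
  have : (𝓝[spin C] x).NeBot := mem_closure_iff_nhdsWithin_neBot.1 ht
  have htc : Tendsto tc (𝓝[spin C] x) (𝓝 t) := by
    have := (continuousAt_tc (P_pi_div_two_notMem_Z t 0)).tendsto
    rw [tc_P_pi_div_two] at this
    exact this.mono_left nhdsWithin_le_nhds
  have hcos : Tendsto (fun y => cos (phc y)) (𝓝[spin C] x) (𝓝 0) := by
    have h1 : Tendsto (fun y => (1 - ‖y‖ ^ 2) * (cosh (tc y) + 1)) (𝓝[spin C] x)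
        (𝓝 ((1 - ‖x‖ ^ 2) * (cosh t + 1))) :=
      ((tendsto_const_nhds.sub ((continuous_norm.tendsto x).mono_left nhdsWithin_le_nhds |>.pow 2))).mul
        (((continuous_cosh.tendsto t).comp htc).add tendsto_const_nhds)
    rw [hx, norm_P_pi_div_two, one_pow, sub_self, zero_mul] at h1
    refine squeeze_zero' ?_ ?_ h1
    · filter_upwards [self_mem_nhdsWithin] with y hy using (cos_pos_of_mem (phc_mem hy.1)).le
    · filter_upwards [self_mem_nhdsWithin] with y hy
      obtain ⟨θ, -, hθ⟩ := P_surj hy.1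
      have hc := cos_pos_of_mem (phc_mem hy.1)
      have h2 := normSq_P (t := tc y) (θ := θ) hc.le
      rw [← hθ] at h2
      have hd := denom_pos (t := tc y) hc.le
      have h3 : kap (tc y) (phc y) * (cosh (tc y) + cos (phc y)) = 1 :=
        inv_mul_cancel₀ hd.ne'
      have hk := kap_pos (t := tc y) hc.le
      have h4 : 1 ≤ kap (tc y) (phc y) * (cosh (tc y) + 1) := by
        have := mul_le_mul_of_nonneg_left (cos_le_one (phc y)) hk.le
        linarith
      rw [h2]
      nlinarith [mul_le_mul_of_nonneg_left h4 hc.le, cosh_pos (tc y), mul_pos hk hc]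
  have hphc : Tendsto phc (𝓝[spin C] x) (𝓝[<] (π / 2)) := by
    refine tendsto_nhdsWithin_iff.2 ⟨?_, ?_⟩
    · have := (continuous_arccos.tendsto 0).comp hcos
      rw [arccos_zero] at this
      refine this.congr' ?_
      filter_upwards [self_mem_nhdsWithin] with y hy
      have := phc_mem hy.1
      exact arccos_cos this.1.le (by linarith [this.2, pi_pos])
    · filter_upwards [self_mem_nhdsWithin] with y hy using (phc_mem hy.1).2
  have hlim : ∀ b, Tendsto (fun y => |u b (phc y) - τ b|) (𝓝[spin C] x) (𝓝 0) := fun b => by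
    have := (((h.tendsto b).comp hphc).sub_const (τ b)).abs
    simpa using this
  have h0 : min |t - τ true| |t - τ false| ≤ 0 := by
    have h1 := (htc.sub_const (τ true)).abs.min (htc.sub_const (τ false)).abs
    have h2 := (hlim true).add (hlim false)
    rw [add_zero] at h2
    refine le_of_tendsto_of_tendsto h1 h2 ?_
    filter_upwards [self_mem_nhdsWithin, hphc.eventually_mem (Ioo_mem_nhdsLT_pi h.mem₀)] with y hy hy2
    obtain ⟨b, hb⟩ := (h.iff _ hy2 _).1 hy.2
    rw [hb]
    cases b
    · exact (min_le_right _ _).trans (le_add_of_nonneg_left (abs_nonneg _))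
    · exact (min_le_left _ _).trans (le_add_of_nonneg_right (abs_nonneg _))
  rcases min_le_iff.1 h0 with h1 | h1
  · exact ⟨true, sub_eq_zero.1 (abs_nonpos_iff.1 h1)⟩
  · exact ⟨false, sub_eq_zero.1 (abs_nonpos_iff.1 h1)⟩

theorem IsAdmissible.eq_biUnion (h : IsAdmissible N n) : N = ⋃ C ∈ geods N, spin C := by
  ext x
  simp only [mem_iUnion, exists_prop]
  constructor
  · intro hx
    rw [h.eq_spin] at hx
    obtain ⟨C, hC, hxC, -⟩ := h.exists_mem_geods hx.2
    exact ⟨C, hC, hx.1, hxC⟩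
  · rintro ⟨C, hC, hx⟩
    rw [h.eq_spin]
    exact spin_mono hC.1 hx

theorem IsAdmissible.finite_geods_of_ends (h : IsAdmissible N n) {𝒯 : Set ℝ} (h𝒯 : 𝒯.Finite)
    (he : ∀ C ∈ geods N, ∀ w τ u Φ₀, IsEndData n C w τ u Φ₀ → ∀ b, τ b ∈ 𝒯) : (geods N).Finite := by
  have hev : ∀ᶠ Φ in 𝓝[<] (π / 2), ∀ p ∈ 𝒯 ×ˢ 𝒯, p.1 ≠ p.2 → 4 < |p.1 - p.2| * √(hh Φ) := by
    refine (Filter.eventually_all_finite (h𝒯.prod h𝒯)).2 fun p _ => ?_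
    by_cases hp : p.1 = p.2
    · exact Eventually.of_forall fun _ h => absurd hp h
    · have := (tendsto_sqrt_atTop.comp tendsto_hh).const_mul_atTop
        (abs_pos.2 (sub_ne_zero.2 hp))
      filter_upwards [this.eventually_gt_atTop 4] with Φ hΦ _ using hΦ
  obtain ⟨Φ, hΦ, hΦI⟩ := (hev.and (Ioo_mem_nhdsLT (by positivity : (0 : ℝ) < π / 2))).exists
  obtain ⟨A, hA⟩ := h𝒯.isBounded.exists_norm_le
  refine (h.finite_geods_inter (K := Icc (-(A + 4)) (A + 4) ×ˢ {Φ})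
    (isCompact_Icc.prod isCompact_singleton)
    fun q hq => by rw [show q.2 = Φ from hq.2]; exact hΦI).subset fun C hC => ⟨hC, ?_⟩
  obtain ⟨w, τ, u, Φ₀, hE⟩ := h.exists_endData hC
  have hτ := he C hC _ _ _ _ hE
  rcases hE.cross Φ hΦI with ⟨t, ht⟩ | ⟨hne, hle⟩
  · refine ⟨(t, Φ), ht, ?_, rfl⟩
    have h1 := abs_le.1 (hE.bound _ ht)
    have h2 := abs_le.1 (hA _ (hτ true))
    simp only at h1
    constructor <;> simp only <;> linarith
  · exact absurd hle (not_le.2 (hΦ (τ true, τ false) ⟨hτ true, hτ false⟩ hne))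

/-- A surface whose ideal boundary is that of a surface with finitely many profile geodesics has
itself only finitely many. -/
theorem IsAdmissible.finite_geods_of_idealBoundary {M M' : Set E3} {n' : E3 → E3}
    (h : IsAdmissible (M \ Z) n) (hf : (geods (M \ Z)).Finite) (h' : IsAdmissible (M' \ Z) n')
    (hid : idealBoundary M = idealBoundary M') : (geods (M' \ Z)).Finite := by
  choose! w τ u Φ₀ hE using fun C (hC : C ∈ geods (M \ Z)) => h.exists_endData hC
  refine h'.finite_geods_of_ends (𝒯 := ⋃ C ∈ geods (M \ Z), range (τ C))
    (hf.biUnion fun C _ => finite_range _) fun C' hC' w' τ' u' Φ' hE' b => ?_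
  have h1 : P (τ' b) (π / 2) 0 ∈ idealBoundary M := by
    rw [hid]
    refine ⟨closure_mono ?_ (hE'.mem_closure b), by simpa using norm_P_pi_div_two _ _⟩
    intro x hx
    have : x ∈ M' \ Z := by rw [h'.eq_spin]; exact spin_mono hC'.1 hx
    exact this.1
  have h2 : P (τ' b) (π / 2) 0 ∈ closure (M \ Z) := by
    have := h1.1
    rw [mem_closure_iff_nhds] at this ⊢
    intro s hs
    obtain ⟨y, hy, hyM⟩ := this _ (inter_mem hs
      (isClosed_Z.isOpen_compl.mem_nhds (P_pi_div_two_notMem_Z (τ' b) 0)))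
    exact ⟨y, hy.1, hyM, hy.2⟩
  rw [h.eq_biUnion, hf.closure_biUnion] at h2
  obtain ⟨C, hC, hx⟩ := mem_iUnion₂.1 h2
  obtain ⟨b', hb'⟩ := (hE C hC).end_eq hx
  exact mem_biUnion hC ⟨b', hb'.symm⟩

end

section

variable {N : Set E3} {n : E3 → E3}

/-- The part of the ball where `φ < Φ`. -/
def below (Φ : ℝ) : Set E3 := {x ∈ B \ Z | phc x < Φ}

/-- The oriented boundary at infinity of a surface, with finitely many ends indexed by `ι`. -/
structure HasEnds {ι : Type} [Fintype ι] (N : Set E3) (n : E3 → E3) (w : ι → ℤ) (τ : ι → ℝ)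
    (u : ι → ℝ → ℝ) (Φ₀ A : ℝ) : Prop where
  mem₀ : Φ₀ ∈ Iφ
  measurableSet : MeasurableSet N
  small : ∀ i, Tendsto (fun Φ => hh Φ * |u i Φ - τ i|) (𝓝[<] (π / 2)) (𝓝 0)
  bound : ∀ x ∈ N, |tc x| ≤ A
  bound_end : ∀ i, ∀ Φ ∈ Ioo Φ₀ (π / 2), |u i Φ| ≤ A
  area : ∀ Φ ∈ Iφ, hypArea (N ∩ below Φ) < ⊤
  null : ∀ Φ ∈ Ioo Φ₀ (π / 2), μHE[2] (N ∩ {x | phc x = Φ}) = 0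
  bdry_below : ∀ Φ ∈ Ioo Φ₀ (π / 2), ∀ Y, IsTestField Y →
    bdry (N ∩ below Φ) n (fun _ => 1) Y = ∑ i, (w i : ℝ) * circ Y (u i Φ) Φ
  bdry_eq : ∀ Y, IsTestField Y →
    bdry N n (fun _ => 1) Y = ∑ i, (w i : ℝ) * circ Y (τ i) (π / 2)

theorem measurableSet_below (Φ : ℝ) : MeasurableSet (below Φ) :=
  measurableSet_spin (C := {q | q.2 < Φ}) (measurableSet_lt measurable_snd measurable_const)

theorem IsAdmissible.norm_normal (h : IsAdmissible N n) {x : E3} (hx : x ∈ N) : ‖n x‖ = 1 :=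
  (h.normal x hx).1

theorem IsAdmissible.integrableOn_flux (h : IsAdmissible N n) (hm : MeasurableSet N)
    (hfin : μHE[2] N < ⊤) {Y : E3 → E3} (hY : IsTestField Y) :
    IntegrableOn (fun x => ⟪curl Y x, n x⟫) N μHE[2] := by
  obtain ⟨C, hC⟩ := curl_bounded hY
  have hc : ContinuousOn (fun x => ⟪curl Y x, n x⟫) N :=
    (curl_continuous (hY.1.of_le (by simp))).continuousOn.inner h.continuousOn_normal
  refine (integrableOn_const (C := C) hfin.ne).mono' (hc.aestronglyMeasurable hm) ?_
  filter_upwards [ae_restrict_mem hm] with x hx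
  refine (norm_inner_le_norm _ _).trans ?_
  rw [h.norm_normal hx, mul_one]
  exact hC x

theorem spin_inter_below (C : Set (ℝ × ℝ)) (Φ : ℝ) :
    spin C ∩ below Φ = spin (C ∩ {q | q.2 < Φ}) := by
  ext x
  exact ⟨fun h => ⟨h.1.1, h.1.2, h.2.2⟩, fun h => ⟨⟨h.1, h.2.1⟩, h.1, h.2.2⟩⟩

/-- A surface with finitely many profile geodesics has a finite number of ends. -/
theorem IsAdmissible.exists_hasEnds (h : IsAdmissible N n) (hf : (geods N).Finite) :
    ∃ (ι : Type) (_ : Fintype ι) (w : ι → ℤ) (τ : ι → ℝ) (u : ι → ℝ → ℝ) (Φ₀ A : ℝ),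
      HasEnds N n w τ u Φ₀ A := by
  classical
  set G := hf.toFinset with hG
  have hGm : ∀ C : G, C.1 ∈ geods N := fun C => hf.mem_toFinset.1 C.2
  choose w τ u Φ₁ hE using fun C : G => h.exists_endData (hGm C)
  obtain ⟨Φ₀, hΦ₀, hle⟩ : ∃ Φ₀ ∈ Iφ, ∀ C, Φ₁ C ≤ Φ₀ := by
    have h1 : ∀ᶠ Φ in 𝓝[<] (π / 2), ∀ C, Φ₁ C ≤ Φ := eventually_all.2 fun C => by
      filter_upwards [Ioo_mem_nhdsLT_pi (hE C).mem₀] with Φ hΦ using hΦ.1.le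
    obtain ⟨Φ, hΦ, hΦI⟩ := (h1.and (Ioo_mem_nhdsLT (by positivity : (0 : ℝ) < π / 2))).exists
    exact ⟨Φ, hΦI, hΦ⟩
  have hsub : ∀ C, ∀ Φ ∈ Ioo Φ₀ (π / 2), Φ ∈ Ioo (Φ₁ C) (π / 2) := fun C Φ hΦ =>
    ⟨(hle C).trans_lt hΦ.1, hΦ.2⟩
  obtain ⟨A, hA⟩ : ∃ A, ∀ C : G, |τ C true| + 4 ≤ A := by
    obtain ⟨A, hA⟩ := (Set.finite_range fun C : G => |τ C true| + 4).bddAbove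
    exact ⟨A, fun C => hA ⟨C, rfl⟩⟩
  have hb : ∀ C : G, ∀ q ∈ C.1, |q.1| ≤ A := fun C q hq => by
    have h1 := abs_sub_abs_le_abs_sub q.1 (τ C true)
    linarith [(hE C).bound q hq, hA C]
  have hN : N = ⋃ C : G, spin C.1 := by
    conv_lhs => rw [h.eq_biUnion]
    ext x
    simp [hG]
  have hm : MeasurableSet N := by
    rw [hN]
    exact MeasurableSet.iUnion fun C => measurableSet_spin (measurableSet_of_mem_geods (hGm C))
  have hmeas : μHE[2] N < ⊤ := by
    rw [hN]
    exact (measure_iUnion_le _).trans_lt (by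
      rw [tsum_fintype]; exact ENNReal.sum_lt_top.2 fun C _ => (hE C).measure)
  have hNb : ∀ Φ, N ∩ below Φ = ⋃ C : G, spin (C.1 ∩ {q | q.2 < Φ}) := fun Φ => by
    rw [hN, iUnion_inter]
    exact iUnion_congr fun C => spin_inter_below _ _
  have hut : ∀ i : G × Bool, Tendsto (u i.1 i.2) (𝓝[<] (π / 2)) (𝓝 (τ i.1 i.2)) :=
    fun i => (hE i.1).tendsto i.2
  have hbb : ∀ Φ ∈ Ioo Φ₀ (π / 2), ∀ Y, IsTestField Y →
      bdry (N ∩ below Φ) n (fun _ => 1) Y =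
        ∑ i : G × Bool, (w i.1 i.2 : ℝ) * circ Y (u i.1 i.2 Φ) Φ := fun Φ hΦ Y hY => by
    have hInt := h.integrableOn_flux hm hmeas hY
    have hsp : ∀ C : G, spin (C.1 ∩ {q | q.2 < Φ}) ⊆ N := fun C => by
      rw [h.eq_spin]; exact spin_mono (inter_subset_left.trans (hGm C).1)
    rw [bdry, hNb]
    simp only [Nat.cast_one, one_mul]
    rw [integral_iUnion_fintype]
    · rw [Fintype.sum_prod_type]
      exact Finset.sum_congr rfl fun C _ => (hE C).flux Φ (hsub C Φ hΦ) Y hY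
    · exact fun C => measurableSet_spin ((measurableSet_of_mem_geods (hGm C)).inter
        (measurableSet_lt measurable_snd measurable_const))
    · intro C C' hne
      refine Set.disjoint_left.2 fun x hx hx' => hne (Subtype.ext ?_)
      exact h.geods_eq (hGm C) (hGm C') hx.2.1 hx'.2.1
    · exact fun C => hInt.mono_set (hsp C)
  refine ⟨G × Bool, inferInstance, fun i => w i.1 i.2, fun i => τ i.1 i.2, fun i => u i.1 i.2, Φ₀, A,
    hΦ₀, hm, fun i => (hE i.1).small i.2, fun x hx => ?_, fun i Φ hΦ => ?_, fun Φ hΦ => ?_,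
    fun Φ hΦ => ?_, hbb, fun Y hY => ?_⟩
  · rw [hN] at hx
    obtain ⟨C, hC⟩ := mem_iUnion.1 hx
    exact hb C _ hC.2
  · exact hb i.1 _ (((hE i.1).iff Φ (hsub i.1 Φ hΦ) _).2 ⟨i.2, rfl⟩)
  · rw [hNb, ← biUnion_univ]
    exact hypArea_biUnion_lt_top finite_univ fun C _ => (hE C).area Φ hΦ
  · refine measure_mono_null (t := ⋃ i : G × Bool, range (P (u i.1 i.2 Φ) Φ)) ?_
      (measure_iUnion_null fun i => measure_circle _ _)
    rintro x ⟨hx, hxΦ⟩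
    rw [hN] at hx
    obtain ⟨C, hC⟩ := mem_iUnion.1 hx
    obtain ⟨θ, -, hθ⟩ := P_surj hC.1
    have hC2 := hC.2
    have hxΦ' : phc x = Φ := hxΦ
    rw [hxΦ'] at hC2 hθ
    obtain ⟨b, hb⟩ := ((hE C).iff Φ (hsub C Φ hΦ) _).1 hC2
    exact mem_iUnion.2 ⟨(C, b), θ, by rw [← hb]; exact hθ.symm⟩
  · obtain ⟨Ψ, hΨm, hΨ, hΨt⟩ := exists_seq_strictMono_tendsto' hΦ₀.2
    have hΨt' : Tendsto Ψ atTop (𝓝[<] (π / 2)) :=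
      tendsto_nhdsWithin_iff.2 ⟨hΨt, Eventually.of_forall fun j => (hΨ j).2⟩
    have hU : ⋃ j, N ∩ below (Ψ j) = N := by
      rw [← inter_iUnion, inter_eq_left]
      intro x hx
      obtain ⟨j, hj⟩ := (hΨt.eventually_const_lt (phc_mem (h.subset hx)).2).exists
      exact mem_iUnion.2 ⟨j, h.subset hx, hj⟩
    have hlim := tendsto_setIntegral_of_monotone (μ := (μHE[2] : Measure E3))
      (f := fun x => ⟪curl Y x, n x⟫) (s := fun j => N ∩ below (Ψ j))
      (fun j => hm.inter (measurableSet_below _))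
      (fun i j hij x hx => ⟨hx.1, hx.2.1, hx.2.2.trans_le (hΨm.monotone hij)⟩)
      (by rw [hU]; exact h.integrableOn_flux hm hmeas hY)
    rw [hU] at hlim
    obtain ⟨D, hD⟩ := hY.1.continuous.bounded_above_of_compact_support hY.2
    have hlim2 : Tendsto (fun j => ∑ i : G × Bool, (w i.1 i.2 : ℝ) * circ Y (u i.1 i.2 (Ψ j)) (Ψ j))
        atTop (𝓝 (∑ i : G × Bool, (w i.1 i.2 : ℝ) * circ Y (τ i.1 i.2) (π / 2))) :=
      tendsto_finsetSum _ fun i _ => (tendsto_circ hY.1.continuous hD cos_pi_div_two_nonneg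
        ((hut i).comp hΨt') hΨt).const_mul _
    have e := tendsto_nhds_unique (hlim.congr fun j => ?_) hlim2
    · rw [bdry]; simpa using e
    · rw [← hbb (Ψ j) (hΨ j) Y hY, bdry]; simp

end

section

/-- Generator of the rotations about the axis. -/
def rotGen (x : E3) : E3 := !₂[-x 1, x 0, 0]

theorem contDiff_rotGen : ContDiff ℝ ∞ rotGen := by
  rw [contDiff_euclidean]
  intro i
  fin_cases i
  · exact (contDiff_coord 1).neg
  · exact contDiff_coord 0
  · exact contDiff_const

theorem exists_testField_circ (g : Polynomial ℝ) : ∃ Y, IsTestField Y ∧ ∀ t,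
    circ Y t (π / 2) = 2 * π * ((cosh t)⁻¹ ^ 2 * g.eval (tanh t)) := by
  let χ : ContDiffBump (0 : E3) := ⟨2, 3, by norm_num, by norm_num⟩
  refine ⟨fun x => χ x • g.eval (x 2) • rotGen x, ⟨?_, ?_⟩, fun t => ?_⟩
  · exact χ.contDiff.smul ((ContDiff.comp (by simpa using g.contDiff_aeval ∞) (contDiff_coord 2)).smul contDiff_rotGen)
  · exact χ.hasCompactSupport.smul_right
  have hk : kap t (π / 2) = (cosh t)⁻¹ := by simp [kap]
  have h1 : ∀ θ, ⟪χ (P t (π / 2) θ) • g.eval (P t (π / 2) θ 2) •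
      rotGen (P t (π / 2) θ), (kap t (π / 2) * sin (π / 2)) • eth θ⟫ =
      (cosh t)⁻¹ ^ 2 * g.eval (tanh t) := fun θ => by
    have hχ : χ (P t (π / 2) θ) = 1 :=
      χ.one_of_mem_closedBall (by simp [norm_P_pi_div_two]; change (1 : ℝ) ≤ 2; norm_num)
    have hz : P t (π / 2) θ 2 = tanh t := by
      simp [P, hk, tanh_eq_sinh_div_cosh]; ring
    have hr : rotGen (P t (π / 2) θ) = (cosh t)⁻¹ • eth θ := by
      apply ext_E3 <;> simp [rotGen, P, eth, hk]
    rw [hχ, hz, hr, one_smul, sin_pi_div_two, mul_one, hk, inner_smul_left, inner_smul_left,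
      inner_smul_right, inner_eth_eth]
    simp only [RCLike.conj_to_real]
    ring
  simp only [circ, h1, intervalIntegral.integral_const, smul_eq_mul]
  ring

/-- The oriented boundary at infinity determines the weighted positions of the ends. -/
theorem sum_weight_eq_zero {ι : Type*} [Fintype ι] {W τ : ι → ℝ}
    (h : ∀ Y, IsTestField Y → ∑ i, W i * circ Y (τ i) (π / 2) = 0) (F : ℝ → ℝ) :
    ∑ i, W i * F (τ i) = 0 := by
  classical
  set s : Finset ℝ := Finset.univ.image τ
  obtain ⟨Y, hY, hc⟩ := exists_testField_circ
    (Lagrange.interpolate s tanh fun t => F t / (2 * π * (cosh t)⁻¹ ^ 2))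
  rw [← h Y hY]
  refine Finset.sum_congr rfl fun i _ => ?_
  rw [hc, Lagrange.eval_interpolate_at_node _ tanh_injective.injOn
    (Finset.mem_image_of_mem τ (Finset.mem_univ i))]
  have := cosh_pos (τ i)
  have := pi_pos
  field_simp

/-- Winding number function of weighted points on a line. -/
def wind {ι : Type*} [Fintype ι] (W : ι → ℤ) (u : ι → ℝ) (t : ℝ) : ℤ :=
  ∑ i, if t < u i then W i else 0

variable {ι : Type*} [Fintype ι] {W : ι → ℤ} {u τ : ι → ℝ}

theorem measurable_wind : Measurable (wind W u) :=
  Finset.measurable_fun_sum _ fun _ _ => Measurable.ite measurableSet_Iio measurable_const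
    measurable_const

theorem abs_wind_le (t : ℝ) : |(wind W u t : ℝ)| ≤ ∑ i, |(W i : ℝ)| := by
  rw [wind, Int.cast_sum]
  refine (Finset.abs_sum_le_sum_abs _ _).trans (Finset.sum_le_sum fun i _ => ?_)
  split_ifs <;> simp

theorem integral_abs_wind_le (h : ∀ F : ℝ → ℝ, ∑ i, (W i : ℝ) * F (τ i) = 0) (S : Set ℝ) :
    ∫ t in S, |(wind W u t : ℝ)| ≤ ∑ i, |(W i : ℝ)| * |u i - τ i| := by
  have h1 : ∀ t, |(wind W u t : ℝ)| ≤
      ∑ i, |(W i : ℝ)| * (uIcc (τ i) (u i)).indicator (fun _ => 1) t := fun t => by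
    have h2 : (wind W u t : ℝ) =
        ∑ i, (W i : ℝ) * ((if t < u i then 1 else 0) - if t < τ i then 1 else 0) := by
      simp only [mul_sub, Finset.sum_sub_distrib, h fun s => if t < s then 1 else 0, sub_zero]
      simp [wind]
    rw [h2]
    refine (Finset.abs_sum_le_sum_abs _ _).trans (Finset.sum_le_sum fun i _ => ?_)
    rw [abs_mul]
    refine mul_le_mul_of_nonneg_left ?_ (abs_nonneg _)
    by_cases ht : t ∈ uIcc (τ i) (u i)
    · rw [indicator_of_mem ht]
      split_ifs <;> simp
    · rw [indicator_of_notMem ht]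
      rw [mem_uIcc] at ht
      have : t < u i ↔ t < τ i := by
        constructor <;> intro h' <;> by_contra h'' <;> exact ht (by grind)
      simp [this]
  have hi : ∀ i, Integrable ((uIcc (τ i) (u i)).indicator fun _ => (1 : ℝ)) := fun i =>
    (integrable_indicator_iff measurableSet_uIcc).2 (integrableOn_const (by simp [uIcc]))
  have hI : Integrable fun t =>
      ∑ i, |(W i : ℝ)| * (uIcc (τ i) (u i)).indicator (fun _ => (1 : ℝ)) t :=
    integrable_finsetSum _ fun i _ => (hi i).const_mul _
  refine (integral_mono_of_nonneg (ae_of_all _ fun t => abs_nonneg _) hI.integrableOn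
    (ae_of_all _ h1)).trans ((setIntegral_le_integral hI (ae_of_all _ fun t =>
      (abs_nonneg _).trans (h1 t))).trans_eq ?_)
  rw [integral_finsetSum _ fun i _ => (hi i).const_mul _]
  refine Finset.sum_congr rfl fun i _ => ?_
  rw [integral_const_mul, integral_indicator measurableSet_uIcc]
  simp

end

section

/-! ### Comparison with a surface closed up by a cylinder -/

theorem IsFluxData.subset {ρ : ℝ} {S S' : Set E3} {n : E3 → E3} {m : E3 → ℕ}
    (h : IsFluxData ρ S n m) (hS : S' ⊆ S) (hm : MeasurableSet S') : IsFluxData ρ S' n m :=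
  ⟨hm, fun x hx => h.norm_le x (hS hx), h.aemeasurable_normal.mono_measure
    (Measure.restrict_mono_set _ hS), ae_mono (Measure.restrict_mono_set _ hS) h.norm_normal,
    h.measurable_mult, (lintegral_mono_set hS).trans_lt h.finite_mass⟩

theorem IsFluxData.neg {ρ : ℝ} {S : Set E3} {n : E3 → E3} {m : E3 → ℕ}
    (h : IsFluxData ρ S n m) : IsFluxData ρ S (fun x => -n x) m :=
  { h with aemeasurable_normal := h.aemeasurable_normal.neg
           norm_normal := by filter_upwards [h.norm_normal] with x hx; rwa [norm_neg] }

theorem IsFluxData.integrableOn_curl {ρ : ℝ} {S : Set E3} {n : E3 → E3} {m : E3 → ℕ}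
    (h : IsFluxData ρ S n m) {Y : E3 → E3} (hY : IsTestField Y) :
    IntegrableOn (fun x => (m x : ℝ) * ⟪curl Y x, n x⟫) S μHE[2] := by
  obtain ⟨C, hC⟩ := curl_bounded hY
  exact (h.integrable_mult.const_mul C).mono' (h.aestronglyMeasurable_mul_inner
    (curl_continuous (hY.1.of_le (by simp))).aestronglyMeasurable)
    (h.ae_abs_le fun x _ _ => hC x)

/-- The compact set `|t| ≤ A`, `φ ≤ Φ`. -/
def solid (A Φ : ℝ) : Set E3 := (fun p : ℝ × ℝ × ℝ => P p.1 p.2.1 p.2.2) ''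
  (Icc (-A) A ×ˢ Icc 0 Φ ×ˢ Icc (-π) π)

theorem cos_pos_of_mem_Icc {Φ φ : ℝ} (hΦ : Φ ∈ Iφ) (h : φ ∈ Icc 0 Φ) : 0 < cos φ :=
  cos_pos_of_mem_Ioo ⟨by linarith [h.1, pi_pos], h.2.trans_lt hΦ.2⟩

theorem isCompact_solid {A Φ : ℝ} (hΦ : Φ ∈ Iφ) : IsCompact (solid A Φ) := by
  refine (isCompact_Icc.prod (isCompact_Icc.prod isCompact_Icc)).image_of_continuousOn ?_
  exact continuousOn_P (by fun_prop) (by fun_prop) (by fun_prop)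
    fun p hp => denom_pos (cos_pos_of_mem_Icc hΦ hp.2.1).le

theorem solid_subset {A Φ : ℝ} (hΦ : Φ ∈ Iφ) : solid A Φ ⊆ B := by
  rintro _ ⟨p, hp, rfl⟩
  exact P_mem_B (cos_pos_of_mem_Icc hΦ hp.2.1)

theorem mem_solid {A Φ : ℝ} {x : E3} (hx : x ∈ B \ Z) (ht : |tc x| ≤ A) (hp : phc x ≤ Φ) :
    x ∈ solid A Φ := by
  obtain ⟨θ, hθ, he⟩ := P_surj hx
  exact ⟨(tc x, phc x, θ), ⟨abs_le.1 ht, ⟨(phc_mem hx).1.le, hp⟩, Ioc_subset_Icc_self hθ⟩, he.symm⟩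

theorem phc_le_of_mem_solid {A Φ : ℝ} (hΦ : Φ ∈ Iφ) {x : E3} (hx : x ∈ solid A Φ) (hZ : x ∉ Z) :
    phc x ≤ Φ := by
  obtain ⟨p, hp, rfl⟩ := hx
  have hp0 : p.2.1 ≠ 0 := fun h0 => hZ (by
    simp only [h0]
    constructor <;> simp [P])
  rw [phc_P ⟨lt_of_le_of_ne hp.2.1.1 hp0.symm, hp.2.1.2.trans_lt hΦ.2⟩]
  exact hp.2.1.2

/-- The surface `φ = Φ`, `|t| < a`. -/
def cyl (a Φ : ℝ) : Set E3 := rev (gr₁ false fun _ => Φ) (gr₂ false fun _ => Φ) (-a) a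

theorem isProfile_cyl {Φ : ℝ} (hΦ : Φ ∈ Iφ) (a c : ℝ) :
    IsProfile (gr₁ false fun _ => Φ) (gr₂ false fun _ => Φ) (gr₁' false fun _ => 0)
      (gr₂' false fun _ => 0) a c :=
  isProfile_graph (fun _ _ => hasDerivAt_const _ _) continuousOn_const fun _ _ => hΦ

theorem speed_cyl (s : ℝ) : speed (gr₁' false fun _ => 0) (gr₂' false fun _ => 0) s = 1 := by
  rw [speed_gr]; simp

theorem cyl_subset {a Φ : ℝ} (hΦ : Φ ∈ Iφ) {x : E3} (hx : x ∈ cyl a Φ) :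
    x ∈ B \ Z ∧ |tc x| ≤ a ∧ phc x = Φ := by
  obtain ⟨s, hs, θ, rfl⟩ := hx
  refine ⟨P_mem hΦ, ?_, phc_P hΦ⟩
  rw [tc_P (φ := gr₂ false (fun _ => Φ) s) hΦ]
  exact abs_le.2 ⟨hs.1.le, hs.2.le⟩

theorem measurable_tc : Measurable tc := by
  unfold tc
  fun_prop

variable {ι : Type*} [Fintype ι] {W : ι → ℤ} {u : ι → ℝ}

theorem bdry_cyl {A Φ : ℝ} (hΦ : Φ ∈ Iφ) (hu : ∀ i, |u i| ≤ A)
    (hW : ∑ i, (W i : ℝ) = 0) {n nn : E3 → E3} {m : E3 → ℕ}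
    (hnn : ∀ s ∈ Ioo (-(A + 1)) (A + 1), ∀ θ, nn (P s Φ θ) = -ep s Φ θ)
    (hn : ∀ x ∈ cyl (A + 1) Φ, (m x : ℝ) • n x = (wind W u (tc x) : ℝ) • nn x)
    {Y : E3 → E3} (hY : IsTestField Y) :
    bdry (cyl (A + 1) Φ) n m Y = ∑ i, (W i : ℝ) * circ Y (u i) Φ := by
  have hp := isProfile_cyl hΦ (-(A + 1)) (A + 1)
  have hInt : ∀ a c : ℝ, IntegrableOn
      (speed (gr₁' false fun _ => 0) (gr₂' false fun _ => 0)) (Ioo a c) := fun a c =>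
    integrableOn_speed_graph continuousOn_const
  set w : ι → ℝ → ℝ := fun i t => if t < u i then (W i : ℝ) else 0
  have key := fun i => hp.flux_rev hY (hInt _ _) (w := w i) (D := |(W i : ℝ)|)
    (Measurable.ite measurableSet_Iio measurable_const measurable_const)
    (fun s => by simp only [w]; split_ifs <;> simp)
    (g := fun x => w i (tc x) * ⟪curl Y x, nn x⟫) (fun s hs θ => by
      rw [speed_cyl, tc_P (φ := gr₂ false (fun _ => Φ) s) hΦ]
      simp only [gr₁, gr₂, gr₁', gr₂', hnn s hs θ]
      simp)
  have hm : MeasurableSet (cyl (A + 1) Φ) :=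
    measurableSet_rev_graph (fun _ _ => hasDerivAt_const _ _) continuousOn_const fun _ _ => hΦ
  have e1 : bdry (cyl (A + 1) Φ) n m Y =
      ∫ x in cyl (A + 1) Φ, ∑ i, w i (tc x) * ⟪curl Y x, nn x⟫ ∂μHE[2] := by
    refine setIntegral_congr_fun hm fun x hx => ?_
    rw [← inner_smul_right, hn x hx, inner_smul_right, ← Finset.sum_mul, wind]
    simp only [w]
    push_cast
    rfl
  rw [e1, integral_finsetSum _ fun i _ => by exact (key i).1]
  have e2 : ∀ i, ∫ x in cyl (A + 1) Φ, w i (tc x) * ⟪curl Y x, nn x⟫ ∂μHE[2] =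
      W i * circ Y (u i) Φ - W i * circ Y (-(A + 1)) Φ := fun i => by
    have hui := abs_le.1 (hu i)
    have hp' := isProfile_cyl hΦ (-(A + 1)) (u i)
    have hc := (cos_pos_of_mem hΦ).le
    rw [cyl, (key i).2, ← mul_sub, ← hp'.integral_flux_eq_sub hY (by linarith) (hInt _ _) hc hc
      (tendsto_id.mono_left nhdsWithin_le_nhds) tendsto_const_nhds
      (tendsto_id.mono_left nhdsWithin_le_nhds) tendsto_const_nhds, ← integral_const_mul]
    have h1 : Ioo (-(A + 1)) (u i) = Ioo (-(A + 1)) (A + 1) ∩ Iio (u i) := by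
      ext s
      simp only [mem_Ioo, mem_inter_iff, mem_Iio]
      constructor <;> intro h <;> refine ⟨?_, ?_⟩ <;> grind
    rw [h1, ← setIntegral_indicator measurableSet_Iio]
    congr 1
    ext s
    by_cases hs : s < u i
    · rw [indicator_of_mem (by exact hs)]; simp [w, hs]
    · rw [indicator_of_notMem (by exact hs)]; simp [w, hs]
  rw [Finset.sum_congr rfl fun i _ => e2 i, Finset.sum_sub_distrib, ← Finset.sum_mul, hW]
  simp

theorem lintegral_cyl {a Φ : ℝ} (hΦ : Φ ∈ Iφ) (W : ι → ℤ) (u : ι → ℝ) :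
    ∫⁻ x in cyl a Φ, ((wind W u (tc x)).natAbs : ENNReal) * ofReal (lam x ^ 2) ∂μHE[2] =
      ofReal (2 * π * hh Φ * ∫ s in Ioo (-a) a, |(wind W u s : ℝ)|) := by
  have hp := isProfile_cyl hΦ (-a) a
  have hh0 := (hh_pos hΦ).le
  have hmw : Measurable fun s => |(wind W u s : ℝ)| :=
    (measurable_from_top (f := fun z : ℤ => |(z : ℝ)|)).comp measurable_wind
  rw [cyl, hp.lintegral_rev_of_rotInv (G := fun s => ofReal (hh Φ * |(wind W u s : ℝ)|))
    (hmw.const_mul _).ennreal_ofReal.aemeasurable, ← ofReal_integral_eq_lintegral_ofReal,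
    ← ENNReal.ofReal_mul (by positivity), integral_const_mul, mul_assoc (2 * π)]
  · refine Integrable.const_mul ((integrableOn_const (C := ∑ i, |(W i : ℝ)|) (by simp)).mono'
      hmw.aestronglyMeasurable (ae_of_all _ fun s => ?_)) _
    rw [norm_of_nonneg (abs_nonneg _)]
    exact abs_wind_le s
  · exact ae_of_all _ fun s => mul_nonneg hh0 (abs_nonneg _)
  · intro s hs θ
    have h1 := hp.jac_mul_lam_sq hs θ
    rw [speed_cyl, mul_one] at h1
    rw [tc_P (φ := gr₂ false (fun _ => Φ) s) hΦ, mul_left_comm,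
      ← ENNReal.ofReal_mul (hp.jac_pos hs).le, h1, mul_comm, ENNReal.ofReal_mul (by exact hh0)]
    congr 1
    change ((wind W u s).natAbs : ENNReal) = _
    rw [← Int.cast_abs, ← Nat.cast_natAbs, ENNReal.ofReal_natCast]

variable {R : OrientedMinimalFoliation} {N D : Set E3}

/-- Closing up a part of a surface orthogonal to the foliation by a cylinder. -/
theorem exists_competitor {A Φ : ℝ} (hΦ : Φ ∈ Iφ) (hu : ∀ i, |u i| ≤ A)
    (hW : ∑ i, (W i : ℝ) = 0) (hN : IsSurface 1 N) (hNn : ∀ x ∈ N, IsUnitNormal N x (R.ν x))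
    (hD : MeasurableSet D) (hDN : D ⊆ N) (hDb : D ⊆ below Φ) (hDt : ∀ x ∈ D, |tc x| ≤ A)
    (ha : hypArea D < ⊤) (h0 : μHE[2] (N ∩ {x | phc x = Φ}) = 0) :
    ∃ T : RectCurrent, T.carrier = D ∪ cyl (A + 1) Φ ∧
      (∀ x ∈ D, T.normal x = R.ν x ∧ T.mult x = 1) ∧
      (∀ x ∈ cyl (A + 1) Φ, T.mult x = (wind W u (tc x)).natAbs) ∧
      ∀ Y, IsTestField Y → bdry T.carrier T.normal T.mult Y =
        bdry D R.ν (fun _ => 1) Y + ∑ i, (W i : ℝ) * circ Y (u i) Φ := by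
  classical
  obtain ⟨nn, hnn, hnn1, hnn2⟩ := exists_measurable_normal (b := false) (a := -(A + 1))
    (c := A + 1) (ψ := fun _ => Φ) (ψ' := fun _ => 0) (fun _ _ => hasDerivAt_const _ _)
    continuousOn_const fun _ _ => hΦ
  have hmc : MeasurableSet (cyl (A + 1) Φ) :=
    measurableSet_rev_graph (fun _ _ => hasDerivAt_const _ _) continuousOn_const fun _ _ => hΦ
  have hnn1' : ∀ s ∈ Ioo (-(A + 1)) (A + 1), ∀ θ, nn (P s Φ θ) = -ep s Φ θ := fun s hs θ => by
    have := hnn1 s hs θ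
    rw [speed_cyl] at this
    simpa [gr₁, gr₂, gr₁', gr₂'] using this
  set C := cyl (A + 1) Φ
  set sg : ℤ → ℝ := fun z => if z < 0 then -1 else 1
  have hsg : ∀ z, sg z = 1 ∨ sg z = -1 := fun z => by simp only [sg]; split_ifs <;> simp
  have hsgz : ∀ z : ℤ, (z.natAbs : ℝ) * sg z = z := fun z => by
    rw [Nat.cast_natAbs, Int.cast_abs]
    simp only [sg]
    split_ifs with h
    · rw [abs_of_neg (by exact_mod_cast h)]; ring
    · rw [abs_of_nonneg (by exact_mod_cast not_lt.1 h)]; ring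
  have hwm : Measurable fun x => wind W u (tc x) := measurable_wind.comp measurable_tc
  have hdisj : ∀ x ∈ D, x ∉ C := fun x hx hxC => (hDb hx).2.ne (cyl_subset hΦ hxC).2.2
  have hDB : D ⊆ B \ Z := fun x hx => (hDb hx).1
  set nT : E3 → E3 := fun x => if x ∈ C then sg (wind W u (tc x)) • nn x else
    (lam x ^ 2)⁻¹ • R.calibExt x
  set mT : E3 → ℕ := fun x => if x ∈ C then (wind W u (tc x)).natAbs else 1
  have hnD : ∀ x ∈ D, nT x = R.ν x := fun x hx => by
    have h1 : lam x ≠ 0 := by linarith [lam_ge_two (hDB hx).1]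
    simp only [nT, if_neg (hdisj x hx)]
    rw [R.calibExt_of_mem (hDB hx), calib, smul_smul,
      inv_mul_cancel₀ (pow_ne_zero 2 h1), one_smul]
  have hmD : ∀ x ∈ D, mT x = 1 := fun x hx => if_neg (hdisj x hx)
  have hnC : ∀ x ∈ C, IsUnitNormal C x (nT x) := fun x hx => by
    simp only [nT, if_pos hx]
    exact hnn2 x hx _ (hsg _)
  have hmlam : Measurable fun x => (lam x ^ 2)⁻¹ := by unfold lam; fun_prop
  have hfin : ∫⁻ x in D ∪ C, (mT x : ENNReal) ∂μHE[2] < ⊤ := by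
    refine (lintegral_union_le _ _ _).trans_lt (ENNReal.add_lt_top.2 ⟨?_, ?_⟩)
    · rw [setLIntegral_congr_fun (g := fun _ => 1) hD fun x hx => by simp [hmD x hx],
        setLIntegral_one]
      exact (measure_le_hypArea hD fun x hx => (hDB hx).1).trans_lt ha
    · refine lt_of_le_of_lt ?_ ((lintegral_cyl (a := A + 1) hΦ W u).trans_lt ENNReal.ofReal_lt_top)
      refine setLIntegral_mono' hmc fun x hx => ?_
      simp only [mT, if_pos hx]
      refine le_mul_of_one_le_right' ?_
      rw [ENNReal.one_le_ofReal]
      nlinarith [lam_ge_two (cyl_subset hΦ hx).1.1]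
  obtain ⟨T, hT1, hT2, hT3⟩ : ∃ T : RectCurrent, T.carrier = D ∪ C ∧ T.normal = nT ∧
      T.mult = mT := by
    refine ⟨⟨D ∪ C, nT, mT, hD.union hmc, ?_, ?_, ⟨solid (A + 1) Φ, isCompact_solid hΦ,
      solid_subset hΦ, ?_⟩, ⟨fun i => if i = 0 then N else C, ?_, ?_, ?_⟩, hfin⟩, rfl, rfl, rfl⟩
    · exact Measurable.ite hmc (((measurable_from_top (f := sg)).comp hwm).smul hnn)
        (hmlam.smul R.measurable_calibExt)
    · exact Measurable.ite hmc ((measurable_from_top (f := Int.natAbs)).comp hwm) measurable_const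
    · rintro x (hx | hx)
      · exact mem_solid (hDB hx) (by linarith [hDt x hx]) (hDb hx).2.le
      · obtain ⟨h1, h2, h3⟩ := cyl_subset hΦ hx
        exact mem_solid h1 h2 h3.le
    · intro i
      by_cases hi : i = 0
      · simpa [hi] using hN
      · simp only [hi, if_false]
        exact isSurface_rev_graph (fun _ _ => hasDerivAt_const _ _) continuousOn_const fun _ _ => hΦ
    · rw [sdiff_eq_empty.2, measure_empty]
      rintro x (hx | hx)
      · exact mem_iUnion.2 ⟨0, by simpa using hDN hx⟩
      · exact mem_iUnion.2 ⟨1, by simpa using hx⟩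
    · intro i
      by_cases hi : i = 0
      · simp only [hi, if_true]
        have h1 : ((D ∪ C) ∩ N : Set E3) =ᵐ[μHE[2]] D := by
          refine ae_eq_set.2 ⟨measure_mono_null ?_ h0, ?_⟩
          · rintro x ⟨⟨hx | hx, hxN⟩, hxD⟩
            exacts [(hxD hx).elim, ⟨hxN, (cyl_subset hΦ hx).2.2⟩]
          · rw [sdiff_eq_empty.2 (subset_inter subset_union_left hDN), measure_empty]
        rw [Measure.restrict_congr_set h1]
        filter_upwards [ae_restrict_mem hD] with x hx
        rw [hnD x hx]
        exact hNn x (hDN hx)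
      · simp only [hi, if_false]
        rw [inter_eq_right.2 subset_union_right]
        filter_upwards [ae_restrict_mem hmc] with x hx using hnC x hx
  refine ⟨T, hT1, fun x hx => ⟨by rw [hT2, hnD x hx], by rw [hT3, hmD x hx]⟩,
    fun x hx => by rw [hT3]; exact if_pos hx, fun Y hY => ?_⟩
  obtain ⟨ρ, -, hF⟩ := T.exists_isFluxData
  have hi := hF.integrableOn_curl hY
  rw [hT1, hT2, hT3] at hi ⊢
  rw [← bdry_cyl hΦ hu hW hnn1' (n := nT) (m := mT) (fun x hx => ?_) hY, bdry,
    setIntegral_union (disjoint_left.2 hdisj) hmc (hi.mono_set subset_union_left)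
      (hi.mono_set subset_union_right)]
  · congr 1
    exact setIntegral_congr_fun hD fun x hx => by simp [hnD x hx, hmD x hx]
  · simp only [nT, mT]
    rw [if_pos hx, if_pos hx, smul_smul, hsgz]

/-- A surface minimizing area almost follows the foliation, if its boundary is close to the one of
a surface orthogonal to the foliation. -/
theorem defect_le {A Φ : ℝ} (hΦ : Φ ∈ Iφ) (hu : ∀ i, |u i| ≤ A)
    (hW : ∑ i, (W i : ℝ) = 0) (hN : IsSurface 1 N) (hNn : ∀ x ∈ N, IsUnitNormal N x (R.ν x))
    (hD : MeasurableSet D) (hDN : D ⊆ N) (hDb : D ⊆ below Φ) (hDt : ∀ x ∈ D, |tc x| ≤ A)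
    (ha : hypArea D < ⊤) (h0 : μHE[2] (N ∩ {x | phc x = Φ}) = 0)
    {S : Set E3} {n : E3 → E3} {ρ : ℝ} (hρ : ρ < 1) (hS : IsFluxData ρ S n fun _ => 1)
    (hb : ∀ Y, IsTestField Y → bdry S n (fun _ => 1) Y =
      bdry D R.ν (fun _ => 1) Y + ∑ i, (W i : ℝ) * circ Y (u i) Φ)
    (hmin : ∀ T : RectCurrent, (∀ Y, IsTestField Y →
      bdry T.carrier T.normal T.mult Y = bdry S n (fun _ => 1) Y) → hypArea S ≤ T.hypMass) :
    ∫ x in S, (lam x ^ 2 - ⟪R.calib x, n x⟫) ∂μHE[2] ≤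
      4 * π * hh Φ * ∫ s in Ioo (-(A + 1)) (A + 1), |(wind W u s : ℝ)| := by
  obtain ⟨T, hT, hTD, hTC, hTb⟩ := exists_competitor hΦ hu hW hN hNn hD hDN hDb hDt ha h0
  obtain ⟨ρ', hρ', hF⟩ := T.exists_isFluxData
  have hm := max_lt hρ hρ'
  have hS' := hS.mono (le_max_left ρ ρ')
  have hF' := hF.mono (le_max_right ρ ρ')
  have hmc : MeasurableSet (cyl (A + 1) Φ) :=
    measurableSet_rev_graph (fun _ _ => hasDerivAt_const _ _) continuousOn_const fun _ _ => hΦ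
  have hdisj : Disjoint D (cyl (A + 1) Φ) := disjoint_left.2 fun x hx hxC =>
    (hDb hx).2.ne (cyl_subset hΦ hxC).2.2
  have hbT := fun Y hY => (hTb Y hY).trans (hb Y hY).symm
  have e1 := R.flux_eq hm hF' hS' hbT
  have e2 := hmin T hbT
  have hFD := hF'.subset (hT ▸ subset_union_left) hD
  have hFC := hF'.subset (hT ▸ subset_union_right) hmc
  have e3 := hFC.neg.flux_le hm R
  have e4 := hFD.flux_nu hm R fun x hx => (hTD x hx.1).1
  have hl := (hF'.ofReal_integral_lam hm).1
  have hl' := (hS'.ofReal_integral_lam hm).1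
  rw [RectCurrent.hypMass, ← (hF'.ofReal_integral_lam hm).2,
    show hypArea S = ofReal (∫ x in S, ((1 : ℕ) : ℝ) * lam x ^ 2 ∂μHE[2]) by
      rw [(hS'.ofReal_integral_lam hm).2, hypArea]; simp,
    ENNReal.ofReal_le_ofReal_iff (integral_nonneg fun x => by positivity)] at e2
  have hc := hF'.integrableOn_calib hm R
  have hc' := hS'.integrableOn_calib hm R
  rw [hT] at e1 e2 hl hc
  rw [setIntegral_union hdisj hmc (hl.mono_set subset_union_left)
    (hl.mono_set subset_union_right)] at e2
  rw [setIntegral_union hdisj hmc (hc.mono_set subset_union_left)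
    (hc.mono_set subset_union_right), e4] at e1
  have e5 : ∫ x in cyl (A + 1) Φ, (T.mult x : ℝ) * lam x ^ 2 ∂μHE[2] =
      2 * π * hh Φ * ∫ s in Ioo (-(A + 1)) (A + 1), |(wind W u s : ℝ)| := by
    have h1 := (hFC.ofReal_integral_lam hm).2
    rw [setLIntegral_congr_fun hmc fun x hx => by rw [hTC x hx], lintegral_cyl hΦ W u,
      ENNReal.ofReal_eq_ofReal_iff (integral_nonneg fun x => by positivity)] at h1
    · exact h1
    · exact mul_nonneg (mul_nonneg (by positivity) (hh_pos hΦ).le)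
        (integral_nonneg fun _ => abs_nonneg _)
  simp only [Nat.cast_one, one_mul, inner_neg_right, mul_neg, integral_neg] at *
  rw [integral_sub hl' hc']
  rw [e5] at e2 e3
  linarith

end

section

variable {R : OrientedMinimalFoliation} {N N' M M' : Set E3} {n n' : E3 → E3}

theorem diff_Z_ae_eq (S : Set E3) : (S \ Z : Set E3) =ᵐ[μHE[2]] S :=
  sdiff_null_ae_eq_self measure_Z

/-- A continuous function on an admissible surface vanishes if it vanishes almost everywhere. -/
theorem IsAdmissible.eq_zero_of_ae (h : IsAdmissible N n) {f : E3 → ℝ} (hf : ContinuousOn f N)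
    {Φ₀ : ℝ} (hΦ₀ : Φ₀ < π / 2) (h0 : ∀ Φ ∈ Ioo Φ₀ (π / 2),
      ∀ᵐ x ∂(μHE[2] : Measure E3).restrict (N ∩ below Φ), f x = 0)
    {x : E3} (hx : x ∈ N) : f x = 0 := by
  obtain ⟨θ, hθ, he⟩ := P_surj (h.subset hx)
  have hφ := phc_mem (h.subset hx)
  have hq : (tc x, phc x) ∈ prof N := (h.P_mem_iff hφ θ).1 (he ▸ hx)
  obtain ⟨α, β, c, hG, hG0, hGN, -⟩ := h.exists_geod_subset hq
  obtain ⟨Φ, hΦ, hΦ2⟩ := exists_between (max_lt hφ.2 hΦ₀)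
  have hcg : Continuous (g₂ α β) := continuous_snd.comp (hG.continuous_geo (t0 := tc x))
  have hcg₁ : Continuous (g₁ α β c (tc x)) := continuous_fst.comp (hG.continuous_geo (t0 := tc x))
  have hG1 : g₁ α β c (tc x) 0 = tc x := congrArg Prod.fst hG0
  have hG2 : g₂ α β 0 = phc x := congrArg Prod.snd hG0
  obtain ⟨a, ha, hlt⟩ : ∃ a > 0, ∀ s ∈ Ioo (-a) a, g₂ α β s < Φ := by
    have : ∀ᶠ s in 𝓝 (0 : ℝ), g₂ α β s < Φ := hcg.continuousAt.eventually_lt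
      continuousAt_const (by rw [hG2]; exact (le_max_left _ _).trans_lt hΦ)
    obtain ⟨a, ha, hs⟩ := Metric.eventually_nhds_iff.1 this
    exact ⟨a, ha, fun s hs' => hs (by rw [dist_eq, sub_zero]; exact abs_lt.2 hs')⟩
  have hp := hG.isProfile (t0 := tc x) (-a) a
  set Q : ℝ × ℝ → E3 := fun p => P (g₁ α β c (tc x) p.1) (g₂ α β p.1) p.2 with hQ
  have hQN : ∀ p, Q p ∈ N := fun p => (h.P_mem_iff (hG.mem _) _).2 (hGN p.1)
  have hQc : Continuous Q := continuousOn_univ.1 (continuousOn_P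
    (by fun_prop) (by fun_prop) (by fun_prop) fun p _ =>
      denom_pos (cos_pos_of_mem (hG.mem p.1)).le)
  have hfQ : Continuous fun p => f (Q p) := hf.comp_continuous hQc hQN
  have hsub : rev (g₁ α β c (tc x)) (g₂ α β) (-a) a ⊆ N ∩ below Φ := by
    rintro _ ⟨s, hs, θ, rfl⟩
    exact ⟨hQN (s, θ), P_mem (hG.mem s), by rw [phc_P (hG.mem s)]; exact hlt s hs⟩
  have h1 : ∫⁻ y in rev (g₁ α β c (tc x)) (g₂ α β) (-a) a, ofReal |f y| ∂μHE[2] = 0 := by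
    rw [lintegral_congr_ae (g := fun _ => 0), lintegral_zero]
    filter_upwards [ae_mono (Measure.restrict_mono_set _ hsub)
      (h0 Φ ⟨(le_max_right _ _).trans_lt hΦ, hΦ2⟩)] with y hy
    simp [hy]
  set O : Set (ℝ × ℝ) := Ioo (-a) a ×ˢ Ioo (-π) π with hO
  have hOm : MeasurableSet O := measurableSet_Ioo.prod measurableSet_Ioo
  have hjc := hp.continuousOn_jac.comp continuousOn_fst fun p (hp : p ∈ O) => hp.1
  rw [hp.lintegral_rev] at h1
  replace h1 := (lintegral_eq_zero_iff' (((hjc.aemeasurable hOm).ennreal_ofReal).mul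
    hfQ.abs.measurable.ennreal_ofReal.aemeasurable)).1 h1
  have h2 : (fun p => f (Q p)) =ᵐ[volume.restrict O] fun _ => 0 := by
    filter_upwards [h1, ae_restrict_mem hOm] with p hp1 hp2
    have h3 : ofReal _ * ofReal |f (Q p)| = 0 := hp1
    simpa using (mul_eq_zero.1 h3).resolve_left (ENNReal.ofReal_pos.2 (hp.jac_pos hp2.1)).ne'
  have h3 := Measure.eqOn_open_of_ae_eq h2 (isOpen_Ioo.prod isOpen_Ioo) hfQ.continuousOn
    continuousOn_const
  have h4 : EqOn (fun θ => f (Q (0, θ))) (fun _ => 0) (Icc (-π) π) := by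
    refine EqOn.of_subset_closure (s := Ioo (-π) π) (fun θ hθ => h3 ⟨⟨by simpa, ha⟩, hθ⟩)
      (hfQ.comp (by fun_prop)).continuousOn continuousOn_const Ioo_subset_Icc_self ?_
    rw [closure_Ioo (by linarith [pi_pos])]
  have h5 := h4 (Ioc_subset_Icc_self hθ)
  simpa only [hQ, hG1, hG2, ← he] using h5

theorem HasEnds.sum_eq_zero {ι ι' : Type} [Fintype ι] [Fintype ι'] {w : ι → ℤ} {τ : ι → ℝ}
    {u : ι → ℝ → ℝ} {w' : ι' → ℤ} {τ' : ι' → ℝ} {u' : ι' → ℝ → ℝ} {Φ₀ A Φ₀' A' : ℝ}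
    (h : HasEnds (M \ Z) n w τ u Φ₀ A) (h' : HasEnds (M' \ Z) n' w' τ' u' Φ₀' A')
    (hs : SameOrientedBoundary M n M' n') (F : ℝ → ℝ) :
    ∑ i, ((Sum.elim w' (-w) i : ℤ) : ℝ) * F (Sum.elim τ' τ i) = 0 := by
  refine sum_weight_eq_zero (W := fun i => ((Sum.elim w' (-w) i : ℤ) : ℝ)) (fun Y hY => ?_) F
  have e := hs.2 Y hY
  rw [← bdry_congr_set (diff_Z_ae_eq M), ← bdry_congr_set (diff_Z_ae_eq M'), h.bdry_eq Y hY,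
    h'.bdry_eq Y hY] at e
  simp [Fintype.sum_sum_type, e]

/-- A minimizing surface with the oriented boundary at infinity of a union of leaves is orthogonal
to the foliation. -/
theorem normal_eq_of_sameOrientedBoundary (h : IsAdmissible (M \ Z) R.ν)
    (hf : (geods (M \ Z)).Finite) (h' : IsAdmissible (M' \ Z) n') (hM' : M' ⊆ B)
    (hmin : IsAreaMinimizing M' n') (hs : SameOrientedBoundary M R.ν M' n') {x : E3}
    (hx : x ∈ M' \ Z) : n' x = R.ν x := by
  obtain ⟨ι, _, w, τ, u, Φ₀, A, hE⟩ := h.exists_hasEnds hf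
  obtain ⟨ι', _, w', τ', u', Φ₀', A', hE'⟩ :=
    h'.exists_hasEnds (h.finite_geods_of_idealBoundary hf h' hs.1)
  have hzero := hE.sum_eq_zero hE' hs
  set W := Sum.elim w' (-w)
  set T := Sum.elim τ' τ
  set V : ℝ → ι' ⊕ ι → ℝ := fun Φ => Sum.elim (fun i => u' i Φ) fun i => u i Φ
  set f : E3 → ℝ := fun x => lam x ^ 2 - ⟪R.calib x, n' x⟫
  have hf0 : ∀ x ∈ M' \ Z, f x = lam x ^ 2 * (1 - ⟪R.ν x, n' x⟫) := fun x _ => by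
    simp only [f, calib, inner_smul_left, RCLike.conj_to_real]; ring
  have hfn : ∀ x ∈ M' \ Z, 0 ≤ f x := fun x hx => by
    rw [hf0 x hx]
    have := real_inner_le_norm (R.ν x) (n' x)
    rw [R.norm_nu (h'.subset hx), h'.norm_normal hx] at this
    exact mul_nonneg (sq_nonneg _) (by linarith)
  have hlim : Tendsto (fun Φ => 4 * π * ∑ i, |(W i : ℝ)| * (hh Φ * |V Φ i - T i|))
      (𝓝[<] (π / 2)) (𝓝 0) := by
    have h1 : ∀ i, Tendsto (fun Φ => |(W i : ℝ)| * (hh Φ * |V Φ i - T i|)) (𝓝[<] (π / 2))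
        (𝓝 0) := fun i => by
      rw [← mul_zero |(W i : ℝ)|]
      refine Tendsto.const_mul _ ?_
      rcases i with i | i
      exacts [hE'.small i, hE.small i]
    simpa using (tendsto_finsetSum Finset.univ fun i _ => h1 i).const_mul (4 * π)
  have hm0 : max Φ₀ Φ₀' < π / 2 := max_lt hE.mem₀.2 hE'.mem₀.2
  have hmem : ∀ Φ ∈ Ioo (max Φ₀ Φ₀') (π / 2), Φ ∈ Iφ ∧ Φ ∈ Ioo Φ₀ (π / 2) ∧
      Φ ∈ Ioo Φ₀' (π / 2) := fun Φ hΦ => by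
    have h1 := (le_max_left Φ₀ Φ₀').trans_lt hΦ.1
    exact ⟨⟨hE.mem₀.1.trans h1, hΦ.2⟩, ⟨h1, hΦ.2⟩, (le_max_right Φ₀ Φ₀').trans_lt hΦ.1, hΦ.2⟩
  have key : ∀ Φ ∈ Ioo (max Φ₀ Φ₀') (π / 2),
      IntegrableOn f (M' \ Z ∩ below Φ) μHE[2] ∧ ∫ x in M' \ Z ∩ below Φ, f x ∂μHE[2] ≤
        4 * π * ∑ i, |(W i : ℝ)| * (hh Φ * |V Φ i - T i|) := fun Φ hΦ => by
    obtain ⟨hΦI, hΦ1, hΦ2⟩ := hmem Φ hΦ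
    set K := solid (max A A') Φ
    have hS : M' \ Z ∩ below Φ ⊆ M' ∩ K := fun y hy => ⟨hy.1.1, mem_solid (h'.subset hy.1)
      ((hE'.bound y hy.1).trans (le_max_right _ _)) hy.2.2.le⟩
    have hae : (M' ∩ K : Set E3) =ᵐ[μHE[2]] (M' \ Z ∩ below Φ : Set E3) := by
      refine ae_eq_set.2 ⟨measure_mono_null (fun y hy => ?_)
        (measure_union_null measure_Z (hE'.null Φ hΦ2)), by
          rw [sdiff_eq_empty.2 hS, measure_empty]⟩
      by_cases hyZ : y ∈ Z
      · exact Or.inl hyZ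
      · refine Or.inr ⟨⟨hy.1.1, hyZ⟩, ?_⟩
        by_contra hne
        exact hy.2 ⟨⟨hy.1.1, hyZ⟩, ⟨hM' hy.1.1, hyZ⟩,
          lt_of_le_of_ne (phc_le_of_mem_solid hΦI hy.1.2 hyZ) hne⟩
    obtain ⟨ρ, hρ, hle⟩ := exists_norm_le_of_isCompact (isCompact_solid (A := max A A') hΦI)
      (solid_subset hΦI)
    have hF : IsFluxData ρ (M' \ Z ∩ below Φ) n' fun _ => 1 := isFluxData_one hρ
      (hE'.measurableSet.inter (measurableSet_below Φ)) (fun y hy => hle y (hS hy).2)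
      (hE'.area Φ hΦI) (h'.continuousOn_normal.mono fun y hy => hy.1.1)
      fun y hy => h'.norm_normal hy.1.1
    have hi := (hF.ofReal_integral_lam hρ).1
    have hi' := hF.integrableOn_calib hρ R
    simp only [Nat.cast_one, one_mul] at hi hi'
    refine ⟨hi.sub hi', ?_⟩
    have hd := defect_le (R := R) (W := W) (u := V Φ) (A := max A A') (N := M \ Z)
      (D := M \ Z ∩ below Φ) hΦI (fun i => ?_) (by simpa using hzero fun _ => 1) h.surface h.normal
      (hE.measurableSet.inter (measurableSet_below Φ)) inter_subset_left inter_subset_right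
      (fun y hy => (hE.bound y hy.1).trans (le_max_left _ _)) (hE.area Φ hΦI) (hE.null Φ hΦ1)
      hρ hF (fun Y hY => ?_) fun T hT => ?_
    · refine hd.trans ?_
      have h1 := integral_abs_wind_le (u := V Φ) hzero (Ioo (-(max A A' + 1)) (max A A' + 1))
      have h2 := (hh_pos hΦI).le
      calc _ ≤ 4 * π * hh Φ * ∑ i, |(W i : ℝ)| * |V Φ i - T i| :=
            mul_le_mul_of_nonneg_left h1 (by positivity)
        _ = _ := by
            rw [mul_assoc, Finset.mul_sum]
            congr 1
            exact Finset.sum_congr rfl fun i _ => by ring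
    · rcases i with i | i
      exacts [(hE'.bound_end i Φ hΦ2).trans (le_max_right _ _),
        (hE.bound_end i Φ hΦ1).trans (le_max_left _ _)]
    · rw [hE.bdry_below Φ hΦ1 Y hY, hE'.bdry_below Φ hΦ2 Y hY]
      simp [Fintype.sum_sum_type, W, V]
    · rw [← hypArea_congr_set hae]
      exact hmin K (isCompact_solid hΦI) (solid_subset hΦI) T fun Y hY => by
        rw [hT Y hY, bdry_congr_set hae]
  have hmeas : ∀ Φ, MeasurableSet (M' \ Z ∩ below Φ) := fun Φ =>
    hE'.measurableSet.inter (measurableSet_below Φ)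
  have hz : ∀ Φ ∈ Ioo (max Φ₀ Φ₀') (π / 2),
      ∀ᵐ x ∂(μHE[2] : Measure E3).restrict (M' \ Z ∩ below Φ), f x = 0 := fun Φ hΦ => by
    have hnn : ∀ Φ', 0 ≤ᵐ[(μHE[2] : Measure E3).restrict (M' \ Z ∩ below Φ')] f := fun Φ' => by
      filter_upwards [ae_restrict_mem (hmeas Φ')] with y hy using hfn y hy.1
    have h1 : ∫ x in M' \ Z ∩ below Φ, f x ∂μHE[2] ≤ 0 := by
      refine ge_of_tendsto hlim ?_
      filter_upwards [Ioo_mem_nhdsLT hΦ.2] with Φ' hΦ'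
      refine (setIntegral_mono_set (key Φ' ⟨hΦ.1.trans hΦ'.1, hΦ'.2⟩).1 (hnn Φ')
        (LE.le.eventuallyLE fun y hy => ?_)).trans
        (key Φ' ⟨hΦ.1.trans hΦ'.1, hΦ'.2⟩).2
      exact ⟨hy.1, hy.2.1, hy.2.2.trans hΦ'.1⟩
    exact (setIntegral_eq_zero_iff_of_nonneg_ae (hnn Φ) (key Φ hΦ).1).1
      (le_antisymm h1 (integral_nonneg_of_ae (hnn Φ)))
  have hfc : ContinuousOn f (M' \ Z) :=
    ((continuousOn_lam.mono fun y hy => (h'.subset hy).1).pow 2).sub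
      ((R.continuousOn_calib.mono h'.subset).inner h'.continuousOn_normal)
  have h0 := h'.eq_zero_of_ae hfc hm0 hz hx
  rw [hf0 x hx] at h0
  have h1 : lam x ^ 2 ≠ 0 := pow_ne_zero 2 (by linarith [lam_ge_two (h'.subset hx).1])
  have h2 := (mul_eq_zero.1 h0).resolve_left h1
  exact ((inner_eq_one_iff_of_norm_eq_one (𝕜 := ℝ) (R.norm_nu (h'.subset hx))
    (h'.norm_normal hx)).1 (by linarith)).symm

end

section

variable {N N' V : Set E3} {f : E3 → ℝ} {p : E3} {ν : E3 → E3}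

/-! ### Surfaces with a common Lipschitz normal field -/

theorem IsDefiningFunction.eq_zero_iff {k : WithTop ℕ∞} (h : IsDefiningFunction k N V f) {x : E3}
    (hx : x ∈ V) : f x = 0 ↔ x ∈ N := by
  have := Set.ext_iff.1 h.2.2.2 x
  simp only [mem_inter_iff, mem_ofPred_eq] at this
  tauto

/-- A chart in which the defining function is linear. -/
theorem IsDefiningFunction.exists_straightening (h : IsDefiningFunction 1 N V f) (hpN : p ∈ N)
    (hp : p ∈ V) : ∃ F G : E3 → E3, ContinuousAt F p ∧ F p = p ∧ G p = p ∧ ContDiffAt ℝ 1 G p ∧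
      (∀ x, ⟪gradient f p, F x - p⟫ = f x) ∧ (∀ᶠ x in 𝓝 p, G (F x) = x) ∧
      ∀ᶠ y in 𝓝 p, F (G y) = y := by
  set g := gradient f p with hg
  have hg0 : ‖g‖ ^ 2 ≠ 0 := pow_ne_zero 2 (norm_ne_zero_iff.2 (h.2.2.1 p hp))
  set c : E3 := (‖g‖ ^ 2)⁻¹ • g
  have hgc : ⟪g, c⟫ = 1 := by
    rw [inner_smul_right, real_inner_self_eq_norm_sq, inv_mul_cancel₀ hg0]
  set F : E3 → E3 := fun x => x + (f x - ⟪g, x - p⟫) • c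
  have hFp : F p = p := by simp [F, (h.eq_zero_iff hp).2 hpN]
  have hfc : ContDiffAt ℝ 1 f p := h.2.1.contDiffAt (h.1.mem_nhds hp)
  have hF : ContDiffAt ℝ 1 F p :=
    contDiffAt_id.add ((hfc.sub (contDiffAt_const.inner ℝ (contDiffAt_id.sub
      contDiffAt_const))).smul contDiffAt_const)
  have hF' : HasFDerivAt F ((ContinuousLinearEquiv.refl ℝ E3 : E3 ≃L[ℝ] E3) : E3 →L[ℝ] E3) p := by
    have h1 := (hfc.differentiableAt one_ne_zero).hasFDerivAt
    have h2 : HasFDerivAt (fun x => ⟪g, x - p⟫) (innerSL ℝ g) p :=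
      (innerSL ℝ g).hasFDerivAt.comp p ((hasFDerivAt_id p).sub_const p)
    refine ((hasFDerivAt_id p).add ((h1.sub h2).smul_const c)).congr_fderiv ?_
    ext1 v
    simp [← inner_gradient, ← hg]
  have hs := hF.hasStrictFDerivAt' hF' one_ne_zero
  refine ⟨F, hF.localInverse hF' one_ne_zero, hF.continuousAt, hFp, ?_, ?_, fun x => ?_,
    hs.eventually_left_inverse, ?_⟩
  · nth_rw 2 [← hFp]
    exact hF.localInverse_apply_image hF' one_ne_zero
  · have := hF.to_localInverse hF' one_ne_zero
    rwa [hFp] at this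
  · simp only [F, add_sub_right_comm, inner_add_right, inner_smul_right, hgc]
    ring
  · have := hs.eventually_right_inverse
    rwa [hFp] at this

theorem IsDefiningFunction.exists_abs_fderiv_le (h : IsDefiningFunction ∞ N V f)
    (hN : ∀ x ∈ N, IsUnitNormal N x (ν x)) {K₂ : NNReal} {t₂ : Set E3} (ht₂ : t₂ ∈ 𝓝 p)
    (hν : LipschitzOnWith K₂ ν t₂) (hpN : p ∈ N) (hp : p ∈ V) :
    ∃ C, ∀ᶠ y in 𝓝 p, ∀ v, ⟪ν y, v⟫ = 0 → |fderiv ℝ f y v| ≤ C * |f y| * ‖v‖ := by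
  have h1 : IsDefiningFunction 1 N V f := h.of_le (by simp)
  obtain ⟨F, G, hF, hFp, hGp, hG, hFf, hGF, hFG⟩ := h1.exists_straightening hpN hp
  set g := gradient f p
  have hfc : ContDiffAt ℝ ∞ f p := h.2.1.contDiffAt (h.1.mem_nhds hp)
  have hdc : ContDiffAt ℝ 1 (fderiv ℝ f) p := hfc.fderiv_right (m := 1) (by norm_cast)
  obtain ⟨K₁, t₁, ht₁, hL₁⟩ := hdc.exists_lipschitzOnWith
  obtain ⟨K₃, t₃, ht₃, hL₃⟩ := hG.exists_lipschitzOnWith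
  set J : E3 → E3 := fun y => F y - (f y / ‖g‖ ^ 2) • g
  have hf0 : f p = 0 := (h.eq_zero_iff hp).2 hpN
  have hFt : Tendsto F (𝓝 p) (𝓝 p) := by simpa only [hFp] using hF.tendsto
  have hJ : Tendsto J (𝓝 p) (𝓝 p) := by
    have : ContinuousAt J p := hF.sub ((hfc.continuousAt.div_const _).smul continuousAt_const)
    simpa [J, hFp, hf0] using this.tendsto
  have hGJ : Tendsto (fun y => G (J y)) (𝓝 p) (𝓝 p) := by
    have := hG.continuousAt.tendsto.comp hJ
    rwa [hGp] at this
  have hbd : ∀ᶠ y in 𝓝 p, ‖fderiv ℝ f y‖ < ‖fderiv ℝ f p‖ + 1 :=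
    hdc.continuousAt.norm.eventually_lt continuousAt_const (by linarith)
  set b := ‖fderiv ℝ f p‖ + 1
  have hg0 : ‖g‖ ≠ 0 := norm_ne_zero_iff.2 (h.2.2.1 p hp)
  refine ⟨(K₁ + b * K₂) * (K₃ / ‖g‖), ?_⟩
  filter_upwards [ht₁, ht₂, hGJ ht₁, hGJ ht₂, hGJ (h.1.mem_nhds hp), hGJ hbd, hFt ht₃, hJ ht₃, hGF,
    hJ hFG] with y a1 a2 a3 a4 a5 a6 a7 a8 a9 a10 v hv
  simp only [mem_preimage, mem_ofPred_eq] at a3 a4 a5 a6 a7 a8 a10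
  set z := G (J y)
  have hz : z ∈ N := by
    rw [← h.eq_zero_iff a5, ← hFf, a10]
    simp only [J]
    rw [sub_right_comm, inner_sub_right, hFf, inner_smul_right, real_inner_self_eq_norm_sq]
    field_simp
    ring
  have hyz : ‖y - z‖ ≤ K₃ / ‖g‖ * |f y| := by
    have := hL₃.norm_sub_le a7 a8
    rw [a9] at this
    refine this.trans (le_of_eq ?_)
    simp only [J, sub_sub_cancel, norm_smul, norm_div, norm_pow, norm_eq_abs, abs_norm]
    field_simp
  have e1 : |fderiv ℝ f y v - fderiv ℝ f z v| ≤ K₁ * ‖y - z‖ * ‖v‖ := by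
    rw [← sub_apply, ← norm_eq_abs]
    exact ContinuousLinearMap.le_of_opNorm_le _ (hL₁.norm_sub_le a1 a3) v
  have e2 : |fderiv ℝ f z v| ≤ b * |⟪ν z, v⟫| := by
    have hb : ‖gradient f z‖ ≤ b := by
      rw [gradient, LinearIsometryEquiv.norm_map]; exact a6.le
    have hgz : ‖gradient f z‖ ≠ 0 := norm_ne_zero_iff.2 (h.2.2.1 z a5)
    have : |fderiv ℝ f z v| = ‖gradient f z‖ * |⟪ν z, v⟫| := by
      rw [← inner_gradient]
      rcases h1.unitNormal_eq hz a5 (hN z hz) with e | e <;>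
      · rw [e]
        simp only [inner_neg_left, inner_smul_left, RCLike.conj_to_real, abs_neg, abs_mul, abs_inv,
          abs_norm]
        field_simp
    rw [this]
    gcongr
  have e3 : |⟪ν z, v⟫| ≤ K₂ * ‖y - z‖ * ‖v‖ := by
    have : ⟪ν z, v⟫ = ⟪ν z - ν y, v⟫ := by rw [inner_sub_left, hv, sub_zero]
    rw [this]
    refine (abs_real_inner_le_norm _ _).trans ?_
    gcongr
    rw [norm_sub_rev]
    exact hν.norm_sub_le a2 a4
  have hb0 : 0 ≤ b := by positivity
  calc |fderiv ℝ f y v| ≤ |fderiv ℝ f y v - fderiv ℝ f z v| + |fderiv ℝ f z v| := by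
        simpa using abs_add_le (fderiv ℝ f y v - fderiv ℝ f z v) (fderiv ℝ f z v)
    _ ≤ K₁ * ‖y - z‖ * ‖v‖ + b * (K₂ * ‖y - z‖ * ‖v‖) :=
        add_le_add e1 (e2.trans (mul_le_mul_of_nonneg_left e3 hb0))
    _ = (K₁ + b * K₂) * ‖y - z‖ * ‖v‖ := by ring
    _ ≤ (K₁ + b * K₂) * (K₃ / ‖g‖ * |f y|) * ‖v‖ := by gcongr
    _ = _ := by ring

/-- Surfaces with a common Lipschitz normal field agree near common points. -/
theorem eventually_mem_of_isUnitNormal (hN : IsSurface ∞ N)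
    (hNn : ∀ x ∈ N, IsUnitNormal N x (ν x)) (hN' : IsSurface 1 N')
    (hNn' : ∀ x ∈ N', IsUnitNormal N' x (ν x)) {K : NNReal} {t : Set E3} (ht : t ∈ 𝓝 p)
    (hν : LipschitzOnWith K ν t) (hpN : p ∈ N) (hpN' : p ∈ N') : ∀ᶠ q in 𝓝 p, q ∈ N' → q ∈ N := by
  obtain ⟨V, f, hp, h⟩ := hN p hpN
  obtain ⟨V', f', hp', h'⟩ := hN' p hpN'
  obtain ⟨C, hC⟩ := h.exists_abs_fderiv_le hNn ht hν hpN hp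
  obtain ⟨F, G, hF, hFp, hGp, hG, hFf, hGF, hFG⟩ := h'.exists_straightening hpN' hp'
  obtain ⟨K₃, t₃, ht₃, hL₃⟩ := hG.exists_lipschitzOnWith
  have hGt : Tendsto G (𝓝 p) (𝓝 p) := by simpa only [hGp] using hG.continuousAt.tendsto
  have hFt : Tendsto F (𝓝 p) (𝓝 p) := by simpa only [hFp] using hF.tendsto
  have hall : ∀ᶠ y in 𝓝 p, (∀ v, ⟪ν (G y), v⟫ = 0 → |fderiv ℝ f (G y) v| ≤ C * |f (G y)| * ‖v‖) ∧
      G y ∈ V ∧ G y ∈ V' ∧ F (G y) = y ∧ ContDiffAt ℝ 1 G y ∧ y ∈ t₃ := by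
    filter_upwards [hGt hC, hGt (h.1.mem_nhds hp), hGt (h'.1.mem_nhds hp'), hFG,
      hG.eventually (by simp), ht₃] with y a1 a2 a3 a4 a5 a6 using ⟨a1, a2, a3, a4, a5, a6⟩
  obtain ⟨r, hr, hball⟩ := Metric.eventually_nhds_iff_ball.1 hall
  filter_upwards [hGF, hFt (ball_mem_nhds p hr), h.1.mem_nhds hp, h'.1.mem_nhds hp']
    with q hq hqr hqV hqV' hqN
  set e := F q - p
  have hγ : ∀ s, HasDerivAt (fun s : ℝ => p + s • e) e s := fun s => by
    simpa using ((hasDerivAt_id s).smul_const e).const_add p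
  set O : Set ℝ := (fun s : ℝ => p + s • e) ⁻¹' ball p r
  have hO : IsOpen O := isOpen_ball.preimage (by fun_prop)
  have hsub : ∀ s ∈ Icc (0 : ℝ) 1, s ∈ O := fun s hs => by
    have h1 : ‖e‖ < r := by simpa [e, dist_eq_norm] using hqr
    simp only [O, mem_preimage, mem_ball_iff_norm, add_sub_cancel_left, norm_smul,
      norm_of_nonneg hs.1]
    exact (mul_le_of_le_one_left (norm_nonneg _) hs.2).trans_lt h1
  have hx : ∀ s ∈ O, HasDerivAt (fun s : ℝ => G (p + s • e)) (fderiv ℝ G (p + s • e) e) s :=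
    fun s hs => ((hball _ hs).2.2.2.2.1.differentiableAt one_ne_zero).hasFDerivAt.comp_hasDerivAt s
      (hγ s)
  have hx' : ∀ s ∈ O, f' (G (p + s • e)) = 0 := fun s hs => by
    rw [← hFf, (hball _ hs).2.2.2.1, add_sub_cancel_left, inner_smul_right, hFf,
      (h'.eq_zero_iff hqV').2 hqN, mul_zero]
  have hort : ∀ s ∈ O, ⟪ν (G (p + s • e)), fderiv ℝ G (p + s • e) e⟫ = 0 := fun s hs => by
    have hV := (hball _ hs).2.2.1
    have h1 := (h'.hasStrictFDerivAt hV).hasFDerivAt.comp_hasDerivAt s (hx s hs)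
    have h2 : HasDerivAt (f' ∘ fun s : ℝ => G (p + s • e)) 0 s :=
      (hasDerivAt_const s 0).congr_of_eventuallyEq (by
        filter_upwards [hO.mem_nhds hs] with s' hs' using hx' s' hs')
    have h3 := h1.unique h2
    rw [← inner_gradient] at h3
    have hmem := (h'.eq_zero_iff hV).1 (hx' s hs)
    rcases h'.unitNormal_eq hmem hV (hNn' _ hmem) with e' | e' <;> rw [e'] <;>
      simp [inner_smul_left, inner_neg_left, h3]
  have hw : ∀ s ∈ O, HasDerivAt (fun s : ℝ => f (G (p + s • e)))
      (fderiv ℝ f (G (p + s • e)) (fderiv ℝ G (p + s • e) e)) s := fun s hs =>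
    ((h.of_le (l := 1) (by simp)).hasStrictFDerivAt (hball _ hs).2.1).hasFDerivAt.comp_hasDerivAt s
      (hx s hs)
  have hz := eq_zero_of_abs_deriv_le_mul_abs_self_of_eq_zero_right (a := 0) (b := 1)
    (K := |C| * (K₃ * ‖e‖)) (fun s hs => (hw s (hsub s hs)).continuousAt.continuousWithinAt)
    (fun s hs => (hw s (hsub s (Ico_subset_Icc_self hs))).hasDerivWithinAt)
    (by simp [hGp, (h.eq_zero_iff hp).2 hpN]) (fun s hs => by
      have hsO := hsub s (Ico_subset_Icc_self hs)
      refine ((hball _ hsO).1 _ (hort s hsO)).trans ?_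
      have h1 : ‖fderiv ℝ G (p + s • e) e‖ ≤ K₃ * ‖e‖ :=
        ContinuousLinearMap.le_of_opNorm_le _ (norm_fderiv_le_of_lipschitzOn ℝ
          (mem_of_superset (isOpen_ball.mem_nhds hsO) fun y hy =>
            (hball y hy).2.2.2.2.2) hL₃) e
      rw [mul_right_comm, norm_eq_abs]
      gcongr
      exact le_abs_self C) 1 (by simp)
  have h1 : p + (1 : ℝ) • e = F q := by simp [e]
  rw [h1, hq] at hz
  exact (h.eq_zero_iff hqV).1 hz

variable {R : OrientedMinimalFoliation}

theorem OrientedMinimalFoliation.SamePlaque.symm {x y : E3} (h : R.SamePlaque x y) :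
    R.SamePlaque y x :=
  let ⟨φ, hφ, t, hx, hy⟩ := h
  ⟨φ, hφ, t, hy, hx⟩

theorem OrientedMinimalFoliation.exists_lipschitzOnWith_nu {x : E3} (hx : x ∈ B \ Z) :
    ∃ K, ∃ t ∈ 𝓝 x, LipschitzOnWith K R.ν t := by
  obtain ⟨K, t, ht, h⟩ := R.lipschitz hx
  rw [isOpen_B_diff_Z.nhdsWithin_eq hx] at ht
  exact ⟨K, t, ht, h⟩

theorem rotZ_rotZ (α β : ℝ) (x : E3) : rotZ α (rotZ β x) = rotZ (α + β) x := by
  apply ext_E3 <;> simp [rotZ, cos_add, sin_add] <;> ring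

theorem rotZ_zero (x : E3) : rotZ 0 x = x := by
  apply ext_E3 <;> simp [rotZ]

/-- A rotationally invariant surface orthogonal to the foliation is a union of leaves. -/
theorem IsAdmissible.consistsOfRotLeaves {M : Set E3} {n : E3 → E3} (h : IsAdmissible (M \ Z) n)
    (hν : ∀ x ∈ M \ Z, n x = R.ν x) (hM : IsSurface ∞ M) : ConsistsOfRotLeaves R M := by
  have hn : ∀ x ∈ M \ Z, IsUnitNormal (M \ Z) x (R.ν x) := fun x hx => hν x hx ▸ h.normal x hx
  have hs : IsSurface ∞ (M \ Z) := fun p hp => by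
    obtain ⟨V, f, hpV, hf⟩ := hM p hp.1
    exact ⟨V ∩ Zᶜ, f, ⟨hpV, hp.2⟩, hf.inter isClosed_Z.isOpen_compl (by ext x; simp)⟩
  have hpl : ∀ φ ∈ R.atlas, ∀ t, IsSurface ∞ (plaque φ t) := fun φ hφ t x hx =>
    let ⟨V, f, hxV, hf, _⟩ := R.minimal φ hφ t x hx
    ⟨V, f, hxV, hf⟩
  have hle : ∀ {S : Set E3}, IsSurface ∞ S → IsSurface 1 S := fun hS x hx =>
    let ⟨V, f, hxV, hf⟩ := hS x hx
    ⟨V, f, hxV, hf.of_le (by simp)⟩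
  have hsat : ∀ φ ∈ R.atlas, ∀ t, ∀ x ∈ plaque φ t, x ∈ M \ Z → plaque φ t ⊆ M \ Z := by
    intro φ hφ t x hx hxM y hy
    have hin : ∀ z ∈ plaque φ t, z ∈ M \ Z →
        z ∈ interior {z | z ∈ plaque φ t → z ∈ M \ Z} := fun z hz hzM => by
      obtain ⟨K, s, hs', hK⟩ := R.exists_lipschitzOnWith_nu (h.subset hzM)
      exact mem_interior_iff_mem_nhds.2 (eventually_mem_of_isUnitNormal hs hn
        (hle (hpl φ hφ t)) (R.normal φ hφ t) hs' hK hzM hz)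
    have hcl : ∀ z ∈ plaque φ t, z ∈ closure (M \ Z) → z ∈ M \ Z := fun z hz hzc =>
      h.closed ⟨hzc, R.source_subset φ hφ hz.1⟩
    by_contra hyM
    obtain ⟨z, hz, hz1, hz2⟩ := (isConnected_plaque hφ t).isPreconnected _ _ isOpen_interior
      (isClosed_closure (s := M \ Z)).isOpen_compl
      (fun z hz => or_iff_not_imp_right.2 fun hzc => hin z hz (hcl z hz (not_not.1 hzc)))
      ⟨x, hx, hin x hx hxM⟩ ⟨y, hy, fun hyc => hyM (hcl y hy hyc)⟩
    exact hz2 (subset_closure (interior_subset hz1 hz))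
  have hleaf : ∀ x ∈ M \ Z, R.leaf x ⊆ M \ Z := fun x hx y hy => by
    induction hy with
    | refl => exact hx
    | tail _ hyz ih =>
      obtain ⟨φ, hφ, t, hy, hz⟩ := hyz
      exact hsat φ hφ t _ hy ih hz
  have horb : ∀ x ∈ M \ Z, ∀ α, rotZ α x ∈ R.leaf x := fun x hx α => by
    have : Std.Symm R.SamePlaque := ⟨fun _ _ => .symm⟩
    have hc : Continuous fun α => rotZ α x := by unfold rotZ; fun_prop
    have := isPreconnected_univ.induction₂ (fun α β : ℝ =>
      Relation.ReflTransGen R.SamePlaque (rotZ α x) (rotZ β x)) (fun α _ => ?_)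
      (fun _ _ _ _ _ _ => Relation.ReflTransGen.trans)
      (fun _ _ _ _ => Relation.ReflTransGen.stdSymm.symm _ _) (mem_univ 0) (mem_univ α)
    · rwa [rotZ_zero] at this
    · have hα := h.rot α x hx
      obtain ⟨φ, hφ, hαφ⟩ := R.cover _ (h.subset hα)
      obtain ⟨K, s, hs', hK⟩ := R.exists_lipschitzOnWith_nu (h.subset hα)
      rw [nhdsWithin_univ]
      filter_upwards [hc.continuousAt.eventually (eventually_mem_of_isUnitNormal
        (hpl φ hφ (φ (rotZ α x)).2) (R.normal φ hφ _) h.surface hn hs' hK ⟨hαφ, rfl⟩ hα)]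
        with β hβ
      exact .single ⟨φ, hφ, _, ⟨hαφ, rfl⟩, hβ (h.rot β x hx)⟩
  refine ⟨R.leaf '' (M \ Z), ?_, ?_⟩
  · rintro _ ⟨x, hx, rfl⟩
    have hsub : ∀ α, ∀ y ∈ R.leaf x, rotZ α y ∈ R.leaf x := fun α y hy =>
      Relation.ReflTransGen.trans hy (horb y (hleaf x hx hy) α)
    refine ⟨⟨x, h.subset hx, rfl⟩, fun α => subset_antisymm (image_subset_iff.2 (hsub α))
      fun y hy => ⟨rotZ (-α) y, hsub _ y hy, ?_⟩⟩
    rw [rotZ_rotZ, add_neg_cancel, rotZ_zero]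
  · ext x
    refine ⟨fun hx => ⟨_, ⟨x, hx, rfl⟩, .refl⟩, ?_⟩
    rintro ⟨_, ⟨y, hy, rfl⟩, hx⟩
    exact hleaf y hy hx

end

end HypFoliation

end

theorem mainTheorem9 (R : HypFoliation.OrientedMinimalFoliation) (hR : R.IsRotationallyInvariant)
    (U M : Set HypFoliation.E3) (hUB : U ⊆ HypFoliation.B) (hU : interior (closure U) = U)
    (hM : M = frontier U ∩ HypFoliation.B) (hleaves : HypFoliation.ConsistsOfRotLeaves R M)
    (hout : ∀ p ∈ M \ HypFoliation.Z, HypFoliation.PointsOut U p (R.ν p)) :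
    HypFoliation.IsAreaMinimizing M R.ν ∧ (M.Nonempty → HypFoliation.hypArea M = ⊤) ∧
    ({L ∈ R.leaves | L ⊆ M}.Finite →
      ∀ (M' : Set HypFoliation.E3) (n' : HypFoliation.E3 → HypFoliation.E3),
        HypFoliation.IsProperOrientedSurface M' n' → (∀ α, HypFoliation.rotZ α '' M' = M') →
        HypFoliation.IsAreaMinimizing M' n' → HypFoliation.SameOrientedBoundary M R.ν M' n' →
        HypFoliation.ConsistsOfRotLeaves R M' ∧ ∀ p ∈ M' \ HypFoliation.Z, n' p = R.ν p) := by
  have hUo : IsOpen U := hU ▸ isOpen_interior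
  have hN := HypFoliation.isAdmissible_of_leaves hUo hM hleaves hout
  have hcl : closure M ∩ HypFoliation.B ⊆ M := by
    rw [hM]
    exact fun x hx => ⟨isClosed_frontier.closure_subset_iff.2 Set.inter_subset_left hx.1, hx.2⟩
  refine ⟨HypFoliation.isAreaMinimizing_of_isAdmissible hcl hN, fun hne => ?_,
    fun hfin M' n' hM' hrot hmin hsame => ?_⟩
  · rw [← HypFoliation.hypArea_diff_Z]
    exact hN.hypArea_eq_top (HypFoliation.nonempty_diff_Z_of_frontier hUB hU hM hne)
  · have hN' := HypFoliation.isAdmissible_of_properSurface hM' hrot hmin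
    have hν : ∀ p ∈ M' \ HypFoliation.Z, n' p = R.ν p := fun p hp =>
      HypFoliation.normal_eq_of_sameOrientedBoundary hN
        (HypFoliation.finite_geods_of_finite_leaves hN hleaves.isSaturated hfin) hN'
        hM'.subset_ball hmin hsame hp
    exact ⟨hN'.consistsOfRotLeaves hν hM'.smooth, hν⟩
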